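/- Let $(M,g)$ be a smooth oriented Riemannian four-manifold with a spin structure, $\mathbb S,\mathbb S'$ its spin bundles (complex rank-two bundles with $\mathbb C\otimes TM\cong\mathbb S\otimes\mathbb S'$), with parallel symplectic forms $\varepsilon_{AB},\varepsilon_{A'B'}$ ($\varepsilon_{01}=\varepsilon_{0'1'}=1$) such that $g=\varepsilon\otimes\varepsilon'$, and spinor conjugation $\widehat{(p,q)}=(\bar q,-\bar p)$ on lower-index components; two-forms $\phi_{AB}\varepsilon_{A'B'}$ with $\phi_{AB}$ symmetric are the anti-self-dual (ASD) ones. Let $\Lambda\neq 0$ be a real constant, $A$ a smooth real one-form on $M$ whose field strength $F_{ab}=\nabla_aA_b-\nabla_bA_a$ is ASD, $F_{ab}=\phi_{AB}\varepsilon_{A'B'}$, and let $\alpha_A,\beta_{A'}$ be smooth spinor fields, the pair $(\alpha,\beta)$ not identically zero on any connected component of $M$, satisfying the Killing spinor equations $$\nabla_{AA'}\alpha_B=e^{i\theta}A_{AA'}\alpha_B+\Big(\frac{e^{i\theta}}{\Lambda}\phi_{AB}-\varepsilon_{AB}\Big)\beta_{A'},\qquad \nabla_{AA'}\beta_{B'}=e^{i\theta}A_{AA'}\beta_{B'}+\Lambda\varepsilon_{A'B'}\alpha_A$$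 with $\theta=\pi/2$. Then: 1. $g$ is Einstein with ASD Weyl tensor, and $\mathrm{Ric}=-6\Lambda g$ (in the sign convention in which round spheres have positive Ricci tensor). 2. $K_{AA'}=i(\hat\alpha_A\beta_{A'}+\alpha_A\hat\beta_{A'})$ is a smooth real Killing vector field. It is non-zero exactly at the points where $\alpha\neq0$ and $\beta\neq0$, and these points form a dense subset of $M$. 3. Around every point where $K\neq 0$ there are local coordinates $(x,y,z,\tau)$ in which $K=\sqrt2\,\partial_\tau$ and $$g=\frac1{z^2}\Big(V\big(dz^2+e^u(dx^2+dy^2)\big)+V^{-1}(d\tau+\omega)^2\Big),$$ where $u=u(x,y,z)$ and $V=V(x,y,z)>0$ are smooth, $z\neq0$, $u$ solves the $SU(\infty)$ Toda equation $u_{xx}+u_{yy}+(e^u)_{zz}=0$, $V$ is given by $-4\Lambda V=zu_z-2$, and $\omega$ is a smooth one-form in the variables $(x,y,z)$ (without $d\tau$ term and with coefficients independent of $\tau$) satisfying $$d\omega=-V_x\,dy\wedge dz-V_y\,dz\wedge dx-(Ve^u)_z\,dx\wedge dy .$$ -/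

import Mathlib

open scoped Manifold ContDiff Matrix

noncomputable section

namespace SpinGeometry

/-- The model space `ℝ⁴`. -/
abbrev E4 : Type := EuclideanSpace ℝ (Fin 4)

/-! ### Two-component spinor algebra -/

/-- The symplectic form `ε`, with `ε₀₁ = 1`; used for both `ε_{AB}` and `ε_{A'B'}`. -/
def eps : Matrix (Fin 2) (Fin 2) ℂ := !![0, 1; -1, 0]

/-- Spinor conjugation of a spinor with lower index: `(p, q) ↦ (q̄, -p̄)`. -/
def hat (α : Fin 2 → ℂ) : Fin 2 → ℂ :=
  ![(starRingEnd ℂ) (α 1), -(starRingEnd ℂ) (α 0)]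

/-- The soldering matrices `σᵃ_{AA'}` identifying `ℝ⁴` with the real (conjugation-invariant)
elements of `S ⊗ S'`, normalised so that `ε^{AB} ε^{A'B'} v_{AA'} v_{BB'} = 2 det v = |v|²` for
`v_{AA'} = ∑ₐ vₐ σᵃ_{AA'}`. They are ordered so that, in a positively oriented orthonormal frame,
the real two-forms `φ_{AB} ε_{A'B'}` with `φ` symmetric are the anti-self-dual ones. -/
def sigma : Fin 4 → Matrix (Fin 2) (Fin 2) ℂ :=
  ![((Real.sqrt 2 : ℝ) : ℂ)⁻¹ • !![1, 0; 0, 1],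
    ((Real.sqrt 2 : ℝ) : ℂ)⁻¹ • !![Complex.I, 0; 0, -Complex.I],
    ((Real.sqrt 2 : ℝ) : ℂ)⁻¹ • !![0, Complex.I; Complex.I, 0],
    ((Real.sqrt 2 : ℝ) : ℂ)⁻¹ • !![0, 1; -1, 0]]

/-- `v_{AA'} = ∑ₐ vₐ σᵃ_{AA'}`. -/
def solder (v : Fin 4 → ℝ) : Matrix (Fin 2) (Fin 2) ℂ := ∑ a, ((v a : ℝ) : ℂ) • sigma a

/-- `δ_{ab}` with real values. -/
def kd (a b : Fin 4) : ℝ := if a = b then 1 else 0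

/-- The totally antisymmetric symbol with `ε₀₁₂₃ = 1`. -/
def leviCivita (a b c d : Fin 4) : ℝ :=
  Matrix.det (Matrix.of fun i j : Fin 4 => kd (![a, b, c, d] i) j)

/-! ### Riemannian geometry in orthonormal frames -/

section Geometry

variable {M : Type*} [TopologicalSpace M] [ChartedSpace E4 M] [IsManifold 𝓘(ℝ, E4) ∞ M]

/-- Smooth Riemannian metrics on the four-manifold `M`. -/
abbrev Metric (M : Type*) [TopologicalSpace M] [ChartedSpace E4 M] [IsManifold 𝓘(ℝ, E4) ∞ M] :
    Type _ :=
  Bundle.ContMDiffRiemannianMetric 𝓘(ℝ, E4) ∞ E4 (fun x : M => TangentSpace 𝓘(ℝ, E4) x)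

/-- Vector fields (not necessarily continuous). -/
abbrev VField (M : Type*) [TopologicalSpace M] [ChartedSpace E4 M] : Type _ :=
  ∀ x : M, TangentSpace 𝓘(ℝ, E4) x

/-- The vector field `X` is smooth on `W`. -/
def SmoothVFieldOn (X : VField M) (W : Set M) : Prop :=
  ContMDiffOn 𝓘(ℝ, E4) 𝓘(ℝ, E4).tangent ∞
    (fun x => (⟨x, X x⟩ : TangentBundle 𝓘(ℝ, E4) M)) W

/-- The derivative `X f` of a real function along a vector field. -/
def dirR (f : M → ℝ) (X : VField M) (x : M) : ℝ :=
  mfderiv 𝓘(ℝ, E4) 𝓘(ℝ, ℝ) f x (X x)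

/-- The derivative `X f` of a complex function along a (real) vector field. -/
def dirC (f : M → ℂ) (X : VField M) (x : M) : ℂ :=
  mfderiv 𝓘(ℝ, E4) 𝓘(ℝ, ℂ) f x (X x)

/-- The Lie bracket of vector fields. -/
def bracket (X Y : VField M) : VField M := VectorField.mlieBracket 𝓘(ℝ, E4) X Y

/-- The structure functions `g([E_a, E_b], E_c)` of a frame. -/
def structFun (g : Metric M) (E : Fin 4 → VField M) (a b c : Fin 4) (x : M) : ℝ :=
  g.inner x (bracket (E a) (E b) x) (E c x)

/-- The Levi-Civita connection `ω_{abc} = g(∇_{E_a} E_b, E_c)` in an orthonormal frame, given by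
the Koszul formula. -/
def conn (g : Metric M) (E : Fin 4 → VField M) (a b c : Fin 4) (x : M) : ℝ :=
  (structFun g E a b c x - structFun g E b c a x + structFun g E c a b x) / 2

/-- The Riemann tensor `R_{abcd} = g(R(E_a, E_b) E_c, E_d)` in an orthonormal frame, where
`R(X, Y) = ∇_X ∇_Y - ∇_Y ∇_X - ∇_{[X, Y]}`. -/
def riem (g : Metric M) (E : Fin 4 → VField M) (a b c d : Fin 4) (x : M) : ℝ :=
  dirR (conn g E b c d) (E a) x - dirR (conn g E a c d) (E b) x
    + ∑ e, (conn g E b c e x * conn g E a e d x - conn g E a c e x * conn g E b e d x)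
    - ∑ e, structFun g E a b e x * conn g E e c d x

/-- The Ricci tensor in an orthonormal frame (positive on round spheres). -/
def ricci (g : Metric M) (E : Fin 4 → VField M) (b c : Fin 4) (x : M) : ℝ :=
  ∑ a, riem g E a b c a x

/-- The scalar curvature. -/
def scalarCurv (g : Metric M) (E : Fin 4 → VField M) (x : M) : ℝ := ∑ a, ricci g E a a x

/-- The Weyl tensor in an orthonormal frame. -/
def weyl (g : Metric M) (E : Fin 4 → VField M) (a b c d : Fin 4) (x : M) : ℝ :=
  riem g E a b c d x
    - (ricci g E b c x * kd a d - ricci g E a c x * kd b d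
        + kd b c * ricci g E a d x - kd a c * ricci g E b d x) / 2
    + scalarCurv g E x / 6 * (kd b c * kd a d - kd a c * kd b d)

/-- The Weyl tensor is anti-self-dual at `x`: `*W = -W`, for the orientation of the frame. -/
def WeylASDAt (g : Metric M) (E : Fin 4 → VField M) (x : M) : Prop :=
  ∀ a b c d, (∑ e, ∑ f, leviCivita a b e f * weyl g E e f c d x) / 2 = -weyl g E a b c d x

/-- `Ric = k g` at `x`. -/
def EinsteinAt (g : Metric M) (E : Fin 4 → VField M) (k : ℝ) (x : M) : Prop :=
  ∀ a b, ricci g E a b x = k * kd a b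

/-- `K` is a smooth Killing vector field: `ℒ_K g = 0`. -/
def IsKilling (g : Metric M) (K : VField M) : Prop :=
  SmoothVFieldOn K Set.univ ∧
    ∀ (W : Set M) (X Y : VField M), IsOpen W → SmoothVFieldOn X W → SmoothVFieldOn Y W →
      ∀ x ∈ W, dirR (fun y => g.inner y (X y) (Y y)) K x
        = g.inner x (bracket K X x) (Y x) + g.inner x (X x) (bracket K Y x)

/-- Real one-forms (not necessarily continuous). -/
abbrev OneForm (M : Type*) [TopologicalSpace M] [ChartedSpace E4 M] : Type _ :=
  ∀ x : M, TangentSpace 𝓘(ℝ, E4) x →L[ℝ] ℝ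

/-- The one-form `A` is smooth: it sends smooth vector fields to smooth functions. -/
def SmoothOneForm (A : OneForm M) : Prop :=
  ∀ (W : Set M) (X : VField M), IsOpen W → SmoothVFieldOn X W →
    ContMDiffOn 𝓘(ℝ, E4) 𝓘(ℝ, ℝ) ∞ (fun x => A x (X x)) W

/-- `(dA)(X, Y) = X (A Y) - Y (A X) - A [X, Y]`; in index notation this is the two-form with
components `∇_a A_b - ∇_b A_a`. -/
def dOneForm (A : OneForm M) (X Y : VField M) (x : M) : ℝ :=
  dirR (fun y => A y (Y y)) X x - dirR (fun y => A y (X y)) Y x - A x (bracket X Y x)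

/-! ### Spin structures and spinor fields -/

/-- A spin structure on `(M, g)` (which also fixes an orientation), given by local data: an open
cover, an oriented orthonormal frame on each member of it, and lifts `(L, R)` to
`Spin(4) = SU(2) × SU(2)` of the transition functions of these frames, satisfying the cocycle
condition. The spin bundles `S` and `S'` are the rank two bundles with transition functions
`L` and `R`; as these lie in `SU(2)`, the form `eps` and the conjugation `hat` are globally defined
on both, and `frame_transition` says that `v ↦ v_{AA'}` is a global isomorphism of `TM` with the
real part of `S ⊗ S'`. -/
structure SpinStructure (g : Metric M) (ι : Type*) where
  /-- the open cover -/
  U : ι → Set M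
  isOpen_U : ∀ i, IsOpen (U i)
  cover : ∀ x, ∃ i, x ∈ U i
  /-- the orthonormal frames -/
  E : ι → Fin 4 → VField M
  smooth_E : ∀ i a, SmoothVFieldOn (E i a) (U i)
  orthonormal : ∀ i, ∀ x ∈ U i, ∀ a b, g.inner x (E i a x) (E i b x) = kd a b
  /-- the transition functions of `S` -/
  L : ι → ι → M → Matrix (Fin 2) (Fin 2) ℂ
  /-- the transition functions of `S'` -/
  R : ι → ι → M → Matrix (Fin 2) (Fin 2) ℂ
  L_mem : ∀ i j, ∀ x ∈ U i ∩ U j, L i j x ∈ Matrix.specialUnitaryGroup (Fin 2) ℂ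
  R_mem : ∀ i j, ∀ x ∈ U i ∩ U j, R i j x ∈ Matrix.specialUnitaryGroup (Fin 2) ℂ
  smooth_L : ∀ i j A B,
    ContMDiffOn 𝓘(ℝ, E4) 𝓘(ℝ, ℂ) ∞ (fun x => L i j x A B) (U i ∩ U j)
  smooth_R : ∀ i j A B,
    ContMDiffOn 𝓘(ℝ, E4) 𝓘(ℝ, ℂ) ∞ (fun x => R i j x A B) (U i ∩ U j)
  cocycle_L : ∀ i j k, ∀ x ∈ U i ∩ U j ∩ U k, L i j x * L j k x = L i k x
  cocycle_R : ∀ i j k, ∀ x ∈ U i ∩ U j ∩ U k, R i j x * R j k x = R i k x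
  frame_transition : ∀ i j, ∀ x ∈ U i ∩ U j, ∀ v : TangentSpace 𝓘(ℝ, E4) x,
    solder (fun a => g.inner x v (E i a x))
      = L i j x * solder (fun a => g.inner x v (E j a x)) * (R i j x)ᵀ

/-- Smooth sections of the rank two bundle with cover `U` and transition functions `T`, as
families of components (lower index); only the values of `α i` on `U i` are meaningful. -/
structure IsSpinorField {ι : Type*} (U : ι → Set M) (T : ι → ι → M → Matrix (Fin 2) (Fin 2) ℂ)
    (α : ι → M → Fin 2 → ℂ) : Prop where
  smooth : ∀ i B, ContMDiffOn 𝓘(ℝ, E4) 𝓘(ℝ, ℂ) ∞ (fun x => α i x B) (U i)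
  transition : ∀ i j, ∀ x ∈ U i ∩ U j, α i x = T i j x *ᵥ α j x

/-- The spinor field `α` does not vanish at `x`. -/
def NonzeroAt {ι : Type*} (U : ι → Set M) (α : ι → M → Fin 2 → ℂ) (x : M) : Prop :=
  ∀ i, x ∈ U i → α i x ≠ 0

/-- The matrix of the spin connection on `S`: `∇_{E_a} α = E_a α + (spinConn a) α`. Together with
`spinConn'` it is the lift of the Levi-Civita connection for which `ε`, `ε'`, the conjugations and
the isomorphism of `TM` with the real part of `S ⊗ S'` are parallel. -/
def spinConn (g : Metric M) (E : Fin 4 → VField M) (a : Fin 4) (x : M) :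
    Matrix (Fin 2) (Fin 2) ℂ :=
  (-(1 / 2) : ℂ) • ∑ b, ∑ c, ((conn g E a b c x : ℝ) : ℂ) • (sigma b * (sigma c)ᴴ)

/-- The matrix of the spin connection on `S'`. -/
def spinConn' (g : Metric M) (E : Fin 4 → VField M) (a : Fin 4) (x : M) :
    Matrix (Fin 2) (Fin 2) ℂ :=
  (1 / 2 : ℂ) • ∑ b, ∑ c, ((conn g E a b c x : ℝ) : ℂ) • ((sigma b)ᴴ * sigma c)ᵀ

/-- Components in the frame `E` of the covariant derivative `∇_{E_a} α` of a section of `S`. -/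
def covD (g : Metric M) (E : Fin 4 → VField M) (α : M → Fin 2 → ℂ) (a : Fin 4) (x : M) :
    Fin 2 → ℂ :=
  fun B => dirC (fun y => α y B) (E a) x + (spinConn g E a x *ᵥ α x) B

/-- Components in the frame `E` of the covariant derivative `∇_{E_a} β` of a section of `S'`. -/
def covD' (g : Metric M) (E : Fin 4 → VField M) (β : M → Fin 2 → ℂ) (a : Fin 4) (x : M) :
    Fin 2 → ℂ :=
  fun B => dirC (fun y => β y B) (E a) x + (spinConn' g E a x *ᵥ β x) B

variable {g : Metric M} {ι : Type*}

/-- `φ_{AB}` is the symmetric spinor of the field strength `F_{ab} = ∇_a A_b - ∇_b A_a`, which is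
anti-self-dual: `F_{ab} = φ_{AB} ε_{A'B'}`. (`F` is real and closed by construction.) -/
structure IsASDMaxwell (s : SpinStructure g ι) (A : OneForm M)
    (φ : ι → M → Matrix (Fin 2) (Fin 2) ℂ) : Prop where
  smooth : SmoothOneForm A
  symm : ∀ i, ∀ x ∈ s.U i, (φ i x)ᵀ = φ i x
  field : ∀ i, ∀ x ∈ s.U i, ∀ P P' Q Q',
    ∑ a, ∑ b, ((dOneForm A (s.E i a) (s.E i b) x : ℝ) : ℂ) * sigma a P P' * sigma b Q Q'
      = φ i x P Q * eps P' Q'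

/-- The Killing spinor equations with parameters `θ` and `Λ`:
`∇_{AA'} α_B = e^{iθ} A_{AA'} α_B + (e^{iθ} Λ⁻¹ φ_{AB} - ε_{AB}) β_{A'}` and
`∇_{AA'} β_{B'} = e^{iθ} A_{AA'} β_{B'} + Λ ε_{A'B'} α_A`. -/
structure IsKillingSpinor (s : SpinStructure g ι) (θ Λ : ℝ) (A : OneForm M)
    (φ : ι → M → Matrix (Fin 2) (Fin 2) ℂ) (α β : ι → M → Fin 2 → ℂ) : Prop where
  unprimed : IsSpinorField s.U s.L α
  primed : IsSpinorField s.U s.R β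
  eq_unprimed : ∀ i, ∀ x ∈ s.U i, ∀ P P' Q,
    ∑ a, sigma a P P' * covD g (s.E i) (α i) a x Q
      = Complex.exp (θ * Complex.I) * solder (fun a => A x (s.E i a x)) P P' * α i x Q
        + (Complex.exp (θ * Complex.I) / Λ * φ i x P Q - eps P Q) * β i x P'
  eq_primed : ∀ i, ∀ x ∈ s.U i, ∀ P P' Q',
    ∑ a, sigma a P P' * covD' g (s.E i) (β i) a x Q'
      = Complex.exp (θ * Complex.I) * solder (fun a => A x (s.E i a x)) P P' * β i x Q'
        + Λ * eps P' Q' * α i x P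

/-- `K` is the real vector field with
`K_{AA'} = i (α̂_A β_{A'} + α_A β̂_{A'})`. -/
def IsSpinorVector (s : SpinStructure g ι) (α β : ι → M → Fin 2 → ℂ) (K : VField M) : Prop :=
  ∀ i, ∀ x ∈ s.U i, ∀ P P', solder (fun a => g.inner x (K x) (s.E i a x)) P P'
    = Complex.I * (hat (α i x) P * β i x P' + α i x P * hat (β i x) P')

end Geometry

/-! ### The local normal form -/

/-- `ℝ³` with coordinates `(x, y, z)`, numbered `0, 1, 2`. -/
abbrev E3 : Type := EuclideanSpace ℝ (Fin 3)

/-- The projection `(x, y, z, τ) ↦ (x, y, z)`. -/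
def proj (w : E4) : E3 := !₂[w 0, w 1, w 2]

/-- The partial derivative in the `k`-th coordinate. -/
def pd (k : Fin 3) (f : E3 → ℝ) (w : E3) : ℝ := fderiv ℝ f w (EuclideanSpace.single k 1)

/-- The equations for `u`, `V` and the one-form `ω = om₀ dx + om₁ dy + om₂ dz` on an open set `D`
of `ℝ³`. -/
structure IsTodaData (Λ : ℝ) (D : Set E3) (u V : E3 → ℝ) (om : Fin 3 → E3 → ℝ) : Prop where
  isOpen : IsOpen D
  smooth_u : ContDiffOn ℝ ∞ u D
  smooth_V : ContDiffOn ℝ ∞ V D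
  smooth_om : ∀ k, ContDiffOn ℝ ∞ (om k) D
  z_ne_zero : ∀ w ∈ D, w 2 ≠ 0
  V_pos : ∀ w ∈ D, 0 < V w
  /-- `u_xx + u_yy + (e^u)_zz = 0` -/
  toda : ∀ w ∈ D, pd 0 (pd 0 u) w + pd 1 (pd 1 u) w
    + pd 2 (pd 2 (fun w' => Real.exp (u w'))) w = 0
  /-- `-4ΛV = z u_z - 2` -/
  V_eq : ∀ w ∈ D, -4 * Λ * V w = w 2 * pd 2 u w - 2
  /-- the `dy ∧ dz` component of `dω` -/
  dom_yz : ∀ w ∈ D, pd 1 (om 2) w - pd 2 (om 1) w = -pd 0 V w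
  /-- the `dz ∧ dx` component of `dω` -/
  dom_zx : ∀ w ∈ D, pd 2 (om 0) w - pd 0 (om 2) w = -pd 1 V w
  /-- the `dx ∧ dy` component of `dω` -/
  dom_xy : ∀ w ∈ D, pd 0 (om 1) w - pd 1 (om 0) w
    = -pd 2 (fun w' => V w' * Real.exp (u w')) w

/-- The value at the point with coordinates `w` of the quadratic form
`z⁻² (V (dz² + e^u (dx² + dy²)) + V⁻¹ (dτ + ω)²)` on a vector with components `v`. -/
def todaMetric (u V : E3 → ℝ) (om : Fin 3 → E3 → ℝ) (w v : E4) : ℝ :=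
  (w 2 ^ 2)⁻¹ *
    (V (proj w) * (v 2 ^ 2 + Real.exp (u (proj w)) * (v 0 ^ 2 + v 1 ^ 2))
      + (V (proj w))⁻¹ *
        (v 3 + om 0 (proj w) * v 0 + om 1 (proj w) * v 1 + om 2 (proj w) * v 2) ^ 2)

/-- The components in the coordinates `Φ = (x, y, z, τ)` of a tangent vector at `x`. -/
def coordVec {M : Type*} [TopologicalSpace M] [ChartedSpace E4 M]
    (Φ : OpenPartialHomeomorph M E4) (x : M) (v : TangentSpace 𝓘(ℝ, E4) x) : E4 :=
  mfderiv 𝓘(ℝ, E4) 𝓘(ℝ, E4) Φ x v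

end SpinGeometry

end

noncomputable section

namespace SpinGeometry

open Set Filter Topology

/-! ### Smooth local inverses and flows -/

/-! For θ = π/2 the factor e^{iθ} is i, so A acts on the spinors by phases and drops out of the
norms P = |α|², N = |β|² and out of K.

Curvature. Commuting covariant derivatives in the equation for β produces i F β together with
φ-terms from ∇α. The coefficient e^{iθ}/Λ is the one for which these cancel by the two-dimensional
identity that skewing over three primed indices gives zero. What remains says that the curvature
acts on β exactly as constant curvature -2Λ does (`KSJet.spinMat'_algRiem`). An element of su(2)
that kills a non-zero spinor is zero, so the self-dual part of R minus its constant-curvature model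
vanishes. With the first Bianchi identity this is the Einstein equation with constant 3·(-2Λ),
together with anti-self-duality of Weyl (`asd_einstein_of_spin`). The argument works where β ≠ 0 and
extends by density and continuity.

Zeros. The function f = P + N satisfies |df| ≤ C f locally, so the common zeros form an open and
closed set, hence there are none (`nonzeroAt_or`). If β vanishes on an open set, its equation forces
α = 0 there. If α does, the skew part of its equation forces β = 0. Hence both spinors are non-zero
on a dense set. Since |K|² = 2PN, this is the set where K ≠ 0. The Killing equation is the
cancellation of the symmetric part of ∇K (`KSJet.killing`).

Normal form. Where both spinors are non-zero, the one-forms m = α_A β_{A'} and n = α_A β̂_{A'}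
satisfy g = 2/(PN)·(|m|² + |n|²), K = -2 Im n, m(K) = 0 and n(K) = -iPN. The Killing spinor
equations become the structure equations `StructEqs`, in particular dN = 2Λ Re n and dm = m ∧ η. The
first suggests the coordinate z = √2Λ/N. The second makes m a multiple of d(x + iy) for suitable x
and y. A multiple of the flow parameter of K serves as τ. Reading off the metric gives u, V and ω,
and the remaining structure equations become the Toda equation and the formula for dω
(`NormalForm.exists_todaData`).

The analytic core is the integrating factor for m (`exists_integrating_factor`). Because L_K m is a
multiple of m, the form m is up to a factor pulled back from a hypersurface transversal to K. A
complex one-form on a three-space has a real kernel direction, so a second reduction leads to a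
surface. There the statement is the existence of isothermal coordinates, that is, of a local
solution of a Beltrami equation with smooth coefficient. That equation is solved by a Neumann series
for Fourier coefficients (`exists_beltrami`), and the reductions use flows depending smoothly on
initial data (`exists_smooth_flow`). -/

theorem exists_smooth_local_inverse {E F : Type*} [NormedAddCommGroup E] [NormedSpace ℝ E]
    [CompleteSpace E] [NormedAddCommGroup F] [NormedSpace ℝ F] {f : E → F} {U : Set E}
    (hU : IsOpen U) (hf : ContDiffOn ℝ ∞ f U) {a : E} (ha : a ∈ U) (f' : E ≃L[ℝ] F)
    (hf' : HasFDerivAt f (f' : E →L[ℝ] F) a) :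
    ∃ Ψ : OpenPartialHomeomorph E F, a ∈ Ψ.source ∧ Ψ.source ⊆ U ∧ (∀ x, Ψ x = f x) ∧
      ContDiffOn ℝ ∞ Ψ.symm Ψ.target ∧
      ∀ x ∈ Ψ.source, ∃ e : E ≃L[ℝ] F, fderiv ℝ f x = e := by
  have hfa : ContDiffAt ℝ ∞ f a := hf.contDiffAt (hU.mem_nhds ha)
  have h0 : (∞ : WithTop ℕ∞) ≠ 0 := by simp
  have hcont : ContinuousOn (fderiv ℝ f) U := hf.continuousOn_fderiv_of_isOpen hU (by simp)
  -- The inverse function theorem yields smoothness of the inverse only near f a. Shrinking the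
  -- source to the open set where the derivative is invertible makes the inverse smooth on the whole
  -- target.
  have hopen : IsOpen (U ∩ fderiv ℝ f ⁻¹' range ((↑) : (E ≃L[ℝ] F) → E →L[ℝ] F)) :=
    hcont.isOpen_inter_preimage hU ContinuousLinearEquiv.isOpen
  set V := U ∩ fderiv ℝ f ⁻¹' range ((↑) : (E ≃L[ℝ] F) → E →L[ℝ] F) with hV
  set Ψ₀ := hfa.toOpenPartialHomeomorph f hf' h0
  have hΨ₀ : ∀ x, Ψ₀ x = f x := fun x => rfl
  refine ⟨Ψ₀.restrOpen V hopen, ?_, ?_, hΨ₀, ?_, ?_⟩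
  · exact ⟨hfa.mem_toOpenPartialHomeomorph_source hf' h0, ha, ⟨f', hf'.fderiv.symm⟩⟩
  · intro x hx
    exact hx.2.1
  · intro y hy
    have hs := (Ψ₀.restrOpen V hopen).map_target hy
    obtain ⟨hs1, hs2, e, he⟩ := hs
    have hd : HasFDerivAt f (fderiv ℝ f ((Ψ₀.restrOpen V hopen).symm y))
        ((Ψ₀.restrOpen V hopen).symm y) :=
      ((hf.contDiffAt (hU.mem_nhds hs2)).differentiableAt (by simp)).hasFDerivAt
    rw [← he] at hd
    exact ((Ψ₀.restrOpen V hopen).contDiffAt_symm hy hd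
      (hf.contDiffAt (hU.mem_nhds hs2))).contDiffWithinAt
  · intro x hx
    obtain ⟨e, he⟩ := hx.2.2
    exact ⟨e, he.symm⟩

section Nemytskii

universe u

variable {I : Type*} [TopologicalSpace I] [CompactSpace I]

/-- Pointwise application of a continuous family of continuous linear maps. -/
def pointwiseApply (E F : Type*) [NormedAddCommGroup E] [NormedSpace ℝ E]
    [NormedAddCommGroup F] [NormedSpace ℝ F] :
    C(I, E →L[ℝ] F) →L[ℝ] C(I, E) →L[ℝ] C(I, F) :=
  LinearMap.mkContinuous₂
    (LinearMap.mk₂ ℝ (fun (T : C(I, E →L[ℝ] F)) (h : C(I, E)) =>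
        (⟨fun t => T t (h t), by fun_prop⟩ : C(I, F)))
      (fun _ _ _ => by ext; simp) (fun _ _ _ => by ext; simp)
      (fun _ _ _ => by ext; simp) (fun _ _ _ => by ext; simp)) 1
    (fun T h => by
      rw [one_mul, ContinuousMap.norm_le _ (by positivity)]
      intro t
      exact ((T t).le_opNorm (h t)).trans (mul_le_mul (T.norm_coe_le_norm t)
        (h.norm_coe_le_norm t) (norm_nonneg _) (norm_nonneg T)))

/-- The derivative of γ ↦ X ∘ γ is γ ↦ pointwise application of DX ∘ γ, again a composition operator
but with values in `E →L[ℝ] F`. The induction on the order of smoothness therefore has to run over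
all codomains at once. -/
theorem contDiff_comp_left_nat {E : Type u} [NormedAddCommGroup E] [NormedSpace ℝ E] (n : ℕ) :
    ∀ (F : Type u) [NormedAddCommGroup F] [NormedSpace ℝ F] (X : C(E, F)),
      ContDiff ℝ ∞ X → ContDiff ℝ n (fun γ : C(I, E) => X.comp γ) := by
  induction n with
  | zero =>
    intro F _ _ X _
    exact contDiff_zero.2 (ContinuousMap.continuous_postcomp X)
  | succ n ih =>
    intro F _ _ X hX
    have hX' : ContDiff ℝ ∞ (fderiv ℝ X) := hX.fderiv_right (by simp)
    set DX : C(E, E →L[ℝ] F) := ⟨fderiv ℝ X, hX'.continuous⟩ with hDX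
    have hXd : ∀ x, HasFDerivAt X (DX x) x := fun x =>
      (hX.differentiable (by simp) x).hasFDerivAt
    have key : ContDiff ℝ ((n : WithTop ℕ∞) + 1) (fun γ : C(I, E) => X.comp γ) := by
      rw [contDiff_succ_iff_hasFDerivAt]
      have hB : ContDiff ℝ n (fun T : C(I, E →L[ℝ] F) => pointwiseApply E F T) :=
        ContinuousLinearMap.contDiff _
      refine ⟨fun γ => pointwiseApply E F (DX.comp γ), hB.comp
        (ih (E →L[ℝ] F) DX hX'), fun γ => ?_⟩
      rw [hasFDerivAt_iff_isLittleO_nhds_zero, Asymptotics.isLittleO_iff]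
      intro c hc
      -- Continuity of γ ↦ DX ∘ γ in the sup norm bounds the variation of DX uniformly in t. The
      -- mean value inequality at each t then gives the little-o estimate in the sup norm.
      have hcont : ContinuousAt (fun h : C(I, E) => DX.comp (γ + h)) 0 :=
        ((ContinuousMap.continuous_postcomp DX).comp (continuous_const.add continuous_id)).continuousAt
      obtain ⟨δ, hδ, hball⟩ :=
        (Metric.continuousAt_iff (α := C(I, E)) (β := C(I, E →L[ℝ] F))).1 hcont c hc
      filter_upwards [Metric.ball_mem_nhds (0 : C(I, E)) hδ] with h hh
      rw [ContinuousMap.norm_le _ (by positivity)]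
      intro t
      have hb : ∀ x ∈ segment ℝ (γ t) (γ t + h t), ‖DX x - DX (γ t)‖ ≤ c := by
        intro x hx
        rw [segment_eq_image'] at hx
        obtain ⟨r, ⟨hr0, hr1⟩, rfl⟩ := hx
        have h1 : dist (r • h) (0 : C(I, E)) < δ := by
          rw [dist_zero_right, norm_smul, Real.norm_of_nonneg hr0]
          have : ‖h‖ < δ := by simpa using hh
          nlinarith [norm_nonneg h]
        have h2 := (hball h1).le
        have h3 := (ContinuousMap.dist_apply_le_dist (f := DX.comp (γ + r • h))
          (g := DX.comp (γ + 0)) t).trans h2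
        rw [dist_eq_norm] at h3
        simpa using h3
      have := (convex_segment (𝕜 := ℝ) (γ t) (γ t + h t)).norm_image_sub_le_of_norm_hasFDerivWithin_le'
        (fun x _ => (hXd x).hasFDerivWithinAt) hb (left_mem_segment ℝ _ _)
        (right_mem_segment ℝ _ _)
      simp only [add_sub_cancel_left] at this
      refine (le_trans ?_ this).trans (mul_le_mul_of_nonneg_left (h.norm_coe_le_norm t) hc.le)
      exact le_of_eq rfl
    exact_mod_cast key

theorem contDiff_comp_left {E F : Type u} [NormedAddCommGroup E] [NormedSpace ℝ E]
    [NormedAddCommGroup F] [NormedSpace ℝ F] (X : C(E, F)) (hX : ContDiff ℝ ∞ X) :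
    ContDiff ℝ ∞ (fun γ : C(I, E) => X.comp γ) :=
  contDiff_infty.2 fun n => contDiff_comp_left_nat n F X hX

end Nemytskii

/-- Primitives of continuous functions on the unit interval. -/
def primitive (E : Type*) [NormedAddCommGroup E] [NormedSpace ℝ E] :
    C(unitInterval, E) →L[ℝ] C(unitInterval, E) :=
  LinearMap.mkContinuous
    { toFun := fun γ => ⟨fun t => ∫ s in (0 : ℝ)..t, γ (projIcc 0 1 zero_le_one s), by
        have : Continuous fun t : ℝ => ∫ s in (0 : ℝ)..t, γ (projIcc 0 1 zero_le_one s) :=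
          intervalIntegral.continuous_primitive (fun a b =>
            (γ.continuous.comp continuous_projIcc).intervalIntegrable a b) 0
        exact this.comp continuous_subtype_val⟩
      map_add' := fun γ δ => by
        ext t
        exact intervalIntegral.integral_add
          ((γ.continuous.comp continuous_projIcc).intervalIntegrable _ _)
          ((δ.continuous.comp continuous_projIcc).intervalIntegrable _ _)
      map_smul' := fun c γ => by
        ext t
        exact intervalIntegral.integral_smul _ _ } 1
    (fun γ => by
      rw [one_mul, ContinuousMap.norm_le _ (norm_nonneg _)]
      intro t
      refine (intervalIntegral.norm_integral_le_of_norm_le_const (C := ‖γ‖)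
        fun s _ => γ.norm_coe_le_norm _).trans ?_
      rw [sub_zero, abs_of_nonneg t.2.1]
      exact mul_le_of_le_one_right (norm_nonneg _) t.2.2)

theorem primitive_apply {E : Type*} [NormedAddCommGroup E] [NormedSpace ℝ E]
    (γ : C(unitInterval, E)) (t : unitInterval) :
    primitive E γ t = ∫ s in (0 : ℝ)..t, γ (projIcc 0 1 zero_le_one s) := rfl

/-- The defect of the integral equation `γ = x + ε ∫ X(γ)` on the unit interval. -/
def flowDefect {E : Type*} [NormedAddCommGroup E] [NormedSpace ℝ E] (X : C(E, E))
    (u : (E × ℝ) × C(unitInterval, E)) : C(unitInterval, E) :=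
  u.2 - ContinuousMap.const _ u.1.1 - u.1.2 • primitive E (X.comp u.2)

theorem contDiff_flowDefect {E : Type*} [NormedAddCommGroup E] [NormedSpace ℝ E] (X : C(E, E))
    (hX : ContDiff ℝ ∞ X) : ContDiff ℝ ∞ (flowDefect X) := by
  have h1 : ContDiff ℝ ∞ fun x : E => (ContinuousMap.const unitInterval x : C(unitInterval, E)) := by
    let L : E →L[ℝ] C(unitInterval, E) := LinearMap.mkContinuous
      { toFun := fun x => ContinuousMap.const _ x
        map_add' := fun _ _ => rfl
        map_smul' := fun _ _ => rfl } 1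
      (fun x => by
        rw [one_mul, ContinuousMap.norm_le _ (norm_nonneg _)]
        exact fun t => le_rfl)
    exact L.contDiff
  have h2 : ContDiff ℝ ∞ fun γ : C(unitInterval, E) => primitive E (X.comp γ) :=
    (primitive E).contDiff.comp (contDiff_comp_left X hX)
  unfold flowDefect
  exact (contDiff_snd.sub (h1.comp contDiff_fst.fst)).sub
    (contDiff_fst.snd.smul (h2.comp contDiff_snd))

theorem flowDefect_eq_zero_iff {E : Type*} [NormedAddCommGroup E] [NormedSpace ℝ E] (X : C(E, E))
    (x : E) (ε : ℝ) (γ : C(unitInterval, E)) :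
    flowDefect X ((x, ε), γ) = 0 ↔ ∀ t : unitInterval,
      γ t = x + ε • ∫ s in (0 : ℝ)..t, X (γ (projIcc 0 1 zero_le_one s)) := by
  rw [ContinuousMap.ext_iff]
  refine forall_congr' fun t => ?_
  simp only [flowDefect, ContinuousMap.sub_apply, ContinuousMap.const_apply,
    ContinuousMap.smul_apply, primitive_apply, ContinuousMap.comp_apply, ContinuousMap.zero_apply]
  rw [sub_sub, sub_eq_zero]

/-- Rescaling of time in a solution of the integral equation. -/
theorem flowDefect_rescale {E : Type*} [NormedAddCommGroup E] [NormedSpace ℝ E] (X : C(E, E))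
    (x : E) (ε : ℝ) (γ : C(unitInterval, E)) (h : flowDefect X ((x, ε), γ) = 0)
    (r : unitInterval) :
    flowDefect X ((x, r * ε), γ.comp ⟨fun t => r * t, by fun_prop⟩) = 0 := by
  rw [flowDefect_eq_zero_iff] at h ⊢
  intro t
  have := h (r * t)
  simp only [ContinuousMap.comp_apply, ContinuousMap.coe_mk]
  rw [this]
  congr 1
  rw [mul_comm (r : ℝ) ε, mul_smul]
  congr 1
  rcases eq_or_ne (r : ℝ) 0 with h0 | h0
  · simp [h0]
  have e1 : ∫ s in (0 : ℝ)..t, X (γ (r * projIcc 0 1 zero_le_one s))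
      = ∫ s in (0 : ℝ)..t, X (γ (projIcc 0 1 zero_le_one (r * s))) := by
    apply intervalIntegral.integral_congr
    intro s hs
    rw [uIcc_of_le t.2.1] at hs
    have hs' : s ∈ Icc (0 : ℝ) 1 := ⟨hs.1, hs.2.trans t.2.2⟩
    have hrs : (r : ℝ) * s ∈ Icc (0 : ℝ) 1 :=
      ⟨mul_nonneg r.2.1 hs'.1, mul_le_one₀ r.2.2 hs'.1 hs'.2⟩
    simp only
    congr 2
    ext
    rw [projIcc_of_mem _ hrs]
    simp [projIcc_of_mem _ hs']
  rw [e1, intervalIntegral.integral_comp_mul_left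
    (fun s => X (γ (projIcc 0 1 zero_le_one s))) h0, smul_inv_smul₀ h0]
  simp

/-- The integral equation γ = x + ε ∫ X(γ) on [0,1] is solved by the inverse function theorem in the
Banach space of continuous curves, so γ depends smoothly on (x, ε). The flow at time ε is γ(1).
Uniqueness of solutions close to the constant curve, combined with rescaling of time, shows that
γ(s) is the flow at time sε, and this gives the differential equation. -/
theorem exists_smooth_flow_of_contDiff {E : Type*} [NormedAddCommGroup E] [NormedSpace ℝ E]
    [CompleteSpace E] (X : E → E) (hX : ContDiff ℝ ∞ X) (p : E) :
    ∃ (fl : E × ℝ → E) (W : Set (E × ℝ)), IsOpen W ∧ (p, 0) ∈ W ∧ ContDiffOn ℝ ∞ fl W ∧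
      (∀ x, (x, (0 : ℝ)) ∈ W → fl (x, 0) = x) ∧
      ∀ q ∈ W, fderiv ℝ fl q (0, 1) = X (fl q) := by
  set Xc : C(E, E) := ⟨X, hX.continuous⟩
  set G := flowDefect Xc with hG
  have hGs : ContDiff ℝ ∞ G := contDiff_flowDefect Xc hX
  set Θ : (E × ℝ) × C(unitInterval, E) → (E × ℝ) × C(unitInterval, E) := fun u => (u.1, G u)
    with hΘ
  have hΘs : ContDiff ℝ ∞ Θ := contDiff_fst.prodMk hGs
  set c₀ : C(unitInterval, E) := ContinuousMap.const _ p with hc₀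
  set u₀ : (E × ℝ) × C(unitInterval, E) := ((p, 0), c₀) with hu₀
  have hG₀ : G u₀ = 0 := by
    simp [hG, flowDefect, hu₀, hc₀]
  -- At ε = 0 the integral term is absent, so the defect is γ - p and its derivative in γ is the
  -- identity.
  have hinr : ∀ h, fderiv ℝ G u₀ (0, h) = h := by
    intro h
    have h1 : HasFDerivAt (fun γ : C(unitInterval, E) => G ((p, 0), γ))
        ((fderiv ℝ G u₀).comp (ContinuousLinearMap.inr ℝ _ _)) c₀ :=
      HasFDerivAt.comp c₀ (hGs.differentiable (by simp) u₀).hasFDerivAt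
        (hasFDerivAt_prodMk_right (p, (0 : ℝ)) c₀)
    have h2 : HasFDerivAt (fun γ : C(unitInterval, E) => G ((p, 0), γ))
        (ContinuousLinearMap.id ℝ _) c₀ := by
      have : (fun γ : C(unitInterval, E) => G ((p, 0), γ)) = fun γ => γ - c₀ := by
        ext γ
        simp [hG, flowDefect, hc₀]
      rw [this]
      exact (hasFDerivAt_id c₀).sub_const c₀
    have := congrArg (fun T => T h) (h1.unique h2)
    simpa using this
  set L := (fderiv ℝ G u₀).comp (ContinuousLinearMap.inl ℝ (E × ℝ) C(unitInterval, E)) with hL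
  let e : ((E × ℝ) × C(unitInterval, E)) ≃L[ℝ] ((E × ℝ) × C(unitInterval, E)) :=
    ContinuousLinearEquiv.equivOfInverse
      ((ContinuousLinearMap.fst ℝ _ _).prod (L.comp (ContinuousLinearMap.fst ℝ _ _) +
        ContinuousLinearMap.snd ℝ _ _))
      ((ContinuousLinearMap.fst ℝ _ _).prod (ContinuousLinearMap.snd ℝ _ _ -
        L.comp (ContinuousLinearMap.fst ℝ _ _)))
      (fun v => by ext <;> simp) (fun v => by ext <;> simp)
  have he : HasFDerivAt Θ (e : _ →L[ℝ] _) u₀ := by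
    have h1 : HasFDerivAt Θ ((ContinuousLinearMap.fst ℝ _ _).prod (fderiv ℝ G u₀)) u₀ :=
      hasFDerivAt_fst.prodMk (hGs.differentiable (by simp) u₀).hasFDerivAt
    convert h1 using 1
    apply ContinuousLinearMap.ext
    rintro ⟨v, h⟩
    have : ((v, h) : (E × ℝ) × C(unitInterval, E)) = (v, 0) + (0, h) := by simp
    have h3 : fderiv ℝ G u₀ (v, h) = L v + h := by
      rw [this, map_add, hinr]; rfl
    change (v, L v + h) = (v, fderiv ℝ G u₀ (v, h))
    rw [h3]
  obtain ⟨Ψ, hΨ₀, -, hΨ, hΨs, -⟩ :=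
    exists_smooth_local_inverse isOpen_univ hΘs.contDiffOn (mem_univ u₀) e he
  obtain ⟨ρ, hρ, hball⟩ := Metric.isOpen_iff.1 Ψ.open_source u₀ hΨ₀
  have hΨu₀ : Ψ u₀ = ((p, 0), 0) := by rw [hΨ]; simp only [hΘ, hG₀]; rfl
  let γ : E × ℝ → C(unitInterval, E) := fun q => (Ψ.symm (q, 0)).2
  set T : Set (E × ℝ) := (fun q => ((q, 0) : (E × ℝ) × C(unitInterval, E))) ⁻¹' Ψ.target with hT
  have hTo : IsOpen T := Ψ.open_target.preimage (by fun_prop)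
  have hT₀ : (p, (0 : ℝ)) ∈ T := by
    change ((p, (0 : ℝ)), (0 : C(unitInterval, E))) ∈ Ψ.target
    rw [← hΨu₀]
    exact Ψ.map_source hΨ₀
  have hγs : ContDiffOn ℝ ∞ γ T :=
    contDiff_snd.comp_contDiffOn (hΨs.comp (by fun_prop) (fun q hq => hq))
  have hγ0 : γ (p, 0) = c₀ := by
    change (Ψ.symm ((p, 0), 0)).2 = c₀
    rw [← hΨu₀, Ψ.left_inv hΨ₀]
  have hsol : ∀ q ∈ T, G (q, γ q) = 0 := by
    intro q hq
    have h := Ψ.right_inv hq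
    rw [hΨ] at h
    have h1 : (Ψ.symm (q, 0)).1 = q := congrArg Prod.fst h
    have h2 : G (Ψ.symm (q, 0)) = 0 := congrArg Prod.snd h
    have h3 : Ψ.symm (q, 0) = (q, γ q) := Prod.ext h1 rfl
    rwa [h3] at h2
  have huniq : ∀ q (δ : C(unitInterval, E)), (q, δ) ∈ Ψ.source → G (q, δ) = 0 → γ q = δ := by
    intro q δ h1 h2
    have h3 : Ψ (q, δ) = (q, 0) := by rw [hΨ]; simp only [hΘ, h2]
    change (Ψ.symm (q, 0)).2 = δ
    rw [← h3, Ψ.left_inv h1]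
  have hnear : ∀ᶠ q in 𝓝 (p, (0 : ℝ)), q ∈ T ∧ dist (γ q) c₀ < ρ := by
    have h1 : ContinuousAt γ (p, 0) := hγs.continuousOn.continuousAt (hTo.mem_nhds hT₀)
    have h2 := h1 (Metric.ball_mem_nhds (γ (p, 0)) hρ)
    rw [hγ0] at h2
    filter_upwards [hTo.mem_nhds hT₀, h2] with q hq1 hq2 using ⟨hq1, hq2⟩
  obtain ⟨r, hr, hrW⟩ := Metric.eventually_nhds_iff.1 hnear
  set R := min r ρ
  have hR : 0 < R := lt_min hr hρ
  have hW : ∀ q ∈ Metric.ball (p, (0 : ℝ)) R, q ∈ T ∧ dist (γ q) c₀ < ρ ∧ dist q (p, 0) < ρ :=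
    fun q hq => ⟨(hrW (lt_of_lt_of_le hq (min_le_left _ _))).1,
      (hrW (lt_of_lt_of_le hq (min_le_left _ _))).2, lt_of_lt_of_le hq (min_le_right _ _)⟩
  let fl : E × ℝ → E := fun q => γ q 1
  have hev : ContDiff ℝ ∞ (fun δ : C(unitInterval, E) => δ 1) :=
    ContinuousLinearMap.contDiff
      (ContinuousMap.evalCLM ℝ (1 : unitInterval) : C(unitInterval, E) →L[ℝ] E)
  have hfls : ContDiffOn ℝ ∞ fl (Metric.ball (p, (0 : ℝ)) R) :=
    hev.comp_contDiffOn (hγs.mono fun q hq => (hW q hq).1)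
  -- The rescaled curve still lies in the neighbourhood of the constant curve on which the local
  -- inverse is injective, so it is the chosen solution for the parameter s·t.
  have hscale : ∀ x t, (x, t) ∈ Metric.ball (p, (0 : ℝ)) R → ∀ s : unitInterval,
      (x, (s : ℝ) * t) ∈ Metric.ball (p, (0 : ℝ)) R ∧ fl (x, s * t) = γ (x, t) s := by
    intro x t hxt s
    have hmem : (x, (s : ℝ) * t) ∈ Metric.ball (p, (0 : ℝ)) R := by
      rw [Metric.mem_ball, Prod.dist_eq, max_lt_iff] at hxt ⊢
      refine ⟨hxt.1, ?_⟩
      have h2 := hxt.2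
      rw [Real.dist_eq, sub_zero] at h2 ⊢
      rw [abs_mul, abs_of_nonneg s.2.1]
      exact lt_of_le_of_lt (mul_le_of_le_one_left (abs_nonneg _) s.2.2) h2
    refine ⟨hmem, ?_⟩
    have h1 := flowDefect_rescale Xc x t (γ (x, t)) (hsol _ (hW _ hxt).1) s
    have h2 := huniq _ _ (hball ?_) h1
    · change γ (x, s * t) 1 = _
      rw [h2]
      simp
    · rw [Metric.mem_ball, Prod.dist_eq, max_lt_iff]
      refine ⟨(hW _ hmem).2.2, ?_⟩
      rw [ContinuousMap.dist_lt_iff hρ]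
      intro v
      exact lt_of_le_of_lt ((γ (x, t)).dist_apply_le_dist (g := c₀) _) (hW _ hxt).2.1
  have hode : ∀ x t, (x, t) ∈ Metric.ball (p, (0 : ℝ)) R →
      HasDerivWithinAt (fun s : ℝ => γ (x, t) (projIcc 0 1 zero_le_one s)) (t • X (fl (x, t)))
        (Icc 0 1) 1 := by
    intro x t hxt
    have h := (flowDefect_eq_zero_iff Xc x t _).1 (hsol _ (hW _ hxt).1)
    have hc : Continuous fun s : ℝ => X (γ (x, t) (projIcc 0 1 zero_le_one s)) :=
      hX.continuous.comp ((γ (x, t)).continuous.comp continuous_projIcc)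
    have hd : HasDerivAt (fun s : ℝ => x + t • ∫ s in (0 : ℝ)..s,
        X (γ (x, t) (projIcc 0 1 zero_le_one s)))
        (t • X (γ (x, t) (projIcc 0 1 zero_le_one 1))) 1 :=
      ((intervalIntegral.integral_hasDerivAt_right (hc.intervalIntegrable _ _)
        (hc.stronglyMeasurableAtFilter _ _) hc.continuousAt).const_smul t).const_add x
    have h1 : projIcc (0 : ℝ) 1 zero_le_one 1 = 1 := projIcc_right _
    rw [h1] at hd
    refine hd.hasDerivWithinAt.congr (fun s hs => ?_) ?_
    · rw [h]
      simp only [projIcc_of_mem _ hs]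
      rfl
    · rw [h]
      simp only [h1]
      rfl
  have hmain : ∀ x t, (x, t) ∈ Metric.ball (p, (0 : ℝ)) R → t ≠ 0 →
      fderiv ℝ fl (x, t) (0, 1) = X (fl (x, t)) := by
    intro x t hxt ht
    have hfd : HasFDerivAt fl (fderiv ℝ fl (x, t)) (x, t) :=
      ((hfls.contDiffAt (Metric.isOpen_ball.mem_nhds hxt)).differentiableAt (by simp)).hasFDerivAt
    have hcurve : HasDerivAt (fun s : ℝ => ((x, s * t) : E × ℝ)) (0, t) 1 := by
      simpa using (hasDerivAt_const (1 : ℝ) x).prodMk ((hasDerivAt_id (1 : ℝ)).mul_const t)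
    have h1 : HasDerivAt (fun s : ℝ => fl (x, s * t)) (fderiv ℝ fl (x, t) (0, t)) 1 := by
      have hfd' : HasFDerivAt fl (fderiv ℝ fl (x, t)) (x, 1 * t) := by rwa [one_mul]
      exact hfd'.comp_hasDerivAt (1 : ℝ) hcurve
    have h2 : HasDerivWithinAt (fun s : ℝ => fl (x, s * t)) (t • X (fl (x, t))) (Icc 0 1) 1 := by
      refine (hode x t hxt).congr (fun s hs => ?_) ?_
      · rw [projIcc_of_mem _ hs]
        exact (hscale x t hxt ⟨s, hs⟩).2
      · rw [show projIcc (0 : ℝ) 1 zero_le_one 1 = 1 from projIcc_right _]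
        simp only [one_mul]
        rfl
    have h3 := (uniqueDiffOn_Icc_zero_one 1 (by simp)).eq_deriv _ h1.hasDerivWithinAt h2
    have h4 : ((0 : E), t) = t • ((0 : E), (1 : ℝ)) := by simp
    rw [h4, map_smul] at h3
    exact smul_right_injective _ ht h3
  refine ⟨fl, Metric.ball (p, 0) R, Metric.isOpen_ball, Metric.mem_ball_self hR, hfls, ?_, ?_⟩
  · intro x hx
    change γ (x, 0) 1 = x
    rw [(flowDefect_eq_zero_iff Xc x 0 _).1 (hsol _ (hW _ hx).1)]
    simp
  · rintro ⟨x, t⟩ hxt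
    have hc1 : ContinuousAt (fun s : ℝ => fderiv ℝ fl (x, s) (0, 1) - X (fl (x, s))) t := by
      have hx1 : ContinuousAt (fun s : ℝ => ((x, s) : E × ℝ)) t := by fun_prop
      have hn := Metric.isOpen_ball.mem_nhds hxt
      have a1 : ContinuousAt (fderiv ℝ fl) (x, t) :=
        (hfls.continuousOn_fderiv_of_isOpen Metric.isOpen_ball (by simp)).continuousAt hn
      have a2 : ContinuousAt fl (x, t) := hfls.continuousOn.continuousAt hn
      have b1 : ContinuousAt (fun s : ℝ => fderiv ℝ fl (x, s)) t :=
        ContinuousAt.comp (f := fun s : ℝ => ((x, s) : E × ℝ)) a1 hx1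
      have b2 : ContinuousAt (fun s : ℝ => fl (x, s)) t :=
        ContinuousAt.comp (f := fun s : ℝ => ((x, s) : E × ℝ)) a2 hx1
      exact (b1.clm_apply continuousAt_const).sub (hX.continuous.continuousAt.comp b2)
    -- The rescaling argument yields t times the desired identity and says nothing at t = 0. There
    -- it follows by continuity of both sides.
    rcases eq_or_ne t 0 with rfl | ht
    · have h1 : Tendsto (fun s : ℝ => fderiv ℝ fl (x, s) (0, 1) - X (fl (x, s))) (𝓝[≠] 0)
          (𝓝 (fderiv ℝ fl (x, 0) (0, 1) - X (fl (x, 0)))) := hc1.tendsto.mono_left nhdsWithin_le_nhds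
      have h2 : (fun s : ℝ => fderiv ℝ fl (x, s) (0, 1) - X (fl (x, s))) =ᶠ[𝓝[≠] 0] fun _ => 0 := by
        have hx1 : ContinuousAt (fun s : ℝ => ((x, s) : E × ℝ)) 0 := by fun_prop
        have := hx1 (Metric.isOpen_ball.mem_nhds hxt)
        filter_upwards [nhdsWithin_le_nhds this, self_mem_nhdsWithin] with s hs hs0
        rw [hmain x s hs hs0, sub_self]
      have h3 := tendsto_nhds_unique (h1.congr' h2) tendsto_const_nhds
      exact sub_eq_zero.1 h3
    · exact hmain x t hxt ht

/-- Multiplying X by a bump function makes it globally smooth. The flow domain is then shrunk to the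
points whose image lies where the bump function equals one. -/
theorem exists_smooth_flow {E : Type*} [NormedAddCommGroup E] [NormedSpace ℝ E]
    [FiniteDimensional ℝ E] {X : E → E} {U : Set E} (hU : IsOpen U) (hX : ContDiffOn ℝ ∞ X U)
    {p : E} (hp : p ∈ U) :
    ∃ (fl : E × ℝ → E) (W : Set (E × ℝ)), IsOpen W ∧ (p, 0) ∈ W ∧ ContDiffOn ℝ ∞ fl W ∧
      (∀ x, (x, (0 : ℝ)) ∈ W → fl (x, 0) = x) ∧ (∀ q ∈ W, fl q ∈ U) ∧
      ∀ q ∈ W, fderiv ℝ fl q (0, 1) = X (fl q) := by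
  have : CompleteSpace E := FiniteDimensional.complete ℝ E
  obtain ⟨r, hr, hrU⟩ := Metric.isOpen_iff.1 hU p hp
  let b : ContDiffBump p := ⟨r / 4, r / 2, by positivity, by linarith⟩
  have hbX : ContDiff ℝ ∞ fun x => b x • X x := by
    rw [contDiff_iff_contDiffAt]
    intro x
    by_cases hx : x ∈ U
    · exact b.contDiffAt.smul (hX.contDiffAt (hU.mem_nhds hx))
    · have hxb : x ∉ tsupport b := by
        rw [b.tsupport_eq]
        intro h
        exact hx (hrU (lt_of_le_of_lt h (by change r / 2 < r; linarith)))
      have h0 := notMem_tsupport_iff_eventuallyEq.1 hxb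
      refine (contDiffAt_const (c := (0 : E))).congr_of_eventuallyEq ?_
      filter_upwards [h0] with y hy
      simp [hy]
  obtain ⟨fl, W, hW, hpW, hfl, h0, hd⟩ := exists_smooth_flow_of_contDiff _ hbX p
  have hopen : IsOpen (W ∩ fl ⁻¹' Metric.ball p (r / 4)) :=
    hfl.continuousOn.isOpen_inter_preimage hW Metric.isOpen_ball
  refine ⟨fl, W ∩ fl ⁻¹' Metric.ball p (r / 4), hopen, ⟨hpW, ?_⟩, hfl.mono inter_subset_left,
    fun x hx => h0 x hx.1, fun q hq => hrU ?_, fun q hq => ?_⟩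
  · rw [mem_preimage, h0 p hpW]
    exact Metric.mem_ball_self (by positivity)
  · exact Metric.ball_subset_ball (by linarith) hq.2
  · rw [hd q hq.1, b.one_of_mem_closedBall (Metric.ball_subset_closedBall hq.2), one_smul]

/-- Straightening of a smooth vector field that does not vanish at `p`. -/
theorem exists_straightening {E F : Type*} [NormedAddCommGroup E] [NormedSpace ℝ E]
    [FiniteDimensional ℝ E] [NormedAddCommGroup F] [NormedSpace ℝ F] {X : E → E} {U : Set E}
    (hU : IsOpen U) (hX : ContDiffOn ℝ ∞ X U) {p : E} (hp : p ∈ U) (T : (F × ℝ) ≃L[ℝ] E)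
    (hT : T (0, 1) = X p) :
    ∃ Ψ : OpenPartialHomeomorph (F × ℝ) E, (0, 0) ∈ Ψ.source ∧ Ψ.target ⊆ U ∧
      ContDiffOn ℝ ∞ Ψ Ψ.source ∧ ContDiffOn ℝ ∞ Ψ.symm Ψ.target ∧
      (∀ q ∈ Ψ.source, fderiv ℝ Ψ q (0, 1) = X (Ψ q)) ∧
      ∀ y, (y, (0 : ℝ)) ∈ Ψ.source → Ψ (y, 0) = p + T (y, 0) := by
  have : FiniteDimensional ℝ (F × ℝ) := T.symm.toLinearEquiv.finiteDimensional
  have : CompleteSpace (F × ℝ) := FiniteDimensional.complete ℝ _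
  obtain ⟨fl, W, hW, hpW, hfl, h0, hflU, hd⟩ := exists_smooth_flow hU hX hp
  -- The straightening map flows for time t from the point p + T(y, 0) of a transversal
  -- hypersurface. Its derivative at the origin is T, because T sends (0, 1) to X p.
  let j : F × ℝ → E × ℝ := fun q => (p + T (q.1, 0), q.2)
  have hj : ContDiff ℝ ∞ j := by
    have : ContDiff ℝ ∞ fun q : F × ℝ => T (q.1, 0) :=
      T.contDiff.comp (contDiff_fst.prodMk contDiff_const)
    exact (contDiff_const.add this).prodMk contDiff_snd
  have hjd : ∀ q, HasFDerivAt j (((T : F × ℝ →L[ℝ] E).comp ((ContinuousLinearMap.fst ℝ F ℝ).prod 0)).prod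
      (ContinuousLinearMap.snd ℝ F ℝ)) q := by
    intro q
    refine HasFDerivAt.prodMk ?_ hasFDerivAt_snd
    have : HasFDerivAt (fun q : F × ℝ => T (q.1, 0))
        ((T : F × ℝ →L[ℝ] E).comp ((ContinuousLinearMap.fst ℝ F ℝ).prod 0)) q :=
      T.hasFDerivAt.comp q (hasFDerivAt_fst.prodMk (hasFDerivAt_const _ _))
    exact this.const_add p
  have hj0 : j (0, 0) = (p, 0) := by simp [j]
  have hV : IsOpen (j ⁻¹' W) := hW.preimage hj.continuous
  have hV0 : ((0 : F), (0 : ℝ)) ∈ j ⁻¹' W := by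
    rw [mem_preimage, hj0]; exact hpW
  have hf : ContDiffOn ℝ ∞ (fl ∘ j) (j ⁻¹' W) := hfl.comp hj.contDiffOn fun q hq => hq
  have hfld : ∀ q ∈ W, HasFDerivAt fl (fderiv ℝ fl q) q := fun q hq =>
    ((hfl.contDiffAt (hW.mem_nhds hq)).differentiableAt (by simp)).hasFDerivAt
  have hfd : ∀ q ∈ j ⁻¹' W, HasFDerivAt (fl ∘ j) ((fderiv ℝ fl (j q)).comp
      (((T : F × ℝ →L[ℝ] E).comp ((ContinuousLinearMap.fst ℝ F ℝ).prod 0)).prod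
      (ContinuousLinearMap.snd ℝ F ℝ))) q := fun q hq => (hfld _ hq).comp q (hjd q)
  have hflx : ∀ v, fderiv ℝ fl (p, 0) (v, 0) = v := by
    intro v
    have h1 : HasFDerivAt (fun x : E => fl (x, 0))
        ((fderiv ℝ fl (p, 0)).comp (ContinuousLinearMap.inl ℝ E ℝ)) p :=
      HasFDerivAt.comp p (hfld _ hpW) (hasFDerivAt_prodMk_left p (0 : ℝ))
    have h2 : HasFDerivAt (fun x : E => fl (x, 0)) (ContinuousLinearMap.id ℝ E) p := by
      refine (hasFDerivAt_id p).congr_of_eventuallyEq ?_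
      have hc : ContinuousAt (fun x : E => ((x, 0) : E × ℝ)) p := by fun_prop
      filter_upwards [hc (hW.mem_nhds hpW)] with x hx
      exact h0 x hx
    have := congrArg (fun S => S v) (h1.unique h2)
    simpa using this
  have hT' : HasFDerivAt (fl ∘ j) (T : F × ℝ →L[ℝ] E) (0, 0) := by
    convert hfd _ hV0 using 1
    apply ContinuousLinearMap.ext
    rintro ⟨y, t⟩
    have e1 : ((T (y, 0), t) : E × ℝ) = (T (y, 0), 0) + t • (0, 1) := by simp
    change T (y, t) = fderiv ℝ fl (j (0, 0)) (T (y, 0), t)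
    rw [hj0, e1, map_add, map_smul, hflx, hd _ hpW, h0 p hpW, ← hT, ← map_smul, ← map_add]
    simp
  obtain ⟨Ψ, hΨ0, hΨV, hΨ, hΨs, -⟩ := exists_smooth_local_inverse hV hf hV0 T hT'
  have hΨf : (Ψ : F × ℝ → E) = fl ∘ j := funext hΨ
  refine ⟨Ψ, hΨ0, ?_, ?_, hΨs, ?_, ?_⟩
  · intro y hy
    have := hΨV (Ψ.map_target hy)
    rw [← Ψ.right_inv hy, hΨ]
    exact hflU _ this
  · rw [hΨf]
    exact hf.mono hΨV
  · intro q hq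
    rw [hΨf, (hfd q (hΨV hq)).fderiv, Function.comp_apply, ← hd _ (hΨV hq)]
    have h00 : ((0 : F), (0 : ℝ)) = 0 := rfl
    simp [h00]
  · intro y hy
    rw [hΨ]
    exact h0 _ (hΨV hy)

end SpinGeometry

end

noncomputable section

namespace SpinGeometry

open Set Filter Topology
open scoped ENNReal

/-! ### A Neumann series in weighted `ℓ¹` -/

section Neumann

variable {ι : Type*} [AddCommGroup ι]

/-- Convolution by `c` after multiplication by `b`. -/
def twistedConv (c b f : ι → ℂ) (n : ι) : ℂ := ∑' k, c k * (b (n - k) * f (n - k))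

/-- The terms of the Neumann series for `f = c + twistedConv c b f`. -/
def neumannTerm (c b : ι → ℂ) : ℕ → ι → ℂ
  | 0 => c
  | j + 1 => twistedConv c b (neumannTerm c b j)

/-- A submultiplicative weight turns ℓ¹ into a convolution algebra, and multiplication by b does not
increase norms. Extended non-negative sums avoid summability hypotheses. -/
theorem tsum_weight_twistedConv_le {c b f : ι → ℂ} (hb : ∀ n, ‖b n‖ₑ ≤ 1) {w : ι → ℝ≥0∞}
    (hw : ∀ n k, w n ≤ w k * w (n - k)) :
    ∑' n, w n * ‖twistedConv c b f n‖ₑ ≤ (∑' n, w n * ‖c n‖ₑ) * ∑' n, w n * ‖f n‖ₑ := by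
  calc ∑' n, w n * ‖twistedConv c b f n‖ₑ
      ≤ ∑' n, ∑' k, (w k * ‖c k‖ₑ) * (w (n - k) * ‖f (n - k)‖ₑ) := by
        refine ENNReal.tsum_le_tsum fun n => ?_
        have h1 : ‖twistedConv c b f n‖ₑ ≤ ∑' k, ‖c k‖ₑ * ‖f (n - k)‖ₑ := by
          refine (enorm_tsum_le_tsum_enorm).trans (ENNReal.tsum_le_tsum fun k => ?_)
          rw [enorm_mul, enorm_mul]
          gcongr
          calc ‖b (n - k)‖ₑ * ‖f (n - k)‖ₑ ≤ 1 * ‖f (n - k)‖ₑ := by gcongr; exact hb _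
            _ = _ := one_mul _
        refine (mul_le_mul_right h1 _).trans ?_
        rw [← ENNReal.tsum_mul_left]
        refine ENNReal.tsum_le_tsum fun k => ?_
        calc w n * (‖c k‖ₑ * ‖f (n - k)‖ₑ) ≤ (w k * w (n - k)) * (‖c k‖ₑ * ‖f (n - k)‖ₑ) := by
              gcongr; exact hw n k
          _ = _ := by ring
    _ = ∑' k, ∑' n, (w k * ‖c k‖ₑ) * (w (n - k) * ‖f (n - k)‖ₑ) := ENNReal.tsum_comm
    _ = ∑' k, (w k * ‖c k‖ₑ) * ∑' n, w n * ‖f n‖ₑ := by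
        refine tsum_congr fun k => ?_
        rw [ENNReal.tsum_mul_left]
        congr 1
        exact (Equiv.subRight k).tsum_eq fun n => w n * ‖f n‖ₑ
    _ = _ := ENNReal.tsum_mul_right

theorem tsum_weight_neumannTerm_le {c b : ι → ℂ} (hb : ∀ n, ‖b n‖ₑ ≤ 1) {w : ι → ℝ≥0∞}
    (hw : ∀ n k, w n ≤ w k * w (n - k)) (j : ℕ) :
    ∑' n, w n * ‖neumannTerm c b j n‖ₑ ≤ (∑' n, w n * ‖c n‖ₑ) ^ (j + 1) := by
  induction j with
  | zero => simp [neumannTerm]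
  | succ j ih =>
    refine (tsum_weight_twistedConv_le hb hw).trans ?_
    rw [pow_succ' _ (j + 1)]
    gcongr

theorem tsum_weight_neumann_le {c b : ι → ℂ} (hb : ∀ n, ‖b n‖ₑ ≤ 1) {w : ι → ℝ≥0∞}
    (hw : ∀ n k, w n ≤ w k * w (n - k)) :
    ∑' n, ∑' j, w n * ‖neumannTerm c b j n‖ₑ ≤
      (∑' n, w n * ‖c n‖ₑ) * (1 - ∑' n, w n * ‖c n‖ₑ)⁻¹ := by
  rw [ENNReal.tsum_comm]
  calc _ ≤ ∑' j : ℕ, (∑' n, w n * ‖c n‖ₑ) ^ (j + 1) :=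
        ENNReal.tsum_le_tsum fun j => tsum_weight_neumannTerm_le hb hw j
    _ = _ := by
        simp_rw [pow_succ']
        rw [ENNReal.tsum_mul_left, ENNReal.tsum_geometric]

theorem summable_of_tsum_enorm_lt_top {κ : Type*} {f : κ → ℂ} (h : ∑' k, ‖f k‖ₑ < ⊤) :
    Summable f := by
  have : Summable fun k => ‖f k‖₊ := ENNReal.tsum_coe_ne_top_iff_summable.1 h.ne
  exact Summable.of_norm (NNReal.summable_coe.2 this)

/-- The Neumann series is dominated by a geometric series in each weighted norm in which c has norm
less than one. The solution f does not depend on the weight, so all these bounds hold for a single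
f. -/
theorem exists_neumann {c b : ι → ℂ} (hb : ∀ n, ‖b n‖ₑ ≤ 1) (hc : ∑' n, ‖c n‖ₑ < 2⁻¹) :
    ∃ f : ι → ℂ, (∀ n, f n = c n + twistedConv c b f n) ∧ ∑' n, ‖f n‖ₑ < 1 ∧
      ∀ w : ι → ℝ≥0∞, (∀ n k, w n ≤ w k * w (n - k)) → ∑' n, w n * ‖c n‖ₑ < 1 →
        ∑' n, w n * ‖f n‖ₑ < ⊤ := by
  have hbound : ∀ w : ι → ℝ≥0∞, ∑' n, w n * ‖∑' j, neumannTerm c b j n‖ₑ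
      ≤ ∑' n, ∑' j, w n * ‖neumannTerm c b j n‖ₑ := by
    intro w
    refine ENNReal.tsum_le_tsum fun n => ?_
    rw [ENNReal.tsum_mul_left]
    gcongr
    exact enorm_tsum_le_tsum_enorm
  have h1 : ∑' n, ∑' j, ‖neumannTerm c b j n‖ₑ < 1 := by
    have := tsum_weight_neumann_le (c := c) hb (w := fun _ => 1) (by simp)
    simp only [one_mul] at this
    refine this.trans_lt ?_
    set S := ∑' n, ‖c n‖ₑ
    -- The bound 1/2 on S is what makes S/(1 - S) less than one. The Beltrami equation later needs
    -- this to keep 1 + h away from zero.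
    have h2 : (2⁻¹ : ℝ≥0∞) ≤ 1 - S := by
      refine ENNReal.le_sub_of_add_le_left (hc.trans_le le_top).ne ?_
      calc S + 2⁻¹ ≤ 2⁻¹ + 2⁻¹ := by gcongr
        _ = 1 := ENNReal.inv_two_add_inv_two
    have h3 : (1 - S)⁻¹ ≤ 2 := by
      rw [← inv_inv (2 : ℝ≥0∞)]
      exact ENNReal.inv_le_inv.2 h2
    calc S * (1 - S)⁻¹ ≤ S * 2 := by gcongr
      _ < 2⁻¹ * 2 := by
          rw [mul_comm S, mul_comm 2⁻¹]
          exact (ENNReal.mul_lt_mul_iff_right (by simp) (by simp)).2 hc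
      _ = 1 := ENNReal.inv_mul_cancel (by simp) (by simp)
  have hfin : ∀ n, ∑' j, ‖neumannTerm c b j n‖ₑ < ⊤ := fun n =>
    (ENNReal.le_tsum n).trans_lt (h1.trans_le le_top)
  refine ⟨fun n => ∑' j, neumannTerm c b j n, fun n => ?_, ?_, fun w hw hcw => ?_⟩
  · have hs := summable_of_tsum_enorm_lt_top (hfin n)
    refine hs.tsum_eq_zero_add.trans ?_
    congr 1
    change ∑' j, ∑' k, c k * (b (n - k) * neumannTerm c b j (n - k)) = _
    have hsum : Summable (Function.uncurry fun (j : ℕ) (k : ι) =>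
        c k * (b (n - k) * neumannTerm c b j (n - k))) := by
      apply summable_of_tsum_enorm_lt_top
      rw [ENNReal.tsum_prod', ENNReal.tsum_comm]
      calc _ ≤ ∑' k, ∑' j, ‖c k‖ₑ * ‖neumannTerm c b j (n - k)‖ₑ := by
            refine ENNReal.tsum_le_tsum fun k => ENNReal.tsum_le_tsum fun j => ?_
            simp only [Function.uncurry, enorm_mul]
            gcongr
            calc ‖b (n - k)‖ₑ * ‖neumannTerm c b j (n - k)‖ₑ
                ≤ 1 * ‖neumannTerm c b j (n - k)‖ₑ := by gcongr; exact hb _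
              _ = _ := one_mul _
        _ ≤ ∑' k, ‖c k‖ₑ * 1 := by
            refine ENNReal.tsum_le_tsum fun k => ?_
            rw [ENNReal.tsum_mul_left]
            gcongr
            exact (ENNReal.le_tsum (n - k)).trans h1.le
        _ < ⊤ := by simpa using hc.trans_le le_top
    refine hsum.tsum_comm.symm.trans ?_
    refine tsum_congr fun k => ?_
    rw [tsum_mul_left, tsum_mul_left]
  · have := (hbound fun _ => 1)
    simp only [one_mul] at this
    exact this.trans_lt h1
  · refine (hbound w).trans_lt ((tsum_weight_neumann_le hb hw).trans_lt ?_)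
    refine ENNReal.mul_lt_top (hcw.trans_le le_top) ?_
    rw [ENNReal.inv_lt_top]
    exact tsub_pos_of_lt hcw

end Neumann

/-- The weights (1 + δ|n|)^s are submultiplicative and grow like |n|^s for each fixed δ > 0. By
dominated convergence the weighted norm of c tends to its plain norm as δ → 0, so it is below one
for small δ, and f inherits polynomial decay of order s. -/
theorem exists_neumann_rapid {c b : (Fin 2 → ℤ) → ℂ} (hb : ∀ n, ‖b n‖ ≤ 1)
    (hc : ∑' n, ‖c n‖ < 1 / 2) (hrapid : ∀ s : ℕ, Summable fun n => ‖n‖ ^ s * ‖c n‖) :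
    ∃ f : (Fin 2 → ℤ) → ℂ, (∀ n, f n = c n + twistedConv c b f n) ∧
      (∑' n, ‖f n‖ < 1) ∧ ∀ s : ℕ, Summable fun n => ‖n‖ ^ s * ‖f n‖ := by
  have hcs : Summable fun n => ‖c n‖ := by simpa using hrapid 0
  have henorm : ∀ z : ℂ, ‖z‖ₑ = ENNReal.ofReal ‖z‖ := fun z => (ofReal_norm z).symm
  have hce : ∑' n, ‖c n‖ₑ < 2⁻¹ := by
    simp_rw [henorm]
    rw [← ENNReal.ofReal_tsum_of_nonneg (fun n => norm_nonneg _) hcs]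
    have : (2⁻¹ : ℝ≥0∞) = ENNReal.ofReal (1 / 2) := by
      rw [one_div, ENNReal.ofReal_inv_of_pos (by norm_num)]
      simp
    rw [this]
    exact (ENNReal.ofReal_lt_ofReal_iff (by norm_num)).2 hc
  obtain ⟨f, hf, hf1, hfw⟩ := exists_neumann (c := c) (b := b)
    (fun n => by rw [henorm]; exact ENNReal.ofReal_le_one.2 (hb n)) hce
  have hfs : Summable f := summable_of_tsum_enorm_lt_top (hf1.trans_le le_top)
  refine ⟨f, hf, ?_, fun s => ?_⟩
  · simp_rw [henorm] at hf1
    rw [← ENNReal.ofReal_tsum_of_nonneg (fun n => norm_nonneg _) hfs.norm,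
      ENNReal.ofReal_lt_one] at hf1
    exact hf1
  · have hsum1 : Summable fun n : Fin 2 → ℤ => (1 + ‖n‖) ^ s * ‖c n‖ := by
      have : ∀ n : Fin 2 → ℤ, (1 + ‖n‖) ^ s * ‖c n‖
          ≤ 2 ^ s * (‖c n‖ + ‖n‖ ^ s * ‖c n‖) := by
        intro n
        have h2 : (1 + ‖n‖) ^ s ≤ 2 ^ s * (1 + ‖n‖ ^ s) := by
          rcases le_total ‖n‖ 1 with h | h
          · calc (1 + ‖n‖) ^ s ≤ 2 ^ s := by gcongr; linarith
              _ ≤ 2 ^ s * (1 + ‖n‖ ^ s) := le_mul_of_one_le_right (by positivity)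
                  (le_add_of_nonneg_right (by positivity))
          · calc (1 + ‖n‖) ^ s ≤ (2 * ‖n‖) ^ s := by gcongr; linarith
              _ = 2 ^ s * ‖n‖ ^ s := mul_pow _ _ _
              _ ≤ 2 ^ s * (1 + ‖n‖ ^ s) := by gcongr; linarith
        calc (1 + ‖n‖) ^ s * ‖c n‖ ≤ (2 ^ s * (1 + ‖n‖ ^ s)) * ‖c n‖ := by gcongr
          _ = _ := by ring
      exact Summable.of_nonneg_of_le (fun n => by positivity) this
        ((hcs.add (hrapid s)).mul_left _)
    have hlim : Tendsto (fun δ : ℝ => ∑' n, (1 + δ * ‖n‖) ^ s * ‖c n‖) (𝓝[>] 0)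
        (𝓝 (∑' n, ‖c n‖)) := by
      refine tendsto_tsum_of_dominated_convergence hsum1 (fun n => ?_) ?_
      · have : Continuous fun δ : ℝ => (1 + δ * ‖n‖) ^ s * ‖c n‖ := by fun_prop
        have h := (this.tendsto 0).mono_left (nhdsWithin_le_nhds (s := Ioi 0))
        simpa using h
      · filter_upwards [Ioo_mem_nhdsGT (show (0 : ℝ) < 1 by norm_num)] with δ hδ n
        have : 0 ≤ δ := hδ.1.le
        rw [Real.norm_of_nonneg (by positivity)]
        gcongr
        exact mul_le_of_le_one_left (norm_nonneg _) hδ.2.le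
    obtain ⟨δ, hδ1, hδ⟩ := ((hlim.eventually_lt_const (u := 1) (by linarith)).and
      (Ioo_mem_nhdsGT (show (0 : ℝ) < 1 by norm_num))).exists
    have hδ0 : 0 < δ := hδ.1
    have hδs : Summable fun n : Fin 2 → ℤ => (1 + δ * ‖n‖) ^ s * ‖c n‖ := by
      refine Summable.of_nonneg_of_le (fun n => by positivity) (fun n => ?_) hsum1
      gcongr
      exact mul_le_of_le_one_left (norm_nonneg _) hδ.2.le
    have hw := hfw (fun n => ENNReal.ofReal ((1 + δ * ‖n‖) ^ s)) (fun n k => ?_) ?_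
    · have h3 : Summable fun n => (((1 + δ * ‖n‖) ^ s : ℝ) : ℂ) * f n := by
        apply summable_of_tsum_enorm_lt_top
        refine lt_of_eq_of_lt (tsum_congr fun n => ?_) hw
        rw [enorm_mul, henorm ((_ : ℝ) : ℂ), Complex.norm_real, Real.norm_of_nonneg (by positivity)]
      have h4 := (h3.norm).mul_left ((δ⁻¹) ^ s)
      refine Summable.of_nonneg_of_le (fun n => by positivity) (fun n => ?_) h4
      rw [norm_mul, Complex.norm_real, Real.norm_of_nonneg (by positivity), ← mul_assoc, ← mul_pow]
      gcongr
      rw [mul_add, inv_mul_cancel_left₀ hδ0.ne']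
      have : 0 ≤ δ⁻¹ * 1 := by positivity
      linarith
    · rw [← ENNReal.ofReal_mul (by positivity), ← mul_pow]
      apply ENNReal.ofReal_le_ofReal
      gcongr
      have : ‖n‖ ≤ ‖k‖ + ‖n - k‖ := by
        calc ‖n‖ = ‖k + (n - k)‖ := by congr 1; abel
          _ ≤ _ := norm_add_le _ _
      nlinarith [norm_nonneg k, norm_nonneg (n - k), mul_nonneg (norm_nonneg k) (norm_nonneg (n - k)),
        mul_nonneg (mul_nonneg hδ0.le hδ0.le) (mul_nonneg (norm_nonneg k) (norm_nonneg (n - k)))]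
    · have : ∀ n : Fin 2 → ℤ, ENNReal.ofReal ((1 + δ * ‖n‖) ^ s) * ‖c n‖ₑ
          = ENNReal.ofReal ((1 + δ * ‖n‖) ^ s * ‖c n‖) := fun n => by
        rw [henorm, ENNReal.ofReal_mul (by positivity)]
      simp_rw [this]
      rw [← ENNReal.ofReal_tsum_of_nonneg (fun n => by positivity) hδs, ENNReal.ofReal_lt_one]
      exact hδ1

end SpinGeometry

end

noncomputable section

namespace SpinGeometry

open Set Filter Topology MeasureTheory

/-! ### Fourier coefficients of functions supported in a fundamental domain -/

/-- The phase `2π (n₀ x₀ + n₁ x₁)`. -/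
def phase (n : Fin 2 → ℤ) : (Fin 2 → ℝ) →L[ℝ] ℝ :=
  ∑ i, (2 * Real.pi * n i : ℝ) • ContinuousLinearMap.proj (R := ℝ) (φ := fun _ : Fin 2 => ℝ) i

theorem phase_apply (n : Fin 2 → ℤ) (x : Fin 2 → ℝ) :
    phase n x = 2 * Real.pi * (n 0 * x 0 + n 1 * x 1) := by
  simp [phase, Fin.sum_univ_two]; ring

/-- The character `exp (2π i n·x)`. -/
def wave (n : Fin 2 → ℤ) (x : Fin 2 → ℝ) : ℂ := Complex.exp (phase n x * Complex.I)

theorem norm_wave (n : Fin 2 → ℤ) (x : Fin 2 → ℝ) : ‖wave n x‖ = 1 :=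
  Complex.norm_exp_ofReal_mul_I _

theorem wave_add (n k : Fin 2 → ℤ) (x : Fin 2 → ℝ) : wave (n + k) x = wave n x * wave k x := by
  simp only [wave, phase_apply]
  rw [← Complex.exp_add]
  congr 1
  push_cast [Pi.add_apply]
  ring

theorem contDiff_wave (n : Fin 2 → ℤ) : ContDiff ℝ ∞ (wave n) := by
  unfold wave
  exact ((Complex.ofRealCLM.contDiff.comp (phase n).contDiff).mul contDiff_const).cexp

theorem hasFDerivAt_wave (n : Fin 2 → ℤ) (x : Fin 2 → ℝ) :
    HasFDerivAt (wave n) ((wave n x * Complex.I) • Complex.ofRealCLM.comp (phase n)) x := by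
  have h : HasFDerivAt (fun x => (phase n x : ℂ) * Complex.I)
      (Complex.I • Complex.ofRealCLM.comp (phase n)) x := by
    have := ((Complex.ofRealCLM.comp (phase n)).hasFDerivAt (x := x)).mul_const Complex.I
    exact this
  have := h.cexp
  rwa [smul_smul] at this

theorem mFourier_coe (n : Fin 2 → ℤ) (x : Fin 2 → ℝ) :
    UnitAddTorus.mFourier n (fun i => (x i : UnitAddCircle)) = wave n x := by
  simp only [UnitAddTorus.mFourier, ContinuousMap.coe_mk, Fin.prod_univ_two, fourier_coe_apply,
    wave, phase_apply]
  rw [← Complex.exp_add]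
  congr 1
  push_cast
  ring

/-- The Fourier coefficient of a function on the plane. -/
def planeCoeff (f : (Fin 2 → ℝ) → ℂ) (n : Fin 2 → ℤ) : ℂ := ∫ x, wave (-n) x * f x

/-- The representative in `(-1/2, 1/2]²` of a point of the torus. -/
def torusRep (θ : UnitAddTorus (Fin 2)) : Fin 2 → ℝ := fun i =>
  (AddCircle.equivIoc (1 : ℝ) (-1 / 2) (θ i) : ℝ)

theorem torusRep_coe {x : Fin 2 → ℝ} (hx : ∀ i, x i ∈ Ioc (-1 / 2 : ℝ) (-1 / 2 + 1)) :
    torusRep (fun i => (x i : UnitAddCircle)) = x := by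
  ext i
  exact AddCircle.equivIoc_coe_of_mem (hx i)

/-- The representative jumps only where some coordinate is ±1/2. The function vanishes in a
neighbourhood of those points, so the composition has no discontinuity. -/
theorem continuous_comp_torusRep {f : (Fin 2 → ℝ) → ℂ} (hf : Continuous f)
    (h0 : ∀ x i, 1 / 4 < |x i| → f x = 0) : Continuous (f ∘ torusRep) := by
  rw [continuous_iff_continuousAt]
  intro θ
  by_cases h : ∀ i, θ i ≠ ((-1 / 2 : ℝ) : UnitAddCircle)
  · refine hf.continuousAt.comp ?_
    rw [ContinuousAt, tendsto_pi_nhds]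
    intro i
    have h1 := AddCircle.continuousAt_equivIoc (1 : ℝ) (-1 / 2) (h i)
    have h2 : ContinuousAt (fun θ : UnitAddTorus (Fin 2) => θ i) θ := (continuous_apply i).continuousAt
    exact (continuous_subtype_val.continuousAt.comp h1).comp_of_eq h2 rfl
  · push Not at h
    obtain ⟨i, hi⟩ := h
    set N : Set UnitAddCircle := ((fun s : ℝ => (s : UnitAddCircle)) '' Icc (-1 / 4) (1 / 4))ᶜ
    have hN : IsOpen N := by
      refine IsClosed.isOpen_compl (self := (IsCompact.isClosed ?_))
      exact isCompact_Icc.image (AddCircle.continuous_mk' 1)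
    have hiN : θ i ∈ N := by
      rintro ⟨s, hs, hse⟩
      rw [hi] at hse
      have h1 := (AddCircle.coe_eq_coe_iff_of_mem_Ico (p := (1 : ℝ)) (a := -1 / 2)
        (x := s) (y := -1 / 2) ⟨by linarith [hs.1], by linarith [hs.2]⟩
        ⟨le_rfl, by norm_num⟩).1 hse
      linarith [hs.1]
    have hz : ∀ θ' : UnitAddTorus (Fin 2), θ' i ∈ N → f (torusRep θ') = 0 := by
      intro θ' hθ'
      apply h0 _ i
      by_contra hcon
      push Not at hcon
      exact hθ' ⟨torusRep θ' i, ⟨by linarith [(abs_le.1 hcon).1], (abs_le.1 hcon).2⟩,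
        AddCircle.coe_equivIoc⟩
    have : (f ∘ torusRep) =ᶠ[𝓝 θ] fun _ => 0 := by
      have hc : ContinuousAt (fun θ : UnitAddTorus (Fin 2) => θ i) θ :=
        (continuous_apply i).continuousAt
      filter_upwards [hc (hN.mem_nhds hiN)] with θ' hθ'
      exact hz θ' hθ'
    exact continuousAt_const.congr this.symm

theorem mFourierCoeff_comp_torusRep {f : (Fin 2 → ℝ) → ℂ}
    (h0 : ∀ x i, 1 / 4 < |x i| → f x = 0) (n : Fin 2 → ℤ) :
    UnitAddTorus.mFourierCoeff (f ∘ torusRep) n = planeCoeff f n := by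
  have hm : MeasurableSet {x : Fin 2 → ℝ | ∀ i, x i ∈ Ioc (-1 / 2 : ℝ) (-1 / 2 + 1)} := by
    rw [ofPred_forall]
    exact MeasurableSet.iInter fun i => (measurable_pi_apply i) measurableSet_Ioc
  have e := setIntegral_eq_integral_of_forall_compl_eq_zero (μ := volume)
      (s := {x : Fin 2 → ℝ | ∀ i, x i ∈ Ioc (-1 / 2 : ℝ) (-1 / 2 + 1)})
      (f := fun x => wave (-n) x * f x) (fun x hx => by
    simp only [mem_ofPred_eq, not_forall] at hx
    obtain ⟨i, hi⟩ := hx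
    rw [h0 x i, mul_zero]
    by_contra hcon
    push Not at hcon
    exact hi ⟨by linarith [(abs_le.1 hcon).1], by linarith [(abs_le.1 hcon).2]⟩)
  rw [UnitAddTorus.mFourierCoeff_eq_integral _ n (fun _ => -1 / 2), planeCoeff, ← e]
  refine setIntegral_congr_fun hm fun x hx => ?_
  simp only [Function.comp_apply, torusRep_coe hx, mFourier_coe, smul_eq_mul]

theorem hasSum_planeCoeff {f : (Fin 2 → ℝ) → ℂ} (hf : Continuous f)
    (h0 : ∀ x i, 1 / 4 < |x i| → f x = 0) (hs : Summable (planeCoeff f)) {x : Fin 2 → ℝ}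
    (hx : ∀ i, |x i| ≤ 1 / 4) : HasSum (fun n => planeCoeff f n * wave n x) (f x) := by
  have h := UnitAddTorus.hasSum_mFourier_series_apply_of_summable
    (f := ⟨f ∘ torusRep, continuous_comp_torusRep hf h0⟩) (by
      convert hs using 1
      ext n
      exact mFourierCoeff_comp_torusRep h0 n) (fun i => (x i : UnitAddCircle))
  have hx' : ∀ i, x i ∈ Ioc (-1 / 2 : ℝ) (-1 / 2 + 1) := fun i =>
    ⟨by linarith [(abs_le.1 (hx i)).1], by linarith [(abs_le.1 (hx i)).2]⟩
  simp only [ContinuousMap.coe_mk, Function.comp_apply, torusRep_coe hx', smul_eq_mul,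
    mFourier_coe] at h
  convert h using 2 with n
  rw [← mFourierCoeff_comp_torusRep h0 n]

/-- The square outside of which the functions below vanish. -/
def square : Set (Fin 2 → ℝ) := Icc (fun _ => -1 / 4) (fun _ => 1 / 4)

theorem mem_square {x : Fin 2 → ℝ} : x ∈ square ↔ ∀ i, |x i| ≤ 1 / 4 := by
  simp only [square, mem_Icc, Pi.le_def, abs_le]
  constructor
  · exact fun h i => ⟨by linarith [h.1 i], h.2 i⟩
  · exact fun h => ⟨fun i => by linarith [(h i).1], fun i => (h i).2⟩

theorem isCompact_square : IsCompact square := isCompact_Icc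

theorem hasCompactSupport_of_square {f : (Fin 2 → ℝ) → ℂ}
    (h0 : ∀ x i, 1 / 4 < |x i| → f x = 0) : HasCompactSupport f :=
  HasCompactSupport.intro isCompact_square fun x hx => by
    rw [mem_square] at hx
    push Not at hx
    obtain ⟨i, hi⟩ := hx
    exact h0 x i hi

theorem planeCoeff_fderiv {f : (Fin 2 → ℝ) → ℂ} (hf : ContDiff ℝ 1 f)
    (h0 : ∀ x i, 1 / 4 < |x i| → f x = 0) (j : Fin 2) (n : Fin 2 → ℤ) :
    planeCoeff (fun x => fderiv ℝ f x (Pi.single j 1)) n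
      = (2 * Real.pi * n j : ℝ) * Complex.I * planeCoeff f n := by
  have hs : HasCompactSupport f := hasCompactSupport_of_square h0
  have hfc : Continuous fun x => fderiv ℝ f x (Pi.single j 1) :=
    (hf.continuous_fderiv (by simp)).clm_apply continuous_const
  have hsd : HasCompactSupport fun x => fderiv ℝ f x (Pi.single j 1) := hs.fderiv_apply (𝕜 := ℝ) _
  have hw : ∀ x, fderiv ℝ (wave (-n)) x (Pi.single j 1)
      = -((2 * Real.pi * n j : ℝ) * Complex.I) * wave (-n) x := by
    intro x
    rw [(hasFDerivAt_wave (-n) x).fderiv]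
    have : phase (-n) (Pi.single j 1) = -(2 * Real.pi * n j) := by
      rw [phase_apply]
      fin_cases j <;> simp
    simp only [smul_apply, ContinuousLinearMap.comp_apply, this, smul_eq_mul,
      Complex.ofRealCLM_apply]
    push_cast
    ring
  have hwc : Continuous (wave (-n)) := (contDiff_wave (-n)).continuous
  have hwc' : Continuous fun x => fderiv ℝ (wave (-n)) x (Pi.single j 1) := by
    simp_rw [hw]
    exact continuous_const.mul hwc
  have := integral_mul_fderiv_eq_neg_fderiv_mul_of_integrable (μ := volume) (f := wave (-n)) (g := f)
    (v := Pi.single j 1)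
    ((hwc'.mul hf.continuous).integrable_of_hasCompactSupport hs.mul_left)
    ((hwc.mul hfc).integrable_of_hasCompactSupport hsd.mul_left)
    ((hwc.mul hf.continuous).integrable_of_hasCompactSupport hs.mul_left)
    (fun x _ => (contDiff_wave (-n)).differentiable (by simp) x)
    (fun x _ => hf.differentiable (by simp) x)
  rw [planeCoeff, this, planeCoeff, ← integral_neg, ← integral_const_mul]
  congr 1
  ext x
  rw [hw]
  ring

/-- Uniform rapid decay of the Fourier coefficients in a smooth family. -/
theorem exists_planeCoeff_bound (j : Fin 2) (k : ℕ) : ∀ H : ℝ × (Fin 2 → ℝ) → ℂ,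
    ContDiff ℝ ∞ H → (∀ ε x i, 1 / 4 < |x i| → H (ε, x) = 0) →
    ∃ C, ∀ ε ∈ Icc (0 : ℝ) 1, ∀ n : Fin 2 → ℤ,
      |(n j : ℝ)| ^ k * ‖planeCoeff (fun x => H (ε, x)) n‖ ≤ C := by
  induction k with
  | zero =>
    intro H hH h0
    obtain ⟨B, hB⟩ := (isCompact_Icc.prod isCompact_square).exists_bound_of_continuousOn
      (f := H) (s := Icc (0 : ℝ) 1 ×ˢ square) hH.continuous.continuousOn
    refine ⟨B * volume.real square, fun ε hε n => ?_⟩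
    rw [pow_zero, one_mul, planeCoeff,
      ← setIntegral_eq_integral_of_forall_compl_eq_zero (s := square)]
    · refine norm_setIntegral_le_of_norm_le_const isCompact_square.measure_lt_top fun x hx => ?_
      rw [norm_mul, norm_wave, one_mul]
      exact hB _ ⟨hε, hx⟩
    · intro x hx
      rw [mem_square] at hx
      push Not at hx
      obtain ⟨i, hi⟩ := hx
      rw [h0 ε x i hi, mul_zero]
  | succ k ih =>
    intro H hH h0
    -- Each partial derivative in the plane multiplies the coefficient by 2πi n_j and is again a
    -- smooth family supported in the square, so one more power of n_j is gained.
    set H' : ℝ × (Fin 2 → ℝ) → ℂ := fun q => fderiv ℝ H q (0, Pi.single j 1) with hH'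
    have hH's : ContDiff ℝ ∞ H' := (hH.fderiv_right (by simp)).clm_apply contDiff_const
    have hslice : ∀ ε x, fderiv ℝ (fun x => H (ε, x)) x (Pi.single j 1) = H' (ε, x) := by
      intro ε x
      have h1 : HasFDerivAt (fun x => H (ε, x))
          ((fderiv ℝ H (ε, x)).comp (ContinuousLinearMap.inr ℝ ℝ (Fin 2 → ℝ))) x :=
        HasFDerivAt.comp x (hH.differentiable (by simp) (ε, x)).hasFDerivAt
          (hasFDerivAt_prodMk_right ε x)
      rw [h1.fderiv]
      rfl
    have h0' : ∀ ε x i, 1 / 4 < |x i| → H' (ε, x) = 0 := by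
      intro ε x i hx
      have hopen : IsOpen {q : ℝ × (Fin 2 → ℝ) | 1 / 4 < |q.2 i|} :=
        isOpen_lt continuous_const (by fun_prop)
      have : H =ᶠ[𝓝 (ε, x)] fun _ => 0 := by
        filter_upwards [hopen.mem_nhds (show (ε, x) ∈ {q : ℝ × (Fin 2 → ℝ) | 1 / 4 < |q.2 i|} from hx)]
          with q hq
        exact h0 q.1 q.2 i hq
      rw [hH']
      simp only [this.fderiv_eq, fderiv_fun_const, Pi.zero_apply, zero_apply]
    obtain ⟨C, hC⟩ := ih H' hH's h0'
    refine ⟨C, fun ε hε n => le_trans ?_ (hC ε hε n)⟩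
    have hsl : ContDiff ℝ 1 fun x => H (ε, x) :=
      (hH.comp (contDiff_const.prodMk contDiff_id)).of_le (by exact_mod_cast le_top)
    have h2 := planeCoeff_fderiv hsl (h0 ε) j n
    simp_rw [hslice] at h2
    rw [h2, norm_mul, norm_mul, Complex.norm_I, mul_one, Complex.norm_real, Real.norm_eq_abs,
      pow_succ, mul_assoc]
    have h3 : |(n j : ℝ)| ≤ |2 * Real.pi * n j| := by
      rw [abs_mul, abs_of_nonneg (by positivity : 0 ≤ 2 * Real.pi)]
      refine le_mul_of_one_le_left (abs_nonneg _) ?_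
      linarith [Real.pi_gt_three]
    exact mul_le_mul_of_nonneg_left (mul_le_mul_of_nonneg_right h3 (norm_nonneg _)) (by positivity)

theorem exists_planeCoeff_norm_bound (k : ℕ) (H : ℝ × (Fin 2 → ℝ) → ℂ)
    (hH : ContDiff ℝ ∞ H) (h0 : ∀ ε x i, 1 / 4 < |x i| → H (ε, x) = 0) :
    ∃ C, ∀ ε ∈ Icc (0 : ℝ) 1, ∀ n : Fin 2 → ℤ,
      ‖n‖ ^ k * ‖planeCoeff (fun x => H (ε, x)) n‖ ≤ C := by
  obtain ⟨C₀, h₀⟩ := exists_planeCoeff_bound 0 k H hH h0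
  obtain ⟨C₁, h₁⟩ := exists_planeCoeff_bound 1 k H hH h0
  refine ⟨max C₀ C₁, fun ε hε n => ?_⟩
  have hle : ∀ i : Fin 2, (∀ j : Fin 2, |(n j : ℝ)| ≤ |(n i : ℝ)|) → ‖n‖ ^ k ≤ |(n i : ℝ)| ^ k := by
    intro i hi
    have : ‖n‖ ≤ |(n i : ℝ)| := (pi_norm_le_iff_of_nonneg (abs_nonneg _)).2 fun j => by
      rw [Int.norm_eq_abs]
      exact hi j
    gcongr
  rcases le_total |(n 0 : ℝ)| |(n 1 : ℝ)| with h | h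
  · refine (mul_le_mul_of_nonneg_right (hle 1 ?_) (norm_nonneg _)).trans
      ((h₁ ε hε n).trans (le_max_right _ _))
    intro j
    fin_cases j
    exacts [h, le_rfl]
  · refine (mul_le_mul_of_nonneg_right (hle 0 ?_) (norm_nonneg _)).trans
      ((h₀ ε hε n).trans (le_max_left _ _))
    intro j
    fin_cases j
    exacts [le_rfl, h]

/-- Exponent 3 exceeds the rank 2 of the lattice. The summand 1 keeps the expression harmless at n =
0. -/
theorem summable_inv_one_add_norm_pow : Summable fun n : Fin 2 → ℤ => (1 + ‖n‖ ^ 3)⁻¹ := by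
  have h := EisensteinSeries.summable_one_div_norm_rpow (k := 3) (by norm_num)
  rw [← (Set.finite_singleton (0 : Fin 2 → ℤ)).summable_compl_iff] at h ⊢
  refine Summable.of_nonneg_of_le (fun n => by simp only [Function.comp_apply]; positivity)
    (fun n => ?_) h
  simp only [Function.comp_apply]
  have hn : 0 < ‖(n : Fin 2 → ℤ)‖ := norm_pos_iff.2 n.2
  rw [Real.rpow_neg hn.le]
  have : ‖(n : Fin 2 → ℤ)‖ ^ (3 : ℝ) = ‖(n : Fin 2 → ℤ)‖ ^ 3 := by
    exact_mod_cast Real.rpow_natCast _ 3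
  rw [this]
  gcongr
  linarith

theorem summable_of_rapid {a : (Fin 2 → ℤ) → ℝ} (h0 : ∀ n, 0 ≤ a n) {C C' : ℝ}
    (h : ∀ n, a n ≤ C) (h' : ∀ n, ‖n‖ ^ 3 * a n ≤ C') : Summable a := by
  refine Summable.of_nonneg_of_le h0 (fun n => ?_) (summable_inv_one_add_norm_pow.mul_left (C + C'))
  rw [← div_eq_mul_inv, le_div_iff₀ (by positivity)]
  linarith [h n, h' n]

theorem summable_planeCoeff_pow (H : ℝ × (Fin 2 → ℝ) → ℂ)
    (hH : ContDiff ℝ ∞ H) (h0 : ∀ ε x i, 1 / 4 < |x i| → H (ε, x) = 0) {ε : ℝ}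
    (hε : ε ∈ Icc (0 : ℝ) 1) (s : ℕ) :
    Summable fun n => ‖n‖ ^ s * ‖planeCoeff (fun x => H (ε, x)) n‖ := by
  obtain ⟨C, hC⟩ := exists_planeCoeff_norm_bound s H hH h0
  obtain ⟨C', hC'⟩ := exists_planeCoeff_norm_bound (3 + s) H hH h0
  refine summable_of_rapid (fun n => by positivity) (hC ε hε) (C' := C') fun n => ?_
  rw [← mul_assoc, ← pow_add]
  exact hC' ε hε n

/-- Each coefficient tends to zero with ε because H(0, ·) = 0, and all of them are bounded by a
multiple of (1 + |n|³)⁻¹ uniformly in ε. Dominated convergence makes the ℓ¹ norm small. -/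
theorem exists_small_planeCoeff (H : ℝ × (Fin 2 → ℝ) → ℂ)
    (hH : ContDiff ℝ ∞ H) (h0 : ∀ ε x i, 1 / 4 < |x i| → H (ε, x) = 0)
    (hz : ∀ x, H (0, x) = 0) :
    ∃ ε ∈ Ioo (0 : ℝ) 1, ∑' n, ‖planeCoeff (fun x => H (ε, x)) n‖ < 1 / 2 := by
  obtain ⟨C, hC⟩ := exists_planeCoeff_norm_bound 0 H hH h0
  obtain ⟨C', hC'⟩ := exists_planeCoeff_norm_bound 3 H hH h0
  obtain ⟨B, hB⟩ := (isCompact_Icc.prod isCompact_square).exists_bound_of_continuousOn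
      (f := H) (s := Icc (0 : ℝ) 1 ×ˢ square) hH.continuous.continuousOn
  have hint : ∀ n, Tendsto (fun ε => planeCoeff (fun x => H (ε, x)) n) (𝓝[>] 0) (𝓝 0) := by
    intro n
    have hset : ∀ ε, planeCoeff (fun x => H (ε, x)) n = ∫ x in square, wave (-n) x * H (ε, x) := by
      intro ε
      rw [planeCoeff, ← setIntegral_eq_integral_of_forall_compl_eq_zero (s := square)]
      intro x hx
      rw [mem_square] at hx
      push Not at hx
      obtain ⟨i, hi⟩ := hx
      rw [h0 ε x i hi, mul_zero]
    simp_rw [hset]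
    have hc : Continuous fun ε => ∫ x in square, wave (-n) x * H (ε, x) := by
      apply continuous_parametric_integral_of_continuous (s := square) _ isCompact_square
      exact ((contDiff_wave (-n)).continuous.comp continuous_snd).mul hH.continuous
    have := (hc.tendsto 0).mono_left (nhdsWithin_le_nhds (s := Ioi 0))
    simpa [hz] using this
  have hlim : Tendsto (fun ε => ∑' n, ‖planeCoeff (fun x => H (ε, x)) n‖) (𝓝[>] 0)
      (𝓝 (∑' _ : Fin 2 → ℤ, (0 : ℝ))) := by
    refine tendsto_tsum_of_dominated_convergence
      (summable_inv_one_add_norm_pow.mul_left (C + C')) (fun n => ?_) ?_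
    · simpa using (hint n).norm
    · filter_upwards [Ioo_mem_nhdsGT (show (0 : ℝ) < 1 by norm_num)] with ε hε n
      have hε' : ε ∈ Icc (0 : ℝ) 1 := Ioo_subset_Icc_self hε
      rw [norm_norm, ← div_eq_mul_inv, le_div_iff₀ (by positivity)]
      have h1 := hC ε hε' n
      have h2 := hC' ε hε' n
      rw [pow_zero, one_mul] at h1
      linarith
  rw [tsum_zero] at hlim
  obtain ⟨ε, h1, h2⟩ := ((hlim.eventually_lt_const (u := 1 / 2) (by norm_num)).and
    (Ioo_mem_nhdsGT (show (0 : ℝ) < 1 by norm_num))).exists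
  exact ⟨ε, h2, h1⟩

end SpinGeometry

end

noncomputable section

namespace SpinGeometry

open Set Filter Topology MeasureTheory

/-! ### Isothermal coordinates: the Beltrami equation -/

theorem norm_phase_le (n : Fin 2 → ℤ) : ‖phase n‖ ≤ 4 * Real.pi * ‖n‖ := by
  refine ContinuousLinearMap.opNorm_le_bound _ (by positivity) fun x => ?_
  rw [phase_apply, norm_mul, Real.norm_of_nonneg (by positivity : 0 ≤ 2 * Real.pi)]
  have hn : ∀ i, ‖(n i : ℝ)‖ ≤ ‖n‖ := fun i => by
    rw [Real.norm_eq_abs, ← Int.norm_eq_abs]; exact norm_le_pi_norm n i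
  have hx : ∀ i, ‖x i‖ ≤ ‖x‖ := fun i => norm_le_pi_norm x i
  have : ‖(n 0 : ℝ) * x 0 + n 1 * x 1‖ ≤ ‖n‖ * ‖x‖ + ‖n‖ * ‖x‖ := by
    refine (norm_add_le _ _).trans ?_
    rw [norm_mul, norm_mul]
    gcongr <;> first | apply hn | apply hx
  calc 2 * Real.pi * ‖(n 0 : ℝ) * x 0 + n 1 * x 1‖
      ≤ 2 * Real.pi * (‖n‖ * ‖x‖ + ‖n‖ * ‖x‖) := by gcongr
    _ = _ := by ring

theorem iteratedDeriv_cexp_mul_I (k : ℕ) :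
    iteratedDeriv k (fun t : ℝ => Complex.exp (t * Complex.I))
      = fun t : ℝ => Complex.I ^ k * Complex.exp (t * Complex.I) := by
  induction k with
  | zero => simp
  | succ k ih =>
    rw [iteratedDeriv_succ, ih]
    ext t
    have : HasDerivAt (fun t : ℝ => Complex.exp (t * Complex.I))
        (Complex.exp (t * Complex.I) * (1 * Complex.I)) t :=
      ((Complex.ofRealCLM.hasDerivAt (x := t)).mul_const Complex.I).cexp
    rw [(this.const_mul _).deriv, pow_succ]
    ring

theorem norm_iteratedFDeriv_wave_le (n : Fin 2 → ℤ) (k : ℕ) (x : Fin 2 → ℝ) :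
    ‖iteratedFDeriv ℝ k (wave n) x‖ ≤ (4 * Real.pi * ‖n‖) ^ k := by
  have hE : ContDiff ℝ ∞ fun t : ℝ => Complex.exp (t * Complex.I) :=
    (Complex.ofRealCLM.contDiff.mul contDiff_const).cexp
  have h := (phase n).iteratedFDeriv_comp_right hE x (i := k) (by exact_mod_cast le_top)
  have h2 : wave n = (fun t : ℝ => Complex.exp (t * Complex.I)) ∘ phase n := rfl
  rw [h2, h]
  refine (ContinuousMultilinearMap.norm_compContinuousLinearMap_le _ _).trans ?_
  rw [norm_iteratedFDeriv_eq_norm_iteratedDeriv, iteratedDeriv_cexp_mul_I, norm_mul, norm_pow,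
    Complex.norm_I, one_pow, Complex.norm_exp_ofReal_mul_I, Finset.prod_const, Finset.card_univ,
    Fintype.card_fin, one_mul, one_mul]
  gcongr
  exact norm_phase_le n

/-- Rapid decay of a double sequence. -/
def Rapid (a : (Fin 2 → ℤ) → ℂ) : Prop := ∀ s : ℕ, Summable fun n => ‖n‖ ^ s * ‖a n‖

theorem Rapid.summable_norm {a : (Fin 2 → ℤ) → ℂ} (ha : Rapid a) : Summable fun n => ‖a n‖ := by
  simpa using ha 0

theorem Rapid.mono {a b : (Fin 2 → ℤ) → ℂ} (ha : Rapid a) (h : ∀ n, ‖b n‖ ≤ ‖a n‖) : Rapid b :=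
  fun s => Summable.of_nonneg_of_le (fun n => by positivity)
    (fun n => mul_le_mul_of_nonneg_left (h n) (by positivity)) (ha s)

theorem Rapid.summable_wave {a : (Fin 2 → ℤ) → ℂ} (ha : Rapid a) (x : Fin 2 → ℝ) :
    Summable fun n => a n * wave n x := by
  refine Summable.of_norm ?_
  simpa [norm_mul, norm_wave] using ha.summable_norm

theorem Rapid.contDiff {a : (Fin 2 → ℤ) → ℂ} (ha : Rapid a) :
    ContDiff ℝ ∞ fun x => ∑' n, a n * wave n x := by
  refine contDiff_tsum (v := fun k n => (4 * Real.pi) ^ k * (‖n‖ ^ k * ‖a n‖))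
    (fun n => contDiff_const.mul (contDiff_wave n)) (fun k _ => (ha k).mul_left _) ?_
  intro k n x _
  have : iteratedFDeriv ℝ k (fun x => a n * wave n x) x = a n • iteratedFDeriv ℝ k (wave n) x :=
    iteratedFDeriv_const_smul_apply (a := a n) (f := wave n) ((contDiff_wave n).contDiffAt.of_le (by exact_mod_cast le_top))
  rw [this, norm_smul]
  calc ‖a n‖ * ‖iteratedFDeriv ℝ k (wave n) x‖ ≤ ‖a n‖ * (4 * Real.pi * ‖n‖) ^ k := by
        gcongr; exact norm_iteratedFDeriv_wave_le n k x
    _ = _ := by rw [mul_pow]; ring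

theorem Rapid.fderiv_apply {a : (Fin 2 → ℤ) → ℂ} (ha : Rapid a) (x v : Fin 2 → ℝ) :
    HasSum (fun n => a n * (wave n x * Complex.I * phase n v))
      (fderiv ℝ (fun x => ∑' n, a n * wave n x) x v) := by
  have hd : ∀ n y, HasFDerivAt (fun x => a n * wave n x)
      (a n • (wave n y * Complex.I) • Complex.ofRealCLM.comp (phase n)) y := fun n y =>
    (hasFDerivAt_wave n y).const_mul (a n)
  have hb : ∀ n y, ‖a n • (wave n y * Complex.I) • Complex.ofRealCLM.comp (phase n)‖
      ≤ 4 * Real.pi * (‖n‖ ^ 1 * ‖a n‖) := by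
    intro n y
    rw [norm_smul, norm_smul, norm_mul, norm_wave, Complex.norm_I, one_mul, one_mul]
    have h1 : ‖Complex.ofRealCLM.comp (phase n)‖ ≤ 4 * Real.pi * ‖n‖ := by
      refine (ContinuousLinearMap.opNorm_comp_le _ _).trans ?_
      rw [Complex.ofRealCLM_norm, one_mul]
      exact norm_phase_le n
    calc _ ≤ ‖a n‖ * (4 * Real.pi * ‖n‖) := by gcongr
      _ = _ := by ring
  have hs := (ha 1).mul_left (4 * Real.pi)
  have h := hasFDerivAt_tsum hs hd hb (ha.summable_wave 0) x
  rw [h.fderiv]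
  have hsum : Summable fun n => a n • (wave n x * Complex.I) • Complex.ofRealCLM.comp (phase n) :=
    Summable.of_norm_bounded hs fun n => hb n x
  have := (ContinuousLinearMap.apply ℝ ℂ v).hasSum hsum.hasSum
  have e : (fun n => a n * (wave n x * Complex.I * phase n v)) = fun n =>
      ContinuousLinearMap.apply ℝ ℂ v
        (a n • (wave n x * Complex.I) • Complex.ofRealCLM.comp (phase n)) := by
    ext n
    simp
  rw [e]
  exact this

theorem tsum_wave_mul_tsum_wave {a d : (Fin 2 → ℤ) → ℂ} (ha : Rapid a) (hd : Rapid d)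
    (x : Fin 2 → ℝ) :
    (∑' n, a n * wave n x) * ∑' n, d n * wave n x
      = ∑' n, (∑' k, a k * d (n - k)) * wave n x := by
  have h1 : Summable fun n => ‖a n * wave n x‖ := by
    simpa [norm_mul, norm_wave] using ha.summable_norm
  have h2 : Summable fun n => ‖d n * wave n x‖ := by
    simpa [norm_mul, norm_wave] using hd.summable_norm
  rw [tsum_mul_tsum_of_summable_norm h1 h2]
  let e : ((Fin 2 → ℤ) × (Fin 2 → ℤ)) ≃ ((Fin 2 → ℤ) × (Fin 2 → ℤ)) :=
    { toFun := fun p => (p.2, p.1 - p.2)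
      invFun := fun p => (p.1 + p.2, p.1)
      left_inv := fun p => by ext <;> simp
      right_inv := fun p => by ext <;> simp }
  have hs := summable_mul_of_summable_norm h1 h2
  rw [← e.tsum_eq]
  have hs' := (e.summable_iff).2 hs
  refine (hs'.tsum_prod).trans ?_
  refine tsum_congr fun n => ?_
  rw [← tsum_mul_right]
  refine tsum_congr fun k => ?_
  change a k * wave k x * (d (n - k) * wave (n - k) x) = _
  have : wave n x = wave k x * wave (n - k) x := by rw [← wave_add]; congr 1; abel
  rw [this]
  ring

/-- The identification of `ℝ²` with `ℂ`. -/
def planeToC : (Fin 2 → ℝ) →L[ℝ] ℂ :=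
  Complex.ofRealCLM.comp (ContinuousLinearMap.proj 0) +
    Complex.I • Complex.ofRealCLM.comp (ContinuousLinearMap.proj 1)

theorem planeToC_apply (x : Fin 2 → ℝ) : planeToC x = x 0 + Complex.I * x 1 := rfl

/-- The inverse of `planeToC`. -/
def planeOfC : ℂ →L[ℝ] (Fin 2 → ℝ) :=
  ContinuousLinearMap.pi ![Complex.reCLM, Complex.imCLM]

theorem planeToC_planeOfC (w : ℂ) : planeToC (planeOfC w) = w := by
  rw [planeToC_apply]
  apply Complex.ext <;> simp [planeOfC]

/-- The symbol of `2 ∂/∂w̄`. -/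
def symbolBar (n : Fin 2 → ℤ) : ℂ := Real.pi * Complex.I * (n 0 + Complex.I * n 1)

/-- The symbol of `2 ∂/∂w`. -/
def symbol (n : Fin 2 → ℤ) : ℂ := Real.pi * Complex.I * (n 0 - Complex.I * n 1)

theorem I_mul_phase (n : Fin 2 → ℤ) (v : Fin 2 → ℝ) :
    Complex.I * phase n v
      = symbol n * planeToC v + symbolBar n * (starRingEnd ℂ) (planeToC v) := by
  rw [phase_apply, planeToC_apply, symbol, symbolBar]
  simp only [map_add, map_mul, Complex.conj_I, Complex.conj_ofReal]
  push_cast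
  linear_combination (2 * Real.pi * n 1 * v 1 * Complex.I) * Complex.I_sq

theorem symbolBar_ne_zero {n : Fin 2 → ℤ} (hn : n ≠ 0) : symbolBar n ≠ 0 := by
  intro h
  apply hn
  rw [symbolBar, mul_eq_zero, mul_eq_zero] at h
  have h1 : (n 0 : ℂ) + Complex.I * n 1 = 0 := by
    rcases h with (h | h) | h
    · exact absurd h (by exact_mod_cast Real.pi_ne_zero)
    · exact absurd h Complex.I_ne_zero
    · exact h
  have hre := congrArg Complex.re h1
  have him := congrArg Complex.im h1
  simp at hre him
  ext i
  fin_cases i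
  exacts [hre, him]

theorem norm_symbol_eq (n : Fin 2 → ℤ) : ‖symbol n‖ = ‖symbolBar n‖ := by
  have : (n 0 : ℂ) - Complex.I * n 1 = (starRingEnd ℂ) ((n 0 : ℂ) + Complex.I * n 1) := by
    simp [sub_eq_add_neg]
  simp only [symbol, symbolBar, norm_mul, this, RCLike.norm_conj]

/-- A solution of the Beltrami equation whose coefficient has a small Fourier series. -/
theorem exists_beltrami_of_rapid {c : (Fin 2 → ℤ) → ℂ} (hc : Rapid c)
    (hsmall : ∑' n, ‖c n‖ < 1 / 2) :
    ∃ Z : (Fin 2 → ℝ) → ℂ, ContDiff ℝ ∞ Z ∧ ∀ x, ∃ h : ℂ, h ≠ 0 ∧ ∀ v,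
      fderiv ℝ Z x v = h * (planeToC v +
        (∑' n, c n * wave n x) * (starRingEnd ℂ) (planeToC v)) := by
  -- This is the multiplier ∂/∂̄ of the Beurling transform. It has modulus one for n ≠ 0, and
  -- division by zero gives it the value 0 at n = 0.
  set b : (Fin 2 → ℤ) → ℂ := fun n => symbol n / symbolBar n
  have hb : ∀ n, ‖b n‖ ≤ 1 := fun n => by
    rw [norm_div, norm_symbol_eq]
    exact div_self_le_one _
  have hb0 : b 0 = 0 := by simp [b, symbol]
  obtain ⟨f, hf, hf1, hfr⟩ := exists_neumann_rapid hb hsmall hc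
  have hfr' : Rapid f := hfr
  have hbf : Rapid fun n => b n * f n := hfr'.mono fun n => by
    rw [norm_mul]
    exact mul_le_of_le_one_left (norm_nonneg _) (hb n)
  obtain ⟨B, hB0, hB⟩ : ∃ B : ℝ, 0 ≤ B ∧ ∀ n : Fin 2 → ℤ, ‖(symbolBar n)⁻¹‖ ≤ B := by
    refine ⟨1, zero_le_one, fun n => ?_⟩
    by_cases hn : n = 0
    · simp [hn, symbolBar]
    · rw [norm_inv]
      apply inv_le_one_of_one_le₀
      rw [symbolBar, norm_mul, norm_mul, Complex.norm_I, mul_one, Complex.norm_real,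
        Real.norm_of_nonneg Real.pi_nonneg]
      have h1 : (1 : ℝ) ≤ ‖(n 0 : ℂ) + Complex.I * n 1‖ := by
        by_cases h0 : n 0 = 0
        · have h1 : n 1 ≠ 0 := fun h1 => hn (by ext i; fin_cases i; exacts [h0, h1])
          refine le_trans ?_ (Complex.abs_im_le_norm _)
          simp only [Complex.add_im, Complex.intCast_im, Complex.mul_im, Complex.I_re,
            Complex.I_im, Complex.intCast_re, zero_mul, one_mul, zero_add]
          exact_mod_cast Int.one_le_abs h1
        · refine le_trans ?_ (Complex.abs_re_le_norm _)
          simp only [Complex.add_re, Complex.intCast_re, Complex.mul_re, Complex.I_re,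
            Complex.I_im, Complex.intCast_im, zero_mul, one_mul, sub_zero, add_zero]
          exact_mod_cast Int.one_le_abs h0
      nlinarith [Real.pi_gt_three]
  have hfl : Rapid fun n => f n / symbolBar n := by
    intro s
    refine Summable.of_nonneg_of_le (fun n => by positivity) (fun n => ?_) ((hfr s).mul_left B)
    change ‖n‖ ^ s * ‖f n / symbolBar n‖ ≤ _
    rw [div_eq_mul_inv, norm_mul]
    calc ‖n‖ ^ s * (‖f n‖ * ‖(symbolBar n)⁻¹‖) ≤ ‖n‖ ^ s * (‖f n‖ * B) := by gcongr; exact hB n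
      _ = _ := by ring
  set W : (Fin 2 → ℝ) → ℂ := fun x => ∑' n, f n / symbolBar n * wave n x
  have hconj : ContDiff ℝ ∞ fun x => (starRingEnd ℂ) (planeToC x) :=
    Complex.conjCLE.contDiff.comp planeToC.contDiff
  -- With M the given coefficient and h the series with coefficients b f, the ansatz has ∂Z = 1 + h
  -- and ∂̄Z = ∑ f(n) exp(2πi n·x). The zero mode of f cannot be a derivative of a periodic
  -- function, so it is supplied by the linear term f(0)·w̄; division by `symbolBar 0 = 0` removes
  -- it from W.
  refine ⟨fun x => planeToC x + f 0 * (starRingEnd ℂ) (planeToC x) + W x,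
    (planeToC.contDiff.add (contDiff_const.mul hconj)).add hfl.contDiff, fun x => ?_⟩
  set h := ∑' n, b n * f n * wave n x with hh
  have hnorm : ‖h‖ < 1 := by
    have e1 : ∀ n, ‖b n * f n * wave n x‖ ≤ ‖f n‖ := fun n => by
      rw [norm_mul, norm_wave, mul_one, norm_mul]
      exact mul_le_of_le_one_left (norm_nonneg _) (hb n)
    exact (tsum_of_norm_bounded hfr'.summable_norm.hasSum e1).trans_lt hf1
  refine ⟨1 + h, ?_, fun v => ?_⟩
  · intro h0
    have : h = -1 := by linear_combination h0
    rw [this] at hnorm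
    simp at hnorm
  · set M := ∑' n, c n * wave n x
    -- Summed over n, the fixed point equation f = c + c * (b f) reads ∂̄Z = M·∂Z, which is the
    -- Beltrami equation.
    have hprod : ∑' n, f n * wave n x = M * (1 + h) := by
      have e1 : M * h = ∑' n, twistedConv c b f n * wave n x := by
        rw [hh]
        exact tsum_wave_mul_tsum_wave hc hbf x
      have e2 : Summable fun n => twistedConv c b f n * wave n x := by
        have : ∀ n, twistedConv c b f n * wave n x = f n * wave n x - c n * wave n x := fun n => by
          rw [hf n]; ring
        simp_rw [this]
        exact (hfr'.summable_wave x).sub (hc.summable_wave x)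
      rw [mul_add, mul_one, e1, ← (hc.summable_wave x).tsum_add e2]
      refine tsum_congr fun n => ?_
      rw [hf n]
      ring
    have hW := hfl.fderiv_apply x v
    have hterm : ∀ n, f n / symbolBar n * (wave n x * Complex.I * phase n v)
        = b n * f n * wave n x * planeToC v + f n * wave n x * (starRingEnd ℂ) (planeToC v)
          - (if n = 0 then f 0 * (starRingEnd ℂ) (planeToC v) else 0) := by
      intro n
      by_cases hn : n = 0
      · have hw0 : wave 0 x = 1 := by simp [wave, phase_apply]
        rw [hn, hb0, hw0]
        simp [symbolBar]
      · rw [if_neg hn, mul_assoc (wave n x), I_mul_phase]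
        have := symbolBar_ne_zero hn
        simp only [b]
        field_simp
        ring
    have hW2 : HasSum (fun n => f n / symbolBar n * (wave n x * Complex.I * phase n v))
        (h * planeToC v + M * (1 + h) * (starRingEnd ℂ) (planeToC v)
          - f 0 * (starRingEnd ℂ) (planeToC v)) := by
      simp_rw [hterm]
      refine HasSum.sub (HasSum.add ?_ ?_) ?_
      · exact (hbf.summable_wave x).hasSum.mul_right _
      · rw [← hprod]
        exact (hfr'.summable_wave x).hasSum.mul_right _
      · exact hasSum_ite_eq 0 _
    have hWe := hW.unique hW2
    have hd1 : HasFDerivAt (fun x => (starRingEnd ℂ) (planeToC x))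
        ((Complex.conjCLE : ℂ →L[ℝ] ℂ).comp planeToC) x :=
      Complex.conjCLE.hasFDerivAt.comp x planeToC.hasFDerivAt
    have hd2 := (planeToC.hasFDerivAt (x := x)).add ((hd1.const_mul (f 0)))
    have hd3 := hd2.add ((hfl.contDiff.differentiable (by simp) x).hasFDerivAt)
    have hd4 := congrArg (fun T : (Fin 2 → ℝ) →L[ℝ] ℂ => T v) hd3.fderiv
    refine hd4.trans ?_
    change planeToC v + f 0 * (starRingEnd ℂ) (planeToC v) + fderiv ℝ W x v = _
    rw [hWe]
    ring

/-- Only a neighbourhood of the origin matters, so μ may be rescaled to μ(ε·) and cut off. Since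
μ(0) = 0, the rescaled coefficient has arbitrarily small Fourier ℓ¹ norm, the periodic problem is
solvable, and undoing the dilation gives ζ. -/
theorem exists_beltrami {μ : ℂ → ℂ} {U : Set ℂ} (hU : IsOpen U) (h0U : (0 : ℂ) ∈ U)
    (hμ : ContDiffOn ℝ ∞ μ U) (hμ0 : μ 0 = 0) :
    ∃ ζ : ℂ → ℂ, ContDiff ℝ ∞ ζ ∧ ∀ᶠ w in 𝓝 (0 : ℂ), ∃ c : ℂ, c ≠ 0 ∧ ∀ v,
      fderiv ℝ ζ w v = c * (v + μ w * (starRingEnd ℂ) v) := by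
  obtain ⟨r, hr, hrU⟩ := Metric.isOpen_iff.1 hU 0 h0U
  let b : ContDiffBump (0 : ℂ) := ⟨r / 4, r / 2, by positivity, by linarith⟩
  have hbμ : ContDiff ℝ ∞ fun x => (b x : ℂ) * μ x := by
    rw [contDiff_iff_contDiffAt]
    intro x
    by_cases hx : x ∈ U
    · exact (Complex.ofRealCLM.contDiff.contDiffAt.comp x b.contDiffAt).mul
        (hμ.contDiffAt (hU.mem_nhds hx))
    · have hxb : x ∉ tsupport b := by
        rw [b.tsupport_eq]
        intro h
        exact hx (hrU (lt_of_le_of_lt h (by change r / 2 < r; linarith)))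
      have h0 := notMem_tsupport_iff_eventuallyEq.1 hxb
      refine (contDiffAt_const (c := (0 : ℂ))).congr_of_eventuallyEq ?_
      filter_upwards [h0] with y hy
      simp [hy]
  let χ : ContDiffBump (0 : Fin 2 → ℝ) := ⟨1 / 8, 1 / 4, by norm_num, by norm_num⟩
  -- The bump function b makes μ globally smooth, while χ confines the rescaled coefficient to the
  -- square inside the fundamental domain. Both equal one near the origin, where the equation is
  -- wanted.
  set H : ℝ × (Fin 2 → ℝ) → ℂ := fun q =>
    (χ q.2 : ℂ) * ((b (q.1 • planeToC q.2) : ℂ) * μ (q.1 • planeToC q.2)) with hH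
  have hHs : ContDiff ℝ ∞ H :=
    (Complex.ofRealCLM.contDiff.comp (χ.contDiff.comp contDiff_snd)).mul
      (hbμ.comp (contDiff_fst.smul (planeToC.contDiff.comp contDiff_snd)))
  have hH0 : ∀ ε x i, 1 / 4 < |x i| → H (ε, x) = 0 := by
    intro ε x i hx
    have : χ x = 0 := by
      apply χ.zero_of_le_dist
      change (1 / 4 : ℝ) ≤ _
      rw [dist_zero_right]
      exact hx.le.trans (norm_le_pi_norm x i)
    simp [hH, this]
  obtain ⟨ε, ⟨hε0, hε1⟩, hε⟩ := exists_small_planeCoeff H hHs hH0 (fun x => by simp [hH, hμ0])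
  have hεI : ε ∈ Icc (0 : ℝ) 1 := ⟨hε0.le, hε1.le⟩
  have hrap : Rapid (planeCoeff fun x => H (ε, x)) := summable_planeCoeff_pow H hHs hH0 hεI
  obtain ⟨Z, hZ, hZd⟩ := exists_beltrami_of_rapid hrap hε
  let S : ℂ →L[ℝ] (Fin 2 → ℝ) := ε⁻¹ • planeOfC
  have hSC : ∀ w, ε • planeToC (S w) = w := fun w => by
    simp only [S, smul_apply, map_smul, planeToC_planeOfC]
    rw [smul_inv_smul₀ hε0.ne']
  refine ⟨Z ∘ S, hZ.comp S.contDiff, ?_⟩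
  have hn1 : ∀ᶠ w in 𝓝 (0 : ℂ), ‖S w‖ ≤ 1 / 8 := by
    have : ContinuousAt (fun w => ‖S w‖) 0 := by fun_prop
    have h2 := this.eventually_lt_const (u := 1 / 8) (by simp)
    exact h2.mono fun w hw => hw.le
  have hn2 : ∀ᶠ w in 𝓝 (0 : ℂ), w ∈ Metric.closedBall (0 : ℂ) (r / 4) :=
    Metric.closedBall_mem_nhds _ (by positivity)
  filter_upwards [hn1, hn2] with w hw1 hw2
  obtain ⟨h, hh0, hh⟩ := hZd (S w)
  have hval : ∑' n, planeCoeff (fun x => H (ε, x)) n * wave n (S w) = μ w := by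
    have h1 := hasSum_planeCoeff (f := fun x => H (ε, x)) (x := S w)
      (hHs.continuous.comp (by fun_prop)) (hH0 ε) (Summable.of_norm hrap.summable_norm)
      (fun i => by
        have := (norm_le_pi_norm (S w) i).trans hw1
        rw [Real.norm_eq_abs] at this
        linarith)
    rw [h1.tsum_eq]
    have hχ : χ (S w) = 1 := χ.one_of_mem_closedBall (by
      rw [mem_closedBall_zero_iff]; exact hw1)
    have hbw : b w = 1 := b.one_of_mem_closedBall hw2
    simp only [hH, hSC, hχ, hbw]
    simp
  refine ⟨h * (ε⁻¹ : ℝ), mul_ne_zero hh0 (by exact_mod_cast (inv_pos.2 hε0).ne'), fun v => ?_⟩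
  have hd : HasFDerivAt (Z ∘ S) ((fderiv ℝ Z (S w)).comp S) w :=
    (hZ.differentiable (by simp) (S w)).hasFDerivAt.comp w S.hasFDerivAt
  rw [hd.fderiv, ContinuousLinearMap.comp_apply, hh, hval]
  have hSv : planeToC (S v) = (ε⁻¹ : ℝ) * v := by
    simp only [S, smul_apply, map_smul, planeToC_planeOfC]
    rfl
  rw [hSv, map_mul, Complex.conj_ofReal]
  ring

end SpinGeometry

end

noncomputable section

namespace SpinGeometry

open Set Filter Topology

/-! ### One-forms on normed spaces -/

section Forms

variable {E F G : Type*} [NormedAddCommGroup E] [NormedSpace ℝ E] [NormedAddCommGroup F]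
  [NormedSpace ℝ F] [NormedAddCommGroup G] [NormedSpace ℝ G]

/-- The exterior derivative of a one-form. -/
def extd (om : E → E →L[ℝ] G) (x v w : E) : G := fderiv ℝ om x v w - fderiv ℝ om x w v

/-- The pullback of a one-form. -/
def pull (Ψ : F → E) (om : E → E →L[ℝ] G) (q : F) : F →L[ℝ] G :=
  (om (Ψ q)).comp (fderiv ℝ Ψ q)

theorem pull_apply (Ψ : F → E) (om : E → E →L[ℝ] G) (q v : F) :
    pull Ψ om q v = om (Ψ q) (fderiv ℝ Ψ q v) := rfl

theorem ContDiffAt.pull {Ψ : F → E} {om : E → E →L[ℝ] G} {q : F} (hΨ : ContDiffAt ℝ ∞ Ψ q)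
    (hom : ContDiffAt ℝ ∞ om (Ψ q)) : ContDiffAt ℝ ∞ (pull Ψ om) q :=
  (hom.comp q hΨ).clm_comp (hΨ.fderiv_right (by simp))

/-- The second derivative of Ψ enters symmetrically and cancels in the skew part. -/
theorem extd_pull {Ψ : F → E} {om : E → E →L[ℝ] G} {q : F} (hΨ : ContDiffAt ℝ ∞ Ψ q)
    (hom : DifferentiableAt ℝ om (Ψ q)) (u w : F) :
    extd (pull Ψ om) q u w = extd om (Ψ q) (fderiv ℝ Ψ q u) (fderiv ℝ Ψ q w) := by
  have hΨd : HasFDerivAt Ψ (fderiv ℝ Ψ q) q := (hΨ.differentiableAt (by simp)).hasFDerivAt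
  have hΨ2 : HasFDerivAt (fderiv ℝ Ψ) (fderiv ℝ (fderiv ℝ Ψ) q) q :=
    ((hΨ.fderiv_right (m := ∞) (by simp)).differentiableAt (by simp)).hasFDerivAt
  have h1 : HasFDerivAt (fun q => om (Ψ q)) ((fderiv ℝ om (Ψ q)).comp (fderiv ℝ Ψ q)) q :=
    hom.hasFDerivAt.comp q hΨd
  have h2 := h1.clm_comp hΨ2
  have h3 : ∀ u w, fderiv ℝ (pull Ψ om) q u w = fderiv ℝ om (Ψ q) (fderiv ℝ Ψ q u) (fderiv ℝ Ψ q w)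
      + om (Ψ q) (fderiv ℝ (fderiv ℝ Ψ) q u w) := by
    intro u w
    have : fderiv ℝ (pull Ψ om) q = _ := h2.fderiv
    rw [this]
    simp [add_comm]
  have hsymm : fderiv ℝ (fderiv ℝ Ψ) q u w = fderiv ℝ (fderiv ℝ Ψ) q w u :=
    (hΨ.isSymmSndFDerivAt (by
      rw [minSmoothness_of_isRCLikeNormedField]; exact WithTop.coe_le_coe.2 le_top)).eq u w
  rw [extd, h3, h3, hsymm, extd]
  abel

end Forms

/-! ### Reduction of complex one-forms to a plane. -/

section Reduction

variable {E F : Type*} [NormedAddCommGroup E] [NormedSpace ℝ E]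
  [NormedAddCommGroup F] [NormedSpace ℝ F]

/-- The restriction of a one-form to the affine subspace `p + T (F × 0)`. -/
def sliceForm (p : E) (T : (F × ℝ) ≃L[ℝ] E) (om : E → E →L[ℝ] ℂ) (y : F) : F →L[ℝ] ℂ :=
  (om (p + T (y, 0))).comp ((T : F × ℝ →L[ℝ] E).comp (ContinuousLinearMap.inl ℝ F ℝ))

theorem sliceForm_apply (p : E) (T : (F × ℝ) ≃L[ℝ] E) (om : E → E →L[ℝ] ℂ) (y v : F) :
    sliceForm p T om y v = om (p + T (y, 0)) (T (v, 0)) := rfl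

theorem hasFDerivAt_slice (p : E) (T : (F × ℝ) ≃L[ℝ] E) (y : F) :
    HasFDerivAt (fun y : F => p + T (y, 0))
      ((T : F × ℝ →L[ℝ] E).comp (ContinuousLinearMap.inl ℝ F ℝ)) y :=
  (T.hasFDerivAt.comp y (hasFDerivAt_prodMk_left y (0 : ℝ))).const_add p

theorem sliceForm_eq_pull (p : E) (T : (F × ℝ) ≃L[ℝ] E) (om : E → E →L[ℝ] ℂ) :
    sliceForm p T om = pull (fun y : F => p + T (y, 0)) om := by
  ext1 y
  rw [sliceForm, pull, (hasFDerivAt_slice p T y).fderiv]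

variable [FiniteDimensional ℝ E]

/-- A complex one-form `m` with `dm = m ∧ η` that annihilates a vector field `X` is, up to a
factor, the pullback of its restriction to a hypersurface transversal to `X`. -/
theorem exists_reduction {m η : E → E →L[ℝ] ℂ} {X : E → E} {p : E} (T : (F × ℝ) ≃L[ℝ] E)
    (hT : T (0, 1) = X p)
    (h : ∀ᶠ x in 𝓝 p, ContDiffAt ℝ ∞ m x ∧ ContinuousAt η x ∧
      ∀ v w, extd m x v w = m x v * η x w - m x w * η x v)
    (hX : ∀ᶠ x in 𝓝 p, ContDiffAt ℝ ∞ X x ∧ m x (X x) = 0) :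
    (∀ᶠ y in 𝓝 (0 : F), ContDiffAt ℝ ∞ (sliceForm p T m) y ∧ ContinuousAt (sliceForm p T η) y ∧
      ∀ v w, extd (sliceForm p T m) y v w = sliceForm p T m y v * sliceForm p T η y w
        - sliceForm p T m y w * sliceForm p T η y v) ∧
    ∃ π : E → F, π p = 0 ∧ ∀ᶠ x in 𝓝 p, ContDiffAt ℝ ∞ π x ∧ ∃ h : ℂ, h ≠ 0 ∧
      ∀ v, m x v = h * sliceForm p T m (π x) (fderiv ℝ π x v) := by
  constructor
  · have hc : ContinuousAt (fun y : F => p + T (y, 0)) 0 := (hasFDerivAt_slice p T 0).continuousAt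
    have hc0 : Tendsto (fun y : F => p + T (y, 0)) (𝓝 0) (𝓝 p) := by
      have h00 : ((0 : F), (0 : ℝ)) = 0 := rfl
      have := hc.tendsto
      rwa [h00, map_zero, add_zero] at this
    have hs : ContDiff ℝ ∞ (fun y : F => p + T (y, 0)) :=
      contDiff_const.add (T.contDiff.comp (contDiff_id.prodMk contDiff_const))
    filter_upwards [hc0.eventually h] with y hy
    obtain ⟨h1, h2, h3⟩ := hy
    refine ⟨?_, ?_, fun v w => ?_⟩
    · rw [sliceForm_eq_pull]
      exact ContDiffAt.pull hs.contDiffAt h1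
    · refine ContinuousAt.clm_comp ?_ continuousAt_const
      exact ContinuousAt.comp (f := fun y : F => p + T (y, 0)) h2 (hasFDerivAt_slice p T y).continuousAt
    · rw [sliceForm_eq_pull, extd_pull hs.contDiffAt (h1.differentiableAt (by simp)), h3,
        (hasFDerivAt_slice p T y).fderiv, sliceForm_eq_pull]
      simp only [pull_apply, (hasFDerivAt_slice p T y).fderiv]
  obtain ⟨U, hUsub, hU, hpU⟩ := eventually_nhds_iff.1 (h.and hX)
  have hXU : ContDiffOn ℝ ∞ X U := fun x hx => (hUsub x hx).2.1.contDiffWithinAt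
  obtain ⟨Ψ, h0s, htU, hΨ, hΨs, hflow, hslice⟩ := exists_straightening hU hXU hpU T hT
  have hFD : FiniteDimensional ℝ (F × ℝ) := T.symm.toLinearEquiv.finiteDimensional
  have hp0 : Ψ (0, 0) = p := by
    rw [hslice 0 h0s]
    have h00 : ((0 : F), (0 : ℝ)) = 0 := rfl
    rw [h00, map_zero, add_zero]
  have hpt : p ∈ Ψ.target := by rw [← hp0]; exact Ψ.map_source h0s
  obtain ⟨δ, hδ, hball⟩ := Metric.isOpen_iff.1 Ψ.open_source (0, 0) h0s
  have hΨat : ∀ q ∈ Ψ.source, ContDiffAt ℝ ∞ Ψ q := fun q hq =>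
    hΨ.contDiffAt (Ψ.open_source.mem_nhds hq)
  have hmem : ∀ q ∈ Ψ.source, Ψ q ∈ U := fun q hq => htU (Ψ.map_source hq)
  set M := pull Ψ m with hM
  have hMt : ∀ q ∈ Ψ.source, M q (0, 1) = 0 := fun q hq => by
    rw [hM, pull_apply, hflow q hq]
    exact (hUsub _ (hmem q hq)).2.2
  have hMs : ∀ q ∈ Ψ.source, ContDiffAt ℝ ∞ M q := fun q hq =>
    ContDiffAt.pull (hΨat q hq) (hUsub _ (hmem q hq)).1.1
  -- Since m(X) = 0, Cartan's formula and dm = m ∧ η give L_X m = -η(X) m. In straightened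
  -- coordinates L_X is the derivative in the last variable.
  have hMd : ∀ q ∈ Ψ.source, ∀ w, fderiv ℝ M q (0, 1) w
      = -(η (Ψ q) (X (Ψ q))) * M q w := by
    intro q hq w
    obtain ⟨⟨h1, h2, h3⟩, h4, h5⟩ := hUsub _ (hmem q hq)
    have e1 := extd_pull (hΨat q hq) (h1.differentiableAt (by simp)) (0, 1) w
    rw [h3, hflow q hq, h5] at e1
    have e2 : fderiv ℝ M q w (0, 1) = 0 := by
      have hz : (fun q => M q (0, 1)) =ᶠ[𝓝 q] fun _ => 0 := by
        filter_upwards [Ψ.open_source.mem_nhds hq] with q' hq' using hMt q' hq'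
      have hd := ((hMs q hq).differentiableAt (by simp)).hasFDerivAt.clm_apply
        (hasFDerivAt_const ((0, 1) : F × ℝ) q)
      have := hz.fderiv_eq (𝕜 := ℝ)
      rw [hd.fderiv] at this
      have := congrArg (fun S => S w) this
      simpa using this
    rw [extd, e2, sub_zero] at e1
    rw [e1, hM, pull_apply]
    ring
  refine ⟨fun x => (Ψ.symm x).1, by
    change (Ψ.symm p).1 = 0
    rw [← hp0, Ψ.left_inv h0s], ?_⟩
  have hnb : ∀ᶠ x in 𝓝 p, x ∈ Ψ.target ∧ Ψ.symm x ∈ Metric.ball ((0 : F), (0 : ℝ)) δ := by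
    have ht : ∀ᶠ x in 𝓝 p, x ∈ Ψ.target := Ψ.open_target.mem_nhds hpt
    refine ht.and ?_
    have hc := Ψ.continuousAt_symm hpt
    have h2 : Ψ.symm p = (0, 0) := by rw [← hp0, Ψ.left_inv h0s]
    have h3 := hc (Metric.ball_mem_nhds _ hδ)
    rw [h2] at h3
    exact h3
  filter_upwards [hnb] with x hx
  obtain ⟨hxt, hxb⟩ := hx
  have hsm : ContDiffAt ℝ ∞ Ψ.symm x := hΨs.contDiffAt (Ψ.open_target.mem_nhds hxt)
  refine ⟨contDiff_fst.contDiffAt.comp x hsm, ?_⟩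
  set q := Ψ.symm x with hq
  have hqs : q ∈ Ψ.source := Ψ.map_target hxt
  have hΨq : Ψ q = x := Ψ.right_inv hxt
  -- the segment from `(q.1, 0)` to `q`
  have hseg : ∀ t ∈ Icc (0 : ℝ) 1, ((q.1, t * q.2) : F × ℝ) ∈ Ψ.source := by
    intro t ht
    apply hball
    rw [Metric.mem_ball, Prod.dist_eq, max_lt_iff] at hxb ⊢
    refine ⟨hxb.1, ?_⟩
    have h2 := hxb.2
    rw [Real.dist_eq, sub_zero] at h2 ⊢
    rw [abs_mul, abs_of_nonneg ht.1]
    exact lt_of_le_of_lt (mul_le_of_le_one_left (abs_nonneg _) ht.2) h2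
  set c : ℝ → F × ℝ := fun t => (q.1, t * q.2) with hc
  have hcd : ∀ t, HasDerivAt c (q.2 • ((0 : F), (1 : ℝ))) t := fun t => by
    simpa [hc] using (hasDerivAt_const t q.1).prodMk ((hasDerivAt_id t).mul_const q.2)
  set a : ℝ → ℂ := fun t => q.2 * η (Ψ (c t)) (X (Ψ (c t))) with ha
  have hac : ContinuousOn a (Icc 0 1) := by
    intro t ht
    apply ContinuousAt.continuousWithinAt
    obtain ⟨⟨h1, h2, h3⟩, h4, h5⟩ := hUsub _ (hmem _ (hseg t ht))
    have hct : ContinuousAt (fun t => Ψ (c t)) t :=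
      ContinuousAt.comp (f := c) (hΨat _ (hseg t ht)).continuousAt (hcd t).continuousAt
    have b1 : ContinuousAt (fun t => η (Ψ (c t))) t := ContinuousAt.comp (f := fun t => Ψ (c t)) h2 hct
    have b2 : ContinuousAt (fun t => X (Ψ (c t))) t :=
      ContinuousAt.comp (f := fun t => Ψ (c t)) h4.continuousAt hct
    exact continuousAt_const.mul (b1.clm_apply b2)
  -- The linear equation along the flow line has the same coefficient a for every component w, so
  -- moving along the line multiplies the whole form by one non-zero number.
  have hk : ∀ w, ∀ t ∈ Icc (0 : ℝ) 1, HasDerivAt (fun t => M (c t) w) (-a t * M (c t) w) t := by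
    intro w t ht
    have h1 := (((hMs _ (hseg t ht)).differentiableAt (by simp)).hasFDerivAt.comp_hasDerivAt t (hcd t))
    have h2 := h1.clm_apply (hasDerivAt_const t w)
    have h3 : (fderiv ℝ M (c t) (q.2 • ((0 : F), (1 : ℝ)))) w = -a t * M (c t) w := by
      rw [map_smul, smul_apply, hMd _ (hseg t ht), Complex.real_smul]
      simp only [ha]
      ring
    rw [h3, map_zero, add_zero] at h2
    exact h2
  -- The coefficient is controlled on [0,1] only. A continuous extension to the line makes its
  -- primitive differentiable at the end points too.
  obtain ⟨a', ha'⟩ : ∃ a' : ℝ → ℂ, Continuous a' ∧ EqOn a a' (Icc 0 1) :=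
    ⟨IccExtend zero_le_one ((Icc (0 : ℝ) 1).domRestrict a),
      (continuousOn_iff_continuous_domRestrict.1 hac).Icc_extend', fun t ht =>
        (IccExtend_of_mem zero_le_one ((Icc (0 : ℝ) 1).domRestrict a) ht).symm⟩
  set A : ℝ → ℂ := fun t => ∫ s in (0 : ℝ)..t, a' s with hA
  have hAd : ∀ t, HasDerivAt A (a' t) t := fun t =>
    intervalIntegral.integral_hasDerivAt_right (ha'.1.intervalIntegrable _ _)
      (ha'.1.stronglyMeasurableAtFilter _ _) ha'.1.continuousAt
  have hconst : ∀ w, Complex.exp (A 1) * M (c 1) w = Complex.exp (A 0) * M (c 0) w := by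
    intro w
    have hd : ∀ t ∈ Icc (0 : ℝ) 1,
        HasDerivAt (fun t => Complex.exp (A t) * M (c t) w) 0 t := by
      intro t ht
      have h1 := (hAd t).cexp.mul (hk w t ht)
      refine h1.congr_deriv ?_
      rw [ha'.2 ht]
      ring
    have := constant_of_has_deriv_right_zero
      (f := fun t => Complex.exp (A t) * M (c t) w) (a := 0) (b := 1)
      (fun t ht => (hd t ht).continuousAt.continuousWithinAt)
      (fun t ht => (hd t (Ico_subset_Icc_self ht)).hasDerivWithinAt) 1 (by simp)
    exact this
  have hA0 : A 0 = 0 := by simp [hA]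
  have hc1 : c 1 = q := by simp [hc]
  have hc0 : c 0 = (q.1, 0) := by simp [hc]
  rw [hc1, hc0, hA0, Complex.exp_zero] at hconst
  have hq0 : ((q.1, (0 : ℝ)) : F × ℝ) ∈ Ψ.source := by
    have := hseg 0 (by simp)
    simpa using this
  have hM0 : ∀ v : F, M (q.1, 0) (v, 0) = sliceForm p T m q.1 v := by
    intro v
    rw [hM, pull_apply, hslice _ hq0, sliceForm_apply]
    congr 1
    have h1 : HasFDerivAt (fun y : F => Ψ (y, 0))
        ((fderiv ℝ Ψ (q.1, 0)).comp (ContinuousLinearMap.inl ℝ F ℝ)) q.1 :=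
      HasFDerivAt.comp q.1 ((hΨat _ hq0).differentiableAt (by simp)).hasFDerivAt
        (hasFDerivAt_prodMk_left q.1 (0 : ℝ))
    have h2 : HasFDerivAt (fun y : F => Ψ (y, 0))
        ((T : F × ℝ →L[ℝ] E).comp (ContinuousLinearMap.inl ℝ F ℝ)) q.1 := by
      refine (hasFDerivAt_slice p T q.1).congr_of_eventuallyEq ?_
      have hcc : ContinuousAt (fun y : F => ((y, 0) : F × ℝ)) q.1 := by fun_prop
      filter_upwards [hcc (Ψ.open_source.mem_nhds hq0)] with y hy
      exact hslice y hy
    have := congrArg (fun S => S v) (h1.unique h2)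
    simpa using this
  refine ⟨(Complex.exp (A 1))⁻¹, inv_ne_zero (Complex.exp_ne_zero _), fun v => ?_⟩
  have hsd : HasFDerivAt Ψ.symm (fderiv ℝ Ψ.symm x) x := (hsm.differentiableAt (by simp)).hasFDerivAt
  have hπd : fderiv ℝ (fun x => (Ψ.symm x).1) x v = (fderiv ℝ Ψ.symm x v).1 := by
    have := (hsd.fst).fderiv
    rw [this]; rfl
  set u := fderiv ℝ Ψ.symm x v with hu
  have hΨu : fderiv ℝ Ψ q u = v := by
    have h1 : HasFDerivAt (fun x => Ψ (Ψ.symm x)) ((fderiv ℝ Ψ q).comp (fderiv ℝ Ψ.symm x)) x :=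
      HasFDerivAt.comp x ((hΨat q hqs).differentiableAt (by simp)).hasFDerivAt hsd
    have h2 : HasFDerivAt (fun x => Ψ (Ψ.symm x)) (ContinuousLinearMap.id ℝ E) x := by
      refine (hasFDerivAt_id x).congr_of_eventuallyEq ?_
      filter_upwards [Ψ.open_target.mem_nhds hxt] with y hy
      exact Ψ.right_inv hy
    have := congrArg (fun S => S v) (h1.unique h2)
    simpa using this
  have hMq : m x v = M q u := by rw [hM, pull_apply, hΨu, hΨq]
  have hu2 : u = (u.1, 0) + u.2 • ((0 : F), (1 : ℝ)) := by ext <;> simp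
  have hMu : M q u = M q (u.1, 0) := by
    conv_lhs => rw [hu2]
    rw [map_add, map_smul, hMt q hqs, smul_zero, add_zero]
  have h5 := hconst (u.1, 0)
  rw [one_mul, hM0] at h5
  rw [hπd, hMq, hMu, ← h5, inv_mul_cancel_left₀ (Complex.exp_ne_zero _)]

end Reduction

theorem complex_real_linear_apply (A : ℂ →L[ℝ] ℂ) (v : ℂ) :
    A v = (A 1 - Complex.I * A Complex.I) / 2 * v
      + (A 1 + Complex.I * A Complex.I) / 2 * (starRingEnd ℂ) v := by
  have h1 : v = v.re • (1 : ℂ) + v.im • Complex.I := by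
    apply Complex.ext <;> simp
  have h2 : A v = v.re * A 1 + v.im * A Complex.I := by
    conv_lhs => rw [h1, map_add, map_smul, map_smul]
    simp
  have h3 : (starRingEnd ℂ) v = v.re - v.im * Complex.I := by
    apply Complex.ext <;> simp
  have h4 : v = v.re + v.im * Complex.I := (Complex.re_add_im v).symm
  rw [h2, h3]
  linear_combination (A Complex.I * v.im) * Complex.I_sq
    - (A 1 - Complex.I * A Complex.I) / 2 * h4

/-- Existence of isothermal coordinates for a complex one-form in the plane. -/
theorem exists_isothermal {m : ℂ → ℂ →L[ℝ] ℂ} (hm : ∀ᶠ w in 𝓝 (0 : ℂ), ContDiffAt ℝ ∞ m w)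
    (h0 : ∀ v, m 0 v = v) :
    ∃ ζ : ℂ → ℂ, ContDiff ℝ ∞ ζ ∧ ∀ᶠ w in 𝓝 (0 : ℂ), ∃ c : ℂ, c ≠ 0 ∧
      ∀ v, m w v = c * fderiv ℝ ζ w v := by
  set a : ℂ → ℂ := fun w => (m w 1 - Complex.I * m w Complex.I) / 2 with ha
  set b : ℂ → ℂ := fun w => (m w 1 + Complex.I * m w Complex.I) / 2 with hb
  have ha0 : a 0 = 1 := by simp [ha, h0]
  have hb0 : b 0 = 0 := by simp [hb, h0]
  have hsa : ∀ w, ContDiffAt ℝ ∞ m w → ContDiffAt ℝ ∞ a w := fun w hw =>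
    ((hw.clm_apply contDiffAt_const).sub
      (contDiffAt_const.mul (hw.clm_apply contDiffAt_const))).div_const 2
  have hsb : ∀ w, ContDiffAt ℝ ∞ m w → ContDiffAt ℝ ∞ b w := fun w hw =>
    ((hw.clm_apply contDiffAt_const).add
      (contDiffAt_const.mul (hw.clm_apply contDiffAt_const))).div_const 2
  have hane : ∀ᶠ w in 𝓝 (0 : ℂ), a w ≠ 0 :=
    (hsa 0 hm.self_of_nhds).continuousAt.eventually_ne (by rw [ha0]; exact one_ne_zero)
  obtain ⟨U, hUsub, hU, h0U⟩ := eventually_nhds_iff.1 (hm.and hane)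
  -- Writing m = a dw + b dw̄ = a (dw + μ dw̄) with μ = b/a reduces the claim to the Beltrami
  -- equation. The normalisation of m at 0 gives a = 1 and b = 0 there.
  obtain ⟨ζ, hζ, hζd⟩ := exists_beltrami (μ := fun w => b w / a w) hU h0U
    (fun w hw => by
      simp only [div_eq_mul_inv]
      exact ((hsb w (hUsub w hw).1).mul
        ((hsa w (hUsub w hw).1).inv (hUsub w hw).2)).contDiffWithinAt)
    (by simp [hb0])
  refine ⟨ζ, hζ, ?_⟩
  filter_upwards [hζd, hU.mem_nhds h0U] with w ⟨c, hc, hcd⟩ hw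
  have haw : a w ≠ 0 := (hUsub w hw).2
  refine ⟨a w / c, div_ne_zero haw hc, fun v => ?_⟩
  rw [hcd, complex_real_linear_apply (m w) v]
  change a w * v + b w * (starRingEnd ℂ) v = _
  field_simp

/-- A complex one-form of real rank two on a four-dimensional space with `dm = m ∧ η` which
annihilates a nowhere zero vector field is a multiple of the differential of a function. -/
theorem exists_integrating_factor {E : Type*} [NormedAddCommGroup E] [NormedSpace ℝ E]
    [FiniteDimensional ℝ E] {m η : E → E →L[ℝ] ℂ} {X : E → E} {p : E}
    (T : ((ℂ × ℝ) × ℝ) ≃L[ℝ] E) (hT : T (0, 1) = X p) (hmT : ∀ q, m p (T q) = q.1.1)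
    (h : ∀ᶠ x in 𝓝 p, ContDiffAt ℝ ∞ m x ∧ ContinuousAt η x ∧
      ∀ v w, extd m x v w = m x v * η x w - m x w * η x v)
    (hX : ∀ᶠ x in 𝓝 p, ContDiffAt ℝ ∞ X x ∧ m x (X x) = 0) :
    ∃ ζ : E → ℂ, ∀ᶠ x in 𝓝 p, ContDiffAt ℝ ∞ ζ x ∧ ∃ c : ℂ, c ≠ 0 ∧
      ∀ v, m x v = c * fderiv ℝ ζ x v := by
  obtain ⟨hs1, π₁, hπ₁0, hπ₁⟩ := exists_reduction T hT h hX
  set m₁ := sliceForm p T m with hm₁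
  set η₁ := sliceForm p T η
  have hm₁0 : ∀ q, m₁ 0 q = q.1 := fun q => by
    have h00 : (((0 : ℂ × ℝ), (0 : ℝ)) : (ℂ × ℝ) × ℝ) = 0 := rfl
    rw [hm₁, sliceForm_apply, h00, map_zero, add_zero, hmT]
  -- On ℂ × ℝ the restriction of m₁ to the ℂ factor is invertible near 0, so solving m₁(Y) = 0 with
  -- last component one produces the field Y along which the second reduction takes place.
  set B : ℂ × ℝ → ℂ →L[ℝ] ℂ := fun y => (m₁ y).comp (ContinuousLinearMap.inl ℝ ℂ ℝ) with hB
  have hB0 : B 0 = ContinuousLinearEquiv.refl ℝ ℂ := by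
    ext v
    simp [hB, hm₁0]
  have hBs : ∀ y, ContDiffAt ℝ ∞ m₁ y → ContDiffAt ℝ ∞ B y := fun y hy =>
    hy.clm_comp contDiffAt_const
  have hBinv : ∀ᶠ y in 𝓝 (0 : ℂ × ℝ), B y ∈ range ((↑) : (ℂ ≃L[ℝ] ℂ) → ℂ →L[ℝ] ℂ) := by
    have hc : ContinuousAt B 0 := (hBs 0 hs1.self_of_nhds.1).continuousAt
    refine hc (ContinuousLinearEquiv.isOpen.mem_nhds ?_)
    exact ⟨_, hB0.symm⟩
  set Y : ℂ × ℝ → ℂ × ℝ := fun y => (-(ContinuousLinearMap.inverse (B y)) (m₁ y (0, 1)), 1) with hY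
  have hYs : ∀ᶠ y in 𝓝 (0 : ℂ × ℝ), ContDiffAt ℝ ∞ Y y ∧ m₁ y (Y y) = 0 := by
    filter_upwards [hs1, hBinv] with y hy hyB
    obtain ⟨e, he⟩ := hyB
    have hi : ContDiffAt ℝ ∞ (fun y => ContinuousLinearMap.inverse (B y)) y := by
      have h1 := contDiffAt_map_inverse (𝕜 := ℝ) (n := ∞) e
      rw [he] at h1
      exact h1.comp y (hBs y hy.1)
    refine ⟨(hi.clm_apply (hy.1.clm_apply contDiffAt_const)).neg.prodMk contDiffAt_const, ?_⟩
    have e1 : ∀ z : ℂ, m₁ y (z, 0) = B y z := fun z => rfl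
    have e2 : Y y = (-(ContinuousLinearMap.inverse (B y)) (m₁ y (0, 1)), 0) + (0, 1) := by
      simp [hY]
    rw [e2, map_add, e1, ← he, ContinuousLinearMap.inverse_equiv, map_neg]
    simp
  have hY0 : Y 0 = (0, 1) := by
    simp [hY, hm₁0]
  obtain ⟨hs2, π₂, hπ₂0, hπ₂⟩ := exists_reduction (ContinuousLinearEquiv.refl ℝ (ℂ × ℝ))
    hY0.symm hs1 hYs
  set m₂ := sliceForm (0 : ℂ × ℝ) (ContinuousLinearEquiv.refl ℝ (ℂ × ℝ)) m₁ with hm₂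
  have hm₂0 : ∀ v, m₂ 0 v = v := fun v => by
    rw [hm₂, sliceForm_apply]
    have : (0 : ℂ × ℝ) + ContinuousLinearEquiv.refl ℝ (ℂ × ℝ) ((0 : ℂ), (0 : ℝ)) = 0 := by simp
    rw [this, hm₁0]
    rfl
  obtain ⟨ζ, hζ, hζd⟩ := exists_isothermal (hs2.mono fun w hw => hw.1) hm₂0
  refine ⟨fun x => ζ (π₂ (π₁ x)), ?_⟩
  have hc1 : Tendsto π₁ (𝓝 p) (𝓝 0) := by
    have := hπ₁.self_of_nhds.1.continuousAt.tendsto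
    rwa [hπ₁0] at this
  have hc2 : Tendsto π₂ (𝓝 0) (𝓝 0) := by
    have := hπ₂.self_of_nhds.1.continuousAt.tendsto
    rwa [hπ₂0] at this
  filter_upwards [hπ₁, hc1.eventually hπ₂, (hc2.comp hc1).eventually hζd] with x hx1 hx2 hx3
  obtain ⟨hx1s, c₁, hc₁, hx1d⟩ := hx1
  obtain ⟨hx2s, c₂, hc₂, hx2d⟩ := hx2
  obtain ⟨c₃, hc₃, hx3d⟩ := hx3
  refine ⟨hζ.contDiffAt.comp x (hx2s.comp x hx1s), c₁ * (c₂ * c₃),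
    mul_ne_zero hc₁ (mul_ne_zero hc₂ hc₃), fun v => ?_⟩
  have hd : HasFDerivAt (fun x => ζ (π₂ (π₁ x))) ((fderiv ℝ ζ (π₂ (π₁ x))).comp
      ((fderiv ℝ π₂ (π₁ x)).comp (fderiv ℝ π₁ x))) x :=
    HasFDerivAt.comp x (hζ.differentiable (by simp) _).hasFDerivAt
      (HasFDerivAt.comp x (hx2s.differentiableAt (by simp)).hasFDerivAt
        (hx1s.differentiableAt (by simp)).hasFDerivAt)
  rw [hd.fderiv, hx1d, hx2d]
  simp only [Function.comp_apply] at hx3d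
  rw [hx3d]
  simp only [ContinuousLinearMap.comp_apply]
  ring

end SpinGeometry

end

/-! ### The structure equations of the coframe m, n. -/

noncomputable section
namespace SpinGeometry
open Set Filter Topology

section Structure

variable {E F : Type*} [NormedAddCommGroup E] [NormedSpace ℝ E]
  [NormedAddCommGroup F] [NormedSpace ℝ F]

/-- The one-form `η` in `dm = m ∧ η`. -/
def connForm (Λ : ℝ) (n : E → E →L[ℝ] ℂ) (A : E → E →L[ℝ] ℝ) (P N : E → ℝ) (x : E) : E →L[ℝ] ℂ :=
  (-2 * Complex.I) • Complex.ofRealCLM.comp (A x)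
    - (2 / P x) • (Complex.conjCLE : ℂ →L[ℝ] ℂ).comp (n x) - (2 * Λ / N x) • n x

theorem connForm_apply (Λ : ℝ) (n : E → E →L[ℝ] ℂ) (A : E → E →L[ℝ] ℝ) (P N : E → ℝ) (x v : E) :
    connForm Λ n A P N x v = -2 * Complex.I * A x v
      - ((2 / P x : ℝ) : ℂ) * (starRingEnd ℂ) (n x v) - ((2 * Λ / N x : ℝ) : ℂ) * n x v := by
  simp [connForm, Complex.real_smul]

/-- `Im (z w̄)`, so that `m ∧ m̄ = 2 i (crossIm m m)`. -/
def crossIm (z w : ℂ) : ℝ := z.im * w.re - z.re * w.im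

/-- The structure equations of the coframe `m, n` built from a pair of spinor fields of norms `P`
and `N` solving the Killing spinor equations with one-form `A`. -/
structure StructEqs (Λ : ℝ) (Ω : Set E) (m n : E → E →L[ℝ] ℂ) (A : E → E →L[ℝ] ℝ)
    (P N : E → ℝ) : Prop where
  smooth_m : ∀ x ∈ Ω, ContDiffAt ℝ ∞ m x
  smooth_n : ∀ x ∈ Ω, ContDiffAt ℝ ∞ n x
  smooth_A : ∀ x ∈ Ω, ContDiffAt ℝ ∞ A x
  smooth_P : ∀ x ∈ Ω, ContDiffAt ℝ ∞ P x
  smooth_N : ∀ x ∈ Ω, ContDiffAt ℝ ∞ N x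
  P_pos : ∀ x ∈ Ω, 0 < P x
  N_pos : ∀ x ∈ Ω, 0 < N x
  dN : ∀ x ∈ Ω, ∀ v, fderiv ℝ N x v = 2 * Λ * (n x v).re
  dm : ∀ x ∈ Ω, ∀ v w, extd m x v w
    = m x v * connForm Λ n A P N x w - m x w * connForm Λ n A P N x v
  dn : ∀ x ∈ Ω, ∀ v w, extd n x v w = Complex.I *
    ((-(N x / Λ) * extd A x v w
      + 2 / P x * (crossIm (m x v) (m x w) - crossIm (n x v) (n x w))
      - 2 * Λ / N x * (crossIm (m x v) (m x w) + crossIm (n x v) (n x w)) : ℝ) : ℂ)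
  -- The numbers a and B are the components of φ relative to α and α̂. They need only exist at each
  -- point, with no regularity, because they cancel from every conclusion drawn later.
  dP_dA : ∀ x ∈ Ω, ∃ (a : ℂ) (B : ℝ),
    (∀ v, fderiv ℝ P x v = 2 * (1 + B * P x / Λ) * (n x v).re - 2 * P x / Λ * (a * m x v).im) ∧
    ∀ v w, extd A x v w = -(2 / N x) * ((a * (m x v * n x w - m x w * n x v)).re
      - B * (crossIm (m x v) (m x w) + crossIm (n x v) (n x w)))

theorem StructEqs.pull {Λ : ℝ} {Ω : Set E} {m n : E → E →L[ℝ] ℂ} {A : E → E →L[ℝ] ℝ}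
    {P N : E → ℝ} (h : StructEqs Λ Ω m n A P N) {Ψ : F → E} {W : Set F}
    (hΨ : ∀ q ∈ W, ContDiffAt ℝ ∞ Ψ q) (hW : ∀ q ∈ W, Ψ q ∈ Ω) :
    StructEqs Λ W (pull Ψ m) (pull Ψ n) (pull Ψ A) (fun q => P (Ψ q)) (fun q => N (Ψ q)) := by
  have hfd : ∀ q ∈ W, ∀ f : E → ℝ, ContDiffAt ℝ ∞ f (Ψ q) → ∀ v,
      fderiv ℝ (fun q => f (Ψ q)) q v = fderiv ℝ f (Ψ q) (fderiv ℝ Ψ q v) := by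
    intro q hq f hf v
    have := fderiv_comp q (hf.differentiableAt (by simp)) ((hΨ q hq).differentiableAt (by simp))
    exact congrArg (fun S => S v) this
  have hex : ∀ q ∈ W, ∀ {G : Type} [NormedAddCommGroup G] [NormedSpace ℝ G] (om : E → E →L[ℝ] G),
      ContDiffAt ℝ ∞ om (Ψ q) → ∀ u w,
      extd (SpinGeometry.pull Ψ om) q u w = extd om (Ψ q) (fderiv ℝ Ψ q u) (fderiv ℝ Ψ q w) :=
    fun q hq G _ _ om hom u w => extd_pull (hΨ q hq) (hom.differentiableAt (by simp)) u w
  have hcf : ∀ q v, connForm Λ (SpinGeometry.pull Ψ n) (SpinGeometry.pull Ψ A)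
      (fun q => P (Ψ q)) (fun q => N (Ψ q)) q v = connForm Λ n A P N (Ψ q) (fderiv ℝ Ψ q v) := by
    intro q v
    simp only [connForm_apply, pull_apply]
  refine ⟨fun q hq => ContDiffAt.pull (hΨ q hq) (h.smooth_m _ (hW q hq)),
    fun q hq => ContDiffAt.pull (hΨ q hq) (h.smooth_n _ (hW q hq)),
    fun q hq => ContDiffAt.pull (hΨ q hq) (h.smooth_A _ (hW q hq)),
    fun q hq => (h.smooth_P _ (hW q hq)).comp q (hΨ q hq),
    fun q hq => (h.smooth_N _ (hW q hq)).comp q (hΨ q hq),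
    fun q hq => h.P_pos _ (hW q hq), fun q hq => h.N_pos _ (hW q hq), ?_, ?_, ?_, ?_⟩
  · intro q hq v
    rw [hfd q hq N (h.smooth_N _ (hW q hq)), h.dN _ (hW q hq), pull_apply]
  · intro q hq v w
    rw [hex q hq m (h.smooth_m _ (hW q hq)), h.dm _ (hW q hq), hcf, hcf, pull_apply, pull_apply]
  · intro q hq v w
    rw [hex q hq n (h.smooth_n _ (hW q hq)), hex q hq A (h.smooth_A _ (hW q hq)), h.dn _ (hW q hq)]
    simp only [pull_apply]
  · intro q hq
    obtain ⟨a, B, h1, h2⟩ := h.dP_dA _ (hW q hq)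
    refine ⟨a, B, fun v => ?_, fun v w => ?_⟩
    · rw [hfd q hq P (h.smooth_P _ (hW q hq)), h1]
      simp only [pull_apply]
    · rw [hex q hq A (h.smooth_A _ (hW q hq)), h2]
      simp only [pull_apply]

theorem StructEqs.mono {Λ : ℝ} {Ω Ω' : Set E} {m n : E → E →L[ℝ] ℂ} {A : E → E →L[ℝ] ℝ}
    {P N : E → ℝ} (h : StructEqs Λ Ω m n A P N) (hs : Ω' ⊆ Ω) : StructEqs Λ Ω' m n A P N :=
  ⟨fun x hx => h.smooth_m x (hs hx), fun x hx => h.smooth_n x (hs hx),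
    fun x hx => h.smooth_A x (hs hx), fun x hx => h.smooth_P x (hs hx),
    fun x hx => h.smooth_N x (hs hx), fun x hx => h.P_pos x (hs hx), fun x hx => h.N_pos x (hs hx),
    fun x hx => h.dN x (hs hx), fun x hx => h.dm x (hs hx), fun x hx => h.dn x (hs hx),
    fun x hx => h.dP_dA x (hs hx)⟩

end Structure

end SpinGeometry
end

/-! ### The coframe in adapted coordinates: first-order consequences. -/

noncomputable section
namespace SpinGeometry
open Set Filter Topology

/-- The standard basis vectors of `ℝ⁴`. -/
abbrev ev (j : Fin 4) : E4 := EuclideanSpace.single j (1 : ℝ)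

/-- A coframe solving the structure equations in the coordinates in which `m` is a multiple of
`dx + i dy`, the norm `N` is `√2 Λ / z` and the Killing vector is `√2 ∂_τ`. -/
structure NormalForm (Λ : ℝ) (W : Set E4) (m n : E4 → E4 →L[ℝ] ℂ) (A : E4 → E4 →L[ℝ] ℝ)
    (P N : E4 → ℝ) (f₀ : ℂ) (l : E4 → ℂ) : Prop where
  eqs : StructEqs Λ W m n A P N
  isOpen : IsOpen W
  f₀_ne : f₀ ≠ 0
  smooth_l : ∀ w ∈ W, ContDiffAt ℝ ∞ l w
  m_eq : ∀ w ∈ W, ∀ v : E4, m w v = f₀ * Complex.exp (l w) * (v 0 + v 1 * Complex.I)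
  z_ne : ∀ w ∈ W, w 2 ≠ 0
  N_eq : ∀ w ∈ W, N w = √2 * Λ / w 2
  n_three : ∀ w ∈ W, n w (ev 3) = -Complex.I * ((P w * N w / √2 : ℝ) : ℂ)

section

variable {Λ : ℝ} {W : Set E4} {m n : E4 → E4 →L[ℝ] ℂ} {A : E4 → E4 →L[ℝ] ℝ}
    {P N : E4 → ℝ} {f₀ : ℂ} {l : E4 → ℂ}

theorem hasFDerivAt_coord (j : Fin 4) (w : E4) :
    HasFDerivAt (fun w : E4 => w j) (EuclideanSpace.proj j : E4 →L[ℝ] ℝ) w :=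
  (EuclideanSpace.proj j : E4 →L[ℝ] ℝ).hasFDerivAt

/-- Differentiate N = √2Λ/z and compare with dN = 2Λ Re n. -/
theorem NormalForm.n_re (h : NormalForm Λ W m n A P N f₀ l) (hΛ : Λ ≠ 0) {w : E4} (hw : w ∈ W)
    (v : E4) : (n w v).re = -(v 2 / (√2 * w 2 ^ 2)) := by
  have h2 : √2 * √2 = (2 : ℝ) := Real.mul_self_sqrt (by norm_num)
  have h20 : (√2 : ℝ) ≠ 0 := by positivity
  have hz := h.z_ne w hw
  have e1 := h.eqs.dN w hw v
  have e2 : N =ᶠ[𝓝 w] fun w => √2 * Λ * (w 2)⁻¹ := by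
    filter_upwards [h.isOpen.mem_nhds hw] with y hy
    rw [h.N_eq y hy, div_eq_mul_inv]
  have e3 := ((hasDerivAt_inv hz).comp_hasFDerivAt w (hasFDerivAt_coord 2 w)).const_mul (√2 * Λ)
  have e4 : HasFDerivAt (fun w : E4 => √2 * Λ * (w 2)⁻¹) _ w := e3
  rw [e2.fderiv_eq, e4.fderiv] at e1
  have e5 : √2 * Λ * (-(w 2 ^ 2)⁻¹ * v 2) = 2 * Λ * (n w v).re := by
    rw [← e1]; simp
  have : (n w v).re = (√2 * Λ * (-(w 2 ^ 2)⁻¹ * v 2)) / (2 * Λ) := by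
    rw [e5]; field_simp
  rw [this]
  field_simp
  linear_combination (-v 2) * h2

/-- The value of the first-order invariants in normal form. -/
theorem NormalForm.scalars (h : NormalForm Λ W m n A P N f₀ l) (hΛ : Λ ≠ 0) {w : E4} (hw : w ∈ W) :
    ∃ α₀ α₁ B : ℝ, ∀ ν₀ ν₁ ν₂ ρ κ φ : ℝ, ν₀ = (n w (ev 0)).im → ν₁ = (n w (ev 1)).im →
      ν₂ = (n w (ev 2)).im → ρ = -(1 / (√2 * w 2 ^ 2)) → κ = -(P w * N w / √2) →
      φ = Complex.normSq (f₀ * Complex.exp (l w)) →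
      fderiv ℝ P w (ev 0) = -(2 * P w / Λ * α₀) ∧
      fderiv ℝ P w (ev 1) = -(2 * P w / Λ * α₁) ∧
      fderiv ℝ P w (ev 2) = 2 * (1 + B * P w / Λ) * ρ ∧
      fderiv ℝ P w (ev 3) = 0 ∧
      extd A w (ev 0) (ev 1) = -(2 / N w) * (-ν₁ * α₀ + ν₀ * α₁ + B * φ) ∧
      extd A w (ev 1) (ev 2) = -(2 / N w) * (-ρ * α₀ - ν₂ * α₁ - B * (ρ * ν₁)) ∧
      extd A w (ev 0) (ev 2) = -(2 / N w) * (ρ * α₁ - ν₂ * α₀ - B * (ρ * ν₀)) ∧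
      (extd n w (ev 0) (ev 1)).im = -(N w / Λ) * extd A w (ev 0) (ev 1)
        - (2 / P w - 2 * Λ / N w) * φ ∧
      (extd n w (ev 1) (ev 2)).im = -(N w / Λ) * extd A w (ev 1) (ev 2)
        - (2 / P w + 2 * Λ / N w) * (ν₁ * ρ) ∧
      (extd n w (ev 0) (ev 2)).im = -(N w / Λ) * extd A w (ev 0) (ev 2)
        - (2 / P w + 2 * Λ / N w) * (ν₀ * ρ) ∧
      (extd n w (ev 3) (ev 0)).im = fderiv ℝ P w (ev 0) * (N w / √2) ∧
      (extd n w (ev 3) (ev 1)).im = fderiv ℝ P w (ev 1) * (N w / √2) ∧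
      (extd n w (ev 3) (ev 2)).im = -(N w / Λ) * (2 / N w * (B * (κ * ρ)))
        - (2 / P w + 2 * Λ / N w) * (κ * ρ) := by
  have h2 : √2 * √2 = (2 : ℝ) := Real.mul_self_sqrt (by norm_num)
  have h20 : (√2 : ℝ) ≠ 0 := by positivity
  have hP := (h.eqs.P_pos w hw).ne'
  have hN := (h.eqs.N_pos w hw).ne'
  obtain ⟨a, B, hdP, hdA⟩ := h.eqs.dP_dA w hw
  set f := f₀ * Complex.exp (l w) with hf
  -- Only the product a·m = a f (dx + i dy) enters dP and dA, so a is recorded through the real and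
  -- imaginary parts of a f. The abbreviations quantified next are the imaginary parts ν_j of n, its
  -- real z-component ρ, its τ-component κ and φ = |f|².
  refine ⟨(a * f).im, (a * f).re, B, ?_⟩
  intro ν₀ ν₁ ν₂ ρ κ φ h0 h1 h2' hρ hκ hφ
  have hm : ∀ v, m w v = f * (v 0 + v 1 * Complex.I) := h.m_eq w hw
  have m0 : m w (ev 0) = f := by rw [hm]; simp
  have m1 : m w (ev 1) = f * Complex.I := by rw [hm]; simp
  have m2 : m w (ev 2) = 0 := by rw [hm]; simp
  have m3 : m w (ev 3) = 0 := by rw [hm]; simp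
  have n0 : n w (ev 0) = ⟨0, ν₀⟩ := by
    apply Complex.ext
    · rw [h.n_re hΛ hw]; simp
    · exact h0.symm
  have n1 : n w (ev 1) = ⟨0, ν₁⟩ := by
    apply Complex.ext
    · rw [h.n_re hΛ hw]; simp
    · exact h1.symm
  have n2 : n w (ev 2) = ⟨ρ, ν₂⟩ := by
    apply Complex.ext
    · rw [h.n_re hΛ hw, hρ]; simp
    · exact h2'.symm
  have n3 : n w (ev 3) = ⟨0, κ⟩ := by
    rw [h.n_three w hw, hκ]
    apply Complex.ext <;> simp
  have hκ' : N w / √2 = -κ / P w := by rw [hκ]; field_simp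
  have hd := h.eqs.dn w hw
  rw [Complex.normSq_apply] at hφ
  refine ⟨?_, ?_, ?_, ?_, ?_, ?_, ?_, ?_, ?_, ?_, ?_, ?_, ?_⟩
  · rw [hdP, n0, m0]
    ring
  · rw [hdP, n1, m1]
    simp only [Complex.mul_re, Complex.mul_im, Complex.I_re, Complex.I_im]
    ring
  · rw [hdP, n2, m2]
    simp only [Complex.mul_im, Complex.zero_re, Complex.zero_im]
    ring
  · rw [hdP, n3, m3]
    simp only [Complex.mul_im, Complex.zero_re, Complex.zero_im]
    ring
  · rw [hdA, n0, n1, m0, m1, hφ]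
    simp only [crossIm, Complex.mul_re, Complex.mul_im, Complex.sub_re, Complex.sub_im,
      Complex.I_re, Complex.I_im]
    ring
  · rw [hdA, n1, n2, m1, m2]
    simp only [crossIm, Complex.mul_re, Complex.mul_im, Complex.sub_re, Complex.sub_im,
      Complex.zero_re, Complex.zero_im, Complex.I_re, Complex.I_im]
    ring
  · rw [hdA, n0, n2, m0, m2]
    simp only [crossIm, Complex.mul_re, Complex.mul_im, Complex.sub_re, Complex.sub_im,
      Complex.zero_re, Complex.zero_im]
    ring
  · rw [hd, n0, n1, m0, m1, hφ, Complex.I_mul_im, Complex.ofReal_re]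
    simp only [crossIm, Complex.mul_re, Complex.mul_im, Complex.I_re, Complex.I_im]
    ring
  · rw [hd, n1, n2, m1, m2, Complex.I_mul_im, Complex.ofReal_re]
    simp only [crossIm, Complex.mul_re, Complex.mul_im, Complex.zero_re, Complex.zero_im,
      Complex.I_re, Complex.I_im]
    ring
  · rw [hd, n0, n2, m0, m2, Complex.I_mul_im, Complex.ofReal_re]
    simp only [crossIm, Complex.zero_re, Complex.zero_im]
    ring
  · rw [hd, hdA, hdP, n3, n0, m3, m0, Complex.I_mul_im, Complex.ofReal_re]
    simp only [crossIm, Complex.mul_re, Complex.mul_im, Complex.sub_re, Complex.sub_im,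
      Complex.zero_re, Complex.zero_im]
    rw [hκ']
    field_simp
    ring
  · rw [hd, hdA, hdP, n3, n1, m3, m1, Complex.I_mul_im, Complex.ofReal_re]
    simp only [crossIm, Complex.mul_re, Complex.mul_im, Complex.sub_re, Complex.sub_im,
      Complex.zero_re, Complex.zero_im, Complex.I_re, Complex.I_im]
    rw [hκ']
    field_simp
    ring
  · rw [hd, hdA, n3, n2, m3, m2, Complex.I_mul_im, Complex.ofReal_re]
    simp only [crossIm, Complex.mul_re, Complex.mul_im, Complex.sub_re, Complex.sub_im,
      Complex.zero_re, Complex.zero_im]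
    field_simp
    ring

/-- The equations `dm = m ∧ η` in normal form. -/
theorem NormalForm.dl (h : NormalForm Λ W m n A P N f₀ l) (hΛ : Λ ≠ 0) {w : E4} (hw : w ∈ W) :
    (fderiv ℝ l w (ev 0)).re - (fderiv ℝ l w (ev 1)).im
      = -2 * A w (ev 1) + (2 / P w - 2 * Λ / N w) * (n w (ev 1)).im ∧
    -(fderiv ℝ l w (ev 0)).im - (fderiv ℝ l w (ev 1)).re
      = -2 * A w (ev 0) + (2 / P w - 2 * Λ / N w) * (n w (ev 0)).im ∧
    (fderiv ℝ l w (ev 2)).re = -((2 / P w + 2 * Λ / N w) * (1 / (√2 * w 2 ^ 2))) ∧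
    (fderiv ℝ l w (ev 3)).re = 0 := by
  set f := f₀ * Complex.exp (l w) with hf
  have hf0 : f ≠ 0 := mul_ne_zero h.f₀_ne (Complex.exp_ne_zero _)
  have hl : HasFDerivAt l (fderiv ℝ l w) w :=
    ((h.smooth_l w hw).differentiableAt (by simp)).hasFDerivAt
  have hm : ∀ v, m w v = f * (v 0 + v 1 * Complex.I) := h.m_eq w hw
  have m0 : m w (ev 0) = f := by rw [hm]; simp
  have m1 : m w (ev 1) = f * Complex.I := by rw [hm]; simp
  have m2 : m w (ev 2) = 0 := by rw [hm]; simp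
  have m3 : m w (ev 3) = 0 := by rw [hm]; simp
  have hdm : ∀ v u, fderiv ℝ m w v u = f * fderiv ℝ l w v * (u 0 + u 1 * Complex.I) := by
    intro v u
    have e1 : (fun w => m w u) =ᶠ[𝓝 w]
        fun w => f₀ * Complex.exp (l w) * (u 0 + u 1 * Complex.I) := by
      filter_upwards [h.isOpen.mem_nhds hw] with y hy using h.m_eq y hy u
    have e2 := ((h.eqs.smooth_m w hw).differentiableAt (by simp)).hasFDerivAt.clm_apply
        (hasFDerivAt_const u w)
    have e3 := ((hl.cexp.const_mul f₀).mul_const ((u 0 : ℂ) + u 1 * Complex.I))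
    have e4 := (e3.congr_of_eventuallyEq e1).unique e2
    have := congrArg (fun S => S v) e4
    simp at this
    rw [← this, hf]
    ring
  have hd : ∀ v u, f * fderiv ℝ l w v * (u 0 + u 1 * Complex.I)
      - f * fderiv ℝ l w u * (v 0 + v 1 * Complex.I)
      = m w v * connForm Λ n A P N w u - m w u * connForm Λ n A P N w v := by
    intro v u
    rw [← hdm, ← hdm]
    exact h.eqs.dm w hw v u
  have d01 := hd (ev 0) (ev 1)
  have d20 := hd (ev 2) (ev 0)
  have d30 := hd (ev 3) (ev 0)
  rw [m0, m1] at d01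
  rw [m0, m2] at d20
  rw [m0, m3] at d30
  have r0 : (n w (ev 0)).re = 0 := by rw [h.n_re hΛ hw]; simp
  have r1 : (n w (ev 1)).re = 0 := by rw [h.n_re hΛ hw]; simp
  have r2 : (n w (ev 2)).re = -(1 / (√2 * w 2 ^ 2)) := by rw [h.n_re hΛ hw]; simp
  have r3 : (n w (ev 3)).re = 0 := by rw [h.n_re hΛ hw]; simp
  -- Since m = f (dx + i dy) with f = f₀ e^l, the equation dm = m ∧ η says that dl + η is a multiple
  -- of dx + i dy. The three component pairs taken here involve that form through the ∂_x, ∂_y, ∂_z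
  -- and ∂_τ slots.
  have k01 : fderiv ℝ l w (ev 0) * Complex.I - fderiv ℝ l w (ev 1)
      = connForm Λ n A P N w (ev 1) - Complex.I * connForm Λ n A P N w (ev 0) := by
    apply mul_left_cancel₀ hf0
    simp at d01
    linear_combination d01
  have k20 : fderiv ℝ l w (ev 2) = -connForm Λ n A P N w (ev 2) := by
    apply mul_left_cancel₀ hf0
    simp at d20
    linear_combination d20
  have k30 : fderiv ℝ l w (ev 3) = -connForm Λ n A P N w (ev 3) := by
    apply mul_left_cancel₀ hf0
    simp at d30
    linear_combination d30
  rw [connForm_apply, connForm_apply] at k01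
  rw [connForm_apply] at k20 k30
  have k01r := congrArg Complex.re k01
  have k01i := congrArg Complex.im k01
  have k20r := congrArg Complex.re k20
  have k30r := congrArg Complex.re k30
  simp [-Complex.ofReal_div, -Complex.ofReal_mul, r0, r1] at k01r k01i
  simp [-Complex.ofReal_div, -Complex.ofReal_mul, r2] at k20r
  simp [-Complex.ofReal_div, -Complex.ofReal_mul, r3] at k30r
  refine ⟨?_, ?_, ?_, ?_⟩
  · linear_combination k01i
  · linear_combination k01r
  · rw [k20r]; ring
  · exact k30r

end

end SpinGeometry
end

/-! ### Directional derivatives and functions independent of τ. -/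

noncomputable section
namespace SpinGeometry
open Set Filter Topology

section LineDeriv

variable {E : Type*} [NormedAddCommGroup E] [NormedSpace ℝ E] {f g : E → ℝ} {f' g' : ℝ} {x v : E}

theorem hld_fderiv {f : E → ℝ} (hf : DifferentiableAt ℝ f x) (v : E) :
    HasLineDerivAt ℝ f (fderiv ℝ f x v) x v := hf.hasFDerivAt.hasLineDerivAt v

theorem hld_unique (hf : HasLineDerivAt ℝ f f' x v) (hg : HasLineDerivAt ℝ g g' x v)
    (h : f =ᶠ[𝓝 x] g) : f' = g' :=
  hf.unique (hg.congr_of_eventuallyEq h)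

theorem hld_mul (hf : HasLineDerivAt ℝ f f' x v) (hg : HasLineDerivAt ℝ g g' x v) :
    HasLineDerivAt ℝ (fun y => f y * g y) (f' * g x + f x * g') x v := by
  have := HasDerivAt.mul hf hg
  simp only [zero_smul, add_zero] at this
  exact this

theorem hld_add (hf : HasLineDerivAt ℝ f f' x v) (hg : HasLineDerivAt ℝ g g' x v) :
    HasLineDerivAt ℝ (fun y => f y + g y) (f' + g') x v := HasDerivAt.add hf hg

theorem hld_sub (hf : HasLineDerivAt ℝ f f' x v) (hg : HasLineDerivAt ℝ g g' x v) :
    HasLineDerivAt ℝ (fun y => f y - g y) (f' - g') x v := HasDerivAt.sub hf hg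

theorem hld_const_mul (c : ℝ) (hf : HasLineDerivAt ℝ f f' x v) :
    HasLineDerivAt ℝ (fun y => c * f y) (c * f') x v := HasDerivAt.const_mul c hf

theorem hld_inv (hf : HasLineDerivAt ℝ f f' x v) (h0 : f x ≠ 0) :
    HasLineDerivAt ℝ (fun y => (f y)⁻¹) (-f' / f x ^ 2) x v := by
  have := HasDerivAt.inv (c := fun t : ℝ => f (x + t • v)) hf (by simpa using h0)
  simp only [zero_smul, add_zero] at this
  exact this

theorem hld_exp (hf : HasLineDerivAt ℝ f f' x v) :
    HasLineDerivAt ℝ (fun y => Real.exp (f y)) (Real.exp (f x) * f') x v := by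
  have := HasDerivAt.exp (f := fun t : ℝ => f (x + t • v)) hf
  simp only [zero_smul, add_zero] at this
  exact this

theorem hld_log (hf : HasLineDerivAt ℝ f f' x v) (h0 : f x ≠ 0) :
    HasLineDerivAt ℝ (fun y => Real.log (f y)) (f' / f x) x v := by
  have := HasDerivAt.log (f := fun t : ℝ => f (x + t • v)) hf (by simpa using h0)
  simp only [zero_smul, add_zero] at this
  exact this

theorem hld_const (c : ℝ) : HasLineDerivAt ℝ (fun _ : E => c) 0 x v := hasDerivAt_const _ c

end LineDeriv

theorem hld_coord {ι : Type*} [Fintype ι] [DecidableEq ι] (j k : ι) (y : EuclideanSpace ℝ ι) :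
    HasLineDerivAt ℝ (fun y : EuclideanSpace ℝ ι => y j) (if j = k then 1 else 0) y
      (EuclideanSpace.single k 1) := by
  have := ((EuclideanSpace.proj j : EuclideanSpace ℝ ι →L[ℝ] ℝ).hasFDerivAt
    (x := y)).hasLineDerivAt (EuclideanSpace.single k 1)
  simpa [Pi.single_apply] using this

theorem pd_eq {k : Fin 3} {f : E3 → ℝ} {f' : ℝ} {y : E3}
    (h : HasLineDerivAt ℝ f f' y (EuclideanSpace.single k 1)) (hf : DifferentiableAt ℝ f y) :
    pd k f y = f' :=
  (hld_fderiv hf _).unique h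

/-- The section `(x, y, z) ↦ (x, y, z, τ)` of `proj`. -/
def sec (τ : ℝ) (y : E3) : E4 := !₂[y 0, y 1, y 2, τ]

theorem sec_add (τ t : ℝ) (y : E3) (k : Fin 3) :
    sec τ (y + t • EuclideanSpace.single k (1 : ℝ)) = sec τ y + t • ev k.castSucc := by
  ext i
  fin_cases i <;> fin_cases k <;> simp [sec]

theorem proj_sec (τ : ℝ) (y : E3) : proj (sec τ y) = y := by
  ext i
  fin_cases i <;> simp [sec, proj]

theorem sec_proj (w : E4) : sec (w 3) (proj w) = w := by
  ext i
  fin_cases i <;> simp [sec, proj]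

theorem contDiff_sec (τ : ℝ) : ContDiff ℝ ∞ (sec τ) := by
  have h : ∀ j : Fin 3, ContDiff ℝ ∞ (fun y : E3 => y j) := fun j =>
    (EuclideanSpace.proj j : E3 →L[ℝ] ℝ).contDiff
  rw [contDiff_euclidean]
  intro i
  fin_cases i
  · exact h 0
  · exact h 1
  · exact h 2
  · exact contDiff_const

theorem contDiff_proj : ContDiff ℝ ∞ proj := by
  have h : ∀ j : Fin 4, ContDiff ℝ ∞ (fun y : E4 => y j) := fun j =>
    (EuclideanSpace.proj j : E4 →L[ℝ] ℝ).contDiff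
  rw [contDiff_euclidean]
  intro i
  fin_cases i
  · exact h 0
  · exact h 1
  · exact h 2

theorem hld_sec {G : E4 → ℝ} {τ : ℝ} {y : E3} (hG : DifferentiableAt ℝ G (sec τ y)) (k : Fin 3) :
    HasLineDerivAt ℝ (fun y => G (sec τ y)) (fderiv ℝ G (sec τ y) (ev k.castSucc)) y
      (EuclideanSpace.single k 1) := by
  have := hld_fderiv hG (ev k.castSucc)
  unfold HasLineDerivAt at this ⊢
  simpa only [sec_add] using this

/-- The part of `ℝ⁴` over `D` and an interval. -/
def box (D : Set E3) (τ₀ δ : ℝ) : Set E4 := {w | proj w ∈ D ∧ w 3 ∈ Metric.ball τ₀ δ}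

theorem sec_mem_box {D : Set E3} {τ₀ δ : ℝ} (hδ : 0 < δ) {y : E3} (hy : y ∈ D) :
    sec τ₀ y ∈ box D τ₀ δ := by
  refine ⟨by rwa [proj_sec], ?_⟩
  simpa [sec] using hδ

/-- A function whose `τ`-derivative vanishes is determined by its values on a slice. -/
theorem eq_sec_of_fderiv_eq_zero {D : Set E3} {τ₀ δ : ℝ} (hδ : 0 < δ) {G : E4 → ℝ}
    (hG : ∀ w ∈ box D τ₀ δ, DifferentiableAt ℝ G w ∧ fderiv ℝ G w (ev 3) = 0) {w : E4}
    (hw : w ∈ box D τ₀ δ) : G w = G (sec τ₀ (proj w)) := by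
  have hmem : ∀ t ∈ Metric.ball τ₀ δ, sec t (proj w) ∈ box D τ₀ δ := fun t ht =>
    ⟨by rw [proj_sec]; exact hw.1, by simpa [sec] using ht⟩
  have hd : ∀ t ∈ Metric.ball τ₀ δ, HasDerivAt (fun t => G (sec t (proj w))) 0 t := by
    intro t ht
    obtain ⟨h1, h2⟩ := hG _ (hmem t ht)
    have h3 := hld_fderiv h1 (ev 3)
    rw [h2] at h3
    have h4 : ∀ r : ℝ, sec t (proj w) + r • ev 3 = sec (t + r) (proj w) := by
      intro r
      ext i
      fin_cases i <;> simp [sec]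
    unfold HasLineDerivAt at h3
    simp only [h4] at h3
    have h5 : HasDerivAt (fun r => G (sec (t + (r - t)) (proj w))) 0 t := by
      have := HasDerivAt.comp_sub_const (f := fun r => G (sec (t + r) (proj w))) (f' := 0) t t
        (by simpa using h3)
      exact this
    simpa using h5
  have := Metric.isOpen_ball.is_const_of_deriv_eq_zero
    (convex_ball τ₀ δ).isPreconnected
    (fun t ht => (hd t ht).differentiableAt.differentiableWithinAt) (fun t ht => (hd t ht).deriv)
    hw.2 (Metric.mem_ball_self hδ)
  simpa [sec_proj] using this

end SpinGeometry
end

/-! ### The coframe in adapted coordinates: invariance under K and the Laplacian of Re l. -/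

noncomputable section
namespace SpinGeometry
open Set Filter Topology

variable {Λ : ℝ} {W : Set E4} {m n : E4 → E4 →L[ℝ] ℂ} {A : E4 → E4 →L[ℝ] ℝ}
    {P N : E4 → ℝ} {f₀ : ℂ} {l : E4 → ℂ}

/-- The imaginary part of the `j`-th component of `n`. -/
def imComp (n : E4 → E4 →L[ℝ] ℂ) (j : Fin 4) (w : E4) : ℝ := (n w (ev j)).im

theorem NormalForm.smooth_imComp (h : NormalForm Λ W m n A P N f₀ l) {w : E4} (hw : w ∈ W)
    (j : Fin 4) : ContDiffAt ℝ ∞ (imComp n j) w :=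
  Complex.imCLM.contDiff.contDiffAt.comp w ((h.eqs.smooth_n w hw).clm_apply contDiffAt_const)

theorem NormalForm.fderiv_imComp (h : NormalForm Λ W m n A P N f₀ l) {w : E4} (hw : w ∈ W)
    (j : Fin 4) (v : E4) : fderiv ℝ (imComp n j) w v = (fderiv ℝ n w v (ev j)).im := by
  have e1 := ((h.eqs.smooth_n w hw).differentiableAt (by simp)).hasFDerivAt.clm_apply
        (hasFDerivAt_const (ev j) w)
  have e2 : HasFDerivAt (imComp n j) _ w := Complex.imCLM.hasFDerivAt.comp w e1
  rw [e2.fderiv]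
  simp

theorem NormalForm.extd_im (h : NormalForm Λ W m n A P N f₀ l) {w : E4} (hw : w ∈ W)
    (i j : Fin 4) : (extd n w (ev i) (ev j)).im
      = fderiv ℝ (imComp n j) w (ev i) - fderiv ℝ (imComp n i) w (ev j) := by
  rw [h.fderiv_imComp hw, h.fderiv_imComp hw, extd, Complex.sub_im]

theorem NormalForm.imComp_three (h : NormalForm Λ W m n A P N f₀ l) {w : E4} (hw : w ∈ W) :
    imComp n 3 w = -(1 / √2) * (P w * N w) := by
  rw [imComp, h.n_three w hw]
  simp
  ring

theorem NormalForm.fderiv_imComp_three (h : NormalForm Λ W m n A P N f₀ l) {w : E4} (hw : w ∈ W)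
    (v : E4) : fderiv ℝ (imComp n 3) w v
      = -(1 / √2) * (fderiv ℝ P w v * N w + P w * fderiv ℝ N w v) := by
  have e1 := hld_const_mul (-(1 / √2)) (hld_mul
    (hld_fderiv ((h.eqs.smooth_P w hw).differentiableAt (by simp)) v)
    (hld_fderiv ((h.eqs.smooth_N w hw).differentiableAt (by simp)) v))
  refine hld_unique (hld_fderiv ((h.smooth_imComp hw 3).differentiableAt (by simp)) v) e1 ?_
  filter_upwards [h.isOpen.mem_nhds hw] with y hy using h.imComp_three hy

/-- These are components of the invariance of Im n under K. The derivative ∂_τ Im n_j equals ∂_j Im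
n_τ plus the (τ, j)-component of d(Im n), and the structure equations together with Im n_τ = -PN/√2
make the two cancel. -/
theorem NormalForm.fderiv_imComp_ev_three (h : NormalForm Λ W m n A P N f₀ l) (hΛ : Λ ≠ 0)
    {w : E4} (hw : w ∈ W) (j : Fin 3) : fderiv ℝ (imComp n j.castSucc) w (ev 3) = 0 := by
  have h20 : (√2 : ℝ) ≠ 0 := by positivity
  have hP := (h.eqs.P_pos w hw).ne'
  have hN := (h.eqs.N_pos w hw).ne'
  have e := h.extd_im hw 3 j.castSucc
  obtain ⟨α₀, α₁, B, hs⟩ := h.scalars hΛ hw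
  obtain ⟨p0, p1, p2, -, -, -, -, -, -, -, q0, q1, q2⟩ := hs _ _ _ _ _ _ rfl rfl rfl rfl rfl rfl
  rw [h.fderiv_imComp_three hw, h.eqs.dN w hw, h.n_re hΛ hw] at e
  fin_cases j
  · change _ = fderiv ℝ (imComp n 0) w (ev 3) - _ at e
    change fderiv ℝ (imComp n 0) w (ev 3) = 0
    change (extd n w (ev 3) (ev 0)).im = _ at e
    rw [q0] at e
    simp at e
    linear_combination -e
  · change _ = fderiv ℝ (imComp n 1) w (ev 3) - _ at e
    change fderiv ℝ (imComp n 1) w (ev 3) = 0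
    change (extd n w (ev 3) (ev 1)).im = _ at e
    rw [q1] at e
    simp at e
    linear_combination -e
  · change fderiv ℝ (imComp n 2) w (ev 3) = 0
    change (extd n w (ev 3) (ev 2)).im = fderiv ℝ (imComp n 2) w (ev 3)
      - -(1 / √2) * (fderiv ℝ P w (ev 2) * N w + P w * (2 * Λ * -((ev 2).ofLp 2 / (√2 * w 2 ^ 2)))) at e
    rw [q2, p2] at e
    have hz := h.z_ne w hw
    have e1 : fderiv ℝ (imComp n 2) w (ev 3) = _ := (sub_eq_iff_eq_add.1 e.symm)
    rw [e1]
    simp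
    field_simp
    ring

/-- The Laplacian of `Re l`. -/
theorem NormalForm.laplacian (h : NormalForm Λ W m n A P N f₀ l) (hΛ : Λ ≠ 0)
    {w : E4} (hw : w ∈ W) :
    fderiv ℝ (fun w => (fderiv ℝ l w (ev 0)).re) w (ev 0)
      + fderiv ℝ (fun w => (fderiv ℝ l w (ev 1)).re) w (ev 1)
    = -2 * extd A w (ev 0) (ev 1) + (2 / P w - 2 * Λ / N w) * (extd n w (ev 0) (ev 1)).im
      - 2 / P w ^ 2 * (fderiv ℝ P w (ev 0) * imComp n 1 w - fderiv ℝ P w (ev 1) * imComp n 0 w) := by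
  have hP := (h.eqs.P_pos w hw).ne'
  have hN := (h.eqs.N_pos w hw).ne'
  have hl2 : ContDiffAt ℝ ∞ (fderiv ℝ l) w := (h.smooth_l w hw).fderiv_right (by simp)
  have hl2d := (hl2.differentiableAt (by simp)).hasFDerivAt
  have hcomp : ∀ (i : Fin 4) (v : E4), HasLineDerivAt ℝ (fun w => (fderiv ℝ l w (ev i)).re)
      (fderiv ℝ (fderiv ℝ l) w v (ev i)).re w v ∧
      HasLineDerivAt ℝ (fun w => (fderiv ℝ l w (ev i)).im)
      (fderiv ℝ (fderiv ℝ l) w v (ev i)).im w v := by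
    intro i v
    have e1 := hl2d.clm_apply (hasFDerivAt_const (ev i) w)
    have e2 : HasFDerivAt (fun w => (fderiv ℝ l w (ev i)).re) _ w := Complex.reCLM.hasFDerivAt.comp w e1
    have e3 : HasFDerivAt (fun w => (fderiv ℝ l w (ev i)).im) _ w := Complex.imCLM.hasFDerivAt.comp w e1
    have e4 := e2.hasLineDerivAt v
    have e5 := e3.hasLineDerivAt v
    simp at e4 e5
    exact ⟨e4, e5⟩
  have hA : ∀ (i : Fin 4) (v : E4), HasLineDerivAt ℝ (fun w => A w (ev i))
      (fderiv ℝ A w v (ev i)) w v := by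
    intro i v
    have e1 := ((h.eqs.smooth_A w hw).differentiableAt (by simp)).hasFDerivAt.clm_apply
        (hasFDerivAt_const (ev i) w)
    have e4 := e1.hasLineDerivAt v
    simpa using e4
  have hν : ∀ (i : Fin 4) (v : E4), HasLineDerivAt ℝ (imComp n i)
      (fderiv ℝ (imComp n i) w v) w v := fun i v =>
    hld_fderiv ((h.smooth_imComp hw i).differentiableAt (by simp)) v
  have hPl := hld_fderiv ((h.eqs.smooth_P w hw).differentiableAt (by simp))
  have hNl := hld_fderiv ((h.eqs.smooth_N w hw).differentiableAt (by simp))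
  have hdN : ∀ i : Fin 2, fderiv ℝ N w (ev (Fin.castLE (by norm_num) i)) = 0 := by
    intro i
    rw [h.eqs.dN w hw, h.n_re hΛ hw]
    fin_cases i <;> simp
  have hN0 : fderiv ℝ N w (ev 0) = 0 := hdN 0
  have hN1 : fderiv ℝ N w (ev 1) = 0 := hdN 1
  have hPN : ∀ v, fderiv ℝ N w v = 0 → HasLineDerivAt ℝ (fun w => 2 * (P w)⁻¹ - 2 * Λ * (N w)⁻¹)
      (-(2 * fderiv ℝ P w v) / P w ^ 2) w v := by
    intro v hv
    have := hld_sub (hld_const_mul 2 (hld_inv (hPl v) hP))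
      (hld_const_mul (2 * Λ) (hld_inv (hNl v) hN))
    rw [hv] at this
    have e : -(2 * fderiv ℝ P w v) / P w ^ 2
        = 2 * (-fderiv ℝ P w v / P w ^ 2) - 2 * Λ * (-0 / N w ^ 2) := by ring
    rw [e]
    exact this
  -- The first two equations of `NormalForm.dl` form a Cauchy–Riemann system with source terms for
  -- l. Differentiating one in x and the other in y and adding eliminates Im l, because mixed
  -- derivatives commute.
  have k0 := hld_unique (hld_sub (hcomp 0 (ev 0)).1 (hcomp 1 (ev 0)).2)
    (hld_add (hld_const_mul (-2) (hA 1 (ev 0))) (hld_mul (hPN (ev 0) hN0) (hν 1 (ev 0)))) (by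
      filter_upwards [h.isOpen.mem_nhds hw] with y hy
      rw [(h.dl hΛ hy).1, imComp]
      ring)
  have k1 := hld_unique (hld_add (hcomp 0 (ev 1)).2 (hcomp 1 (ev 1)).1)
    (hld_sub (hld_const_mul 2 (hA 0 (ev 1))) (hld_mul (hPN (ev 1) hN1) (hν 0 (ev 1)))) (by
      filter_upwards [h.isOpen.mem_nhds hw] with y hy
      have := (h.dl hΛ hy).2.1
      simp only [imComp]
      linear_combination -this)
  have hsymm : fderiv ℝ (fderiv ℝ l) w (ev 0) (ev 1) = fderiv ℝ (fderiv ℝ l) w (ev 1) (ev 0) :=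
    ((h.smooth_l w hw).isSymmSndFDerivAt (by
      rw [minSmoothness_of_isRCLikeNormedField]; exact WithTop.coe_le_coe.2 le_top)).eq _ _
  have d0 : DifferentiableAt ℝ (fun w => (fderiv ℝ l w (ev 0)).re) w :=
    (Complex.reCLM.hasFDerivAt.comp w (hl2d.clm_apply (hasFDerivAt_const (ev 0) w))).differentiableAt
  have d1 : DifferentiableAt ℝ (fun w => (fderiv ℝ l w (ev 1)).re) w :=
    (Complex.reCLM.hasFDerivAt.comp w (hl2d.clm_apply (hasFDerivAt_const (ev 1) w))).differentiableAt
  rw [(hld_fderiv d0 (ev 0)).unique (hcomp 0 (ev 0)).1,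
    (hld_fderiv d1 (ev 1)).unique (hcomp 1 (ev 1)).1, h.extd_im hw, extd]
  rw [hsymm] at k0
  linear_combination k0 + k1

end SpinGeometry
end

/-! ### The Toda equation and the equation for ω. -/

noncomputable section
namespace SpinGeometry
open Set Filter Topology

variable {Λ : ℝ} {m n : E4 → E4 →L[ℝ] ℂ} {A : E4 → E4 →L[ℝ] ℝ}
    {P N : E4 → ℝ} {f₀ : ℂ} {l : E4 → ℂ}

/-- A coframe in normal form defines a solution of the Toda equation, and its metric is the
associated one. -/
theorem NormalForm.exists_todaData {D : Set E3} {τ₀ δ : ℝ} (hD : IsOpen D) (hδ : 0 < δ)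
    (h : NormalForm Λ (box D τ₀ δ) m n A P N f₀ l) (hΛ : Λ ≠ 0) :
    ∃ (u V : E3 → ℝ) (om : Fin 3 → E3 → ℝ), IsTodaData Λ D u V om ∧
      ∀ w ∈ box D τ₀ δ, ∀ v : E4,
        2 / (P w * N w) * (Complex.normSq (m w v) + Complex.normSq (n w v))
          = todaMetric u V om w v := by
  have h2 : √2 * √2 = (2 : ℝ) := Real.mul_self_sqrt (by norm_num)
  have h20 : (√2 : ℝ) ≠ 0 := by positivity
  have hc0 : 0 < 2 * Complex.normSq f₀ := by
    have := Complex.normSq_pos.2 h.f₀_ne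
    positivity
  set s : E3 → E4 := sec τ₀ with hs
  have hsW : ∀ y ∈ D, s y ∈ box D τ₀ δ := fun y hy => sec_mem_box hδ hy
  have hsz : ∀ y : E3, s y 2 = y 2 := fun y => by simp [hs, sec]
  have hz : ∀ y ∈ D, y 2 ≠ 0 := fun y hy => by
    rw [← hsz]; exact h.z_ne _ (hsW y hy)
  set L : E4 → ℝ := fun w => (l w).re with hL
  have hLs : ∀ w ∈ box D τ₀ δ, ContDiffAt ℝ ∞ L w := fun w hw =>
    Complex.reCLM.contDiff.contDiffAt.comp w (h.smooth_l w hw)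
  have hLd : ∀ w ∈ box D τ₀ δ, ∀ v, fderiv ℝ L w v = (fderiv ℝ l w v).re := by
    intro w hw v
    have e1 : HasFDerivAt L _ w := Complex.reCLM.hasFDerivAt.comp w
      ((h.smooth_l w hw).differentiableAt (by simp)).hasFDerivAt
    rw [e1.fderiv]
    simp
  -- The definitions of u, V and ω are forced by matching 2/(PN)·(|m|² + |n|²) with the Toda metric.
  -- The dz² coefficient gives V = 1/(√2ΛPz), the dx² + dy² coefficient gives e^u = 2|f|²z⁴, and Im
  -- n = -(PN/√2)(dτ + ω) gives ω. The logarithm is that of |z|, so u makes sense for either sign of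
  -- z.
  set u : E3 → ℝ := fun y => 2 * L (s y) + 4 * Real.log (y 2)
    + Real.log (2 * Complex.normSq f₀) with hu
  set V : E3 → ℝ := fun y => (√2 * Λ)⁻¹ * ((P (s y))⁻¹ * (y 2)⁻¹) with hV
  set om : Fin 3 → E3 → ℝ := fun k y =>
    -(Λ⁻¹) * (y 2 * ((P (s y))⁻¹ * imComp n k.castSucc (s y))) with hom
  have hexp : ∀ y ∈ D, Real.exp (u y)
      = 2 * Complex.normSq (f₀ * Complex.exp (l (s y))) * y 2 ^ 4 := by
    intro y hy
    have e1 : 4 * Real.log (y 2) = Real.log (y 2 ^ 4) := by rw [Real.log_pow]; norm_num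
    have e2 : 0 < y 2 ^ 4 := by
      have := hz y hy
      positivity
    rw [hu]
    simp only
    rw [Real.exp_add, Real.exp_add, e1, Real.exp_log e2, Real.exp_log hc0, map_mul,
      Complex.normSq_eq_norm_sq (Complex.exp _), Complex.norm_exp, ← Real.exp_nat_mul]
    push_cast
    ring
  -- smoothness
  have hcomp : ∀ G : E4 → ℝ, (∀ w ∈ box D τ₀ δ, ContDiffAt ℝ ∞ G w) →
      ∀ y ∈ D, ContDiffAt ℝ ∞ (fun y => G (s y)) y := fun G hG y hy =>
    ContDiffAt.comp y (hG _ (hsW y hy)) (contDiff_sec τ₀).contDiffAt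
  have hcoord : ∀ y : E3, ContDiffAt ℝ ∞ (fun y : E3 => y 2) y := fun y =>
    (EuclideanSpace.proj 2 : E3 →L[ℝ] ℝ).contDiff.contDiffAt
  have hPs := hcomp P h.eqs.smooth_P
  have hPi : ∀ y ∈ D, ContDiffAt ℝ ∞ (fun y => (P (s y))⁻¹) y := fun y hy =>
    (hPs y hy).inv (h.eqs.P_pos _ (hsW y hy)).ne'
  have hus : ∀ y ∈ D, ContDiffAt ℝ ∞ u y := fun y hy =>
    (((contDiffAt_const.mul (hcomp L hLs y hy)).add
      (contDiffAt_const.mul ((hcoord y).log (hz y hy)))).add contDiffAt_const)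
  have hVs : ∀ y ∈ D, ContDiffAt ℝ ∞ V y := fun y hy =>
    contDiffAt_const.mul ((hPi y hy).mul ((hcoord y).inv (hz y hy)))
  have homs : ∀ k, ∀ y ∈ D, ContDiffAt ℝ ∞ (om k) y := fun k y hy =>
    contDiffAt_const.mul ((hcoord y).mul ((hPi y hy).mul
      (hcomp _ (fun w hw => h.smooth_imComp hw k.castSucc) y hy)))
  -- first derivatives
  have hPl : ∀ y ∈ D, ∀ k : Fin 3, HasLineDerivAt ℝ (fun y => P (s y))
      (fderiv ℝ P (s y) (ev k.castSucc)) y (EuclideanSpace.single k 1) := fun y hy k =>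
    hld_sec ((h.eqs.smooth_P _ (hsW y hy)).differentiableAt (by simp)) k
  have hul : ∀ y ∈ D, ∀ k : Fin 3, HasLineDerivAt ℝ u
      (2 * (fderiv ℝ l (s y) (ev k.castSucc)).re + 4 * ((if 2 = k then 1 else 0) / y 2) + 0) y
      (EuclideanSpace.single k 1) := by
    intro y hy k
    have := hld_sec (τ := τ₀) ((hLs _ (hsW y hy)).differentiableAt (by simp)) k
    rw [hLd _ (hsW y hy)] at this
    exact hld_add (hld_add (hld_const_mul 2 this)
      (hld_const_mul 4 (hld_log (hld_coord 2 k y) (hz y hy)))) (hld_const _)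
  have hVl : ∀ y ∈ D, ∀ k : Fin 3, HasLineDerivAt ℝ V
      ((√2 * Λ)⁻¹ * (-fderiv ℝ P (s y) (ev k.castSucc) / P (s y) ^ 2 * (y 2)⁻¹
        + (P (s y))⁻¹ * (-(if 2 = k then 1 else 0) / y 2 ^ 2))) y (EuclideanSpace.single k 1) :=
    fun y hy k => hld_const_mul _ (hld_mul (hld_inv (hPl y hy k) (h.eqs.P_pos _ (hsW y hy)).ne')
      (hld_inv (hld_coord 2 k y) (hz y hy)))
  have homl : ∀ y ∈ D, ∀ k j : Fin 3, HasLineDerivAt ℝ (om j)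
      (-(Λ⁻¹) * ((if 2 = k then 1 else 0) * ((P (s y))⁻¹ * imComp n j.castSucc (s y))
        + y 2 * (-fderiv ℝ P (s y) (ev k.castSucc) / P (s y) ^ 2 * imComp n j.castSucc (s y)
          + (P (s y))⁻¹ * fderiv ℝ (imComp n j.castSucc) (s y) (ev k.castSucc)))) y
      (EuclideanSpace.single k 1) := fun y hy k j =>
    hld_const_mul _ (hld_mul (hld_coord 2 k y)
      (hld_mul (hld_inv (hPl y hy k) (h.eqs.P_pos _ (hsW y hy)).ne')
        (hld_sec ((h.smooth_imComp (hsW y hy) j.castSucc).differentiableAt (by simp)) k)))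
  have pdu := fun y hy k => pd_eq (hul y hy k) ((hus y hy).differentiableAt (by simp))
  have pdV := fun y hy k => pd_eq (hVl y hy k) ((hVs y hy).differentiableAt (by simp))
  have pdom := fun y hy k j => pd_eq (homl y hy k j) ((homs j y hy).differentiableAt (by simp))
  have pdexp : ∀ y ∈ D, ∀ k, pd k (fun y => Real.exp (u y)) y = Real.exp (u y) * pd k u y := by
    intro y hy k
    rw [pdu y hy k]
    exact pd_eq (hld_exp (hul y hy k)) (((hus y hy).exp).differentiableAt (by simp))
  have hNs : ∀ y ∈ D, N (s y) = √2 * Λ / y 2 := fun y hy => by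
    rw [h.N_eq _ (hsW y hy), hsz]
  -- The ∂_z equation for Re l gives u_z = 2/z - 2√2/(Pz²). Comparison with V shows at once that z
  -- u_z - 2 = -4ΛV.
  have hu2 : ∀ y ∈ D, pd 2 u y = 2 * (y 2)⁻¹ - 2 * √2 * ((P (s y))⁻¹ * ((y 2)⁻¹ * (y 2)⁻¹)) := by
    intro y hy
    rw [pdu y hy 2]
    have e := (h.dl hΛ (hsW y hy)).2.2.1
    change 2 * (fderiv ℝ l (s y) (ev 2)).re + _ + _ = _
    have hz' := hz y hy
    have hP := (h.eqs.P_pos _ (hsW y hy)).ne'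
    rw [e, hNs y hy, hsz, if_pos rfl]
    field_simp
    ring_nf
    linear_combination (2 * √2 + 2 * P (s y) * y 2) * h2
  refine ⟨u, V, om, ?_, ?_⟩
  · refine ⟨hD, fun y hy => (hus y hy).contDiffWithinAt, fun y hy => (hVs y hy).contDiffWithinAt,
      fun k y hy => (homs k y hy).contDiffWithinAt, hz, ?_, ?_, ?_, ?_, ?_, ?_⟩
    · intro y hy
      have hP := h.eqs.P_pos _ (hsW y hy)
      have hN := h.eqs.N_pos _ (hsW y hy)
      rw [hNs y hy] at hN
      -- Rewritten in this way, V = N/(2Λ²P), which is positive whatever the signs of Λ and z.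
      have e : V y = (√2 * Λ / y 2) / (2 * Λ ^ 2 * P (s y)) := by
        have hz' := hz y hy
        simp only [hV]
        field_simp
        linear_combination -h2
      rw [e]
      positivity
    · intro y hy
      have hGs : ∀ i : Fin 4, ∀ w ∈ box D τ₀ δ,
          ContDiffAt ℝ ∞ (fun w => (fderiv ℝ l w (ev i)).re) w := fun i w hw =>
        Complex.reCLM.contDiff.contDiffAt.comp w
          (((h.smooth_l w hw).fderiv_right (m := ∞) (by simp)).clm_apply contDiffAt_const)
      have hxx : ∀ k : Fin 3, k ≠ 2 → pd k (pd k u) y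
          = 2 * fderiv ℝ (fun w => (fderiv ℝ l w (ev k.castSucc)).re) (s y) (ev k.castSucc) := by
        intro k hk
        have e1 : pd k u =ᶠ[𝓝 y] fun y => 2 * (fderiv ℝ l (s y) (ev k.castSucc)).re := by
          filter_upwards [hD.mem_nhds hy] with y' hy'
          rw [pdu y' hy' k, if_neg hk.symm]
          ring
        have e2 : pd k (pd k u) y
            = pd k (fun y => 2 * (fderiv ℝ l (s y) (ev k.castSucc)).re) y := by
          unfold pd at e1 ⊢
          rw [e1.fderiv_eq]
        rw [e2]
        refine pd_eq (hld_const_mul 2 (hld_sec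
          ((hGs k.castSucc _ (hsW y hy)).differentiableAt (by simp)) k)) ?_
        exact (contDiffAt_const.mul (hcomp _ (hGs k.castSucc) y hy)).differentiableAt
          (n := ∞) (by simp)
      have e1 : (pd 2 fun y => Real.exp (u y)) =ᶠ[𝓝 y] fun y => Real.exp (u y)
          * (2 * (y 2)⁻¹ - 2 * √2 * ((P (s y))⁻¹ * ((y 2)⁻¹ * (y 2)⁻¹))) := by
        filter_upwards [hD.mem_nhds hy] with y' hy'
        rw [pdexp y' hy', hu2 y' hy']
      have e2 : pd 2 (pd 2 fun y => Real.exp (u y)) y = pd 2 (fun y => Real.exp (u y)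
          * (2 * (y 2)⁻¹ - 2 * √2 * ((P (s y))⁻¹ * ((y 2)⁻¹ * (y 2)⁻¹)))) y := by
        unfold pd at e1 ⊢
        rw [e1.fderiv_eq]
      have hzi := (hcoord y).inv (hz y hy)
      have hzl := hld_inv (hld_coord 2 2 y) (hz y hy)
      have e3 := pd_eq (hld_mul (hld_exp (hul y hy 2)) (hld_sub (hld_const_mul 2 hzl)
        (hld_const_mul (2 * √2) (hld_mul (hld_inv (hPl y hy 2) (h.eqs.P_pos _ (hsW y hy)).ne')
          (hld_mul hzl hzl)))))
        (((hus y hy).exp.mul ((contDiffAt_const.mul hzi).sub (contDiffAt_const.mul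
          ((hPi y hy).mul (hzi.mul hzi))))).differentiableAt (n := ∞) (by simp))
      obtain ⟨α₀, α₁, B, hsc⟩ := h.scalars hΛ (hsW y hy)
      obtain ⟨p0, p1, p2, -, f01, f12, f02, n01, n12, n02, -⟩ :=
        hsc _ _ _ _ _ _ rfl rfl rfl rfl rfl rfl
      have hlap := h.laplacian hΛ (hsW y hy)
      rw [n01, f01, p0, p1, hNs y hy] at hlap
      rw [e2, e3, ← pdu y hy 2, hu2 y hy, hexp y hy, hxx 0 (by decide), hxx 1 (by decide)]
      have hz' := hz y hy
      have hP := (h.eqs.P_pos _ (hsW y hy)).ne'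
      simp only [show (2 : Fin 3).castSucc = 2 from rfl, show (1 : Fin 3).castSucc = 1 from rfl,
        show (0 : Fin 3).castSucc = 0 from rfl]
      rw [← mul_add, hlap, p2, hsz]
      simp only [imComp, if_true]
      -- What is left is an identity of rational functions modulo √2² = 2. No relation among α₀, α₁,
      -- B and the components of n is used.
      generalize P (s y) = p at *
      generalize y 2 = z at *
      generalize (n (s y) (ev 0)).im = a1
      generalize (n (s y) (ev 1)).im = a2
      generalize Complex.normSq (f₀ * Complex.exp (l (s y))) = φ
      clear * - h2 h20 hz' hP hΛ
      field_simp
      ring_nf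
      grind
    · intro y hy
      have hz' := hz y hy
      have hP := (h.eqs.P_pos _ (hsW y hy)).ne'
      rw [hu2 y hy]
      simp only [hV]
      field_simp
      linear_combination (2 : ℝ) * h2
    · intro y hy
      obtain ⟨α₀, α₁, B, hsc⟩ := h.scalars hΛ (hsW y hy)
      obtain ⟨p0, p1, p2, -, f01, f12, f02, n01, n12, n02, -⟩ :=
        hsc _ _ _ _ _ _ rfl rfl rfl rfl rfl rfl
      rw [h.extd_im (hsW y hy), f12, hNs y hy, hsz] at n12
      rw [pdom y hy 1 2, pdom y hy 2 1, pdV y hy 0]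
      have hz' := hz y hy
      have hP := (h.eqs.P_pos _ (hsW y hy)).ne'
      simp only [Fin.isValue, Fin.reduceEq, if_false, if_true,
        show (2 : Fin 3).castSucc = 2 from rfl, show (1 : Fin 3).castSucc = 1 from rfl,
        show (0 : Fin 3).castSucc = 0 from rfl]
      rw [sub_eq_iff_eq_add.1 n12, p0, p1, p2, hsz]
      simp only [imComp]
      generalize P (s y) = p at *
      generalize y 2 = z at *
      generalize (n (s y) (ev 1)).im = a1
      generalize (n (s y) (ev 2)).im = a2
      clear * - h2 h20 hz' hP hΛ
      field_simp
      grind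
    · intro y hy
      obtain ⟨α₀, α₁, B, hsc⟩ := h.scalars hΛ (hsW y hy)
      obtain ⟨p0, p1, p2, -, f01, f12, f02, n01, n12, n02, -⟩ :=
        hsc _ _ _ _ _ _ rfl rfl rfl rfl rfl rfl
      rw [h.extd_im (hsW y hy), f02, hNs y hy, hsz] at n02
      rw [pdom y hy 0 2, pdom y hy 2 0, pdV y hy 1]
      have hz' := hz y hy
      have hP := (h.eqs.P_pos _ (hsW y hy)).ne'
      simp only [Fin.isValue, Fin.reduceEq, if_false, if_true, 
        show (2 : Fin 3).castSucc = 2 from rfl, show (1 : Fin 3).castSucc = 1 from rfl,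
        show (0 : Fin 3).castSucc = 0 from rfl]
      rw [sub_eq_iff_eq_add.1 n02, p0, p1, p2, hsz]
      simp only [imComp]
      generalize P (s y) = p at *
      generalize y 2 = z at *
      generalize (n (s y) (ev 0)).im = a1
      generalize (n (s y) (ev 2)).im = a2
      clear * - h2 h20 hz' hP hΛ
      field_simp
      grind
    · intro y hy
      obtain ⟨α₀, α₁, B, hsc⟩ := h.scalars hΛ (hsW y hy)
      obtain ⟨p0, p1, p2, -, f01, f12, f02, n01, n12, n02, -⟩ :=
        hsc _ _ _ _ _ _ rfl rfl rfl rfl rfl rfl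
      rw [h.extd_im (hsW y hy), f01, hNs y hy] at n01
      have hVe := pd_eq (hld_mul (hVl y hy 2) (hld_exp (hul y hy 2)))
        (((hVs y hy).mul (hus y hy).exp).differentiableAt (by simp))
      rw [← pdV y hy 2, ← pdu y hy 2, hu2 y hy, pdV y hy 2, hexp y hy] at hVe
      rw [hVe, pdom y hy 0 1, pdom y hy 1 0]
      have hz' := hz y hy
      have hP := (h.eqs.P_pos _ (hsW y hy)).ne'
      simp only [Fin.isValue, Fin.reduceEq, if_false, if_true, 
        show (2 : Fin 3).castSucc = 2 from rfl, show (1 : Fin 3).castSucc = 1 from rfl,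
        show (0 : Fin 3).castSucc = 0 from rfl]
      rw [sub_eq_iff_eq_add.1 n01, p0, p1, p2, hsz]
      simp only [imComp, hV]
      generalize P (s y) = p at *
      generalize y 2 = z at *
      generalize (n (s y) (ev 0)).im = a1
      generalize (n (s y) (ev 1)).im = a2
      generalize Complex.normSq (f₀ * Complex.exp (l (s y))) = φ
      clear * - h2 h20 hz' hP hΛ
      field_simp
      grind
  · intro w hw v
    have hw' := hw.1
    have hy2 : (proj w) 2 = w 2 := by simp [proj]
    set y := proj w with hy
    -- The functions u, V and ω were defined on the slice τ = τ₀. The metric agrees off the slice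
    -- because P, Re l and the relevant components of Im n have vanishing τ-derivative. The phase Im
    -- l does not enter |m|².
    have hPw : P w = P (s y) := eq_sec_of_fderiv_eq_zero hδ (fun w hw => by
      obtain ⟨α₀, α₁, B, hsc⟩ := h.scalars hΛ hw
      exact ⟨(h.eqs.smooth_P w hw).differentiableAt (by simp),
        (hsc _ _ _ _ _ _ rfl rfl rfl rfl rfl rfl).2.2.2.1⟩) hw
    have hLw : L w = L (s y) := eq_sec_of_fderiv_eq_zero hδ (fun w hw =>
      ⟨(hLs w hw).differentiableAt (by simp), by rw [hLd w hw, (h.dl hΛ hw).2.2.2]⟩) hw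
    have hνw : ∀ j : Fin 3, imComp n j.castSucc w = imComp n j.castSucc (s y) := fun j =>
      eq_sec_of_fderiv_eq_zero hδ (fun w hw =>
        ⟨(h.smooth_imComp hw j.castSucc).differentiableAt (by simp),
          h.fderiv_imComp_ev_three hΛ hw j⟩) hw
    have hφ : Complex.normSq (f₀ * Complex.exp (l w))
        = Complex.normSq (f₀ * Complex.exp (l (s y))) := by
      rw [map_mul, map_mul, Complex.normSq_eq_norm_sq (Complex.exp _),
        Complex.normSq_eq_norm_sq (Complex.exp _), Complex.norm_exp, Complex.norm_exp]
      have : (l w).re = (l (s y)).re := hLw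
      rw [this]
    have hm : Complex.normSq (m w v)
        = Complex.normSq (f₀ * Complex.exp (l (s y))) * (v 0 ^ 2 + v 1 ^ 2) := by
      rw [h.m_eq w hw, map_mul, hφ, Complex.normSq_add_mul_I]
    have hv : v = v 0 • ev 0 + v 1 • ev 1 + v 2 • ev 2 + v 3 • ev 3 := by
      ext i
      fin_cases i <;> simp
    have him : (n w v).im = v 0 * imComp n 0 (s y) + v 1 * imComp n 1 (s y)
        + v 2 * imComp n 2 (s y) + v 3 * (-(1 / √2) * (P (s y) * N w)) := by
      have h0 := hνw 0
      have h1 := hνw 1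
      have h2 := hνw 2
      simp only [show (2 : Fin 3).castSucc = 2 from rfl, show (1 : Fin 3).castSucc = 1 from rfl,
        show (0 : Fin 3).castSucc = 0 from rfl] at h0 h1 h2
      conv_lhs => rw [hv]
      rw [← h0, ← h1, ← h2, ← hPw, ← h.imComp_three hw]
      simp [imComp]
    rw [Complex.normSq_apply (n w v), hm, h.n_re hΛ hw, him, todaMetric, hexp y hw', hPw,
      h.N_eq w hw]
    have hz' := h.z_ne w hw
    have hP := (h.eqs.P_pos _ (hsW y hw')).ne'
    simp only [hV, hom, ← hy, hy2, show (2 : Fin 3).castSucc = 2 from rfl,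
      show (1 : Fin 3).castSucc = 1 from rfl, show (0 : Fin 3).castSucc = 0 from rfl]
    generalize P (s y) = p at *
    generalize w 2 = z at *
    generalize imComp n 0 (s y) = a0
    generalize imComp n 1 (s y) = a1
    generalize imComp n 2 (s y) = a2
    generalize Complex.normSq (f₀ * Complex.exp (l (s y))) = φ
    generalize v 0 = v0
    generalize v 1 = v1
    generalize v 2 = v2
    generalize v 3 = v3
    clear * - h2 h20 hz' hP hΛ
    field_simp
    grind

end SpinGeometry
end

/-! ### Existence of the coordinates (x, y, z, τ). -/

noncomputable section
namespace SpinGeometry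
open Set Filter Topology

section Inverse

variable {E F : Type*} [NormedAddCommGroup E] [NormedSpace ℝ E] [NormedAddCommGroup F]
  [NormedSpace ℝ F] {Φ : OpenPartialHomeomorph E F}

theorem fderiv_symm_fderiv {x : E} (hx : x ∈ Φ.source) (h : DifferentiableAt ℝ Φ x)
    (h' : DifferentiableAt ℝ Φ.symm (Φ x)) (v : E) :
    fderiv ℝ Φ.symm (Φ x) (fderiv ℝ Φ x v) = v := by
  have h1 : HasFDerivAt (fun y => Φ.symm (Φ y)) _ x := h'.hasFDerivAt.comp x h.hasFDerivAt
  have h2 : HasFDerivAt (fun y => Φ.symm (Φ y)) (ContinuousLinearMap.id ℝ E) x := by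
    refine (hasFDerivAt_id x).congr_of_eventuallyEq ?_
    filter_upwards [Φ.open_source.mem_nhds hx] with y hy using Φ.left_inv hy
  exact congrArg (fun S => S v) (h1.unique h2)

theorem fderiv_fderiv_symm {w : F} (hw : w ∈ Φ.target) (h : DifferentiableAt ℝ Φ (Φ.symm w))
    (h' : DifferentiableAt ℝ Φ.symm w) (v : F) :
    fderiv ℝ Φ (Φ.symm w) (fderiv ℝ Φ.symm w v) = v := by
  have h1 : HasFDerivAt (fun y => Φ (Φ.symm y)) _ w := h.hasFDerivAt.comp w h'.hasFDerivAt
  have h2 : HasFDerivAt (fun y => Φ (Φ.symm y)) (ContinuousLinearMap.id ℝ F) w := by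
    refine (hasFDerivAt_id w).congr_of_eventuallyEq ?_
    filter_upwards [Φ.open_target.mem_nhds hw] with y hy using Φ.right_inv hy
  exact congrArg (fun S => S v) (h1.unique h2)

end Inverse

theorem exists_box_subset {S : Set E4} {w₀ : E4} (hS : S ∈ 𝓝 w₀) :
    ∃ δ > 0, box (Metric.ball (proj w₀) δ) (w₀ 3) δ ⊆ S := by
  have hc : ContinuousAt (fun q : E3 × ℝ => sec q.2 q.1) (proj w₀, w₀ 3) := by
    have : Continuous (fun q : E3 × ℝ => sec q.2 q.1) := by
      unfold sec
      refine (PiLp.continuous_toLp 2 _).comp ?_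
      refine continuous_pi fun i => ?_
      fin_cases i <;> simp <;> fun_prop
    exact this.continuousAt
  have h2 := hc.preimage_mem_nhds (t := S) (by rw [sec_proj]; exact hS)
  obtain ⟨δ, hδ, hb⟩ := Metric.mem_nhds_iff.1 h2
  refine ⟨δ, hδ, fun w hw => ?_⟩
  have h3 : ((proj w, w 3) : E3 × ℝ) ∈ Metric.ball (proj w₀, w₀ 3) δ := by
    rw [Metric.mem_ball, Prod.dist_eq]
    exact max_lt hw.1 hw.2
  have h4 := hb h3
  simp only [mem_preimage, sec_proj] at h4
  exact h4

theorem isOpen_box {D : Set E3} (hD : IsOpen D) (τ₀ δ : ℝ) : IsOpen (box D τ₀ δ) := by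
  refine (hD.preimage contDiff_proj.continuous).inter (Metric.isOpen_ball.preimage ?_)
  exact (EuclideanSpace.proj 3 : E4 →L[ℝ] ℝ).continuous

variable {Λ : ℝ} {Ω : Set E4} {m n : E4 → E4 →L[ℝ] ℂ} {A : E4 → E4 →L[ℝ] ℝ}
    {P N : E4 → ℝ} {k : E4 → E4} {p : E4}

/-- Linear coordinates adapted to the coframe at a point. -/
theorem exists_adapted_frame {m₀ n₀ : E4 →L[ℝ] ℂ} {κ : ℝ} (hκ : κ ≠ 0) {k₀ : E4} (hm : m₀ k₀ = 0)
    (hn : n₀ k₀ = -Complex.I * κ) (hinj : ∀ v, m₀ v = 0 → n₀ v = 0 → v = 0) :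
    ∃ T : ((ℂ × ℝ) × ℝ) ≃L[ℝ] E4, T (0, 1) = k₀ ∧ ∀ q, m₀ (T q) = q.1.1 := by
  -- The coordinates of v are m(v), Re n(v) and -Im n(v)/κ. Their common kernel is trivial by
  -- hypothesis, and they send k₀ to the last basis vector.
  set S : E4 →ₗ[ℝ] (ℂ × ℝ) × ℝ :=
    ((m₀ : E4 →ₗ[ℝ] ℂ).prod (Complex.reLm.comp (n₀ : E4 →ₗ[ℝ] ℂ))).prod
      ((-κ⁻¹) • Complex.imLm.comp (n₀ : E4 →ₗ[ℝ] ℂ)) with hS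
  have hSa : ∀ v, S v = ((m₀ v, (n₀ v).re), -κ⁻¹ * (n₀ v).im) := fun v => rfl
  have hi : Function.Injective S := by
    rw [← LinearMap.ker_eq_bot, LinearMap.ker_eq_bot']
    intro v hv
    rw [hSa, Prod.mk_eq_zero, Prod.mk_eq_zero] at hv
    refine hinj v hv.1.1 (Complex.ext hv.1.2 ?_)
    have := hv.2
    simpa [hκ] using this
  have hdim : Module.finrank ℝ E4 = Module.finrank ℝ ((ℂ × ℝ) × ℝ) := by
    simp
  set T := (LinearMap.linearEquivOfInjective S hi hdim).toContinuousLinearEquiv.symm with hT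
  have hST : ∀ q, S (T q) = q := fun q =>
    (LinearMap.linearEquivOfInjective S hi hdim).toContinuousLinearEquiv.apply_symm_apply q
  refine ⟨T, hi ?_, fun q => ?_⟩
  · rw [hST, hSa, hm, hn]
    ext <;> simp [hκ]
  · have := hST q
    rw [hSa] at this
    exact congrArg (fun q => q.1.1) this

theorem StructEqs.continuousAt_connForm (h : StructEqs Λ Ω m n A P N) {x : E4} (hx : x ∈ Ω) :
    ContinuousAt (connForm Λ n A P N) x := by
  have hA := (h.smooth_A x hx).continuousAt
  have hn := (h.smooth_n x hx).continuousAt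
  have hP := (h.smooth_P x hx).continuousAt
  have hN := (h.smooth_N x hx).continuousAt
  have hP2 : ContinuousAt (fun x => 2 / P x) x := continuousAt_const.div hP (h.P_pos x hx).ne'
  have hN2 : ContinuousAt (fun x => 2 * Λ / N x) x :=
    continuousAt_const.div hN (h.N_pos x hx).ne'
  have c1 : ContinuousAt (fun x => Complex.ofRealCLM.comp (A x)) x :=
    ContinuousAt.comp (f := A) (g := fun L : E4 →L[ℝ] ℝ => Complex.ofRealCLM.comp L)
      (ContinuousLinearMap.compL ℝ E4 ℝ ℂ Complex.ofRealCLM).continuous.continuousAt hA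
  have c2 : ContinuousAt (fun x => (Complex.conjCLE : ℂ →L[ℝ] ℂ).comp (n x)) x :=
    ContinuousAt.comp (f := n) (g := fun L : E4 →L[ℝ] ℂ => (Complex.conjCLE : ℂ →L[ℝ] ℂ).comp L)
      (ContinuousLinearMap.compL ℝ E4 ℂ ℂ (Complex.conjCLE : ℂ →L[ℝ] ℂ)).continuous.continuousAt hn
  exact ((c1.const_smul (-2 * Complex.I)).sub (hP2.smul c2)).sub (hN2.smul hn)

/-- The coordinates `(x, y, z, τ)`. -/
theorem StructEqs.exists_coordinates (h : StructEqs Λ Ω m n A P N) (hΛ : Λ ≠ 0) (hΩ : IsOpen Ω)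
    (hk : ∀ x ∈ Ω, ContDiffAt ℝ ∞ k x) (hmk : ∀ x ∈ Ω, m x (k x) = 0)
    (hnk : ∀ x ∈ Ω, n x (k x) = -Complex.I * ((P x * N x : ℝ) : ℂ))
    (hinj : ∀ x ∈ Ω, ∀ v, m x v = 0 → n x v = 0 → v = 0) (hp : p ∈ Ω) :
    ∃ Φ : OpenPartialHomeomorph E4 E4, p ∈ Φ.source ∧ Φ.source ⊆ Ω ∧
      (∀ x ∈ Φ.source, ContDiffAt ℝ ∞ Φ x) ∧ (∀ w ∈ Φ.target, ContDiffAt ℝ ∞ Φ.symm w) ∧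
      ∀ x ∈ Φ.source, fderiv ℝ Φ x (k x) = EuclideanSpace.single 3 √2 ∧
        (Φ x) 2 = √2 * Λ / N x ∧
        ∃ c : ℂ, c ≠ 0 ∧ ∀ v, m x v = c * ((fderiv ℝ Φ x v) 0 + (fderiv ℝ Φ x v) 1 * Complex.I) := by
  have h20 : (√2 : ℝ) ≠ 0 := by positivity
  have hκ : P p * N p ≠ 0 := (mul_pos (h.P_pos p hp) (h.N_pos p hp)).ne'
  obtain ⟨T, hT, hmT⟩ := exists_adapted_frame hκ (hmk p hp) (hnk p hp) (hinj p hp)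
  have hΩn : ∀ᶠ x in 𝓝 p, x ∈ Ω := hΩ.mem_nhds hp
  obtain ⟨ζ, hζ⟩ := exists_integrating_factor (m := m) (η := connForm Λ n A P N) (X := k) T hT hmT
    (by filter_upwards [hΩn] with x hx using
      ⟨h.smooth_m x hx, h.continuousAt_connForm hx, h.dm x hx⟩)
    (by filter_upwards [hΩn] with x hx using ⟨hk x hx, hmk x hx⟩)
  obtain ⟨Ψ, h0s, htΩ, hΨ, hΨs, hflow, hslice⟩ := exists_straightening hΩ
    (fun x hx => (hk x hx).contDiffWithinAt) hp T hT
  have hp0 : Ψ (0, 0) = p := by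
    rw [hslice 0 h0s]
    have h00 : ((0 : ℂ × ℝ), (0 : ℝ)) = 0 := rfl
    rw [h00, map_zero, add_zero]
  have hpt : p ∈ Ψ.target := by rw [← hp0]; exact Ψ.map_source h0s
  have hΨt : ∀ᶠ x in 𝓝 p, x ∈ Ψ.target := Ψ.open_target.mem_nhds hpt
  obtain ⟨U, hUsub, hU, hpU⟩ := eventually_nhds_iff.1 ((hζ.and hΩn).and hΨt)
  -- The factor √2 gives dτ(K) = √2, hence K = √2 ∂_τ.
  set τ : E4 → ℝ := fun x => √2 * (Ψ.symm x).2 with hτ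
  have hΨsat : ∀ x ∈ Ψ.target, ContDiffAt ℝ ∞ Ψ.symm x := fun x hx =>
    hΨs.contDiffAt (Ψ.open_target.mem_nhds hx)
  have hτs : ∀ x ∈ U, ContDiffAt ℝ ∞ τ x := fun x hx =>
    contDiffAt_const.mul (contDiff_snd.contDiffAt.comp x (hΨsat x (hUsub x hx).2))
  have hτk : ∀ x ∈ U, fderiv ℝ τ x (k x) = √2 := by
    intro x hx
    have hxt := (hUsub x hx).2
    have hqs := Ψ.map_target hxt
    have e1 := ((hΨsat x hxt).differentiableAt (by simp)).hasFDerivAt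
    have e2 : HasFDerivAt τ _ x := e1.snd.const_mul √2
    have e3 := fderiv_symm_fderiv hqs
      ((hΨ.contDiffAt (Ψ.open_source.mem_nhds hqs)).differentiableAt (by simp))
      (by rw [Ψ.right_inv hxt]; exact (hΨsat x hxt).differentiableAt (by simp)) (0, 1)
    rw [hflow _ hqs, Ψ.right_inv hxt] at e3
    rw [e2.fderiv]
    simp [e3]
  set z : E4 → ℝ := fun x => √2 * Λ * (N x)⁻¹ with hz
  have hzs : ∀ x ∈ U, ContDiffAt ℝ ∞ z x := fun x hx =>
    contDiffAt_const.mul ((h.smooth_N x (hUsub x hx).1.2).inv (h.N_pos x (hUsub x hx).1.2).ne')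
  have hzd : ∀ x ∈ U, ∀ v, fderiv ℝ z x v = √2 * Λ * (-(2 * Λ * (n x v).re) / N x ^ 2) := by
    intro x hx v
    have hxΩ := (hUsub x hx).1.2
    have e1 := hld_const_mul (√2 * Λ) (hld_inv (hld_fderiv
      ((h.smooth_N x hxΩ).differentiableAt (by simp)) v) (h.N_pos x hxΩ).ne')
    rw [h.dN x hxΩ] at e1
    exact (hld_fderiv ((hzs x hx).differentiableAt (by simp)) v).unique e1
  have hζs : ∀ x ∈ U, ContDiffAt ℝ ∞ ζ x := fun x hx => (hUsub x hx).1.1.1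
  set G : E4 → E4 := fun x => !₂[(ζ x).re, (ζ x).im, z x, τ x] with hG
  have hGs : ∀ x ∈ U, ContDiffAt ℝ ∞ G x := by
    intro x hx
    rw [contDiffAt_euclidean]
    intro i
    fin_cases i
    · exact Complex.reCLM.contDiff.contDiffAt.comp x (hζs x hx)
    · exact Complex.imCLM.contDiff.contDiffAt.comp x (hζs x hx)
    · exact hzs x hx
    · exact hτs x hx
  have hGd : ∀ x ∈ U, ∀ v, fderiv ℝ G x v
      = !₂[(fderiv ℝ ζ x v).re, (fderiv ℝ ζ x v).im, fderiv ℝ z x v, fderiv ℝ τ x v] := by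
    intro x hx v
    have e0 := ((hζs x hx).differentiableAt (by simp)).hasFDerivAt
    have e : ∀ i : Fin 4, (fderiv ℝ G x v) i = fderiv ℝ (fun x => G x i) x v := by
      intro i
      have e1 := ((hGs x hx).differentiableAt (by simp)).hasFDerivAt
      have e2 : HasFDerivAt (fun x => G x i) _ x :=
        (EuclideanSpace.proj i : E4 →L[ℝ] ℝ).hasFDerivAt.comp x e1
      rw [e2.fderiv]
      simp
    have er : HasFDerivAt (fun x => (ζ x).re) _ x := Complex.reCLM.hasFDerivAt.comp x e0
    have ei : HasFDerivAt (fun x => (ζ x).im) _ x := Complex.imCLM.hasFDerivAt.comp x e0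
    ext i
    rw [e]
    fin_cases i
    · change fderiv ℝ (fun x => (ζ x).re) x v = (fderiv ℝ ζ x v).re
      rw [er.fderiv]; simp
    · change fderiv ℝ (fun x => (ζ x).im) x v = (fderiv ℝ ζ x v).im
      rw [ei.fderiv]; simp
    · rfl
    · rfl
  have hGk : ∀ x ∈ U, fderiv ℝ G x (k x) = EuclideanSpace.single 3 √2 := by
    intro x hx
    have hxΩ := (hUsub x hx).1.2
    obtain ⟨c, hc, hcm⟩ := (hUsub x hx).1.1.2
    have e1 : fderiv ℝ ζ x (k x) = 0 := by
      have := hcm (k x)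
      rw [hmk x hxΩ] at this
      exact (mul_eq_zero.1 this.symm).resolve_left hc
    rw [hGd x hx, e1, hzd x hx, hτk x hx, hnk x hxΩ]
    ext i
    fin_cases i <;> simp
  -- A vector killed by dx, dy and dz has m(v) = 0 and Re n(v) = 0. Subtracting a suitable multiple
  -- of K also kills Im n, so v is a multiple of K, and dτ(v) = 0 makes that multiple zero.
  have hGinj : Function.Injective (fderiv ℝ G p : E4 →ₗ[ℝ] E4) := by
    rw [← LinearMap.ker_eq_bot, LinearMap.ker_eq_bot']
    intro v hv
    obtain ⟨c, hc, hcm⟩ := (hUsub p hpU).1.1.2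
    change fderiv ℝ G p v = 0 at hv
    rw [hGd p hpU] at hv
    have c0 := congrArg (fun w : E4 => w 0) hv
    have c1 := congrArg (fun w : E4 => w 1) hv
    have c2 := congrArg (fun w : E4 => w 2) hv
    have c3 := congrArg (fun w : E4 => w 3) hv
    simp at c0 c1 c2 c3
    have e1 : m p v = 0 := by
      rw [hcm, Complex.ext (z := fderiv ℝ ζ p v) (w := 0) c0 c1, mul_zero]
    have e2 : (n p v).re = 0 := by
      rw [hzd p hpU] at c2
      have := (h.N_pos p hp).ne'
      simpa [hΛ, this] using c2
    set r := -(n p v).im / (P p * N p) with hr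
    have e3 : v - r • k p = 0 := by
      refine hinj p hp _ ?_ ?_
      · rw [map_sub, map_smul, e1, hmk p hp, smul_zero, sub_zero]
      · rw [map_sub, map_smul, hnk p hp]
        have hP := (h.P_pos p hp).ne'
        have hN := (h.N_pos p hp).ne'
        have e5 : ∀ r κ : ℝ, (r • (-Complex.I * (κ : ℂ))).re = 0 ∧
            (r • (-Complex.I * (κ : ℂ))).im = -(r * κ) := fun r κ => by constructor <;> simp
        apply Complex.ext
        · rw [Complex.sub_re, e2, (e5 _ _).1, sub_zero, Complex.zero_re]
        · rw [Complex.sub_im, (e5 _ _).2, hr, Complex.zero_im]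
          field_simp
          ring
    have e4 : v = r • k p := sub_eq_zero.1 e3
    rw [e4, map_smul, hτk p hpU] at c3
    have : r = 0 := by simpa [h20] using c3
    rw [e4, this, zero_smul]
  set G' := (LinearMap.linearEquivOfInjective _ hGinj rfl).toContinuousLinearEquiv with hG'
  have hGG' : HasFDerivAt G (G' : E4 →L[ℝ] E4) p := by
    have := ((hGs p hpU).differentiableAt (by simp)).hasFDerivAt
    have e : (G' : E4 →L[ℝ] E4) = fderiv ℝ G p := by ext v : 1; rfl
    rw [e]
    exact this
  obtain ⟨Φ, hpΦ, hΦU, hΦG, hΦs, -⟩ := exists_smooth_local_inverse hU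
    (fun x hx => (hGs x hx).contDiffWithinAt) hpU G' hGG'
  have hΦe : (Φ : E4 → E4) = G := funext hΦG
  refine ⟨Φ, hpΦ, fun x hx => (hUsub x (hΦU hx)).1.2, fun x hx => by rw [hΦe]; exact hGs x (hΦU hx),
    fun w hw => hΦs.contDiffAt (Φ.open_target.mem_nhds hw), fun x hx => ?_⟩
  have hxU := hΦU hx
  rw [hΦe]
  refine ⟨hGk x hxU, ?_, ?_⟩
  · simp [hG, hz, div_eq_mul_inv]
  · obtain ⟨c, hc, hcm⟩ := (hUsub x hxU).1.1.2
    refine ⟨c, hc, fun v => ?_⟩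
    rw [hcm, hGd x hxU]
    simp

end SpinGeometry
end

/-! ### From the structure equations to the Toda normal form. -/

noncomputable section
namespace SpinGeometry
open Set Filter Topology

variable {Λ : ℝ} {Ω : Set E4} {m n : E4 → E4 →L[ℝ] ℂ} {A : E4 → E4 →L[ℝ] ℝ}
    {P N : E4 → ℝ} {k : E4 → E4} {p : E4}

/-- Toda normal form of the metric of a coframe solving the structure equations. -/
theorem StructEqs.exists_toda (h : StructEqs Λ Ω m n A P N) (hΛ : Λ ≠ 0) (hΩ : IsOpen Ω)
    (hk : ∀ x ∈ Ω, ContDiffAt ℝ ∞ k x) (hmk : ∀ x ∈ Ω, m x (k x) = 0)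
    (hnk : ∀ x ∈ Ω, n x (k x) = -Complex.I * ((P x * N x : ℝ) : ℂ))
    (hinj : ∀ x ∈ Ω, ∀ v, m x v = 0 → n x v = 0 → v = 0) (hp : p ∈ Ω) :
    ∃ (Φ : OpenPartialHomeomorph E4 E4) (D : Set E3) (u V : E3 → ℝ) (om : Fin 3 → E3 → ℝ),
      p ∈ Φ.source ∧ Φ.source ⊆ Ω ∧
      (∀ x ∈ Φ.source, ContDiffAt ℝ ∞ Φ x) ∧ (∀ w ∈ Φ.target, ContDiffAt ℝ ∞ Φ.symm w) ∧
      IsTodaData Λ D u V om ∧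
      ∀ x ∈ Φ.source, proj (Φ x) ∈ D ∧
        (∀ v, 2 / (P x * N x) * (Complex.normSq (m x v) + Complex.normSq (n x v))
          = todaMetric u V om (Φ x) (fderiv ℝ Φ x v)) ∧
        fderiv ℝ Φ x (k x) = EuclideanSpace.single 3 √2 := by
  have h2 : √2 * √2 = (2 : ℝ) := Real.mul_self_sqrt (by norm_num)
  have h20 : (√2 : ℝ) ≠ 0 := by positivity
  obtain ⟨Φ, hpΦ, hΦΩ, hΦs, hΦs', hΦ⟩ := h.exists_coordinates hΛ hΩ hk hmk hnk hinj hp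
  have hd : ∀ w ∈ Φ.target, ∀ v, fderiv ℝ Φ (Φ.symm w) (fderiv ℝ Φ.symm w v) = v := fun w hw v =>
    fderiv_fderiv_symm hw ((hΦs _ (Φ.map_target hw)).differentiableAt (by simp))
      ((hΦs' w hw).differentiableAt (by simp)) v
  have hd' : ∀ x ∈ Φ.source, ∀ v, fderiv ℝ Φ.symm (Φ x) (fderiv ℝ Φ x v) = v := fun x hx v =>
    fderiv_symm_fderiv hx ((hΦs x hx).differentiableAt (by simp))
      ((hΦs' _ (Φ.map_source hx)).differentiableAt (by simp)) v
  have hpull := h.pull (Ψ := Φ.symm) (W := Φ.target) hΦs' (fun w hw => hΦΩ (Φ.map_target hw))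
  set M := SpinGeometry.pull Φ.symm m with hM
  set f : E4 → ℂ := fun w => M w (ev 0) with hf
  have hMf : ∀ w ∈ Φ.target, f w ≠ 0 ∧ ∀ v : E4, M w v = f w * (v 0 + v 1 * Complex.I) := by
    intro w hw
    obtain ⟨-, -, c, hc, hcm⟩ := hΦ _ (Φ.map_target hw)
    have e : ∀ v : E4, M w v = c * (v 0 + v 1 * Complex.I) := fun v => by
      rw [hM, pull_apply, hcm, hd w hw]
    have e0 : f w = c := by
      simp only [hf]
      rw [e]
      simp
    rw [e0]
    exact ⟨hc, e⟩
  have hfs : ∀ w ∈ Φ.target, ContDiffAt ℝ ∞ f w := fun w hw =>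
    (hpull.smooth_m w hw).clm_apply contDiffAt_const
  set w₀ := Φ p with hw₀
  have hw₀t : w₀ ∈ Φ.target := Φ.map_source hpΦ
  have hf₀ := (hMf w₀ hw₀t).1
  -- Near the base point f/f(w₀) is close to 1, so the principal logarithm is smooth there and f =
  -- f(w₀) e^l.
  have hslit : ∀ᶠ w in 𝓝 w₀, f w / f w₀ ∈ Complex.slitPlane := by
    have hc : ContinuousAt (fun w => f w / f w₀) w₀ := (hfs w₀ hw₀t).continuousAt.div_const _
    refine hc.eventually_mem (Complex.isOpen_slitPlane.mem_nhds ?_)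
    rw [div_self hf₀]
    exact Complex.one_mem_slitPlane
  have htn : ∀ᶠ w in 𝓝 w₀, w ∈ Φ.target := Φ.open_target.mem_nhds hw₀t
  obtain ⟨δ, hδ, hbox⟩ := exists_box_subset (htn.and hslit)
  set D := Metric.ball (proj w₀) δ with hD
  set l : E4 → ℂ := fun w => Complex.log (f w / f w₀) with hl
  have hnf : NormalForm Λ (box D (w₀ 3) δ) M (SpinGeometry.pull Φ.symm n) (SpinGeometry.pull Φ.symm A)
      (fun w => P (Φ.symm w)) (fun w => N (Φ.symm w)) (f w₀) l := by
    refine ⟨hpull.mono fun w hw => (hbox hw).1, isOpen_box Metric.isOpen_ball _ _, hf₀, ?_, ?_, ?_,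
      ?_, ?_⟩
    · intro w hw
      have e1 : ContDiffAt ℝ ∞ (fun w => f w / f w₀) w := (hfs w (hbox hw).1).div_const _
      exact ContDiffAt.comp w ((Complex.contDiffAt_log (hbox hw).2).restrict_scalars ℝ) e1
    · intro w hw v
      obtain ⟨h1, h2⟩ := hMf w (hbox hw).1
      rw [h2, hl]
      simp only
      rw [Complex.exp_log (div_ne_zero h1 hf₀), mul_div_cancel₀ _ hf₀]
    · intro w hw
      have e := (hΦ _ (Φ.map_target (hbox hw).1)).2.1
      rw [Φ.right_inv (hbox hw).1] at e
      rw [e]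
      have := (h.N_pos _ (hΦΩ (Φ.map_target (hbox hw).1))).ne'
      positivity
    · intro w hw
      have e := (hΦ _ (Φ.map_target (hbox hw).1)).2.1
      rw [Φ.right_inv (hbox hw).1] at e
      rw [e]
      have := (h.N_pos _ (hΦΩ (Φ.map_target (hbox hw).1))).ne'
      field_simp
    · intro w hw
      have hwt := (hbox hw).1
      have hx := Φ.map_target hwt
      have e := (hΦ _ hx).1
      have e1 := hd' _ hx (k (Φ.symm w))
      rw [e, Φ.right_inv hwt] at e1
      have e2 : (EuclideanSpace.single 3 √2 : E4) = √2 • ev 3 := by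
        ext i
        fin_cases i <;> simp
      rw [e2, map_smul] at e1
      have e3 := hnk _ (hΦΩ hx)
      rw [← e1, map_smul] at e3
      rw [pull_apply]
      have h20' : (√2 : ℂ) ≠ 0 := by exact_mod_cast h20
      rw [Complex.real_smul] at e3
      apply mul_left_cancel₀ h20'
      rw [e3]
      push_cast
      field_simp
  obtain ⟨u, V, om, hT, hmet⟩ := hnf.exists_todaData Metric.isOpen_ball hδ hΛ
  have hopen : IsOpen (Φ.source ∩ Φ ⁻¹' box D (w₀ 3) δ) :=
    Φ.isOpen_inter_preimage (isOpen_box Metric.isOpen_ball _ _)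
  set Φ' := Φ.restrOpen _ hopen with hΦ'
  have hsrc : ∀ x ∈ Φ'.source, x ∈ Φ.source ∧ Φ x ∈ box D (w₀ 3) δ := by
    intro x hx
    rw [hΦ', Φ.restrOpen_source] at hx
    exact hx.2
  refine ⟨Φ', D, u, V, om, ?_, fun x hx => hΦΩ (hsrc x hx).1, fun x hx => hΦs x (hsrc x hx).1, ?_,
    hT, ?_⟩
  · rw [hΦ', Φ.restrOpen_source]
    exact ⟨hpΦ, hpΦ, Metric.mem_ball_self hδ, Metric.mem_ball_self hδ⟩
  · intro w hw
    refine hΦs' w ?_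
    have h1 := (hsrc _ (Φ'.map_target hw)).1
    have h3 := Φ.map_source h1
    have h4 : Φ (Φ'.symm w) = w := Φ'.right_inv hw
    rwa [h4] at h3
  · intro x hx
    obtain ⟨h1, h3⟩ := hsrc x hx
    refine ⟨h3.1, fun v => ?_, (hΦ x h1).1⟩
    have e := hmet (Φ x) h3 (fderiv ℝ Φ x v)
    rw [hM, pull_apply, pull_apply, hd' x h1, Φ.left_inv h1] at e
    exact e

end SpinGeometry
end

noncomputable section
namespace SpinGeometry
open Set Filter Topology

/-! ### Spinor algebra -/

theorem inv_sqrt_two_mul_self : ((√2 : ℝ) : ℂ)⁻¹ * ((√2 : ℝ) : ℂ)⁻¹ = 1 / 2 := by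
  have h : (√2 : ℝ) * √2 = 2 := Real.mul_self_sqrt (by norm_num)
  have h' : ((√2 : ℝ) : ℂ) * ((√2 : ℝ) : ℂ) = 2 := by exact_mod_cast h
  rw [← mul_inv, h']
  norm_num

theorem conj_inv_sqrt_two : (starRingEnd ℂ) (((√2 : ℝ) : ℂ)⁻¹) = ((√2 : ℝ) : ℂ)⁻¹ := by
  rw [map_inv₀, Complex.conj_ofReal]

theorem sigma_conj (a : Fin 4) :
    (starRingEnd ℂ) (sigma a 0 0) = sigma a 1 1 ∧ (starRingEnd ℂ) (sigma a 0 1) = -sigma a 1 0 ∧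
    (starRingEnd ℂ) (sigma a 1 0) = -sigma a 0 1 ∧ (starRingEnd ℂ) (sigma a 1 1) = sigma a 0 0 := by
  fin_cases a <;> simp [sigma]

theorem sigma_complete (A A' P P' : Fin 2) :
    ∑ b, sigma b A A' * (starRingEnd ℂ) (sigma b P P')
      = (if A = P then 1 else 0) * (if A' = P' then 1 else 0) := by
  have h := inv_sqrt_two_mul_self
  have hI := Complex.I_mul_I
  rw [Fin.sum_univ_four]
  fin_cases A <;> fin_cases A' <;> fin_cases P <;> fin_cases P' <;>
    simp [sigma] <;> grind

theorem sigma_orthonormal (a b : Fin 4) :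
    ∑ P, ∑ P', (starRingEnd ℂ) (sigma a P P') * sigma b P P' = if a = b then 1 else 0 := by
  have h := inv_sqrt_two_mul_self
  have hI := Complex.I_mul_I
  simp only [Fin.sum_univ_two]
  fin_cases a <;> fin_cases b <;> simp [sigma] <;> grind

/-- A spinor-index contraction of a complex covector. -/
def spinContr (X : Fin 4 → ℂ) (P P' : Fin 2) : ℂ := ∑ a, sigma a P P' * X a

/-- The components of the covector with given spinor components. -/
def vecOf (X : Fin 2 → Fin 2 → ℂ) (a : Fin 4) : ℂ :=
  ∑ P, ∑ P', (starRingEnd ℂ) (sigma a P P') * X P P'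

theorem spinContr_vecOf (X : Fin 2 → Fin 2 → ℂ) (P P' : Fin 2) : spinContr (vecOf X) P P' = X P P' := by
  unfold spinContr vecOf
  have h := sigma_complete P P'
  simp only [Fin.sum_univ_two, Fin.sum_univ_four] at h ⊢
  have h00 := h 0 0
  have h01 := h 0 1
  have h10 := h 1 0
  have h11 := h 1 1
  fin_cases P <;> fin_cases P' <;> simp at h00 h01 h10 h11 ⊢ <;>
    linear_combination X 0 0 * h00 + X 0 1 * h01 + X 1 0 * h10 + X 1 1 * h11

theorem vecOf_spinContr (X : Fin 4 → ℂ) : vecOf (spinContr X) = X := by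
  funext a
  unfold spinContr vecOf
  have h := sigma_orthonormal a
  simp only [Fin.sum_univ_two, Fin.sum_univ_four] at h ⊢
  have h0 := h 0
  have h1 := h 1
  have h2 := h 2
  have h3 := h 3
  fin_cases a <;> simp at h0 h1 h2 h3 ⊢ <;>
    linear_combination X 0 * h0 + X 1 * h1 + X 2 * h2 + X 3 * h3

/-- The soldering matrices form a unitary change of basis between covector components and pairs of
spinor indices. Tensor identities can therefore be verified on spinor components, where the Killing
spinor equations are polynomial. -/
theorem ext_spinContr {X Y : Fin 4 → ℂ} (h : ∀ P P', spinContr X P P' = spinContr Y P P') :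
    X = Y := by
  have : spinContr X = spinContr Y := by
    funext P P'
    exact h P P'
  rw [← vecOf_spinContr X, this, vecOf_spinContr]

/-- Contraction of a tensor with two indices. -/
def spinContr₂ (X : Fin 4 → Fin 4 → ℂ) (P P' Q Q' : Fin 2) : ℂ :=
  spinContr (fun a => spinContr (X a) Q Q') P P'

theorem ext_spinContr₂ {X Y : Fin 4 → Fin 4 → ℂ}
    (h : ∀ P P' Q Q', spinContr₂ X P P' Q Q' = spinContr₂ Y P P' Q Q') : X = Y := by
  funext a
  refine ext_spinContr fun Q Q' => ?_
  exact congrFun (ext_spinContr (X := fun a => spinContr (X a) Q Q')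
    (Y := fun a => spinContr (Y a) Q Q') fun P P' => h P P' Q Q') a

theorem spinContr_add (X Y : Fin 4 → ℂ) (P P' : Fin 2) :
    spinContr (fun a => X a + Y a) P P' = spinContr X P P' + spinContr Y P P' := by
  simp only [spinContr, mul_add, Finset.sum_add_distrib]

theorem spinContr_sub (X Y : Fin 4 → ℂ) (P P' : Fin 2) :
    spinContr (fun a => X a - Y a) P P' = spinContr X P P' - spinContr Y P P' := by
  simp only [spinContr, mul_sub, Finset.sum_sub_distrib]

theorem spinContr_mul (c : ℂ) (X : Fin 4 → ℂ) (P P' : Fin 2) :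
    spinContr (fun a => c * X a) P P' = c * spinContr X P P' := by
  simp only [spinContr, Finset.mul_sum]
  refine Finset.sum_congr rfl fun a _ => ?_
  ring

theorem spinContr_mul_right (c : ℂ) (X : Fin 4 → ℂ) (P P' : Fin 2) :
    spinContr (fun a => X a * c) P P' = spinContr X P P' * c := by
  simp only [mul_comm _ c]
  exact spinContr_mul c X P P'

/-- The spinor components of the conjugate of a covector. -/
theorem spinContr_conj (X : Fin 4 → ℂ) :
    spinContr (fun a => (starRingEnd ℂ) (X a)) 0 0 = (starRingEnd ℂ) (spinContr X 1 1) ∧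
    spinContr (fun a => (starRingEnd ℂ) (X a)) 0 1 = -(starRingEnd ℂ) (spinContr X 1 0) ∧
    spinContr (fun a => (starRingEnd ℂ) (X a)) 1 0 = -(starRingEnd ℂ) (spinContr X 0 1) ∧
    spinContr (fun a => (starRingEnd ℂ) (X a)) 1 1 = (starRingEnd ℂ) (spinContr X 0 0) := by
  have h0 := fun a => (sigma_conj a).1
  have h1 := fun a => (sigma_conj a).2.1
  have h2 := fun a => (sigma_conj a).2.2.1
  have h3 := fun a => (sigma_conj a).2.2.2
  unfold spinContr
  refine ⟨?_, ?_, ?_, ?_⟩ <;> simp [map_sum, h0, h1, h2, h3]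

/-- The spin connection matrix on `S` of an antisymmetric matrix. -/
def spinMat (om : Fin 4 → Fin 4 → ℝ) : Matrix (Fin 2) (Fin 2) ℂ :=
  (-(1 / 2) : ℂ) • ∑ b, ∑ c, ((om b c : ℝ) : ℂ) • (sigma b * (sigma c)ᴴ)

/-- The spin connection matrix on `S'` of an antisymmetric matrix. -/
def spinMat' (om : Fin 4 → Fin 4 → ℝ) : Matrix (Fin 2) (Fin 2) ℂ :=
  (1 / 2 : ℂ) • ∑ b, ∑ c, ((om b c : ℝ) : ℂ) • ((sigma b)ᴴ * sigma c)ᵀ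

/-- An element of `su(2)`. -/
def suMat (p q r : ℝ) : Matrix (Fin 2) (Fin 2) ℂ :=
  !![Complex.I * p, q + Complex.I * r; -q + Complex.I * r, -(Complex.I * p)]

theorem spinMat_apply (om : Fin 4 → Fin 4 → ℝ) (i j : Fin 2) : spinMat om i j
    = -(1 / 2) * ∑ b, ∑ c, (om b c : ℂ) * ∑ k, sigma b i k * (starRingEnd ℂ) (sigma c j k) := by
  simp only [spinMat, Matrix.smul_apply, Matrix.sum_apply, Matrix.mul_apply,
    Matrix.conjTranspose_apply, smul_eq_mul]
  rfl

theorem spinMat'_apply (om : Fin 4 → Fin 4 → ℝ) (i j : Fin 2) : spinMat' om i j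
    = 1 / 2 * ∑ b, ∑ c, (om b c : ℂ) * ∑ k, (starRingEnd ℂ) (sigma b k j) * sigma c k i := by
  simp only [spinMat', Matrix.smul_apply, Matrix.sum_apply, Matrix.mul_apply, Matrix.transpose_apply,
    Matrix.conjTranspose_apply, smul_eq_mul]
  rfl

/-- The double cover Spin(4) = SU(2) × SU(2) splits antisymmetric matrices into two copies of su(2).
The matrix on S sees only the anti-self-dual part, the one on S' only the self-dual part. -/
theorem spinMat_eq {om : Fin 4 → Fin 4 → ℝ} (h : ∀ b c, om b c = -om c b) :
    spinMat om = suMat ((om 0 1 - om 2 3) / 2) ((om 0 3 - om 1 2) / 2) ((om 0 2 + om 1 3) / 2) := by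
  have hr := inv_sqrt_two_mul_self
  have hI := Complex.I_mul_I
  have d : ∀ b, om b b = 0 := fun b => by linarith [h b b]
  ext i j
  rw [spinMat_apply]
  simp only [Fin.sum_univ_four, Fin.sum_univ_two, d, h 1 0, h 2 0, h 3 0, h 2 1, h 3 1, h 3 2]
  clear h d
  fin_cases i <;> fin_cases j <;> simp [sigma, suMat] <;> grind

theorem spinMat'_eq {om : Fin 4 → Fin 4 → ℝ} (h : ∀ b c, om b c = -om c b) :
    spinMat' om = suMat ((om 0 1 + om 2 3) / 2) (-(om 0 3 + om 1 2) / 2) ((om 0 2 - om 1 3) / 2) := by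
  have hr := inv_sqrt_two_mul_self
  have hI := Complex.I_mul_I
  have d : ∀ b, om b b = 0 := fun b => by linarith [h b b]
  ext i j
  rw [spinMat'_apply]
  simp only [Fin.sum_univ_four, Fin.sum_univ_two, d, h 1 0, h 2 0, h 3 0, h 2 1, h 3 1, h 3 2]
  clear h d
  fin_cases i <;> fin_cases j <;> simp [sigma, suMat] <;> grind

end SpinGeometry
end

/-! ### Action of su(2) on spinors and Clifford multiplication. -/

noncomputable section
namespace SpinGeometry
open Set Filter Topology

theorem hat_zero (ψ : Fin 2 → ℂ) : hat ψ 0 = (starRingEnd ℂ) (ψ 1) := rfl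

theorem hat_one (ψ : Fin 2 → ℂ) : hat ψ 1 = -(starRingEnd ℂ) (ψ 0) := rfl

theorem suMat_mulVec (p q r : ℝ) (ψ : Fin 2 → ℂ) :
    (suMat p q r *ᵥ ψ) 0 = Complex.I * p * ψ 0 + (q + Complex.I * r) * ψ 1 ∧
    (suMat p q r *ᵥ ψ) 1 = (-q + Complex.I * r) * ψ 0 - Complex.I * p * ψ 1 := by
  simp [suMat, Matrix.mulVec, dotProduct, Fin.sum_univ_two]
  ring

theorem hat_suMat (p q r : ℝ) (ψ : Fin 2 → ℂ) :
    hat (suMat p q r *ᵥ ψ) = suMat p q r *ᵥ hat ψ := by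
  obtain ⟨h0, h1⟩ := suMat_mulVec p q r ψ
  obtain ⟨k0, k1⟩ := suMat_mulVec p q r (hat ψ)
  ext i
  fin_cases i
  · simp only [Fin.zero_eta, k0, hat_zero, hat_one, h1]
    simp
    ring
  · simp only [Fin.mk_one, k1, hat_zero, hat_one, h0]
    simp
    ring

theorem hat_add (ψ χ : Fin 2 → ℂ) : hat (ψ + χ) = hat ψ + hat χ := by
  ext i
  fin_cases i
  · simp [hat]
  · simp [hat]; ring

theorem hat_hat (ψ : Fin 2 → ℂ) : hat (hat ψ) = -ψ := by
  ext i
  fin_cases i <;> simp [hat]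

/-- The skew pairing of spinors. -/
def skew (ψ χ : Fin 2 → ℂ) : ℂ := ψ 0 * χ 1 - ψ 1 * χ 0

theorem skew_suMat (p q r : ℝ) (ψ χ : Fin 2 → ℂ) :
    skew (suMat p q r *ᵥ ψ) χ + skew ψ (suMat p q r *ᵥ χ) = 0 := by
  obtain ⟨h0, h1⟩ := suMat_mulVec p q r ψ
  obtain ⟨k0, k1⟩ := suMat_mulVec p q r χ
  simp only [skew, h0, h1, k0, k1]
  ring

/-- The determinant of an element of su(2) is p² + q² + r², so a singular one is zero. This lets a
single non-zero β control the whole self-dual part of the curvature. -/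
theorem suMat_eq_zero_of_mulVec {p q r : ℝ} {ψ : Fin 2 → ℂ} (hψ : ψ ≠ 0)
    (h : suMat p q r *ᵥ ψ = 0) : p = 0 ∧ q = 0 ∧ r = 0 := by
  have hdet : (suMat p q r).det = 0 := by
    by_contra h0
    exact hψ (Matrix.eq_zero_of_mulVec_eq_zero h0 h)
  have : ((p ^ 2 + q ^ 2 + r ^ 2 : ℝ) : ℂ) = 0 := by
    rw [← hdet, suMat, Matrix.det_fin_two_of]
    push_cast
    linear_combination (p ^ 2 + r ^ 2 : ℂ) * Complex.I_sq
  have h2 : p ^ 2 + q ^ 2 + r ^ 2 = 0 := by exact_mod_cast this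
  refine ⟨?_, ?_, ?_⟩ <;> nlinarith [sq_nonneg p, sq_nonneg q, sq_nonneg r]

section Antisymm

variable {om om' : Fin 4 → Fin 4 → ℝ}

theorem hat_spinMat (h : ∀ b c, om b c = -om c b) (ψ : Fin 2 → ℂ) :
    hat (spinMat om *ᵥ ψ) = spinMat om *ᵥ hat ψ := by
  rw [spinMat_eq h, hat_suMat]

theorem hat_spinMat' (h : ∀ b c, om b c = -om c b) (ψ : Fin 2 → ℂ) :
    hat (spinMat' om *ᵥ ψ) = spinMat' om *ᵥ hat ψ := by
  rw [spinMat'_eq h, hat_suMat]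

/-- The connections on `S` and `S'` induce the connection on the tangent bundle. -/
theorem spinContr_connection (h : ∀ b c, om b c = -om c b) (ψ χ : Fin 2 → ℂ) (A A' : Fin 2) :
    spinContr (fun b => ∑ c, (om b c : ℂ) * vecOf (fun P P' => ψ P * χ P') c) A A'
      = -((spinMat om *ᵥ ψ) A * χ A' + ψ A * (spinMat' om *ᵥ χ) A') := by
  rw [spinMat_eq h, spinMat'_eq h]
  have hr := inv_sqrt_two_mul_self
  have hI := Complex.I_mul_I
  have d : ∀ b, om b b = 0 := fun b => by linarith [h b b]
  unfold spinContr vecOf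
  simp only [Fin.sum_univ_four, Fin.sum_univ_two, d, h 1 0, h 2 0, h 3 0, h 2 1, h 3 1, h 3 2]
  obtain ⟨h0, h1⟩ := suMat_mulVec ((om 0 1 - om 2 3) / 2) ((om 0 3 - om 1 2) / 2)
    ((om 0 2 + om 1 3) / 2) ψ
  obtain ⟨k0, k1⟩ := suMat_mulVec ((om 0 1 + om 2 3) / 2) (-(om 0 3 + om 1 2) / 2)
    ((om 0 2 - om 1 3) / 2) χ
  clear h d
  fin_cases A <;> fin_cases A' <;>
    simp only [Fin.zero_eta, Fin.mk_one, h0, h1, k0, k1] <;>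
    clear h0 h1 k0 k1 <;> simp [sigma] <;> grind

/-- Clifford multiplication by the `b`-th frame vector. -/
def cliff (b : Fin 4) (ψ : Fin 2 → ℂ) (B' : Fin 2) : ℂ := vecOf (fun A A' => eps A' B' * ψ A) b

theorem spinContr_cliff (ψ : Fin 2 → ℂ) (B' A A' : Fin 2) :
    spinContr (fun b => cliff b ψ B') A A' = eps A' B' * ψ A := spinContr_vecOf _ A A'

theorem cliff_add (b : Fin 4) (ψ χ : Fin 2 → ℂ) (B' : Fin 2) :
    cliff b (ψ + χ) B' = cliff b ψ B' + cliff b χ B' := by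
  simp only [cliff, vecOf, Pi.add_apply, mul_add, Finset.sum_add_distrib]

/-- Clifford multiplication is parallel. -/
theorem cliff_connection (h : ∀ b c, om b c = -om c b) (ψ : Fin 2 → ℂ) (b : Fin 4) (B' : Fin 2) :
    (spinMat' om *ᵥ cliff b ψ) B' - ∑ c, (om b c : ℂ) * cliff c ψ B'
      = cliff b (spinMat om *ᵥ ψ) B' := by
  rw [spinMat_eq h, spinMat'_eq h]
  have hI := Complex.I_mul_I
  have d : ∀ b, om b b = 0 := fun b => by linarith [h b b]
  obtain ⟨h0, h1⟩ := suMat_mulVec ((om 0 1 - om 2 3) / 2) ((om 0 3 - om 1 2) / 2)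
    ((om 0 2 + om 1 3) / 2) ψ
  have k0 := fun χ => (suMat_mulVec ((om 0 1 + om 2 3) / 2) (-(om 0 3 + om 1 2) / 2)
    ((om 0 2 - om 1 3) / 2) χ).1
  have k1 := fun χ => (suMat_mulVec ((om 0 1 + om 2 3) / 2) (-(om 0 3 + om 1 2) / 2)
    ((om 0 2 - om 1 3) / 2) χ).2
  simp only [Fin.sum_univ_four]
  fin_cases b <;> fin_cases B' <;>
    simp only [Fin.zero_eta, Fin.mk_one, Fin.reduceFinMk, k0, k1, d, h 1 0, h 2 0, h 3 0,
      h 2 1, h 3 1, h 3 2] <;>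
    simp only [cliff, vecOf, Fin.sum_univ_two, h0, h1] <;>
    clear h0 h1 k0 k1 h d <;> simp [sigma, eps] <;> grind

/-- `spinMat'` is a homomorphism of Lie algebras. -/
theorem spinMat'_commutator (h : ∀ b c, om b c = -om c b) (h' : ∀ b c, om' b c = -om' c b) :
    spinMat' (fun c d => ∑ e, (om' c e * om e d - om c e * om' e d))
      = spinMat' om * spinMat' om' - spinMat' om' * spinMat' om := by
  have hh : ∀ b c, (fun c d => ∑ e, (om' c e * om e d - om c e * om' e d)) b c
      = -(fun c d => ∑ e, (om' c e * om e d - om c e * om' e d)) c b := by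
    intro b c
    simp only [← Finset.sum_neg_distrib]
    refine Finset.sum_congr rfl fun e _ => ?_
    rw [h' b e, h e c, h b e, h' e c]
    ring
  rw [spinMat'_eq h, spinMat'_eq h', spinMat'_eq hh]
  have d : ∀ b, om b b = 0 := fun b => by linarith [h b b]
  have d' : ∀ b, om' b b = 0 := fun b => by linarith [h' b b]
  have hI := Complex.I_mul_I
  simp only [Fin.sum_univ_four, d, d', h 1 0, h 2 0, h 2 1, h 3 1, h 3 2, h' 1 0, h' 2 0,
    h' 2 1, h' 3 1, h' 3 2]
  clear h h' d d' hh
  ext i j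
  fin_cases i <;> fin_cases j <;>
    simp [suMat] <;> grind

theorem spinMat'_add (x y : Fin 4 → Fin 4 → ℝ) :
    spinMat' (fun b c => x b c + y b c) = spinMat' x + spinMat' y := by
  simp only [spinMat', Complex.ofReal_add, add_smul, Finset.sum_add_distrib, smul_add]

theorem spinMat'_sub (x y : Fin 4 → Fin 4 → ℝ) :
    spinMat' (fun b c => x b c - y b c) = spinMat' x - spinMat' y := by
  simp only [spinMat', Complex.ofReal_sub, sub_smul, Finset.sum_sub_distrib, smul_sub]

theorem spinMat'_mul (r : ℝ) (y : Fin 4 → Fin 4 → ℝ) :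
    spinMat' (fun b c => r * y b c) = (r : ℂ) • spinMat' y := by
  simp only [spinMat', Complex.ofReal_mul, mul_smul, Finset.smul_sum]
  refine Finset.sum_congr rfl fun b _ => Finset.sum_congr rfl fun c _ => ?_
  rw [smul_comm]

end Antisymm

end SpinGeometry
end

/-! ### The Killing spinor equations at a point and their conjugates. -/

noncomputable section
namespace SpinGeometry
open Set Filter Topology

theorem spinContr₂_sub (X Y : Fin 4 → Fin 4 → ℂ) (P P' Q Q' : Fin 2) :
    spinContr₂ (fun a b => X a b - Y a b) P P' Q Q'
      = spinContr₂ X P P' Q Q' - spinContr₂ Y P P' Q Q' := by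
  simp only [spinContr₂, spinContr_sub]

theorem spinContr₂_add (X Y : Fin 4 → Fin 4 → ℂ) (P P' Q Q' : Fin 2) :
    spinContr₂ (fun a b => X a b + Y a b) P P' Q Q'
      = spinContr₂ X P P' Q Q' + spinContr₂ Y P P' Q Q' := by
  simp only [spinContr₂, spinContr_add]

theorem spinContr₂_mul (c : ℂ) (X : Fin 4 → Fin 4 → ℂ) (P P' Q Q' : Fin 2) :
    spinContr₂ (fun a b => c * X a b) P P' Q Q' = c * spinContr₂ X P P' Q Q' := by
  simp only [spinContr₂, spinContr_mul]

theorem spinContr₂_prod (x y : Fin 4 → ℂ) (P P' Q Q' : Fin 2) :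
    spinContr₂ (fun a b => x a * y b) P P' Q Q' = spinContr x P P' * spinContr y Q Q' := by
  simp only [spinContr₂, spinContr_mul, spinContr_mul_right]

theorem spinContr₂_swap (X : Fin 4 → Fin 4 → ℂ) (P P' Q Q' : Fin 2) :
    spinContr₂ (fun a b => X b a) P P' Q Q' = spinContr₂ X Q Q' P P' := by
  simp only [spinContr₂, spinContr, Finset.mul_sum]
  rw [Finset.sum_comm]
  refine Finset.sum_congr rfl fun a _ => Finset.sum_congr rfl fun b _ => ?_
  ring

theorem spinContr₂_eq_sum (X : Fin 4 → Fin 4 → ℂ) (P P' Q Q' : Fin 2) :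
    spinContr₂ X P P' Q Q' = ∑ a, ∑ b, X a b * sigma a P P' * sigma b Q Q' := by
  simp only [spinContr₂, spinContr, Finset.mul_sum]
  refine Finset.sum_congr rfl fun a _ => Finset.sum_congr rfl fun b _ => ?_
  ring

/-- The vector with spinor components `ψ_A χ_{A'}`. -/
def bil (ψ χ : Fin 2 → ℂ) (a : Fin 4) : ℂ := vecOf (fun P P' => ψ P * χ P') a

theorem spinContr_bil (ψ χ : Fin 2 → ℂ) (P P' : Fin 2) : spinContr (bil ψ χ) P P' = ψ P * χ P' :=
  spinContr_vecOf _ P P'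

/-- The soldering matrices identify real vectors with the conjugation-invariant elements of S ⊗ S'.
As hat squares to -1, the conjugate of n = α β̂ is -α̂ β. -/
theorem conj_bil (ψ χ : Fin 2 → ℂ) (a : Fin 4) :
    (starRingEnd ℂ) (bil ψ χ a) = bil (hat ψ) (hat χ) a := by
  refine congrFun (ext_spinContr (X := fun a => (starRingEnd ℂ) (bil ψ χ a)) fun P P' => ?_) a
  obtain ⟨h00, h01, h10, h11⟩ := spinContr_conj (bil ψ χ)
  fin_cases P <;> fin_cases P' <;>
    simp only [Fin.zero_eta, Fin.mk_one, h00, h01, h10, h11, spinContr_bil, hat_zero, hat_one,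
      map_mul] <;> ring

theorem bil_neg_right (ψ χ : Fin 2 → ℂ) (a : Fin 4) : bil ψ (-χ) a = -bil ψ χ a := by
  simp only [bil, vecOf, Pi.neg_apply, mul_neg, Finset.sum_neg_distrib]

/-- The scalar product of complex vectors. -/
theorem sum_mul_eq (X Y : Fin 4 → ℂ) : ∑ a, X a * Y a
    = spinContr X 0 0 * spinContr Y 1 1 + spinContr X 1 1 * spinContr Y 0 0
      - spinContr X 0 1 * spinContr Y 1 0 - spinContr X 1 0 * spinContr Y 0 1 := by
  have h := inv_sqrt_two_mul_self
  have hI := Complex.I_mul_I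
  simp only [spinContr, Fin.sum_univ_four]
  simp [sigma]
  grind

/-- The derivative of `bil ψ χ` along a frame vector, in terms of covariant derivatives. -/
theorem spinContr_covDeriv_bil {om : Fin 4 → Fin 4 → ℝ} (h : ∀ b c, om b c = -om c b)
    (ψ χ dψ dχ : Fin 2 → ℂ) (A A' : Fin 2) :
    spinContr (fun b => bil dψ χ b + bil ψ dχ b - ∑ c, (om b c : ℂ) * bil ψ χ c) A A'
      = (dψ A + (spinMat om *ᵥ ψ) A) * χ A' + ψ A * (dχ A' + (spinMat' om *ᵥ χ) A') := by
  rw [spinContr_sub, spinContr_add, spinContr_bil, spinContr_bil]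
  have := spinContr_connection h ψ χ A A'
  unfold bil
  rw [this]
  ring

/-- The first-order data, at a point and in an orthonormal frame, of a solution of the Killing
spinor equations: the spinors, their derivatives along the frame, the connection coefficients, the
one-form, its field strength and `φ`. -/
structure KSJet (Λ : ℝ) (al be : Fin 2 → ℂ) (dal dbe : Fin 4 → Fin 2 → ℂ)
    (om : Fin 4 → Fin 4 → Fin 4 → ℝ) (A : Fin 4 → ℝ) (F : Fin 4 → Fin 4 → ℝ)
    (φ : Matrix (Fin 2) (Fin 2) ℂ) : Prop where
  antisymm : ∀ a b c, om a b c = -om a c b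
  φ_symm : φᵀ = φ
  field : ∀ P P' Q Q', spinContr₂ (fun a b => (F a b : ℂ)) P P' Q Q' = φ P Q * eps P' Q'
  eq_al : ∀ P P' Q, spinContr (fun a => dal a Q + (spinMat (om a) *ᵥ al) Q) P P'
    = Complex.I * spinContr (fun a => (A a : ℂ)) P P' * al Q
      + (Complex.I / Λ * φ P Q - eps P Q) * be P'
  eq_be : ∀ P P' Q', spinContr (fun a => dbe a Q' + (spinMat' (om a) *ᵥ be) Q') P P'
    = Complex.I * spinContr (fun a => (A a : ℂ)) P P' * be Q' + Λ * eps P' Q' * al P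

theorem eps_vals : eps 0 0 = 0 ∧ eps 0 1 = 1 ∧ eps 1 0 = -1 ∧ eps 1 1 = 0 := by
  simp [eps]

theorem spinContr_real (A : Fin 4 → ℝ) :
    (starRingEnd ℂ) (spinContr (fun a => (A a : ℂ)) 1 1) = spinContr (fun a => (A a : ℂ)) 0 0 ∧
    (starRingEnd ℂ) (spinContr (fun a => (A a : ℂ)) 0 0) = spinContr (fun a => (A a : ℂ)) 1 1 ∧
    (starRingEnd ℂ) (spinContr (fun a => (A a : ℂ)) 1 0) = -spinContr (fun a => (A a : ℂ)) 0 1 ∧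
    (starRingEnd ℂ) (spinContr (fun a => (A a : ℂ)) 0 1) = -spinContr (fun a => (A a : ℂ)) 1 0 := by
  obtain ⟨h00, h01, h10, h11⟩ := spinContr_conj fun a => (A a : ℂ)
  simp only [Complex.conj_ofReal] at h00 h01 h10 h11
  exact ⟨h00.symm, h11.symm, by rw [h01, neg_neg], by rw [h10, neg_neg]⟩

namespace KSJet

variable {Λ : ℝ} {al be : Fin 2 → ℂ} {dal dbe : Fin 4 → Fin 2 → ℂ}
    {om : Fin 4 → Fin 4 → Fin 4 → ℝ} {A : Fin 4 → ℝ} {F : Fin 4 → Fin 4 → ℝ}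
    {φ : Matrix (Fin 2) (Fin 2) ℂ}

theorem φ_eq (h : KSJet Λ al be dal dbe om A F φ) : φ 1 0 = φ 0 1 :=
  congrFun (congrFun h.φ_symm 0) 1

/-- The reality conditions on `φ`. -/
theorem φ_real (h : KSJet Λ al be dal dbe om A F φ) :
    (starRingEnd ℂ) (φ 0 0) = φ 1 1 ∧ (starRingEnd ℂ) (φ 1 1) = φ 0 0 ∧
    (starRingEnd ℂ) (φ 0 1) = -φ 0 1 := by
  obtain ⟨e00, e01, e10, e11⟩ := eps_vals
  have hs := sigma_conj
  have f1 := h.field 0 0 0 1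
  have f2 := h.field 1 1 1 0
  have f3 := h.field 0 0 1 1
  have f4 := h.field 1 1 0 0
  rw [spinContr₂_eq_sum] at f1 f2 f3 f4
  rw [e01] at f1 f3
  rw [e10] at f2 f4
  rw [mul_one] at f1 f3
  have c1 : (starRingEnd ℂ) (φ 0 0) = φ 1 1 := by
    rw [← f1]
    have : φ 1 1 = -(φ 1 1 * -1) := by ring
    rw [this, ← f2, map_sum, ← Finset.sum_neg_distrib]
    refine Finset.sum_congr rfl fun a _ => ?_
    rw [map_sum, ← Finset.sum_neg_distrib]
    refine Finset.sum_congr rfl fun b _ => ?_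
    rw [map_mul, map_mul, Complex.conj_ofReal, (hs a).1, (hs b).2.1]
    ring
  refine ⟨c1, by rw [← c1, Complex.conj_conj], ?_⟩
  rw [← f3]
  have : -φ 0 1 = φ 1 0 * -1 := by rw [h.φ_eq]; ring
  rw [f3, this, ← f4, ← f3, map_sum]
  refine Finset.sum_congr rfl fun a _ => ?_
  rw [map_sum]
  refine Finset.sum_congr rfl fun b _ => ?_
  rw [map_mul, map_mul, Complex.conj_ofReal, (hs a).1, (hs b).2.2.2]

theorem eq_al_hat (h : KSJet Λ al be dal dbe om A F φ) (P P' Q : Fin 2) :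
    spinContr (fun a => hat (dal a) Q + (spinMat (om a) *ᵥ hat al) Q) P P'
    = -(Complex.I * spinContr (fun a => (A a : ℂ)) P P' * hat al Q)
      + (-(Complex.I / Λ * φ P Q) - eps P Q) * hat be P' := by
  have e1 : ∀ a Q, hat (dal a) Q + (spinMat (om a) *ᵥ hat al) Q
      = hat (dal a + spinMat (om a) *ᵥ al) Q := by
    intro a Q
    rw [hat_add, hat_spinMat (h.antisymm a)]
    rfl
  simp only [e1]
  obtain ⟨a1, a2, a3, a4⟩ := spinContr_real A
  obtain ⟨p1, p2, p3⟩ := h.φ_real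
  have p4 := h.φ_eq
  obtain ⟨e00, e01, e10, e11⟩ := eps_vals
  have key := h.eq_al
  set X : Fin 2 → Fin 4 → ℂ := fun Q a => dal a Q + (spinMat (om a) *ᵥ al) Q
  have hX0 : (fun a => hat (dal a + spinMat (om a) *ᵥ al) 0) = fun a => (starRingEnd ℂ) (X 1 a) := rfl
  have hX1 : (fun a => hat (dal a + spinMat (om a) *ᵥ al) 1) = fun a => (-1) * (starRingEnd ℂ) (X 0 a) := by
    funext a
    rw [hat_one, neg_one_mul]
    rfl
  obtain ⟨b00, b01, b10, b11⟩ := spinContr_conj (X 0)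
  obtain ⟨c00, c01, c10, c11⟩ := spinContr_conj (X 1)
  have k : ∀ P P' Q, spinContr (X Q) P P' = _ := key
  fin_cases Q
  · simp only [Fin.zero_eta, hX0]
    fin_cases P <;> fin_cases P' <;> simp only [Fin.zero_eta, Fin.mk_one, c00, c01, c10, c11, k] <;>
      simp [a1, a2, a3, a4, p2, p3, p4, e00, e01, e10, e11, hat_zero, hat_one] <;> ring
  · simp only [Fin.mk_one, hX1, spinContr_mul]
    fin_cases P <;> fin_cases P' <;> simp only [Fin.zero_eta, Fin.mk_one, b00, b01, b10, b11, k] <;>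
      simp [a1, a2, a3, a4, p1, p3, p4, e00, e01, e10, e11, hat_zero, hat_one] <;> ring

theorem eq_be_hat (h : KSJet Λ al be dal dbe om A F φ) (P P' Q' : Fin 2) :
    spinContr (fun a => hat (dbe a) Q' + (spinMat' (om a) *ᵥ hat be) Q') P P'
    = -(Complex.I * spinContr (fun a => (A a : ℂ)) P P' * hat be Q') + Λ * eps P' Q' * hat al P := by
  have e1 : ∀ a Q, hat (dbe a) Q + (spinMat' (om a) *ᵥ hat be) Q
      = hat (dbe a + spinMat' (om a) *ᵥ be) Q := by
    intro a Q
    rw [hat_add, hat_spinMat' (h.antisymm a)]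
    rfl
  simp only [e1]
  obtain ⟨a1, a2, a3, a4⟩ := spinContr_real A
  obtain ⟨e00, e01, e10, e11⟩ := eps_vals
  have key := h.eq_be
  set X : Fin 2 → Fin 4 → ℂ := fun Q a => dbe a Q + (spinMat' (om a) *ᵥ be) Q
  have hX0 : (fun a => hat (dbe a + spinMat' (om a) *ᵥ be) 0) = fun a => (starRingEnd ℂ) (X 1 a) := rfl
  have hX1 : (fun a => hat (dbe a + spinMat' (om a) *ᵥ be) 1) = fun a => (-1) * (starRingEnd ℂ) (X 0 a) := by
    funext a
    rw [hat_one, neg_one_mul]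
    rfl
  obtain ⟨b00, b01, b10, b11⟩ := spinContr_conj (X 0)
  obtain ⟨c00, c01, c10, c11⟩ := spinContr_conj (X 1)
  have k : ∀ P P' Q, spinContr (X Q) P P' = _ := key
  fin_cases Q'
  · simp only [Fin.zero_eta, hX0]
    fin_cases P <;> fin_cases P' <;> simp only [Fin.zero_eta, Fin.mk_one, c00, c01, c10, c11, k] <;>
      simp [a1, a2, a3, a4, e00, e01, e10, e11, hat_zero, hat_one] <;> ring
  · simp only [Fin.mk_one, hX1, spinContr_mul]
    fin_cases P <;> fin_cases P' <;> simp only [Fin.zero_eta, Fin.mk_one, b00, b01, b10, b11, k] <;>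
      simp [a1, a2, a3, a4, e00, e01, e10, e11, hat_zero, hat_one] <;> ring

end KSJet

end SpinGeometry
end

/-! ### Differentials of the norms of the spinors. -/

noncomputable section
namespace SpinGeometry
open Set Filter Topology

/-- The squared norm of a spinor. -/
def spinNorm (ψ : Fin 2 → ℂ) : ℝ := Complex.normSq (ψ 0) + Complex.normSq (ψ 1)

theorem spinNorm_cast (ψ : Fin 2 → ℂ) :
    (spinNorm ψ : ℂ) = ψ 0 * (starRingEnd ℂ) (ψ 0) + ψ 1 * (starRingEnd ℂ) (ψ 1) := by
  rw [spinNorm, Complex.ofReal_add, Complex.mul_conj, Complex.mul_conj]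

theorem spinNorm_pos {ψ : Fin 2 → ℂ} (h : ψ ≠ 0) : 0 < spinNorm ψ := by
  by_contra hn
  have h0 := Complex.normSq_nonneg (ψ 0)
  have h1 := Complex.normSq_nonneg (ψ 1)
  unfold spinNorm at hn
  apply h
  ext i
  fin_cases i
  · have : Complex.normSq (ψ 0) = 0 := le_antisymm (by linarith) h0
    exact Complex.normSq_eq_zero.1 this
  · have : Complex.normSq (ψ 1) = 0 := le_antisymm (by linarith) h1
    exact Complex.normSq_eq_zero.1 this

/-- The derivative of the squared norm. -/
def dNorm (ψ dψ : Fin 2 → ℂ) : ℝ :=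
  2 * ((starRingEnd ℂ) (ψ 0) * dψ 0 + (starRingEnd ℂ) (ψ 1) * dψ 1).re

theorem dNorm_cast (ψ dψ : Fin 2 → ℂ) :
    (dNorm ψ dψ : ℂ) = -(skew dψ (hat ψ) + skew ψ (hat dψ)) := by
  have h : ∀ z : ℂ, ((2 * z.re : ℝ) : ℂ) = z + (starRingEnd ℂ) z := fun z => by
    rw [Complex.add_conj]
  rw [dNorm, h]
  simp only [skew, hat_zero, hat_one, map_add, map_mul, Complex.conj_conj]
  ring

/-- The spinor components of the differential of a squared norm. -/
theorem spinContr_dNorm {S : Fin 4 → Matrix (Fin 2) (Fin 2) ℂ}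
    (hS : ∀ a ψ χ, skew (S a *ᵥ ψ) χ + skew ψ (S a *ᵥ χ) = 0) (ψ : Fin 2 → ℂ)
    (dψ : Fin 4 → Fin 2 → ℂ) (P P' : Fin 2) :
    spinContr (fun a => (dNorm ψ (dψ a) : ℂ)) P P'
      = -(spinContr (fun a => dψ a 0 + (S a *ᵥ ψ) 0) P P' * hat ψ 1
          - spinContr (fun a => dψ a 1 + (S a *ᵥ ψ) 1) P P' * hat ψ 0
        + ψ 0 * spinContr (fun a => hat (dψ a) 1 + (S a *ᵥ hat ψ) 1) P P'
        - ψ 1 * spinContr (fun a => hat (dψ a) 0 + (S a *ᵥ hat ψ) 0) P P') := by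
  rw [← spinContr_mul_right, ← spinContr_mul_right, ← spinContr_mul, ← spinContr_mul,
    ← spinContr_sub, ← spinContr_add, ← spinContr_sub, ← neg_one_mul, ← spinContr_mul]
  congr 1
  funext a
  rw [dNorm_cast]
  have := hS a ψ (hat ψ)
  simp only [skew] at this ⊢
  linear_combination this

namespace KSJet

variable {Λ : ℝ} {al be : Fin 2 → ℂ} {dal dbe : Fin 4 → Fin 2 → ℂ}
    {om : Fin 4 → Fin 4 → Fin 4 → ℝ} {A : Fin 4 → ℝ} {F : Fin 4 → Fin 4 → ℝ}
    {φ : Matrix (Fin 2) (Fin 2) ℂ}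

theorem skew_spinMat (h : KSJet Λ al be dal dbe om A F φ) (a : Fin 4) (ψ χ : Fin 2 → ℂ) :
    skew (spinMat (om a) *ᵥ ψ) χ + skew ψ (spinMat (om a) *ᵥ χ) = 0 := by
  rw [spinMat_eq (h.antisymm a), skew_suMat]

theorem skew_spinMat' (h : KSJet Λ al be dal dbe om A F φ) (a : Fin 4) (ψ χ : Fin 2 → ℂ) :
    skew (spinMat' (om a) *ᵥ ψ) χ + skew ψ (spinMat' (om a) *ᵥ χ) = 0 := by
  rw [spinMat'_eq (h.antisymm a), skew_suMat]

theorem re_bil_cast (ψ χ : Fin 2 → ℂ) (a : Fin 4) :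
    ((2 * (bil ψ (hat χ) a).re : ℝ) : ℂ) = bil ψ (hat χ) a - bil (hat ψ) χ a := by
  rw [← Complex.add_conj, conj_bil, hat_hat, bil_neg_right, sub_eq_add_neg]

/-- The coefficient of A is imaginary, so its contributions from β and β̂ cancel in |β|² and only
the α-term remains. This is the equation dN = 2Λ Re n. -/
theorem dNorm_be (h : KSJet Λ al be dal dbe om A F φ) (a : Fin 4) :
    dNorm be (dbe a) = 2 * Λ * (bil al (hat be) a).re := by
  have e : (dNorm be (dbe a) : ℂ) = Λ * (bil al (hat be) a - bil (hat al) be a) := by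
    refine congrFun (ext_spinContr (X := fun a => (dNorm be (dbe a) : ℂ))
      (Y := fun a => Λ * (bil al (hat be) a - bil (hat al) be a)) fun P P' => ?_) a
    rw [spinContr_dNorm h.skew_spinMat', h.eq_be, h.eq_be, h.eq_be_hat, h.eq_be_hat, spinContr_mul,
      spinContr_sub, spinContr_bil, spinContr_bil]
    obtain ⟨e00, e01, e10, e11⟩ := eps_vals
    fin_cases P' <;> simp only [Fin.zero_eta, Fin.mk_one, e00, e01, e10, e11] <;> ring
  rw [← re_bil_cast] at e
  have : ((dNorm be (dbe a) : ℝ) : ℂ) = ((Λ * (2 * (bil al (hat be) a).re) : ℝ) : ℂ) := by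
    rw [e]
    push_cast
    ring
  have := Complex.ofReal_injective this
  rw [this]
  ring

/-- The decomposition of `φ` with respect to a non-vanishing spinor and its conjugate. -/
theorem exists_φ (h : KSJet Λ al be dal dbe om A F φ) (hal : al ≠ 0) :
    ∃ (a : ℂ) (B : ℝ), ∀ P Q, φ P Q = a * al P * al Q
      + Complex.I * B * (al P * hat al Q + hat al P * al Q)
      + (starRingEnd ℂ) a * hat al P * hat al Q := by
  obtain ⟨p1, p2, p3⟩ := h.φ_real
  have p4 := h.φ_eq
  have hP : (spinNorm al : ℂ) ≠ 0 := by exact_mod_cast (spinNorm_pos hal).ne'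
  have hPc := spinNorm_cast al
  set p := (spinNorm al : ℂ) with hp
  have hpr : (starRingEnd ℂ) p = p := Complex.conj_ofReal _
  set x0 := al 0
  set x1 := al 1
  set y0 := (starRingEnd ℂ) x0 with hy0
  set y1 := (starRingEnd ℂ) x1 with hy1
  have cy0 : (starRingEnd ℂ) y0 = x0 := Complex.conj_conj _
  have cy1 : (starRingEnd ℂ) y1 = x1 := Complex.conj_conj _
  -- The coefficients come from evaluating φ on the basis dual to α, α̂. Contraction with ᾱ = (y0,
  -- y1) annihilates α̂ and pairs with α to |α|², while contraction with (-x1, x0) annihilates α.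
  -- The reality of φ makes b real and the α̂α̂-coefficient conjugate to a.
  set b : ℂ := Complex.I * (-(φ 0 0 * x1 * y0) + φ 0 1 * (x0 * y0 - x1 * y1) + φ 1 1 * x0 * y1) / p ^ 2
    with hb
  have hbr : (starRingEnd ℂ) b = b := by
    rw [hb]
    simp only [map_div₀, map_mul, map_add, map_sub, map_neg, map_pow, hpr, p1, p2, p3, cy0, cy1,
      Complex.conj_I, ← hy0, ← hy1]
    ring
  set a : ℂ := (φ 0 0 * y0 ^ 2 + 2 * φ 0 1 * y0 * y1 + φ 1 1 * y1 ^ 2) / p ^ 2 with ha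
  have hac : (starRingEnd ℂ) a = (φ 1 1 * x0 ^ 2 - 2 * φ 0 1 * x0 * x1 + φ 0 0 * x1 ^ 2) / p ^ 2 := by
    rw [ha]
    simp only [map_div₀, map_mul, map_add, map_pow, hpr, p1, p2, p3, cy0, cy1,
      map_ofNat]
    ring
  obtain ⟨B, hB⟩ := Complex.conj_eq_iff_real.1 hbr
  refine ⟨a, B, fun P Q => ?_⟩
  rw [hac, ← hB]
  have hI := Complex.I_mul_I
  have hpp : p = x0 * y0 + x1 * y1 := hPc
  have h0 : hat al 0 = y1 := rfl
  have h1 : hat al 1 = -y0 := rfl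
  have ea : a * p ^ 2 = φ 0 0 * y0 ^ 2 + 2 * φ 0 1 * y0 * y1 + φ 1 1 * y1 ^ 2 := by
    rw [ha]; field_simp
  have eb : b * p ^ 2 = Complex.I * (-(φ 0 0 * x1 * y0) + φ 0 1 * (x0 * y0 - x1 * y1)
      + φ 1 1 * x0 * y1) := by
    rw [hb]; field_simp
  have ec : (φ 1 1 * x0 ^ 2 - 2 * φ 0 1 * x0 * x1 + φ 0 0 * x1 ^ 2) / p ^ 2 * p ^ 2
      = φ 1 1 * x0 ^ 2 - 2 * φ 0 1 * x0 * x1 + φ 0 0 * x1 ^ 2 := by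
    field_simp
  generalize (φ 1 1 * x0 ^ 2 - 2 * φ 0 1 * x0 * x1 + φ 0 0 * x1 ^ 2) / p ^ 2 = c at ec ⊢
  apply mul_right_cancel₀ (pow_ne_zero 2 hP)
  have key : ∀ P Q, (a * al P * al Q + Complex.I * b * (al P * hat al Q + hat al P * al Q)
      + c * hat al P * hat al Q) * p ^ 2
      = (φ 0 0 * y0 ^ 2 + 2 * φ 0 1 * y0 * y1 + φ 1 1 * y1 ^ 2) * al P * al Q
        - (-(φ 0 0 * x1 * y0) + φ 0 1 * (x0 * y0 - x1 * y1) + φ 1 1 * x0 * y1)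
          * (al P * hat al Q + hat al P * al Q)
        + (φ 1 1 * x0 ^ 2 - 2 * φ 0 1 * x0 * x1 + φ 0 0 * x1 ^ 2) * hat al P * hat al Q := by
    intro P Q
    linear_combination (al P * al Q) * ea + (Complex.I * (al P * hat al Q + hat al P * al Q)) * eb
      + (hat al P * hat al Q) * ec + (-(φ 0 0 * x1 * y0) + φ 0 1 * (x0 * y0 - x1 * y1)
      + φ 1 1 * x0 * y1) * (al P * hat al Q + hat al P * al Q) * hI
  rw [key, hpp]
  have hx0 : al 0 = x0 := rfl
  have hx1 : al 1 = x1 := rfl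
  fin_cases P <;> fin_cases Q <;> simp only [Fin.zero_eta, Fin.mk_one, h0, h1, hx0, hx1, p4] <;> ring

/-- The differential of `|α|²`. -/
theorem spinContr_dNorm_al (h : KSJet Λ al be dal dbe om A F φ) (P P' : Fin 2) :
    spinContr (fun a => (dNorm al (dal a) : ℂ)) P P' = al P * hat be P' - hat al P * be P'
      + Complex.I / Λ * ((φ P 1 * hat al 0 - φ P 0 * hat al 1) * be P'
        + (φ P 1 * al 0 - φ P 0 * al 1) * hat be P') := by
  rw [spinContr_dNorm h.skew_spinMat, h.eq_al, h.eq_al, h.eq_al_hat, h.eq_al_hat]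
  obtain ⟨e00, e01, e10, e11⟩ := eps_vals
  fin_cases P <;> simp only [Fin.zero_eta, Fin.mk_one, e00, e01, e10, e11] <;> ring

/-- As for |β|², the A-terms cancel. The ε-term contributes Re n, and φ contributes through its
components c and B in the basis α, α̂. -/
theorem dNorm_al (h : KSJet Λ al be dal dbe om A F φ) {c : ℂ} {B : ℝ}
    (hφ : ∀ P Q, φ P Q = c * al P * al Q
      + Complex.I * B * (al P * hat al Q + hat al P * al Q)
      + (starRingEnd ℂ) c * hat al P * hat al Q) (a : Fin 4) :
    dNorm al (dal a) = 2 * (1 + B * spinNorm al / Λ) * (bil al (hat be) a).re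
      - 2 * spinNorm al / Λ * (c * bil al be a).im := by
  have hPc := spinNorm_cast al
  have e : (dNorm al (dal a) : ℂ)
      = (1 + B * spinNorm al / Λ) * (bil al (hat be) a - bil (hat al) be a)
        - Complex.I * spinNorm al / Λ * ((starRingEnd ℂ) c * bil (hat al) (hat be) a
          - c * bil al be a) := by
    refine congrFun (ext_spinContr (X := fun a => (dNorm al (dal a) : ℂ))
      (Y := fun a => (1 + B * spinNorm al / Λ) * (bil al (hat be) a - bil (hat al) be a)
        - Complex.I * spinNorm al / Λ * ((starRingEnd ℂ) c * bil (hat al) (hat be) a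
          - c * bil al be a)) fun P P' => ?_) a
    rw [h.spinContr_dNorm_al]
    simp only [spinContr_sub, spinContr_mul, spinContr_bil, hφ, hPc, div_eq_mul_inv]
    have hI := Complex.I_mul_I
    fin_cases P <;> simp only [Fin.zero_eta, Fin.mk_one, hat_zero, hat_one] <;> grind
  have e2 : ((2 * (c * bil al be a).im : ℝ) : ℂ) * Complex.I
      = c * bil al be a - (starRingEnd ℂ) c * bil (hat al) (hat be) a := by
    rw [← conj_bil, ← map_mul, Complex.sub_conj]
  rw [← re_bil_cast] at e
  apply Complex.ofReal_injective
  rw [e]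
  push_cast at e2 ⊢
  linear_combination (-(spinNorm al : ℂ) / Λ * Complex.I) * e2 + 2 * ((spinNorm al : ℂ) / Λ
    * (c * bil al be a).im) * Complex.I_sq

end KSJet

end SpinGeometry
end

/-! ### Exterior derivatives of m and n, and the field strength. -/

noncomputable section
namespace SpinGeometry
open Set Filter Topology

theorem crossIm_cast (z w : ℂ) : 2 * Complex.I * (crossIm z w : ℂ)
    = z * (starRingEnd ℂ) w - w * (starRingEnd ℂ) z := by
  apply Complex.ext
  · simp [crossIm]; ring
  · simp [crossIm]; ring

/-- The antisymmetrised derivative of `bil ψ χ` along frame vectors. -/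
def dBil (om : Fin 4 → Fin 4 → Fin 4 → ℝ) (ψ χ : Fin 2 → ℂ) (dψ dχ : Fin 4 → Fin 2 → ℂ)
    (a b : Fin 4) : ℂ :=
  (bil (dψ a) χ b + bil ψ (dχ a) b) - (bil (dψ b) χ a + bil ψ (dχ b) a)
    - ∑ c, ((om a b c - om b a c : ℝ) : ℂ) * bil ψ χ c

theorem spinContr₂_covDeriv_bil {om : Fin 4 → Fin 4 → Fin 4 → ℝ}
    (h : ∀ a b c, om a b c = -om a c b) (ψ χ : Fin 2 → ℂ) (dψ dχ : Fin 4 → Fin 2 → ℂ)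
    (C C' A A' : Fin 2) :
    spinContr₂ (fun a b => bil (dψ a) χ b + bil ψ (dχ a) b - ∑ c, (om a b c : ℂ) * bil ψ χ c)
        C C' A A'
      = spinContr (fun a => dψ a A + (spinMat (om a) *ᵥ ψ) A) C C' * χ A'
        + ψ A * spinContr (fun a => dχ a A' + (spinMat' (om a) *ᵥ χ) A') C C' := by
  unfold spinContr₂
  simp only [spinContr_covDeriv_bil (h _)]
  rw [spinContr_add, spinContr_mul_right, spinContr_mul]

theorem spinContr₂_dBil {om : Fin 4 → Fin 4 → Fin 4 → ℝ}
    (h : ∀ a b c, om a b c = -om a c b) (ψ χ : Fin 2 → ℂ) (dψ dχ : Fin 4 → Fin 2 → ℂ)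
    (C C' A A' : Fin 2) :
    spinContr₂ (dBil om ψ χ dψ dχ) C C' A A'
      = spinContr (fun a => dψ a A + (spinMat (om a) *ᵥ ψ) A) C C' * χ A'
        + ψ A * spinContr (fun a => dχ a A' + (spinMat' (om a) *ᵥ χ) A') C C'
        - (spinContr (fun a => dψ a C + (spinMat (om a) *ᵥ ψ) C) A A' * χ C'
        + ψ C * spinContr (fun a => dχ a C' + (spinMat' (om a) *ᵥ χ) C') A A') := by
  rw [← spinContr₂_covDeriv_bil h, ← spinContr₂_covDeriv_bil h,
    ← spinContr₂_swap _ C C' A A', ← spinContr₂_sub]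
  congr 1
  funext a b
  simp only [dBil, Complex.ofReal_sub, sub_mul, Finset.sum_sub_distrib]
  ring

namespace KSJet

variable {Λ : ℝ} {al be : Fin 2 → ℂ} {dal dbe : Fin 4 → Fin 2 → ℂ}
    {om : Fin 4 → Fin 4 → Fin 4 → ℝ} {A : Fin 4 → ℝ} {F : Fin 4 → Fin 4 → ℝ}
    {φ : Matrix (Fin 2) (Fin 2) ℂ}

/-- The φ-term φ_{CA} β_{C'} β_{A'} is symmetric under exchange of index pairs, so it disappears
from dm. The remaining ε-terms are multiples of m ∧ n̄ and m ∧ n, since P ε_{AB} and N ε_{A'B'} are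
skew products of a spinor with its conjugate. Hence dm is divisible by m. -/
theorem dm_eq (h : KSJet Λ al be dal dbe om A F φ) (hal : al ≠ 0) (hbe : be ≠ 0) (a b : Fin 4) :
    dBil om al be dal dbe a b
      = bil al be a * (-2 * Complex.I * A b
          - ((2 / spinNorm al : ℝ) : ℂ) * (starRingEnd ℂ) (bil al (hat be) b)
          - ((2 * Λ / spinNorm be : ℝ) : ℂ) * bil al (hat be) b)
        - bil al be b * (-2 * Complex.I * A a
          - ((2 / spinNorm al : ℝ) : ℂ) * (starRingEnd ℂ) (bil al (hat be) a)
          - ((2 * Λ / spinNorm be : ℝ) : ℂ) * bil al (hat be) a) := by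
  have hP : (spinNorm al : ℂ) ≠ 0 := by exact_mod_cast (spinNorm_pos hal).ne'
  have hN : (spinNorm be : ℂ) ≠ 0 := by exact_mod_cast (spinNorm_pos hbe).ne'
  have hPc := spinNorm_cast al
  have hNc := spinNorm_cast be
  simp only [conj_bil, hat_hat, bil_neg_right]
  set η : Fin 4 → ℂ := fun b => -2 * Complex.I * A b
          - ((2 / spinNorm al : ℝ) : ℂ) * (-bil (hat al) be b)
          - ((2 * Λ / spinNorm be : ℝ) : ℂ) * bil al (hat be) b with hη
  refine congrFun (congrFun (ext_spinContr₂ (X := dBil om al be dal dbe)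
    (Y := fun a b => bil al be a * η b - bil al be b * η a) fun C C' A₁ A' => ?_) a) b
  have hηc : ∀ P P', spinContr η P P' = -2 * Complex.I * spinContr (fun a => (A a : ℂ)) P P'
      + 2 / spinNorm al * (hat al P * be P') - 2 * Λ / spinNorm be * (al P * hat be P') := by
    intro P P'
    rw [hη]
    simp only [← neg_one_mul (bil _ _ _), spinContr_sub, spinContr_mul, spinContr_bil]
    push_cast
    ring
  rw [spinContr₂_dBil h.antisymm, h.eq_al, h.eq_al, h.eq_be, h.eq_be, spinContr₂_sub,
    spinContr₂_prod, spinContr₂_swap (fun a b => bil al be a * η b), spinContr₂_prod,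
    spinContr_bil, spinContr_bil, hηc, hηc]
  have p4 := h.φ_eq
  obtain ⟨e00, e01, e10, e11⟩ := eps_vals
  generalize (spinNorm al : ℂ) = p at *
  generalize (spinNorm be : ℂ) = q at *
  clear hη hηc
  clear_value η
  fin_cases C <;> fin_cases C' <;> fin_cases A₁ <;> fin_cases A' <;>
    simp only [Fin.zero_eta, Fin.mk_one, e00, e01, e10, e11, hat_zero, hat_one, p4] <;>
    field_simp <;> (try rw [hPc, hNc]) <;> ring

/-- Substitute the decomposition of φ over α, α̂ and write N ε_{A'B'} as the skew product of β and
β̂. The products of spinors regroup into wedge products of m, n and their conjugates. -/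
theorem F_eq (h : KSJet Λ al be dal dbe om A F φ) (hbe : be ≠ 0) {c : ℂ} {B : ℝ}
    (hφ : ∀ P Q, φ P Q = c * al P * al Q
      + Complex.I * B * (al P * hat al Q + hat al P * al Q)
      + (starRingEnd ℂ) c * hat al P * hat al Q) (a b : Fin 4) :
    F a b = -(2 / spinNorm be) * ((c * (bil al be a * bil al (hat be) b
        - bil al be b * bil al (hat be) a)).re
      - B * (crossIm (bil al be a) (bil al be b)
        + crossIm (bil al (hat be) a) (bil al (hat be) b))) := by
  have hN : (spinNorm be : ℂ) ≠ 0 := by exact_mod_cast (spinNorm_pos hbe).ne'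
  have hNc := spinNorm_cast be
  apply Complex.ofReal_injective
  have e1 : ∀ z : ℂ, ((2 * z.re : ℝ) : ℂ) = z + (starRingEnd ℂ) z := fun z => by
    rw [Complex.add_conj]
  have e2 : ∀ z w, (crossIm z w : ℂ)
      = -(Complex.I / 2) * (z * (starRingEnd ℂ) w - w * (starRingEnd ℂ) z) := fun z w => by
    rw [← crossIm_cast]
    linear_combination (crossIm z w : ℂ) * Complex.I_sq
  have e : (F a b : ℂ) = -(1 / spinNorm be) * (
        (c * (bil al be a * bil al (hat be) b - bil al be b * bil al (hat be) a)
        + (starRingEnd ℂ) c * (bil (hat al) (hat be) a * -bil (hat al) be b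
          - bil (hat al) (hat be) b * -bil (hat al) be a))
      + Complex.I * B * ((bil al be a * bil (hat al) (hat be) b - bil al be b * bil (hat al) (hat be) a)
        + (bil al (hat be) a * -bil (hat al) be b - bil al (hat be) b * -bil (hat al) be a))) := by
    refine congrFun (congrFun (ext_spinContr₂ (X := fun a b => (F a b : ℂ))
      (Y := fun a b => -(1 / spinNorm be) * (
        (c * (bil al be a * bil al (hat be) b - bil al be b * bil al (hat be) a)
        + (starRingEnd ℂ) c * (bil (hat al) (hat be) a * -bil (hat al) be b
          - bil (hat al) (hat be) b * -bil (hat al) be a))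
      + Complex.I * B * ((bil al be a * bil (hat al) (hat be) b - bil al be b * bil (hat al) (hat be) a)
        + (bil al (hat be) a * -bil (hat al) be b - bil al (hat be) b * -bil (hat al) be a))))
      fun C C' A₁ A' => ?_) a) b
    rw [h.field]
    have sw : ∀ ψ χ ψ' χ' : Fin 2 → ℂ, spinContr₂ (fun a b => bil ψ χ b * bil ψ' χ' a) C C' A₁ A'
        = ψ A₁ * χ A' * (ψ' C * χ' C') := by
      intro ψ χ ψ' χ'
      rw [spinContr₂_swap (fun a b => bil ψ χ a * bil ψ' χ' b), spinContr₂_prod, spinContr_bil,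
        spinContr_bil]
    simp only [mul_neg, ← neg_one_mul (bil _ _ _ * bil _ _ _), spinContr₂_mul, spinContr₂_add,
      spinContr₂_sub, spinContr₂_prod, sw, spinContr_bil, hφ]
    obtain ⟨e00, e01, e10, e11⟩ := eps_vals
    generalize (spinNorm be : ℂ) = q at *
    fin_cases C <;> fin_cases C' <;> fin_cases A₁ <;> fin_cases A' <;>
      simp only [Fin.zero_eta, Fin.mk_one, e00, e01, e10, e11, hat_zero, hat_one] <;>
      field_simp <;> (try rw [hNc]) <;> ring
  rw [e]
  push_cast
  have e3 := e1 (c * (bil al be a * bil al (hat be) b - bil al be b * bil al (hat be) a))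
  simp only [map_mul, map_sub, conj_bil, hat_hat, bil_neg_right] at e3
  push_cast at e3
  rw [e2, e2]
  simp only [conj_bil, hat_hat, bil_neg_right]
  linear_combination (1 / (spinNorm be : ℂ)) * e3

/-- The factors α and β̂ carry opposite charges, so A drops out. Skewing φ_{CA} β_{C'} β̂_{A'}
leaves N φ ε' up to a factor, which accounts for the multiple of F. -/
theorem dn_eq (h : KSJet Λ al be dal dbe om A F φ) (hΛ : Λ ≠ 0) (hal : al ≠ 0) (hbe : be ≠ 0)
    (a b : Fin 4) :
    dBil om al (hat be) dal (fun a => hat (dbe a)) a b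
      = Complex.I * ((-(spinNorm be / Λ) * F a b
        + 2 / spinNorm al * (crossIm (bil al be a) (bil al be b)
            - crossIm (bil al (hat be) a) (bil al (hat be) b))
        - 2 * Λ / spinNorm be * (crossIm (bil al be a) (bil al be b)
            + crossIm (bil al (hat be) a) (bil al (hat be) b)) : ℝ) : ℂ) := by
  have hP : (spinNorm al : ℂ) ≠ 0 := by exact_mod_cast (spinNorm_pos hal).ne'
  have hN : (spinNorm be : ℂ) ≠ 0 := by exact_mod_cast (spinNorm_pos hbe).ne'
  have hPc := spinNorm_cast al
  have hNc := spinNorm_cast be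
  have hL : (Λ : ℂ) ≠ 0 := by exact_mod_cast hΛ
  have e2 : ∀ z w, (crossIm z w : ℂ)
      = -(Complex.I / 2) * (z * (starRingEnd ℂ) w - w * (starRingEnd ℂ) z) := fun z w => by
    rw [← crossIm_cast]
    linear_combination (crossIm z w : ℂ) * Complex.I_sq
  have e : dBil om al (hat be) dal (fun a => hat (dbe a)) a b
      = -(Complex.I * spinNorm be / Λ) * F a b
        + (1 / spinNorm al - Λ / spinNorm be)
          * (bil al be a * bil (hat al) (hat be) b - bil al be b * bil (hat al) (hat be) a)
        + (-(1 / spinNorm al) - Λ / spinNorm be)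
          * (bil al (hat be) a * -bil (hat al) be b - bil al (hat be) b * -bil (hat al) be a) := by
    refine congrFun (congrFun (ext_spinContr₂
      (X := dBil om al (hat be) dal (fun a => hat (dbe a)))
      (Y := fun a b => -(Complex.I * spinNorm be / Λ) * F a b
        + (1 / spinNorm al - Λ / spinNorm be)
          * (bil al be a * bil (hat al) (hat be) b - bil al be b * bil (hat al) (hat be) a)
        + (-(1 / spinNorm al) - Λ / spinNorm be)
          * (bil al (hat be) a * -bil (hat al) be b - bil al (hat be) b * -bil (hat al) be a))
      fun C C' A₁ A' => ?_) a) b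
    have sw : ∀ ψ χ ψ' χ' : Fin 2 → ℂ, spinContr₂ (fun a b => bil ψ χ b * bil ψ' χ' a) C C' A₁ A'
        = ψ A₁ * χ A' * (ψ' C * χ' C') := by
      intro ψ χ ψ' χ'
      rw [spinContr₂_swap (fun a b => bil ψ χ a * bil ψ' χ' b), spinContr₂_prod, spinContr_bil,
        spinContr_bil]
    simp only [mul_neg, ← neg_one_mul (bil _ _ _ * bil _ _ _), spinContr₂_mul, spinContr₂_add,
      spinContr₂_sub, spinContr₂_prod, sw, spinContr_bil, h.field]
    rw [spinContr₂_dBil h.antisymm, h.eq_al, h.eq_al, h.eq_be_hat, h.eq_be_hat]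
    have p4 := h.φ_eq
    obtain ⟨e00, e01, e10, e11⟩ := eps_vals
    generalize (spinNorm al : ℂ) = p at *
    generalize (spinNorm be : ℂ) = q at *
    fin_cases C <;> fin_cases C' <;> fin_cases A₁ <;> fin_cases A' <;>
      simp only [Fin.zero_eta, Fin.mk_one, e00, e01, e10, e11, hat_zero, hat_one, p4] <;>
      field_simp <;> (try rw [hPc, hNc]) <;> ring
  rw [e]
  push_cast
  rw [e2, e2]
  simp only [conj_bil, hat_hat, bil_neg_right]
  linear_combination ((1 / spinNorm al - Λ / spinNorm be)
          * (bil al be a * bil (hat al) (hat be) b - bil al be b * bil (hat al) (hat be) a)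
        + (-(1 / spinNorm al) - Λ / spinNorm be)
          * (bil al (hat be) a * -bil (hat al) be b - bil al (hat be) b * -bil (hat al) be a))
        * Complex.I_sq

end KSJet

end SpinGeometry
end

noncomputable section
namespace SpinGeometry
open Set Filter Topology

/-! ### The vector field `K` -/

/-- The components of `i (α̂_A β_{A'} + α_A β̂_{A'})` in an orthonormal frame. -/
def killVec (al be : Fin 2 → ℂ) (a : Fin 4) : ℝ := -2 * (bil al (hat be) a).im

theorem killVec_cast (al be : Fin 2 → ℂ) (a : Fin 4) :
    (killVec al be a : ℂ) = Complex.I * (bil (hat al) be a + bil al (hat be) a) := by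
  have h := Complex.sub_conj (bil al (hat be) a)
  rw [conj_bil, hat_hat, bil_neg_right, sub_neg_eq_add] at h
  rw [killVec, add_comm, h]
  push_cast
  linear_combination (-2 * ((bil al (hat be) a).im : ℂ)) * Complex.I_sq

theorem spinContr_killVec (al be : Fin 2 → ℂ) (P P' : Fin 2) :
    spinContr (fun a => (killVec al be a : ℂ)) P P'
      = Complex.I * (hat al P * be P' + al P * hat be P') := by
  simp only [killVec_cast, spinContr_mul, spinContr_add, spinContr_bil]

theorem sum_bil_killVec (al be : Fin 2 → ℂ) : ∑ a, bil al be a * (killVec al be a : ℂ) = 0 := by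
  rw [sum_mul_eq]
  simp only [spinContr_killVec, spinContr_bil, hat_zero, hat_one]
  ring

theorem sum_bil_hat_killVec (al be : Fin 2 → ℂ) :
    ∑ a, bil al (hat be) a * (killVec al be a : ℂ)
      = -Complex.I * ((spinNorm al * spinNorm be : ℝ) : ℂ) := by
  rw [sum_mul_eq]
  push_cast
  simp only [spinContr_killVec, spinContr_bil, hat_zero, hat_one, spinNorm_cast]
  ring

theorem sum_killVec_sq (al be : Fin 2 → ℂ) :
    ∑ a, killVec al be a ^ 2 = 2 * (spinNorm al * spinNorm be) := by
  have h := sum_mul_eq (fun a => (killVec al be a : ℂ)) (fun a => (killVec al be a : ℂ))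
  apply Complex.ofReal_injective
  push_cast
  simp only [sq]
  rw [h]
  simp only [spinContr_killVec, hat_zero, hat_one, spinNorm_cast]
  linear_combination (-2 * (al 0 * (starRingEnd ℂ) (al 0) + al 1 * (starRingEnd ℂ) (al 1))
    * (be 0 * (starRingEnd ℂ) (be 0) + be 1 * (starRingEnd ℂ) (be 1))) * Complex.I_sq

/-- The scalar product of real vectors in the null tetrad determined by two spinors. -/
theorem norm_sq_eq_bil {al be : Fin 2 → ℂ} (hal : al ≠ 0) (hbe : be ≠ 0) (v : Fin 4 → ℝ) :
    ∑ a, v a ^ 2 = 2 / (spinNorm al * spinNorm be)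
      * (Complex.normSq (∑ a, bil al be a * (v a : ℂ))
        + Complex.normSq (∑ a, bil al (hat be) a * (v a : ℂ))) := by
  have hP : (spinNorm al : ℂ) ≠ 0 := by exact_mod_cast (spinNorm_pos hal).ne'
  have hN : (spinNorm be : ℂ) ≠ 0 := by exact_mod_cast (spinNorm_pos hbe).ne'
  have hPc := spinNorm_cast al
  have hNc := spinNorm_cast be
  have h := sum_mul_eq (fun a => (v a : ℂ)) (fun a => (v a : ℂ))
  have h1 := sum_mul_eq (bil al be) (fun a => (v a : ℂ))
  have h2 := sum_mul_eq (bil al (hat be)) (fun a => (v a : ℂ))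
  obtain ⟨c1, c2, c3, c4⟩ := spinContr_real v
  apply Complex.ofReal_injective
  push_cast
  rw [← Complex.mul_conj, ← Complex.mul_conj, h1, h2]
  simp only [sq]
  rw [h]
  simp only [spinContr_bil, map_sub, map_add, map_mul, c1, c2, c3, c4, hat_zero, hat_one,
    Complex.conj_conj, map_neg]
  field_simp
  rw [hPc, hNc]
  ring

namespace KSJet

variable {Λ : ℝ} {al be : Fin 2 → ℂ} {dal dbe : Fin 4 → Fin 2 → ℂ}
    {om : Fin 4 → Fin 4 → Fin 4 → ℝ} {A : Fin 4 → ℝ} {F : Fin 4 → Fin 4 → ℝ}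
    {φ : Matrix (Fin 2) (Fin 2) ℂ}

/-- The Killing equation. -/
theorem killing (h : KSJet Λ al be dal dbe om A F φ) (a b : Fin 4) :
    -2 * (bil (dal a) (hat be) b + bil al (hat (dbe a)) b).im
      + -2 * (bil (dal b) (hat be) a + bil al (hat (dbe b)) a).im
      = ∑ c, (om a b c + om b a c) * killVec al be c := by
  set X : Fin 4 → Fin 4 → ℂ := fun a b =>
    bil (dal a) (hat be) b + bil al (hat (dbe a)) b - ∑ c, (om a b c : ℂ) * bil al (hat be) c with hX
  set Y : Fin 4 → Fin 4 → ℂ := fun a b =>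
    bil (hat (dal a)) be b + bil (hat al) (dbe a) b - ∑ c, (om a b c : ℂ) * bil (hat al) be c with hY
  have hconj : ∀ a b, (starRingEnd ℂ) (X a b) = -Y a b := by
    intro a b
    simp only [hX, hY, map_sub, map_add, map_sum, map_mul, conj_bil, hat_hat, bil_neg_right,
      Complex.conj_ofReal, mul_neg, Finset.sum_neg_distrib]
    ring
  -- The sum X + Y is the covariant derivative of n - n̄, up to the factor i that of K. In spinor
  -- components the A-terms cancel, φ multiplies a skew expression in the primed indices, and the
  -- ε-terms are skew under exchange of pairs, so the symmetric part vanishes.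
  have key : (fun a b => X a b + Y a b) = fun a b => -1 * (X b a + Y b a) := by
    refine ext_spinContr₂ fun C C' D D' => ?_
    rw [spinContr₂_mul, spinContr₂_swap (fun a b => X a b + Y a b), spinContr₂_add, spinContr₂_add,
      hX, hY,
      spinContr₂_covDeriv_bil h.antisymm al (hat be) dal (fun a => hat (dbe a)),
      spinContr₂_covDeriv_bil h.antisymm (hat al) be (fun a => hat (dal a)) dbe,
      spinContr₂_covDeriv_bil h.antisymm al (hat be) dal (fun a => hat (dbe a)),
      spinContr₂_covDeriv_bil h.antisymm (hat al) be (fun a => hat (dal a)) dbe]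
    simp only [h.eq_al, h.eq_be, h.eq_al_hat, h.eq_be_hat]
    have p4 := h.φ_eq
    obtain ⟨e00, e01, e10, e11⟩ := eps_vals
    fin_cases C <;> fin_cases C' <;> fin_cases D <;> fin_cases D' <;>
      simp only [Fin.zero_eta, Fin.mk_one, e00, e01, e10, e11, p4] <;> ring
  have key2 := congrFun (congrFun key a) b
  have him : ∀ a b, X a b + Y a b = 2 * Complex.I * ((X a b).im : ℂ) := by
    intro a b
    have := Complex.sub_conj (X a b)
    rw [hconj, sub_neg_eq_add] at this
    rw [this]
    push_cast
    ring
  simp only [him] at key2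
  have h2I : (2 * Complex.I : ℂ) ≠ 0 := mul_ne_zero two_ne_zero Complex.I_ne_zero
  have key3 : (X a b).im + (X b a).im = 0 := by
    have : (2 * Complex.I : ℂ) * (((X a b).im + (X b a).im : ℝ) : ℂ) = 0 := by
      push_cast
      linear_combination key2
    exact_mod_cast (mul_eq_zero.1 this).resolve_left h2I
  have e : ∀ a b, (X a b).im = (bil (dal a) (hat be) b + bil al (hat (dbe a)) b).im
      + 1 / 2 * ∑ c, om a b c * killVec al be c := by
    intro a b
    simp only [hX, Complex.sub_im, Complex.im_sum, Complex.im_ofReal_mul, killVec, Finset.mul_sum]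
    rw [sub_eq_add_neg, ← Finset.sum_neg_distrib]
    congr 1
    refine Finset.sum_congr rfl fun c _ => ?_
    ring
  rw [e, e] at key3
  simp only [add_mul, Finset.sum_add_distrib]
  linarith

/-- When α and its derivative vanish, what remains is (iφ_{PQ}/Λ - ε_{PQ}) β = 0. Skewing in P, Q
removes the symmetric φ and leaves β = 0. -/
theorem eq_zero_of_al_eq_zero (h : KSJet Λ al be dal dbe om A F φ) (hal : al = 0)
    (hdal : ∀ a, dal a = 0) : be = 0 := by
  have k := fun P P' => h.eq_al P P' 0
  have k' := fun P P' => h.eq_al P P' 1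
  have z : ∀ Q P P', spinContr (fun a => dal a Q + (spinMat (om a) *ᵥ al) Q) P P' = 0 := by
    intro Q P P'
    simp [hal, hdal, spinContr]
  obtain ⟨e00, e01, e10, e11⟩ := eps_vals
  ext i
  have k1 := k 1 i
  have k2 := k' 0 i
  rw [z, e10] at k1
  rw [z, e01] at k2
  rw [h.φ_eq, hal] at k1
  rw [hal] at k2
  simp only [Pi.zero_apply] at k1 k2 ⊢
  linear_combination -(1 / 2 : ℂ) * k1 + (1 / 2 : ℂ) * k2

/-- Only the term Λ ε α survives in the equation for β, and Λ ≠ 0. -/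
theorem eq_zero_of_be_eq_zero (h : KSJet Λ al be dal dbe om A F φ) (hΛ : Λ ≠ 0) (hbe : be = 0)
    (hdbe : ∀ a, dbe a = 0) : al = 0 := by
  have hL : (Λ : ℂ) ≠ 0 := by exact_mod_cast hΛ
  have k := fun P => h.eq_be P 0 1
  have z : ∀ P, spinContr (fun a => dbe a 1 + (spinMat' (om a) *ᵥ be) 1) P 0 = 0 := by
    intro P
    simp [hbe, hdbe, spinContr]
  ext i
  have k1 := k i
  rw [z, eps_vals.2.1, hbe] at k1
  simp only [Pi.zero_apply, mul_zero, zero_add, mul_one] at k1 ⊢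
  exact (mul_eq_zero.1 k1.symm).resolve_left hL

end KSJet
end SpinGeometry
end

noncomputable section
namespace SpinGeometry
open Set Filter Topology

/-! ### Bounds for the derivatives of the norms -/

theorem norm_sigma_le (a : Fin 4) (P P' : Fin 2) : ‖sigma a P P'‖ ≤ 1 := by
  have h : ‖((√2 : ℝ) : ℂ)⁻¹‖ ≤ 1 := by
    rw [norm_inv, Complex.norm_real, Real.norm_eq_abs, abs_of_nonneg (Real.sqrt_nonneg 2)]
    exact inv_le_one_of_one_le₀ (Real.one_le_sqrt.2 (by norm_num))
  fin_cases a <;> fin_cases P <;> fin_cases P' <;> simp [sigma] at h ⊢ <;> exact h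

theorem norm_vecOf_le {X : Fin 2 → Fin 2 → ℂ} {r : ℝ} (h : ∀ P P', ‖X P P'‖ ≤ r) (a : Fin 4) :
    ‖vecOf X a‖ ≤ 4 * r := by
  have h1 : ∀ P P', ‖(starRingEnd ℂ) (sigma a P P') * X P P'‖ ≤ r := by
    intro P P'
    rw [norm_mul, RCLike.norm_conj]
    have := mul_le_mul (norm_sigma_le a P P') (h P P') (norm_nonneg _) zero_le_one
    rwa [one_mul] at this
  unfold vecOf
  simp only [Fin.sum_univ_two]
  have e1 := norm_add_le (((starRingEnd ℂ) (sigma a 0 0) * X 0 0) + ((starRingEnd ℂ) (sigma a 0 1) * X 0 1))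
    (((starRingEnd ℂ) (sigma a 1 0) * X 1 0) + ((starRingEnd ℂ) (sigma a 1 1) * X 1 1))
  have e2 := norm_add_le ((starRingEnd ℂ) (sigma a 0 0) * X 0 0) ((starRingEnd ℂ) (sigma a 0 1) * X 0 1)
  have e3 := norm_add_le ((starRingEnd ℂ) (sigma a 1 0) * X 1 0) ((starRingEnd ℂ) (sigma a 1 1) * X 1 1)
  linarith [h1 0 0, h1 0 1, h1 1 0, h1 1 1]

theorem normSq_le_spinNorm (ψ : Fin 2 → ℂ) (i : Fin 2) : ‖ψ i‖ ^ 2 ≤ spinNorm ψ := by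
  have h0 := Complex.normSq_nonneg (ψ 0)
  have h1 := Complex.normSq_nonneg (ψ 1)
  rw [← Complex.normSq_eq_norm_sq, spinNorm]
  fin_cases i <;> simp only [Fin.zero_eta, Fin.mk_one] <;> linarith

theorem spinNorm_hat (ψ : Fin 2 → ℂ) : spinNorm (hat ψ) = spinNorm ψ := by
  simp only [spinNorm, hat_zero, hat_one, Complex.normSq_neg, Complex.normSq_conj]
  ring

theorem norm_mul_le_spinNorm (ψ χ : Fin 2 → ℂ) (i j : Fin 2) :
    ‖ψ i * χ j‖ ≤ spinNorm ψ + spinNorm χ := by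
  rw [norm_mul]
  nlinarith [normSq_le_spinNorm ψ i, normSq_le_spinNorm χ j, sq_nonneg (‖ψ i‖ - ‖χ j‖),
    norm_nonneg (ψ i), norm_nonneg (χ j), sq_nonneg (‖ψ i‖), sq_nonneg ‖χ j‖]

theorem abs_re_bil_le (ψ χ : Fin 2 → ℂ) (a : Fin 4) :
    |(bil ψ χ a).re| ≤ 4 * (spinNorm ψ + spinNorm χ) :=
  (Complex.abs_re_le_norm _).trans
    (norm_vecOf_le (fun P P' => norm_mul_le_spinNorm ψ χ P P') a)

namespace KSJet

variable {Λ : ℝ} {al be : Fin 2 → ℂ} {dal dbe : Fin 4 → Fin 2 → ℂ}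
    {om : Fin 4 → Fin 4 → Fin 4 → ℝ} {A : Fin 4 → ℝ} {F : Fin 4 → Fin 4 → ℝ}
    {φ : Matrix (Fin 2) (Fin 2) ℂ}

theorem norm_φ_le (h : KSJet Λ al be dal dbe om A F φ) (P Q : Fin 2) :
    ‖φ P Q‖ ≤ ∑ a, ∑ b, |F a b| := by
  have hf := h.field P 0 Q 1
  rw [eps_vals.2.1, mul_one, spinContr₂_eq_sum] at hf
  rw [← hf]
  refine (norm_sum_le _ _).trans (Finset.sum_le_sum fun a _ => ?_)
  refine (norm_sum_le _ _).trans (Finset.sum_le_sum fun b _ => ?_)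
  rw [norm_mul, norm_mul, Complex.norm_real, Real.norm_eq_abs]
  calc |F a b| * ‖sigma a P 0‖ * ‖sigma b Q 1‖ ≤ |F a b| * 1 * 1 := by
        gcongr
        · exact norm_sigma_le _ _ _
        · exact norm_sigma_le _ _ _
    _ = |F a b| := by ring

theorem abs_dNorm_be_le (h : KSJet Λ al be dal dbe om A F φ) (a : Fin 4) :
    |dNorm be (dbe a)| ≤ 8 * |Λ| * (spinNorm al + spinNorm be) := by
  rw [h.dNorm_be, abs_mul, abs_mul, abs_two]
  have := abs_re_bil_le al (hat be) a
  rw [spinNorm_hat] at this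
  nlinarith [abs_nonneg Λ]

/-- The bound must also hold where α = 0, so it uses the undecomposed formula for d|α|² rather than
the components of φ along α. That formula is quadratic in the spinors with coefficients bounded by
|F|. A factor 4 comes from passing from spinor to vector components. -/
theorem abs_dNorm_al_le (h : KSJet Λ al be dal dbe om A F φ) (a : Fin 4) :
    |dNorm al (dal a)|
      ≤ (8 + 16 * |Λ|⁻¹ * ∑ a, ∑ b, |F a b|) * (spinNorm al + spinNorm be) := by
  set s := ∑ a, ∑ b, |F a b|
  have hs : 0 ≤ s := Finset.sum_nonneg fun a _ => Finset.sum_nonneg fun b _ => abs_nonneg _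
  set n := spinNorm al + spinNorm be
  have e : (dNorm al (dal a) : ℂ) = vecOf (spinContr fun a => (dNorm al (dal a) : ℂ)) a := by
    rw [vecOf_spinContr]
  have hn : ‖(dNorm al (dal a) : ℂ)‖ = |dNorm al (dal a)| := by
    rw [Complex.norm_real, Real.norm_eq_abs]
  rw [← hn, e]
  have key : ∀ P P', ‖spinContr (fun a => (dNorm al (dal a) : ℂ)) P P'‖
      ≤ (2 + 4 * |Λ|⁻¹ * s) * n := by
    intro P P'
    rw [h.spinContr_dNorm_al]
    have b1 : ∀ i j, ‖al i * hat be j‖ ≤ n := fun i j => by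
      simpa only [spinNorm_hat] using norm_mul_le_spinNorm al (hat be) i j
    have b2 : ∀ i j, ‖hat al i * be j‖ ≤ n := fun i j => by
      simpa only [spinNorm_hat] using norm_mul_le_spinNorm (hat al) be i j
    have b3 : ∀ P Q i j, ‖φ P Q * (al i * hat be j)‖ ≤ s * n := fun P Q i j => by
      rw [norm_mul]
      exact mul_le_mul (h.norm_φ_le P Q) (b1 i j) (norm_nonneg _) hs
    have b4 : ∀ P Q i j, ‖φ P Q * (hat al i * be j)‖ ≤ s * n := fun P Q i j => by
      rw [norm_mul]
      exact mul_le_mul (h.norm_φ_le P Q) (b2 i j) (norm_nonneg _) hs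
    have hI : ‖Complex.I / (Λ : ℂ)‖ = |Λ|⁻¹ := by
      rw [norm_div, Complex.norm_I, Complex.norm_real, Real.norm_eq_abs, one_div]
    have e2 : (φ P 1 * hat al 0 - φ P 0 * hat al 1) * be P'
        + (φ P 1 * al 0 - φ P 0 * al 1) * hat be P'
        = (φ P 1 * (hat al 0 * be P') - φ P 0 * (hat al 1 * be P'))
        + (φ P 1 * (al 0 * hat be P') - φ P 0 * (al 1 * hat be P')) := by ring
    rw [e2]
    refine (norm_add_le _ _).trans ?_
    rw [norm_mul, hI]
    have t1 := norm_sub_le (al P * hat be P') (hat al P * be P')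
    have t2 := norm_add_le (φ P 1 * (hat al 0 * be P') - φ P 0 * (hat al 1 * be P'))
      (φ P 1 * (al 0 * hat be P') - φ P 0 * (al 1 * hat be P'))
    have t3 := norm_sub_le (φ P 1 * (hat al 0 * be P')) (φ P 0 * (hat al 1 * be P'))
    have t4 := norm_sub_le (φ P 1 * (al 0 * hat be P')) (φ P 0 * (al 1 * hat be P'))
    have hL : 0 ≤ |Λ|⁻¹ := inv_nonneg.2 (abs_nonneg _)
    have t5 : |Λ|⁻¹ * ‖(φ P 1 * (hat al 0 * be P') - φ P 0 * (hat al 1 * be P'))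
      + (φ P 1 * (al 0 * hat be P') - φ P 0 * (al 1 * hat be P'))‖ ≤ |Λ|⁻¹ * (4 * (s * n)) := by
      refine mul_le_mul_of_nonneg_left ?_ hL
      linarith [b3 P 1 0 P', b3 P 0 1 P', b4 P 1 0 P', b4 P 0 1 P']
    linarith [b1 P P', b2 P P']
  refine (norm_vecOf_le key a).trans (le_of_eq ?_)
  ring

end KSJet

/-! ### Curvature tensors of anti-self-dual Einstein type -/

/-- The Ricci tensor of a curvature tensor. -/
def algRicci (R : Fin 4 → Fin 4 → Fin 4 → Fin 4 → ℝ) (b c : Fin 4) : ℝ := ∑ a, R a b c a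

/-- The Weyl tensor of a curvature tensor. -/
def algWeyl (R : Fin 4 → Fin 4 → Fin 4 → Fin 4 → ℝ) (a b c d : Fin 4) : ℝ :=
  R a b c d
    - (algRicci R b c * kd a d - algRicci R a c * kd b d
        + kd b c * algRicci R a d - kd a c * algRicci R b d) / 2
    + (∑ e, algRicci R e e) / 6 * (kd b c * kd a d - kd a c * kd b d)

/-- The Hodge dual of a two-form which is anti-self-dual. -/
theorem hodge_eq_neg {W : Fin 4 → Fin 4 → ℝ} (h : ∀ a b, W a b = -W b a) (h1 : W 0 1 = -W 2 3)
    (h2 : W 0 2 = W 1 3) (h3 : W 0 3 = -W 1 2) (a b : Fin 4) :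
    (∑ e, ∑ f, leviCivita a b e f * W e f) / 2 = -W a b := by
  have d : ∀ b, W b b = 0 := fun b => by linarith [h b b]
  -- This is the Laplace expansion of the 4 × 4 determinant along its first two rows, by
  -- complementary 2 × 2 minors.
  have e : ∀ a b c d : Fin 4, leviCivita a b c d
    = (kd a 0 * kd b 1 - kd a 1 * kd b 0) * (kd c 2 * kd d 3 - kd c 3 * kd d 2)
    - (kd a 0 * kd b 2 - kd a 2 * kd b 0) * (kd c 1 * kd d 3 - kd c 3 * kd d 1)
    + (kd a 0 * kd b 3 - kd a 3 * kd b 0) * (kd c 1 * kd d 2 - kd c 2 * kd d 1)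
    + (kd a 1 * kd b 2 - kd a 2 * kd b 1) * (kd c 0 * kd d 3 - kd c 3 * kd d 0)
    - (kd a 1 * kd b 3 - kd a 3 * kd b 1) * (kd c 0 * kd d 2 - kd c 2 * kd d 0)
    + (kd a 2 * kd b 3 - kd a 3 * kd b 2) * (kd c 0 * kd d 1 - kd c 1 * kd d 0) := by
    intro a b c d
    rw [leviCivita, Matrix.det_succ_row_zero]
    simp [Fin.sum_univ_succ, Matrix.det_fin_three, Fin.succAbove]
    ring
  have w : ∀ (x : Fin 4 → Fin 4 → ℝ), ∑ e, ∑ f, x e f * W e f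
      = (x 0 1 - x 1 0 - (x 2 3 - x 3 2)) * W 0 1 + (x 0 2 - x 2 0 + (x 1 3 - x 3 1)) * W 0 2
        + (x 0 3 - x 3 0 - (x 1 2 - x 2 1)) * W 0 3 := by
    intro x
    simp only [Fin.sum_univ_four, d, h 1 0, h 2 0, h 3 0, h 2 1, h 3 1, h 3 2]
    have h1' : W 2 3 = -W 0 1 := by linarith
    have h3' : W 1 2 = -W 0 3 := by linarith
    rw [h1', h3', ← h2]
    ring
  rw [w]
  simp only [e]
  fin_cases a <;> fin_cases b <;>
    simp [kd, d, h 1 0, h 2 0, h 3 0, h 2 1, h 3 1, h 3 2] <;> linarith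

/-- Subtracting the curvature of constant type κ leaves a tensor T that is anti-self-dual in its
last pair. The first Bianchi identity gives pair symmetry, so T is anti-self-dual in both pairs.
Such a tensor has no trace-free Ricci part, and the Bianchi identity also kills its scalar. Thus T
is the Weyl tensor and Ric is that of the model. -/
theorem asd_einstein_of_spin {R : Fin 4 → Fin 4 → Fin 4 → Fin 4 → ℝ} {κ : ℝ}
    (hab : ∀ a b c d, R a b c d = -R b a c d) (hcd : ∀ a b c d, R a b c d = -R a b d c)
    (hB : ∀ a b c d, R a b c d + R b c a d + R c a b d = 0)
    (h : ∀ a b, ∀ T : Fin 4 → Fin 4 → ℝ,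
      (∀ c d, T c d = R a b c d - κ * (kd b c * kd a d - kd a c * kd b d)) →
      T 0 1 = -T 2 3 ∧ T 0 2 = T 1 3 ∧ T 0 3 = -T 1 2) :
    (∀ a b, algRicci R a b = 3 * κ * kd a b) ∧
    ∀ a b c d, (∑ e, ∑ f, leviCivita a b e f * algWeyl R e f c d) / 2 = -algWeyl R a b c d := by
  set T : Fin 4 → Fin 4 → Fin 4 → Fin 4 → ℝ :=
    fun a b c d => R a b c d - κ * (kd b c * kd a d - kd a c * kd b d) with hT
  have kds : ∀ a b, kd a b = kd b a := fun a b => by simp only [kd, eq_comm]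
  have tab : ∀ a b c d, T a b c d = -T b a c d := by
    intro a b c d
    simp only [hT, hab a b c d]
    ring
  have tcd : ∀ a b c d, T a b c d = -T a b d c := by
    intro a b c d
    simp only [hT, hcd a b c d]
    ring
  have tB : ∀ a b c d, T a b c d + T b c a d + T c a b d = 0 := by
    intro a b c d
    simp only [hT]
    rw [kds c a, kds b a, kds c b]
    linear_combination hB a b c d
  -- The usual octahedron argument: pair symmetry is a combination of four cyclic identities and the
  -- two skew symmetries.
  have pair : ∀ a b c d, T a b c d = T c d a b := by
    intro a b c d
    linarith [tB a b c d, tB b c d a, tB c d a b, tB d a b c, tcd a b c d, tcd b c a d, tcd c a b d,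
      tab c a b d, tab d b c a, tcd d b c a, tcd a c d b, tab a c d b, tab c d a b, tcd c d a b,
      tab d a b c, tcd d a b c, tab b d a c, tcd b d a c, tcd b c d a, tab a c b d, tab b d c a]
  have t1 : ∀ a b, T a b 0 1 = -T a b 2 3 := fun a b => (h a b (T a b) fun _ _ => rfl).1
  have t2 : ∀ a b, T a b 0 2 = T a b 1 3 := fun a b => (h a b (T a b) fun _ _ => rfl).2.1
  have t3 : ∀ a b, T a b 0 3 = -T a b 1 2 := fun a b => (h a b (T a b) fun _ _ => rfl).2.2
  have zab : ∀ a c d, T a a c d = 0 := fun a c d => by linarith [tab a a c d]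
  have zcd : ∀ a b c, T a b c c = 0 := fun a b c => by linarith [tcd a b c c]
  -- With all components reduced to the pairs 01, 02, 03, the off-diagonal traces cancel by pair
  -- symmetry. The diagonal ones reduce to the single cyclic identity b1.
  have ric : ∀ b c, ∑ a, T a b c a = 0 := by
    intro b c
    have u1 : ∀ c d, T 0 1 c d = -T 2 3 c d := fun c d => by rw [pair, t1, pair c d]
    have u2 : ∀ c d, T 0 2 c d = T 1 3 c d := fun c d => by rw [pair, t2, pair c d]
    have u3 : ∀ c d, T 0 3 c d = -T 1 2 c d := fun c d => by rw [pair, t3, pair c d]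
    have b1 := tB 0 1 2 3
    have p1 := pair 2 3 1 3
    have p2 := pair 2 3 1 2
    have p3 := pair 1 3 1 2
    rw [Fin.sum_univ_four]
    fin_cases b <;> fin_cases c <;>
      simp only [Fin.zero_eta, Fin.mk_one, Fin.reduceFinMk, zab, zcd, tab 1 0, tab 2 0, tab 3 0,
        tab 2 1, tab 3 1, tab 3 2, tcd _ _ 1 0, tcd _ _ 2 0, tcd _ _ 3 0, tcd _ _ 2 1, tcd _ _ 3 1,
        tcd _ _ 3 2, u1, u2, u3, t1, t2, t3] at b1 ⊢ <;>
      linarith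
  have hRT : ∀ a b c d, R a b c d = T a b c d + κ * (kd b c * kd a d - kd a c * kd b d) := by
    intro a b c d
    simp only [hT]
    ring
  have hric : ∀ a b, algRicci R a b = 3 * κ * kd a b := by
    intro b c
    have e : algRicci R b c = ∑ a, T a b c a
        + ∑ a, κ * (kd b c * kd a a - kd a c * kd b a) := by
      rw [← Finset.sum_add_distrib]
      exact Finset.sum_congr rfl fun a _ => hRT a b c a
    rw [e, ric, Fin.sum_univ_four]
    fin_cases b <;> fin_cases c <;> simp [kd] <;> ring
  refine ⟨hric, fun a b c d => ?_⟩
  have hW : ∀ a b c d, algWeyl R a b c d = T a b c d := by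
    intro a b c d
    have e : ∑ e : Fin 4, 3 * κ * kd e e = 12 * κ := by
      simp [kd]
      ring
    simp only [algWeyl, hric, hRT a b c d]
    rw [e]
    ring
  simp only [hW]
  refine hodge_eq_neg (W := fun e f => T e f c d) (fun a b => tab a b c d) ?_ ?_ ?_ a b
  · simp only [pair _ _ c d]; exact t1 c d
  · simp only [pair _ _ c d]; exact t2 c d
  · simp only [pair _ _ c d]; exact t3 c d

end SpinGeometry
end

/-! ### Integrability of the equation for β and its consequence for the curvature. -/

noncomputable section
namespace SpinGeometry
open Set Filter Topology

theorem spinMat'_sum (c : Fin 4 → ℝ) (y : Fin 4 → Fin 4 → Fin 4 → ℝ) :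
    spinMat' (fun b d => ∑ e, c e * y e b d) = ∑ e, (c e : ℂ) • spinMat' (y e) := by
  simp only [← spinMat'_mul, Fin.sum_univ_four]
  rw [spinMat'_add, spinMat'_add, spinMat'_add]

/-- The action of a curvature operator of constant curvature on a spinor. -/
theorem spinContr₂_spinMat'_const (κ : ℝ) (ψ : Fin 2 → ℂ) (B' C C' A A' : Fin 2) :
    spinContr₂ (fun a b =>
        (spinMat' (fun c d => κ * (kd b c * kd a d - kd a c * kd b d)) *ᵥ ψ) B') C C' A A'
      = κ / 2 * eps C A * (eps A' B' * ψ C' + eps C' B' * ψ A') := by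
  have hr := inv_sqrt_two_mul_self
  have hI := Complex.I_mul_I
  have e : ∀ a b, spinMat' (fun c d => κ * (kd b c * kd a d - kd a c * kd b d))
      = suMat (κ * (kd b 0 * kd a 1 - kd a 0 * kd b 1 + (kd b 2 * kd a 3 - kd a 2 * kd b 3)) / 2)
        (-(κ * (kd b 0 * kd a 3 - kd a 0 * kd b 3 + (kd b 1 * kd a 2 - kd a 1 * kd b 2))) / 2)
        (κ * (kd b 0 * kd a 2 - kd a 0 * kd b 2 - (kd b 1 * kd a 3 - kd a 1 * kd b 3)) / 2) := by
    intro a b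
    rw [spinMat'_eq (fun c d => by ring)]
    congr 1 <;> ring
  simp only [e]
  have k0 := fun p q r => (suMat_mulVec p q r ψ).1
  have k1 := fun p q r => (suMat_mulVec p q r ψ).2
  rw [spinContr₂_eq_sum]
  simp only [Fin.sum_univ_four]
  obtain ⟨e00, e01, e10, e11⟩ := eps_vals
  fin_cases B' <;> simp only [Fin.zero_eta, Fin.mk_one, k0, k1] <;> clear k0 k1 e <;>
    simp only [kd, Fin.isValue, Fin.reduceEq, if_true, if_false] <;>
    fin_cases C <;> fin_cases C' <;> fin_cases A <;> fin_cases A' <;>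
    simp only [Fin.zero_eta, Fin.mk_one, e00, e01, e10, e11] <;>
    simp [sigma] <;> grind

/-- The curvature tensor determined by connection coefficients and their derivatives. -/
def algRiem (om : Fin 4 → Fin 4 → Fin 4 → ℝ) (dom : Fin 4 → Fin 4 → Fin 4 → Fin 4 → ℝ)
    (a b c d : Fin 4) : ℝ :=
  dom a b c d - dom b a c d + ∑ e, (om b c e * om a e d - om a c e * om b e d)
    - ∑ e, (om a b e - om b a e) * om e c d

namespace KSJet

variable {Λ : ℝ} {al be : Fin 2 → ℂ} {dal dbe : Fin 4 → Fin 2 → ℂ}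
    {om : Fin 4 → Fin 4 → Fin 4 → ℝ} {A : Fin 4 → ℝ} {F : Fin 4 → Fin 4 → ℝ}
    {φ : Matrix (Fin 2) (Fin 2) ℂ}

theorem dbe_eq (h : KSJet Λ al be dal dbe om A F φ) (a : Fin 4) (B' : Fin 2) :
    dbe a B' = Complex.I * A a * be B' + Λ * cliff a al B' - (spinMat' (om a) *ᵥ be) B' := by
  have e : (fun a => dbe a B' + (spinMat' (om a) *ᵥ be) B')
      = fun a => Complex.I * be B' * A a + Λ * cliff a al B' := by
    refine ext_spinContr fun P P' => ?_
    rw [h.eq_be, spinContr_add, spinContr_mul, spinContr_mul, spinContr_cliff]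
    ring
  linear_combination congrFun e a

/-- The integrability condition of the equation for `β`. -/
theorem spinMat'_algRiem (h : KSJet Λ al be dal dbe om A F φ) (hΛ : Λ ≠ 0)
    {dA : Fin 4 → Fin 4 → ℝ} {dom : Fin 4 → Fin 4 → Fin 4 → Fin 4 → ℝ}
    {ddbe : Fin 4 → Fin 4 → Fin 2 → ℂ}
    (hF : ∀ a b, F a b = dA a b - dA b a - ∑ e, (om a b e - om b a e) * A e)
    (hdd : ∀ a b B', ddbe a b B' = Complex.I * (dA a b * be B' + A b * dbe a B')
      + Λ * cliff b (dal a) B' - (spinMat' (dom a b) *ᵥ be) B' - (spinMat' (om b) *ᵥ dbe a) B')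
    (hc : ∀ a b B', ddbe a b B' - ddbe b a B' = ∑ e, ((om a b e - om b a e : ℝ) : ℂ) * dbe e B')
    (a b : Fin 4) (B' : Fin 2) :
    (spinMat' (algRiem om dom a b) *ᵥ be) B'
      = (spinMat' (fun c d => -2 * Λ * (kd b c * kd a d - kd a c * kd b d)) *ᵥ be) B' := by
  -- The spin representation is a homomorphism of Lie algebras, so the curvature of the tangent
  -- bundle acts on S' as the curvature of the spin connection.
  have e1 : (spinMat' (algRiem om dom a b) *ᵥ be) B'
      = (spinMat' (dom a b) *ᵥ be) B' - (spinMat' (dom b a) *ᵥ be) B'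
        + ((spinMat' (om a) *ᵥ (spinMat' (om b) *ᵥ be)) B'
          - (spinMat' (om b) *ᵥ (spinMat' (om a) *ᵥ be)) B')
        - ∑ e, ((om a b e - om b a e : ℝ) : ℂ) * (spinMat' (om e) *ᵥ be) B' := by
    have e2 : algRiem om dom a b = fun c d => dom a b c d - dom b a c d
        + (∑ e, (om b c e * om a e d - om a c e * om b e d))
        - (∑ e, (om a b e - om b a e) * om e c d) := rfl
    rw [e2, spinMat'_sub, spinMat'_add, spinMat'_sub,
      spinMat'_commutator (h.antisymm a) (h.antisymm b), spinMat'_sum]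
    simp only [Matrix.sub_mulVec, Matrix.add_mulVec, Matrix.sum_mulVec, Matrix.smul_mulVec,
      Matrix.mulVec_mulVec, Pi.sub_apply, Pi.add_apply, Finset.sum_apply, Pi.smul_apply, smul_eq_mul]
  have e3 : ∀ a b, (spinMat' (om b) *ᵥ dbe a) B' = Complex.I * A a * (spinMat' (om b) *ᵥ be) B'
      + Λ * (spinMat' (om b) *ᵥ cliff a al) B'
      - (spinMat' (om b) *ᵥ (spinMat' (om a) *ᵥ be)) B' := by
    intro a b
    have : dbe a = (Complex.I * A a) • be + (Λ : ℂ) • cliff a al - spinMat' (om a) *ᵥ be := by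
      funext B'
      rw [h.dbe_eq]
      rfl
    rw [this, Matrix.mulVec_sub, Matrix.mulVec_add, Matrix.mulVec_smul, Matrix.mulVec_smul]
    rfl
  set X : Fin 4 → Fin 2 → ℂ := fun a => dal a + spinMat (om a) *ᵥ al with hX
  have e4 : ∀ a b, cliff b (dal a) B' + (spinMat' (om a) *ᵥ cliff b al) B'
      = cliff b (X a) B' + ∑ c, (om a b c : ℂ) * cliff c al B' := by
    intro a b
    rw [hX, cliff_add]
    linear_combination cliff_connection (h.antisymm a) al b B'
  have hcc := hc a b B'
  rw [hdd, hdd, e3, e3] at hcc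
  have hFc : (F a b : ℂ) = dA a b - dA b a - ∑ e, ((om a b e - om b a e : ℝ) : ℂ) * A e := by
    rw [hF]
    push_cast
    rfl
  have e5 : ∑ e, ((om a b e - om b a e : ℝ) : ℂ) * dbe e B'
      = Complex.I * (∑ e, ((om a b e - om b a e : ℝ) : ℂ) * A e) * be B'
        + Λ * (∑ e, ((om a b e : ℝ) : ℂ) * cliff e al B' - ∑ e, ((om b a e : ℝ) : ℂ) * cliff e al B')
        - ∑ e, ((om a b e - om b a e : ℝ) : ℂ) * (spinMat' (om e) *ᵥ be) B' := by
    simp only [h.dbe_eq, Finset.mul_sum, Finset.sum_mul, ← Finset.sum_sub_distrib,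
      ← Finset.sum_add_distrib]
    refine Finset.sum_congr rfl fun e _ => ?_
    push_cast
    ring
  -- The terms quadratic in the connection cancel against those in the commutator of derivatives of
  -- β. Parallelism of Clifford multiplication turns dα into the covariant derivative X, for which
  -- the first Killing spinor equation is available.
  have main : (spinMat' (algRiem om dom a b) *ᵥ be) B' = Complex.I * be B' * F a b
      + Complex.I * Λ * (cliff a al B' * A b - A a * cliff b al B')
      + Λ * (cliff b (X a) B' - cliff a (X b) B') := by
    rw [e1, hFc]
    rw [e5] at hcc
    rw [h.dbe_eq a, h.dbe_eq b] at hcc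
    linear_combination -hcc + Λ * e4 a b - Λ * e4 b a
  rw [main]
  refine congrFun (congrFun (ext_spinContr₂ (X := fun a b => Complex.I * be B' * F a b
      + Complex.I * Λ * (cliff a al B' * A b - A a * cliff b al B')
      + Λ * (cliff b (X a) B' - cliff a (X b) B')) (Y := fun a b =>
      (spinMat' (fun c d => -2 * Λ * (kd b c * kd a d - kd a c * kd b d)) *ᵥ be) B')
      fun C C' D D' => ?_) a) b
  have hX1 : ∀ C C' D D', spinContr₂ (fun a b => cliff b (X a) B') C C' D D'
      = eps D' B' * spinContr (fun a => X a D) C C' := by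
    intro C C' D D'
    unfold spinContr₂
    simp only [spinContr_cliff, spinContr_mul]
  have hX2 : ∀ C C' Q, spinContr (fun a => X a Q) C C' = _ := fun C C' Q => h.eq_al C C' Q
  rw [spinContr₂_spinMat'_const, spinContr₂_add, spinContr₂_add, spinContr₂_mul, spinContr₂_mul,
    spinContr₂_mul, spinContr₂_sub, spinContr₂_sub, h.field, spinContr₂_prod, spinContr₂_prod,
    hX1, spinContr₂_swap (fun a b => cliff b (X a) B'), hX1, hX2, hX2, spinContr_cliff,
    spinContr_cliff]
  have p4 := h.φ_eq
  obtain ⟨e00, e01, e10, e11⟩ := eps_vals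
  have hL : (Λ : ℂ) ≠ 0 := by exact_mod_cast hΛ
  -- Writing i = Λ·(i/Λ) puts the φ-terms from iFβ and from ∇α over the same coefficient. They then
  -- add up to φ_{CD} times the cyclic sum of ε_{C'D'} β_{B'}, which vanishes in two dimensions.
  have hL2 : (Λ : ℂ) * (Complex.I / Λ) = Complex.I := by field_simp
  generalize Complex.I / (Λ : ℂ) = r at *
  rw [← hL2]
  push_cast
  clear hX2 hX1 main hcc e5 hFc e4 e3 e1 hX
  fin_cases B' <;> fin_cases C <;> fin_cases C' <;> fin_cases D <;> fin_cases D' <;>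
    simp only [Fin.zero_eta, Fin.mk_one, e00, e01, e10, e11, p4] <;> ring

/-- The curvature of a solution is that of an anti-self-dual Einstein metric. -/
theorem asd_einstein (h : KSJet Λ al be dal dbe om A F φ) (hΛ : Λ ≠ 0) (hbe : be ≠ 0)
    {dA : Fin 4 → Fin 4 → ℝ} {dom : Fin 4 → Fin 4 → Fin 4 → Fin 4 → ℝ}
    {ddbe : Fin 4 → Fin 4 → Fin 2 → ℂ}
    (hF : ∀ a b, F a b = dA a b - dA b a - ∑ e, (om a b e - om b a e) * A e)
    (hdd : ∀ a b B', ddbe a b B' = Complex.I * (dA a b * be B' + A b * dbe a B')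
      + Λ * cliff b (dal a) B' - (spinMat' (dom a b) *ᵥ be) B' - (spinMat' (om b) *ᵥ dbe a) B')
    (hc : ∀ a b B', ddbe a b B' - ddbe b a B' = ∑ e, ((om a b e - om b a e : ℝ) : ℂ) * dbe e B')
    (hdom : ∀ a b c d, dom a b c d = -dom a b d c)
    (hB : ∀ a b c d, algRiem om dom a b c d + algRiem om dom b c a d + algRiem om dom c a b d = 0) :
    (∀ a b, algRicci (algRiem om dom) a b = -6 * Λ * kd a b) ∧
    ∀ a b c d, (∑ e, ∑ f, leviCivita a b e f * algWeyl (algRiem om dom) e f c d) / 2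
      = -algWeyl (algRiem om dom) a b c d := by
  have hcd : ∀ a b c d, algRiem om dom a b c d = -algRiem om dom a b d c := by
    intro a b c d
    simp only [algRiem, hdom a b c d, hdom b a c d, Fin.sum_univ_four, h.antisymm _ d c]
    have e : ∀ e, om b c e * om a e d - om a c e * om b e d
        = -(om b d e * om a e c - om a d e * om b e c) := by
      intro e
      rw [h.antisymm b c e, h.antisymm a e d, h.antisymm a c e, h.antisymm b e d]
      ring
    simp only [e, h.antisymm _ c d]
    ring
  have key := asd_einstein_of_spin (R := algRiem om dom) (κ := -2 * Λ) ?_ hcd hB ?_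
  · refine ⟨fun a b => ?_, key.2⟩
    rw [key.1]
    ring
  · intro a b c d
    simp only [algRiem, Fin.sum_univ_four]
    ring
  · intro a b T hT
    have hTa : ∀ c d, T c d = -T d c := by
      intro c d
      rw [hT, hT, hcd a b c d]
      ring
    have hz : spinMat' T *ᵥ be = 0 := by
      have e : T = fun c d => algRiem om dom a b c d
          - -2 * Λ * (kd b c * kd a d - kd a c * kd b d) := by
        funext c d
        exact hT c d
      rw [e, spinMat'_sub, Matrix.sub_mulVec]
      funext B'
      rw [Pi.sub_apply, Pi.zero_apply, sub_eq_zero]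
      exact h.spinMat'_algRiem hΛ hF hdd hc a b B'
    rw [spinMat'_eq hTa] at hz
    obtain ⟨z1, z2, z3⟩ := suMat_eq_zero_of_mulVec hbe hz
    refine ⟨?_, ?_, ?_⟩ <;> linarith

end KSJet
end SpinGeometry
end

noncomputable section
namespace SpinGeometry
open Set Filter Topology

/-! ### Frames on open subsets of `ℝ⁴` -/

/-- The linear map with the given values on the standard basis. -/
def frameMap (e : Fin 4 → E4) : E4 →L[ℝ] E4 :=
  ∑ a, (EuclideanSpace.proj a : E4 →L[ℝ] ℝ).smulRight (e a)

theorem frameMap_apply (e : Fin 4 → E4) (v : E4) : frameMap e v = ∑ a, v a • e a := by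
  simp [frameMap]

/-- The coframe dual to a frame. -/
def coframe (e : Fin 4 → E4 → E4) (a : Fin 4) (x : E4) : E4 →L[ℝ] ℝ :=
  (EuclideanSpace.proj a : E4 →L[ℝ] ℝ).comp (frameMap fun b => e b x).inverse

theorem exists_frameEquiv {e : Fin 4 → E4} (h : LinearIndependent ℝ e) :
    ∃ L : E4 ≃L[ℝ] E4, (L : E4 →L[ℝ] E4) = frameMap e := by
  have hinj : Function.Injective (frameMap e) := by
    rw [injective_iff_map_eq_zero]
    intro v hv
    rw [frameMap_apply] at hv
    ext a
    exact Fintype.linearIndependent_iff.1 h _ hv a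
  refine ⟨(LinearEquiv.ofInjectiveEndo (frameMap e : E4 →ₗ[ℝ] E4) hinj).toContinuousLinearEquiv, ?_⟩
  ext v : 1
  rfl

section Frame

variable {e : Fin 4 → E4 → E4} {x : E4}

theorem coframe_apply (h : LinearIndependent ℝ fun a => e a x) (a b : Fin 4) :
    coframe e a x (e b x) = kd a b := by
  obtain ⟨L, hL⟩ := exists_frameEquiv h
  have : L (EuclideanSpace.single b 1) = e b x := by
    have h1 : L (EuclideanSpace.single b 1) = frameMap (fun c => e c x) (EuclideanSpace.single b 1) := by
      rw [← hL]; rfl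
    rw [h1, frameMap_apply]
    simp [PiLp.single_apply]
  rw [coframe, ← hL, ContinuousLinearMap.inverse_equiv]
  simp only [ContinuousLinearMap.comp_apply, ContinuousLinearEquiv.coe_coe]
  rw [← this, L.symm_apply_apply]
  simp [kd, PiLp.single_apply]

theorem sum_coframe (h : LinearIndependent ℝ fun a => e a x) (v : E4) :
    ∑ a, coframe e a x v • e a x = v := by
  obtain ⟨L, hL⟩ := exists_frameEquiv h
  simp only [coframe, ← hL, ContinuousLinearMap.inverse_equiv]
  have := frameMap_apply (fun a => e a x) (L.symm v)
  rw [← hL] at this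
  simp only [ContinuousLinearEquiv.coe_coe, L.apply_symm_apply] at this
  exact this.symm

theorem coframe_unique (h : LinearIndependent ℝ fun a => e a x) {c : Fin 4 → ℝ} {v : E4}
    (hv : v = ∑ b, c b • e b x) (a : Fin 4) : coframe e a x v = c a := by
  rw [hv, map_sum]
  simp only [map_smul, coframe_apply h, smul_eq_mul, kd]
  simp

theorem contDiffAt_coframe (h : LinearIndependent ℝ fun a => e a x)
    (he : ∀ a, ContDiffAt ℝ ∞ (e a) x) (a : Fin 4) : ContDiffAt ℝ ∞ (coframe e a) x := by
  obtain ⟨L, hL⟩ := exists_frameEquiv h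
  have h1 : ContDiffAt ℝ ∞ (fun y => frameMap fun b => e b y) x := by
    unfold frameMap
    exact ContDiffAt.sum fun b _ => contDiffAt_const.smulRight (he b)
  have h2 : ContDiffAt ℝ ∞ (fun y => (frameMap fun b => e b y).inverse) x := by
    have := contDiffAt_map_inverse (𝕜 := ℝ) (n := ∞) L
    rw [hL] at this
    exact this.comp x h1
  exact contDiffAt_const.clm_comp h2

/-- The structure functions of a frame. -/
def frameC (e : Fin 4 → E4 → E4) (a b c : Fin 4) (x : E4) : ℝ :=
  coframe e c x (fderiv ℝ (e b) x (e a x) - fderiv ℝ (e a) x (e b x))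

/-- The Levi-Civita connection of the metric in which a frame is orthonormal. -/
def frameConn (e : Fin 4 → E4 → E4) (a b c : Fin 4) (x : E4) : ℝ :=
  (frameC e a b c x - frameC e b c a x + frameC e c a b x) / 2

theorem frameC_antisymm (a b c : Fin 4) : frameC e a b c x = -frameC e b a c x := by
  rw [frameC, frameC, ← map_neg, neg_sub]

theorem frameConn_antisymm (a b c : Fin 4) : frameConn e a b c x = -frameConn e a c b x := by
  rw [frameConn, frameConn, frameC_antisymm a b, frameC_antisymm b c, frameC_antisymm c a]
  ring

/-- Vanishing torsion of the Koszul connection. -/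
theorem frameConn_sub (a b c : Fin 4) :
    frameConn e a b c x - frameConn e b a c x = frameC e a b c x := by
  rw [frameConn, frameConn, frameC_antisymm b a, frameC_antisymm b c, frameC_antisymm c a]
  ring

theorem contDiffAt_frameC (h : LinearIndependent ℝ fun a => e a x)
    (he : ∀ a, ContDiffAt ℝ ∞ (e a) x) (a b c : Fin 4) : ContDiffAt ℝ ∞ (frameC e a b c) x := by
  have h1 : ∀ a b, ContDiffAt ℝ ∞ (fun y => fderiv ℝ (e b) y (e a y)) x := fun a b =>
    ((he b).fderiv_right (m := ∞) (by simp)).clm_apply (he a)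
  exact (contDiffAt_coframe h he c).clm_apply ((h1 a b).sub (h1 b a))

theorem contDiffAt_frameConn (h : LinearIndependent ℝ fun a => e a x)
    (he : ∀ a, ContDiffAt ℝ ∞ (e a) x) (a b c : Fin 4) : ContDiffAt ℝ ∞ (frameConn e a b c) x :=
  (((contDiffAt_frameC h he a b c).sub (contDiffAt_frameC h he b c a)).add
    (contDiffAt_frameC h he c a b)).div_const 2

variable {F : Type*} [NormedAddCommGroup F] [NormedSpace ℝ F]

/-- The commutator of the derivations along the frame vectors. -/
theorem frame_commutator (h : LinearIndependent ℝ fun a => e a x)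
    (he : ∀ a, ContDiffAt ℝ ∞ (e a) x) {f : E4 → F} (hf : ContDiffAt ℝ ∞ f x) (a b : Fin 4) :
    fderiv ℝ (fun y => fderiv ℝ f y (e b y)) x (e a x)
      - fderiv ℝ (fun y => fderiv ℝ f y (e a y)) x (e b x)
      = ∑ c, frameC e a b c x • fderiv ℝ f x (e c x) := by
  have hf1 : DifferentiableAt ℝ (fderiv ℝ f) x :=
    (hf.fderiv_right (m := ∞) (by simp)).differentiableAt (by simp)
  have h1 : ∀ b v, fderiv ℝ (fun y => fderiv ℝ f y (e b y)) x v
      = fderiv ℝ (fderiv ℝ f) x v (e b x) + fderiv ℝ f x (fderiv ℝ (e b) x v) := by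
    intro b v
    have := (hf1.hasFDerivAt.clm_apply ((he b).differentiableAt (by simp)).hasFDerivAt).fderiv
    rw [this]
    simp [add_comm]
  have hsymm := (hf.isSymmSndFDerivAt (by
      rw [minSmoothness_of_isRCLikeNormedField]; exact WithTop.coe_le_coe.2 le_top)).eq
        (e a x) (e b x)
  rw [h1, h1, hsymm, add_sub_add_left_eq_sub, ← map_sub]
  conv_lhs => rw [← sum_coframe h (fderiv ℝ (e b) x (e a x) - fderiv ℝ (e a) x (e b x))]
  rw [map_sum]
  simp only [map_smul]
  rfl

theorem frame_bracket (h : LinearIndependent ℝ fun a => e a x) (a b : Fin 4) :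
    fderiv ℝ (e b) x (e a x) - fderiv ℝ (e a) x (e b x) = ∑ c, frameC e a b c x • e c x :=
  (sum_coframe h _).symm

/-- The Jacobi identity for the structure functions. -/
theorem frameC_jacobi {Ω : Set E4} (hΩ : IsOpen Ω) (h : ∀ y ∈ Ω, LinearIndependent ℝ fun a => e a y)
    (he : ∀ y ∈ Ω, ∀ a, ContDiffAt ℝ ∞ (e a) y) (hx : x ∈ Ω) (a b c d : Fin 4) :
    (fderiv ℝ (frameC e b c d) x (e a x) + ∑ k, frameC e b c k x * frameC e a k d x)
      + (fderiv ℝ (frameC e c a d) x (e b x) + ∑ k, frameC e c a k x * frameC e b k d x)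
      + (fderiv ℝ (frameC e a b d) x (e c x) + ∑ k, frameC e a b k x * frameC e c k d x) = 0 := by
  have hd : ∀ b c, DifferentiableAt ℝ (fun y => fderiv ℝ (e c) y (e b y)) x := fun b c =>
    (((he x hx c).fderiv_right (m := ∞) (by simp)).clm_apply (he x hx b)).differentiableAt (by simp)
  -- The Jacobi identity results from computing derivatives of brackets in two ways: here by
  -- differentiating the expansion of [e_b, e_c], below by commuting the derivations e_a, e_b
  -- applied to e_c.
  have h1 : ∀ a b c, fderiv ℝ (fun y => fderiv ℝ (e c) y (e b y)) x (e a x)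
      - fderiv ℝ (fun y => fderiv ℝ (e b) y (e c y)) x (e a x)
      = ∑ k, (frameC e b c k x • fderiv ℝ (e k) x (e a x)
        + fderiv ℝ (frameC e b c k) x (e a x) • e k x) := by
    intro a b c
    have ev : (fun y => fderiv ℝ (e c) y (e b y) - fderiv ℝ (e b) y (e c y))
        =ᶠ[𝓝 x] fun y => ∑ k, frameC e b c k y • e k y :=
      Filter.mem_of_superset (hΩ.mem_nhds hx) fun y hy => frame_bracket (h y hy) b c
    have e1 := ev.fderiv_eq (𝕜 := ℝ)
    rw [fderiv_fun_sub (hd b c) (hd c b), fderiv_fun_sum (A := fun k y => frameC e b c k y • e k y)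
      fun k _ => ((contDiffAt_frameC (h x hx) (he x hx) b c k).smul (he x hx k)).differentiableAt (by simp)] at e1
    have e2 := congrArg (fun S : E4 →L[ℝ] E4 => S (e a x)) e1
    simp only [sub_apply, sum_apply] at e2
    rw [e2]
    refine Finset.sum_congr rfl fun k _ => ?_
    rw [fderiv_fun_smul ((contDiffAt_frameC (h x hx) (he x hx) b c k).differentiableAt (by simp))
      ((he x hx k).differentiableAt (by simp))]
    simp
  have h2 := fun a b c => frame_commutator (h x hx) (he x hx) (he x hx c) a b
  have h3 : ∀ a b c, coframe e d x (∑ k, frameC e b c k x • fderiv ℝ (e k) x (e a x))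
      - coframe e d x (∑ k, frameC e b c k x • fderiv ℝ (e a) x (e k x))
      = ∑ k, frameC e b c k x * frameC e a k d x := by
    intro a b c
    rw [← map_sub, ← Finset.sum_sub_distrib, map_sum]
    refine Finset.sum_congr rfl fun k _ => ?_
    rw [← smul_sub, map_smul, smul_eq_mul]
    rfl
  have h4 : ∀ a b c, coframe e d x (∑ k, fderiv ℝ (frameC e b c k) x (e a x) • e k x)
      = fderiv ℝ (frameC e b c d) x (e a x) := fun a b c =>
    coframe_unique (h x hx) (c := fun k => fderiv ℝ (frameC e b c k) x (e a x)) rfl d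
  have k1 := fun a b c => congrArg (coframe e d x) (h1 a b c)
  have k2 := fun a b c => congrArg (coframe e d x) (h2 a b c)
  simp only [Finset.sum_add_distrib, map_add, map_sub, h4] at k1 k2
  linear_combination -k1 a b c - k1 b c a - k1 c a b + k2 a b c + k2 b c a + k2 c a b
    - h3 a b c - h3 b c a - h3 c a b

/-- The Riemann tensor of the metric in which a frame is orthonormal. -/
def frameRiem (e : Fin 4 → E4 → E4) (x : E4) : Fin 4 → Fin 4 → Fin 4 → Fin 4 → ℝ :=
  algRiem (fun a b c => frameConn e a b c x) fun a b c d => fderiv ℝ (frameConn e b c d) x (e a x)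

/-- For a torsion-free connection the cyclic sum of the curvature is the Jacobi identity for the
structure functions, rewritten through `frameConn_sub`. -/
theorem frameRiem_bianchi {Ω : Set E4} (hΩ : IsOpen Ω)
    (h : ∀ y ∈ Ω, LinearIndependent ℝ fun a => e a y)
    (he : ∀ y ∈ Ω, ∀ a, ContDiffAt ℝ ∞ (e a) y) (hx : x ∈ Ω) (a b c d : Fin 4) :
    frameRiem e x a b c d + frameRiem e x b c a d + frameRiem e x c a b d = 0 := by
  have hj := frameC_jacobi hΩ h he hx a b c d
  have hdC : ∀ b c v, fderiv ℝ (frameC e b c d) x v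
      = fderiv ℝ (frameConn e b c d) x v - fderiv ℝ (frameConn e c b d) x v := by
    intro b c v
    have e1 : frameC e b c d = fun y => frameConn e b c d y - frameConn e c b d y := by
      funext y
      rw [frameConn_sub]
    rw [e1, fderiv_fun_sub ((contDiffAt_frameConn (h x hx) (he x hx) _ _ _).differentiableAt (by simp))
      ((contDiffAt_frameConn (h x hx) (he x hx) _ _ _).differentiableAt (by simp))]
    rfl
  rw [hdC, hdC, hdC] at hj
  simp only [← frameConn_sub] at hj
  simp only [frameRiem, algRiem, Fin.sum_univ_four] at hj ⊢
  linear_combination hj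

theorem frameRiem_dom_antisymm (a b c d : Fin 4) : fderiv ℝ (frameConn e b c d) x (e a x)
    = -fderiv ℝ (frameConn e b d c) x (e a x) := by
  have e1 : frameConn e b c d = fun y => -frameConn e b d c y := by
    funext y
    rw [frameConn_antisymm]
  rw [e1, fderiv_fun_neg]
  rfl

end Frame

end SpinGeometry
end

/-! ### Local solutions: from spinor identities to the structure equations. -/

noncomputable section
namespace SpinGeometry
open Set Filter Topology

/-- The components of the exterior derivative of `∑ A a • coframe e a`. -/
def frameF (e : Fin 4 → E4 → E4) (A : Fin 4 → E4 → ℝ) (x : E4) (a b : Fin 4) : ℝ :=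
  fderiv ℝ (A b) x (e a x) - fderiv ℝ (A a) x (e b x) - ∑ c, frameC e a b c x * A c x

/-- A solution of the Killing spinor equations on an open subset of `ℝ⁴`, with the metric given by
an orthonormal frame. -/
structure KSLocal (Λ : ℝ) (Ω : Set E4) (e : Fin 4 → E4 → E4) (al be : E4 → Fin 2 → ℂ)
    (A : Fin 4 → E4 → ℝ) (φ : E4 → Matrix (Fin 2) (Fin 2) ℂ) : Prop where
  isOpen : IsOpen Ω
  indep : ∀ x ∈ Ω, LinearIndependent ℝ fun a => e a x
  smooth_e : ∀ x ∈ Ω, ∀ a, ContDiffAt ℝ ∞ (e a) x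
  smooth_al : ∀ x ∈ Ω, ContDiffAt ℝ ∞ al x
  smooth_be : ∀ x ∈ Ω, ContDiffAt ℝ ∞ be x
  smooth_A : ∀ x ∈ Ω, ∀ a, ContDiffAt ℝ ∞ (A a) x
  jet : ∀ x ∈ Ω, KSJet Λ (al x) (be x) (fun a => fderiv ℝ al x (e a x))
    (fun a => fderiv ℝ be x (e a x)) (fun a b c => frameConn e a b c x) (fun a => A a x)
    (frameF e A x) (φ x)

/-- `hat` as a real-linear map. -/
def hatL : (Fin 2 → ℂ) →L[ℝ] (Fin 2 → ℂ) :=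
  ContinuousLinearMap.pi ![(Complex.conjCLE : ℂ →L[ℝ] ℂ).comp (ContinuousLinearMap.proj 1),
    -((Complex.conjCLE : ℂ →L[ℝ] ℂ).comp (ContinuousLinearMap.proj 0))]

theorem hatL_apply (ψ : Fin 2 → ℂ) : hatL ψ = hat ψ := by
  ext i
  fin_cases i <;> simp [hatL, hat]

section Calculus

variable {E : Type*} [NormedAddCommGroup E] [NormedSpace ℝ E] {al be : E → Fin 2 → ℂ} {x : E}

theorem contDiffAt_hat (h : ContDiffAt ℝ ∞ al x) : ContDiffAt ℝ ∞ (fun y => hat (al y)) x := by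
  simp only [← hatL_apply]
  exact hatL.contDiff.contDiffAt.comp x h

theorem fderiv_hat (h : DifferentiableAt ℝ al x) (v : E) :
    fderiv ℝ (fun y => hat (al y)) x v = hat (fderiv ℝ al x v) := by
  simp only [← hatL_apply]
  have := (hatL.hasFDerivAt.comp x h.hasFDerivAt).fderiv
  exact DFunLike.congr_fun this v

theorem hasFDerivAt_component (h : DifferentiableAt ℝ al x) (i : Fin 2) :
    HasFDerivAt (fun y => al y i) ((ContinuousLinearMap.proj i).comp (fderiv ℝ al x)) x :=
  hasFDerivAt_pi'.1 h.hasFDerivAt i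

theorem contDiffAt_bil (h : ContDiffAt ℝ ∞ al x) (h' : ContDiffAt ℝ ∞ be x) (b : Fin 4) :
    ContDiffAt ℝ ∞ (fun y => bil (al y) (be y) b) x := by
  unfold bil vecOf
  exact ContDiffAt.sum fun P _ => ContDiffAt.sum fun P' _ =>
    contDiffAt_const.mul ((contDiffAt_pi.1 h P).mul (contDiffAt_pi.1 h' P'))

theorem fderiv_bil (h : DifferentiableAt ℝ al x) (h' : DifferentiableAt ℝ be x) (b : Fin 4) (v : E) :
    fderiv ℝ (fun y => bil (al y) (be y) b) x v
      = bil (fderiv ℝ al x v) (be x) b + bil (al x) (fderiv ℝ be x v) b := by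
  have h1 := HasFDerivAt.fun_sum (u := Finset.univ) fun (P : Fin 2) _ =>
    HasFDerivAt.fun_sum (u := Finset.univ) fun (P' : Fin 2) _ =>
      ((hasFDerivAt_component h P).mul (hasFDerivAt_component h' P')).const_mul
        ((starRingEnd ℂ) (sigma b P P'))
  have h2 : fderiv ℝ (fun y => bil (al y) (be y) b) x = _ := h1.fderiv
  rw [h2]
  simp only [bil, vecOf, Fin.sum_univ_two]
  simp
  ring

theorem contDiffAt_spinNorm (h : ContDiffAt ℝ ∞ al x) :
    ContDiffAt ℝ ∞ (fun y => spinNorm (al y)) x := by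
  have h1 : ∀ i, ContDiffAt ℝ ∞ (fun y => Complex.normSq (al y i)) x := fun i => by
    have hc := contDiffAt_pi.1 h i
    simp only [Complex.normSq_apply]
    have hr := Complex.reCLM.contDiff.contDiffAt.comp x hc
    have hi := Complex.imCLM.contDiff.contDiffAt.comp x hc
    exact (hr.mul hr).add (hi.mul hi)
  exact (h1 0).add (h1 1)

theorem fderiv_spinNorm (h : DifferentiableAt ℝ al x) (v : E) :
    fderiv ℝ (fun y => spinNorm (al y)) x v = dNorm (al x) (fderiv ℝ al x v) := by
  have h1 : ∀ i, HasFDerivAt (fun y => Complex.normSq (al y i))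
      ((al x i).re • (Complex.reCLM.comp ((ContinuousLinearMap.proj i).comp (fderiv ℝ al x)))
        + (al x i).re • (Complex.reCLM.comp ((ContinuousLinearMap.proj i).comp (fderiv ℝ al x)))
        + ((al x i).im • (Complex.imCLM.comp ((ContinuousLinearMap.proj i).comp (fderiv ℝ al x)))
        + (al x i).im • (Complex.imCLM.comp ((ContinuousLinearMap.proj i).comp (fderiv ℝ al x))))) x := by
    intro i
    simp only [Complex.normSq_apply]
    have hr := Complex.reCLM.hasFDerivAt.comp x (hasFDerivAt_component h i)
    have hi := Complex.imCLM.hasFDerivAt.comp x (hasFDerivAt_component h i)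
    exact (hr.mul hr).add (hi.mul hi)
  have h2 : fderiv ℝ (fun y => spinNorm (al y)) x = _ := ((h1 0).add (h1 1)).fderiv
  rw [h2]
  simp [dNorm]
  ring

theorem isBilinearMap_extd {G : Type*} [NormedAddCommGroup G] [NormedSpace ℝ G] (om : E → E →L[ℝ] G)
    (x : E) : IsBilinearMap ℝ (extd om x) where
  add_left v v' w := by simp only [extd, map_add, add_apply]; abel
  smul_left c v w := by simp only [extd, map_smul, smul_apply, smul_sub]
  add_right v w w' := by simp only [extd, map_add, add_apply]; abel
  smul_right c v w := by simp only [extd, map_smul, smul_apply, smul_sub]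

end Calculus

section Frame

variable {e : Fin 4 → E4 → E4} {x : E4}

theorem bilinear_ext_frame {G : Type*} [AddCommGroup G] [Module ℝ G]
    (h : LinearIndependent ℝ fun a => e a x) {f g : E4 → E4 → G} (hf : IsBilinearMap ℝ f)
    (hg : IsBilinearMap ℝ g) (hfg : ∀ a b, f (e a x) (e b x) = g (e a x) (e b x)) : f = g := by
  have key : ∀ {f : E4 → E4 → G}, IsBilinearMap ℝ f → ∀ v w, f v w = ∑ a, ∑ b,
      coframe e a x v • coframe e b x w • f (e a x) (e b x) := by
    intro f hf v w
    have h1 : hf.toLinearMap v w = ∑ a, ∑ b, coframe e a x v • coframe e b x w •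
        hf.toLinearMap (e a x) (e b x) := by
      conv_lhs => rw [← sum_coframe h v, ← sum_coframe h w]
      simp only [map_sum, map_smul, LinearMap.sum_apply, LinearMap.smul_apply, Finset.smul_sum]
      rw [Finset.sum_comm]
      refine Finset.sum_congr rfl fun a _ => Finset.sum_congr rfl fun b _ => smul_comm _ _ _
    exact h1
  funext v w
  rw [key hf, key hg]
  simp only [hfg]

variable {G : Type*} [NormedAddCommGroup G] [NormedSpace ℝ G]

/-- The one-form with the given components in the coframe. -/
def formOf (e : Fin 4 → E4 → E4) (X : Fin 4 → E4 → G) (x : E4) : E4 →L[ℝ] G :=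
  ∑ a, (coframe e a x).smulRight (X a x)

theorem formOf_apply (X : Fin 4 → E4 → G) (v : E4) :
    formOf e X x v = ∑ a, coframe e a x v • X a x := by
  simp [formOf]

theorem formOf_frame (h : LinearIndependent ℝ fun a => e a x) (X : Fin 4 → E4 → G) (b : Fin 4) :
    formOf e X x (e b x) = X b x := by
  simp [formOf_apply, coframe_apply h, kd]

theorem contDiffAt_formOf (h : LinearIndependent ℝ fun a => e a x)
    (he : ∀ a, ContDiffAt ℝ ∞ (e a) x) {X : Fin 4 → E4 → G} (hX : ∀ a, ContDiffAt ℝ ∞ (X a) x) :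
    ContDiffAt ℝ ∞ (formOf e X) x := by
  unfold formOf
  exact ContDiffAt.sum fun a _ => (contDiffAt_coframe h he a).smulRight (hX a)

theorem extd_formOf {Ω : Set E4} (hΩ : IsOpen Ω) (h : ∀ y ∈ Ω, LinearIndependent ℝ fun a => e a y)
    (he : ∀ y ∈ Ω, ∀ a, ContDiffAt ℝ ∞ (e a) y) (hx : x ∈ Ω) {X : Fin 4 → E4 → G}
    (hX : ∀ a, ContDiffAt ℝ ∞ (X a) x) (a b : Fin 4) :
    extd (formOf e X) x (e a x) (e b x) = fderiv ℝ (X b) x (e a x) - fderiv ℝ (X a) x (e b x)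
      - ∑ c, frameC e a b c x • X c x := by
  have hd : HasFDerivAt (formOf e X) (fderiv ℝ (formOf e X) x) x :=
    ((contDiffAt_formOf (h x hx) (he x hx) hX).differentiableAt (by simp)).hasFDerivAt
  have h1 : ∀ b v, fderiv ℝ (X b) x v
      = fderiv ℝ (formOf e X) x v (e b x) + formOf e X x (fderiv ℝ (e b) x v) := by
    intro b v
    have ev : (fun y => formOf e X y (e b y)) =ᶠ[𝓝 x] X b :=
      Filter.mem_of_superset (hΩ.mem_nhds hx) fun y hy => formOf_frame (h y hy) X b
    rw [← ev.fderiv_eq (𝕜 := ℝ),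
      (hd.clm_apply ((he x hx b).differentiableAt (by simp)).hasFDerivAt).fderiv]
    simp [add_comm]
  have h2 : formOf e X x (fderiv ℝ (e b) x (e a x) - fderiv ℝ (e a) x (e b x))
      = ∑ c, frameC e a b c x • X c x := by
    rw [frame_bracket (h x hx), map_sum]
    simp only [map_smul, formOf_frame (h x hx)]
  rw [← h2, h1, h1, extd, map_sub]
  abel

end Frame

namespace KSLocal

variable {Λ : ℝ} {Ω : Set E4} {e : Fin 4 → E4 → E4} {al be : E4 → Fin 2 → ℂ}
    {A : Fin 4 → E4 → ℝ} {φ : E4 → Matrix (Fin 2) (Fin 2) ℂ}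

theorem mono (h : KSLocal Λ Ω e al be A φ) {Ω' : Set E4} (hΩ' : IsOpen Ω') (hsub : Ω' ⊆ Ω) :
    KSLocal Λ Ω' e al be A φ :=
  ⟨hΩ', fun x hx => h.indep x (hsub hx), fun x hx => h.smooth_e x (hsub hx),
    fun x hx => h.smooth_al x (hsub hx), fun x hx => h.smooth_be x (hsub hx),
    fun x hx => h.smooth_A x (hsub hx), fun x hx => h.jet x (hsub hx)⟩

theorem extd_bil (h : KSLocal Λ Ω e al be A φ) {ψ χ : E4 → Fin 2 → ℂ} {x : E4} (hx : x ∈ Ω)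
    (hψ : ContDiffAt ℝ ∞ ψ x) (hχ : ContDiffAt ℝ ∞ χ x) (a b : Fin 4) :
    extd (formOf e fun b y => bil (ψ y) (χ y) b) x (e a x) (e b x)
      = dBil (fun a b c => frameConn e a b c x) (ψ x) (χ x) (fun a => fderiv ℝ ψ x (e a x))
        (fun a => fderiv ℝ χ x (e a x)) a b := by
  rw [extd_formOf h.isOpen h.indep h.smooth_e hx fun a => contDiffAt_bil hψ hχ a,
    fderiv_bil (hψ.differentiableAt (by simp)) (hχ.differentiableAt (by simp)),
    fderiv_bil (hψ.differentiableAt (by simp)) (hχ.differentiableAt (by simp)), dBil]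
  simp only [frameConn_sub, Complex.real_smul]

/-- The structure equations hold where both spinors are non-zero. -/
theorem structEqs (h : KSLocal Λ Ω e al be A φ) (hΛ : Λ ≠ 0) (hal : ∀ x ∈ Ω, al x ≠ 0)
    (hbe : ∀ x ∈ Ω, be x ≠ 0) :
    StructEqs Λ Ω (formOf e fun b y => bil (al y) (be y) b)
      (formOf e fun b y => bil (al y) (hat (be y)) b) (formOf e A)
      (fun x => spinNorm (al x)) (fun x => spinNorm (be x)) := by
  have hre : ∀ x ∈ Ω, ∀ v, (formOf e (fun b y => bil (al y) (hat (be y)) b) x v).re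
      = ∑ a, coframe e a x v * (bil (al x) (hat (be x)) a).re := by
    intro x hx v
    simp [formOf_apply, Complex.re_sum]
  have him : ∀ c : ℂ, ∀ x ∈ Ω, ∀ v, (c * formOf e (fun b y => bil (al y) (be y) b) x v).im
      = ∑ a, coframe e a x v * (c * bil (al x) (be x) a).im := by
    intro c x hx v
    rw [formOf_apply, Finset.mul_sum, Complex.im_sum]
    refine Finset.sum_congr rfl fun a _ => ?_
    rw [mul_smul_comm, Complex.smul_im, smul_eq_mul]
  have hexp : ∀ x ∈ Ω, ∀ (f : E4 → ℝ) v, fderiv ℝ f x v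
      = ∑ a, coframe e a x v * fderiv ℝ f x (e a x) := by
    intro x hx f v
    conv_lhs => rw [← sum_coframe (h.indep x hx) v]
    simp
  have hF : ∀ x ∈ Ω, ∀ a b, extd (formOf e A) x (e a x) (e b x) = frameF e A x a b := by
    intro x hx a b
    rw [extd_formOf h.isOpen h.indep h.smooth_e hx (h.smooth_A x hx)]
    rfl
  have hbF := fun (x : E4) (hx : x ∈ Ω) => formOf_frame (G := ℂ) (h.indep x hx)
  refine ⟨?_, ?_, ?_, ?_, ?_, ?_, ?_, ?_, ?_, ?_, ?_⟩
  · exact fun x hx => contDiffAt_formOf (h.indep x hx) (h.smooth_e x hx) fun a =>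
      contDiffAt_bil (h.smooth_al x hx) (h.smooth_be x hx) a
  · exact fun x hx => contDiffAt_formOf (h.indep x hx) (h.smooth_e x hx) fun a =>
      contDiffAt_bil (h.smooth_al x hx) (contDiffAt_hat (h.smooth_be x hx)) a
  · exact fun x hx => contDiffAt_formOf (h.indep x hx) (h.smooth_e x hx) (h.smooth_A x hx)
  · exact fun x hx => contDiffAt_spinNorm (h.smooth_al x hx)
  · exact fun x hx => contDiffAt_spinNorm (h.smooth_be x hx)
  · exact fun x hx => spinNorm_pos (hal x hx)
  · exact fun x hx => spinNorm_pos (hbe x hx)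
  · intro x hx v
    rw [hexp x hx, hre x hx, Finset.mul_sum]
    refine Finset.sum_congr rfl fun a _ => ?_
    rw [fderiv_spinNorm ((h.smooth_be x hx).differentiableAt (by simp)), (h.jet x hx).dNorm_be]
    ring
  · intro x hx v w
    -- Both sides are bilinear in the vectors, so the pointwise identity for frame vectors suffices.
    -- The two-form equations below are treated in the same way.
    refine congrFun (congrFun (bilinear_ext_frame (h.indep x hx) (isBilinearMap_extd _ x)
      (g := fun v w => formOf e (fun b y => bil (al y) (be y) b) x v * connForm Λ
        (formOf e fun b y => bil (al y) (hat (be y)) b) (formOf e A)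
        (fun x => spinNorm (al x)) (fun x => spinNorm (be x)) x w
        - formOf e (fun b y => bil (al y) (be y) b) x w * connForm Λ
        (formOf e fun b y => bil (al y) (hat (be y)) b) (formOf e A)
        (fun x => spinNorm (al x)) (fun x => spinNorm (be x)) x v) ⟨?_, ?_, ?_, ?_⟩ ?_) v) w
    · intro _ _ _; simp only [map_add]; ring
    · intro _ _ _; simp only [map_smul, Complex.real_smul]; ring
    · intro _ _ _; simp only [map_add]; ring
    · intro _ _ _; simp only [map_smul, Complex.real_smul]; ring
    · intro a b
      rw [h.extd_bil hx (h.smooth_al x hx) (h.smooth_be x hx),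
        (h.jet x hx).dm_eq (hal x hx) (hbe x hx)]
      simp only [connForm_apply, hbF x hx, formOf_frame (h.indep x hx)]
  · intro x hx v w
    refine congrFun (congrFun (bilinear_ext_frame (h.indep x hx) (isBilinearMap_extd _ x)
      (g := fun v w => Complex.I * ((-(spinNorm (be x) / Λ) * extd (formOf e A) x v w
        + 2 / spinNorm (al x) * (crossIm (formOf e (fun b y => bil (al y) (be y) b) x v)
            (formOf e (fun b y => bil (al y) (be y) b) x w)
          - crossIm (formOf e (fun b y => bil (al y) (hat (be y)) b) x v)
            (formOf e (fun b y => bil (al y) (hat (be y)) b) x w))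
        - 2 * Λ / spinNorm (be x) * (crossIm (formOf e (fun b y => bil (al y) (be y) b) x v)
            (formOf e (fun b y => bil (al y) (be y) b) x w)
          + crossIm (formOf e (fun b y => bil (al y) (hat (be y)) b) x v)
            (formOf e (fun b y => bil (al y) (hat (be y)) b) x w)) : ℝ) : ℂ)) ⟨?_, ?_, ?_, ?_⟩ ?_)
      v) w
    · intro _ _ _
      simp only [map_add, crossIm, Complex.add_re, Complex.add_im, (isBilinearMap_extd _ x).add_left]
      push_cast; ring
    · intro _ _ _
      simp only [map_smul, crossIm, smul_eq_mul,
        (isBilinearMap_extd _ x).smul_left, Complex.real_smul,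
        Complex.re_ofReal_mul, Complex.im_ofReal_mul]
      push_cast; ring
    · intro _ _ _
      simp only [map_add, crossIm, Complex.add_re, Complex.add_im, (isBilinearMap_extd _ x).add_right]
      push_cast; ring
    · intro _ _ _
      simp only [map_smul, crossIm, smul_eq_mul,
        (isBilinearMap_extd _ x).smul_right, Complex.real_smul,
        Complex.re_ofReal_mul, Complex.im_ofReal_mul]
      push_cast; ring
    · intro a b
      have hdh : (fun a => fderiv ℝ (fun y => hat (be y)) x (e a x))
          = fun a => hat (fderiv ℝ be x (e a x)) := by
        funext a
        exact fderiv_hat ((h.smooth_be x hx).differentiableAt (by simp)) _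
      rw [h.extd_bil hx (h.smooth_al x hx) (contDiffAt_hat (h.smooth_be x hx)), hdh,
        (h.jet x hx).dn_eq hΛ (hal x hx) (hbe x hx)]
      simp only [hbF x hx, hF x hx]
  · intro x hx
    obtain ⟨c, B, hφ⟩ := (h.jet x hx).exists_φ (hal x hx)
    refine ⟨c, B, fun v => ?_, fun v w => ?_⟩
    · rw [hexp x hx, hre x hx, him c x hx, Finset.mul_sum, Finset.mul_sum, ← Finset.sum_sub_distrib]
      refine Finset.sum_congr rfl fun a _ => ?_
      rw [fderiv_spinNorm ((h.smooth_al x hx).differentiableAt (by simp)), (h.jet x hx).dNorm_al hφ]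
      ring
    · refine congrFun (congrFun (bilinear_ext_frame (h.indep x hx) (isBilinearMap_extd _ x)
        (g := fun v w => -(2 / spinNorm (be x)) *
          ((c * (formOf e (fun b y => bil (al y) (be y) b) x v
              * formOf e (fun b y => bil (al y) (hat (be y)) b) x w
            - formOf e (fun b y => bil (al y) (be y) b) x w
              * formOf e (fun b y => bil (al y) (hat (be y)) b) x v)).re
          - B * (crossIm (formOf e (fun b y => bil (al y) (be y) b) x v)
              (formOf e (fun b y => bil (al y) (be y) b) x w)
            + crossIm (formOf e (fun b y => bil (al y) (hat (be y)) b) x v)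
              (formOf e (fun b y => bil (al y) (hat (be y)) b) x w)))) ⟨?_, ?_, ?_, ?_⟩ ?_) v) w
      · intro _ _ _
        simp only [map_add, crossIm, Complex.add_re, Complex.add_im, Complex.mul_re, Complex.mul_im,
          Complex.sub_re, Complex.sub_im]
        ring
      · intro _ _ _
        simp only [map_smul, crossIm, Complex.smul_re, Complex.smul_im, smul_eq_mul, Complex.mul_re,
          Complex.mul_im, Complex.sub_re, Complex.sub_im]
        ring
      · intro _ _ _
        simp only [map_add, crossIm, Complex.add_re, Complex.add_im, Complex.mul_re, Complex.mul_im,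
          Complex.sub_re, Complex.sub_im]
        ring
      · intro _ _ _
        simp only [map_smul, crossIm, Complex.smul_re, Complex.smul_im, smul_eq_mul, Complex.mul_re,
          Complex.mul_im, Complex.sub_re, Complex.sub_im]
        ring
      · intro a b
        rw [hF x hx, (h.jet x hx).F_eq (hbe x hx) hφ]
        simp only [hbF x hx]

end KSLocal

end SpinGeometry
end

/-! ### Local solutions: Killing equation, curvature and normal form. -/

noncomputable section
namespace SpinGeometry
open Set Filter Topology

namespace KSLocal

variable {Λ : ℝ} {Ω : Set E4} {e : Fin 4 → E4 → E4} {al be : E4 → Fin 2 → ℂ}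
    {A : Fin 4 → E4 → ℝ} {φ : E4 → Matrix (Fin 2) (Fin 2) ℂ}

theorem contDiffAt_killVec (h : KSLocal Λ Ω e al be A φ) {x : E4} (hx : x ∈ Ω) (a : Fin 4) :
    ContDiffAt ℝ ∞ (fun y => killVec (al y) (be y) a) x :=
  contDiffAt_const.mul (Complex.imCLM.contDiff.contDiffAt.comp x
    (contDiffAt_bil (h.smooth_al x hx) (contDiffAt_hat (h.smooth_be x hx)) a))

theorem fderiv_killVec (h : KSLocal Λ Ω e al be A φ) {x : E4} (hx : x ∈ Ω) (b : Fin 4) (v : E4) :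
    fderiv ℝ (fun y => killVec (al y) (be y) b) x v
      = -2 * (bil (fderiv ℝ al x v) (hat (be x)) b + bil (al x) (hat (fderiv ℝ be x v)) b).im := by
  have hal := (h.smooth_al x hx).differentiableAt (n := ∞) (by simp)
  have hbe := (h.smooth_be x hx).differentiableAt (n := ∞) (by simp)
  have hbh := (contDiffAt_hat (h.smooth_be x hx)).differentiableAt (n := ∞) (by simp)
  have hd := ((contDiffAt_bil (h.smooth_al x hx) (contDiffAt_hat (h.smooth_be x hx)) b).differentiableAt
    (n := ∞) (by simp)).hasFDerivAt
  have h1 : fderiv ℝ (fun y => killVec (al y) (be y) b) x = _ :=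
    ((Complex.imCLM.hasFDerivAt.comp x hd).const_mul (-2)).fderiv
  rw [h1, ← fderiv_hat hbe, ← fderiv_bil hal hbh]
  simp

theorem killing (h : KSLocal Λ Ω e al be A φ) {x : E4} (hx : x ∈ Ω) (a b : Fin 4) :
    fderiv ℝ (fun y => killVec (al y) (be y) b) x (e a x)
      + fderiv ℝ (fun y => killVec (al y) (be y) a) x (e b x)
      = ∑ c, (frameC e c a b x + frameC e c b a x) * killVec (al x) (be x) c := by
  rw [h.fderiv_killVec hx, h.fderiv_killVec hx, (h.jet x hx).killing]
  refine Finset.sum_congr rfl fun c _ => ?_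
  rw [frameConn, frameConn, frameC_antisymm b c, frameC_antisymm a c, frameC_antisymm a b]
  ring

/-- The pointwise integrability argument needs second derivatives of β. They are found by
differentiating the equation for β on a neighbourhood, and their skew part comes from the commutator
of frame derivations. -/
theorem asd_einstein (h : KSLocal Λ Ω e al be A φ) (hΛ : Λ ≠ 0) {x : E4} (hx : x ∈ Ω)
    (hbe : be x ≠ 0) :
    (∀ a b, algRicci (frameRiem e x) a b = -6 * Λ * kd a b) ∧
    ∀ a b c d, (∑ k, ∑ f, leviCivita a b k f * algWeyl (frameRiem e x) k f c d) / 2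
      = -algWeyl (frameRiem e x) a b c d := by
  have hbed := (h.smooth_be x hx).differentiableAt (n := ∞) (by simp)
  have hald := (h.smooth_al x hx).differentiableAt (n := ∞) (by simp)
  refine (h.jet x hx).asd_einstein hΛ hbe (dA := fun a b => fderiv ℝ (A b) x (e a x))
    (ddbe := fun a b B' => fderiv ℝ (fun y => fderiv ℝ be y (e b y)) x (e a x) B') ?_ ?_ ?_
    frameRiem_dom_antisymm (frameRiem_bianchi h.isOpen h.indep h.smooth_e hx)
  · intro a b
    simp only [frameF, frameConn_sub]
  · intro a b B'
    have hcliff : ∀ ψ : Fin 2 → ℂ, cliff b ψ B' = bil ψ (fun A' => eps A' B') b := by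
      intro ψ
      simp only [cliff, bil, mul_comm]
    have hmul : ∀ (om : Fin 4 → Fin 4 → ℝ) (ψ : Fin 2 → ℂ), (spinMat' om *ᵥ ψ) B'
        = 1 / 2 * ∑ c, ∑ d, (om c d : ℂ) * ((((sigma c)ᴴ * sigma d)ᵀ) *ᵥ ψ) B' := by
      intro om ψ
      simp only [spinMat', Matrix.smul_mulVec, Matrix.sum_mulVec, Pi.smul_apply, smul_eq_mul,
        Finset.sum_apply]
    -- The solved form of the equation for β holds on an open set, so it may be differentiated once
    -- more.
    have ev : (fun y => fderiv ℝ be y (e b y) B') =ᶠ[𝓝 x] fun y =>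
        Complex.I * A b y * be y B' + Λ * bil (al y) (fun A' => eps A' B') b
          - (spinMat' (fun c d => frameConn e b c d y) *ᵥ be y) B' :=
      Filter.mem_of_superset (h.isOpen.mem_nhds hx) fun y hy => by
        have := (h.jet y hy).dbe_eq b B'
        rw [hcliff] at this
        exact this
    have hd0 : DifferentiableAt ℝ (fun y => fderiv ℝ be y (e b y)) x :=
      (((h.smooth_be x hx).fderiv_right (m := ∞) (by simp)).clm_apply
        (h.smooth_e x hx b)).differentiableAt (by simp)
    have h1 : HasFDerivAt (fun y => (A b y : ℂ)) (Complex.ofRealCLM.comp (fderiv ℝ (A b) x)) x :=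
      Complex.ofRealCLM.hasFDerivAt.comp x
        ((h.smooth_A x hx b).differentiableAt (by simp)).hasFDerivAt
    have h2 := hasFDerivAt_component hbed B'
    have h3 : HasFDerivAt (fun y => bil (al y) (fun A' => eps A' B') b)
        (fderiv ℝ (fun y => bil (al y) (fun A' => eps A' B') b) x) x :=
      ((contDiffAt_bil (h.smooth_al x hx) contDiffAt_const b).differentiableAt (n := ∞)
        (by simp)).hasFDerivAt
    have h4 : ∀ c d, HasFDerivAt (fun y => (frameConn e b c d y : ℂ))
        (Complex.ofRealCLM.comp (fderiv ℝ (frameConn e b c d) x)) x := fun c d =>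
      Complex.ofRealCLM.hasFDerivAt.comp x
        ((contDiffAt_frameConn (h.indep x hx) (h.smooth_e x hx) b c d).differentiableAt
          (by simp)).hasFDerivAt
    have h5 : ∀ S : Matrix (Fin 2) (Fin 2) ℂ, HasFDerivAt (fun y => (S *ᵥ be y) B')
        (∑ i, S B' i • ((ContinuousLinearMap.proj i).comp (fderiv ℝ be x))) x := fun S =>
      HasFDerivAt.fun_sum (u := Finset.univ) fun i _ => (hasFDerivAt_component hbed i).const_mul (S B' i)
    have h6 := (((h1.const_mul Complex.I).mul h2).add (h3.const_mul (Λ : ℂ))).sub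
      ((HasFDerivAt.fun_sum (u := Finset.univ) fun (c : Fin 4) _ =>
        HasFDerivAt.fun_sum (u := Finset.univ) fun (d : Fin 4) _ =>
          (h4 c d).mul (h5 (((sigma c)ᴴ * sigma d)ᵀ))).const_mul (1 / 2 : ℂ))
    have e1 : fderiv ℝ (fun y => fderiv ℝ be y (e b y)) x (e a x) B'
        = fderiv ℝ (fun y => fderiv ℝ be y (e b y) B') x (e a x) :=
      (DFunLike.congr_fun (hasFDerivAt_component hd0 B').fderiv (e a x)).symm
    rw [e1, ev.fderiv_eq (𝕜 := ℝ)]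
    simp only [hmul]
    have e2 : ∀ (S : Matrix (Fin 2) (Fin 2) ℂ) v,
        (∑ i, S B' i • ((ContinuousLinearMap.proj (R := ℝ) (φ := fun _ : Fin 2 => ℂ) i).comp
          (fderiv ℝ be x))) v = (S *ᵥ fderiv ℝ be x v) B' := by
      intro S v
      simp [Matrix.mulVec, dotProduct]
    have e3 : fderiv ℝ (fun y => bil (al y) (fun A' => eps A' B') b) x (e a x)
        = cliff b (fderiv ℝ al x (e a x)) B' := by
      rw [fderiv_bil hald (differentiableAt_const _), hcliff]
      simp [bil, vecOf]
    have h7 : fderiv ℝ (fun y => Complex.I * (A b y : ℂ) * be y B'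
        + Λ * bil (al y) (fun A' => eps A' B') b
        - 1 / 2 * ∑ c, ∑ d, (frameConn e b c d y : ℂ) * (((sigma c)ᴴ * sigma d)ᵀ *ᵥ be y) B') x = _ :=
      h6.fderiv
    rw [h7]
    simp only [add_apply, sub_apply, smul_apply, sum_apply, e2, e3, ContinuousLinearMap.comp_apply,
      Complex.ofRealCLM_apply, ContinuousLinearMap.proj_apply, smul_eq_mul, Finset.sum_add_distrib,
      mul_add]
    simp only [mul_comm _ ((fderiv ℝ (frameConn e b _ _) x (e a x) : ℝ) : ℂ)]
    ring
  · intro a b B'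
    have := congrFun (frame_commutator (h.indep x hx) (h.smooth_e x hx) (h.smooth_be x hx) a b) B'
    rw [Pi.sub_apply, Finset.sum_apply] at this
    rw [this]
    refine Finset.sum_congr rfl fun c _ => ?_
    rw [frameConn_sub]
    simp only [Pi.smul_apply, Complex.real_smul]

theorem exists_toda (h : KSLocal Λ Ω e al be A φ) (hΛ : Λ ≠ 0) {p : E4} (hp : p ∈ Ω)
    (hal : al p ≠ 0) (hbe : be p ≠ 0) :
    ∃ (Φ : OpenPartialHomeomorph E4 E4) (D : Set E3) (u V : E3 → ℝ) (om : Fin 3 → E3 → ℝ),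
      p ∈ Φ.source ∧ Φ.source ⊆ Ω ∧ (∀ x ∈ Φ.source, ContDiffAt ℝ ∞ Φ x) ∧
      (∀ w ∈ Φ.target, ContDiffAt ℝ ∞ Φ.symm w) ∧ IsTodaData Λ D u V om ∧
      ∀ x ∈ Φ.source, proj (Φ x) ∈ D ∧
        (∀ v, ∑ a, coframe e a x v ^ 2 = todaMetric u V om (Φ x) (fderiv ℝ Φ x v)) ∧
        fderiv ℝ Φ x (∑ a, killVec (al x) (be x) a • e a x)
          = EuclideanSpace.single 3 (Real.sqrt 2) := by
  have hopen : IsOpen {x | x ∈ Ω ∧ al x ≠ 0 ∧ be x ≠ 0} := by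
    rw [isOpen_iff_mem_nhds]
    rintro x ⟨hx, h1, h2⟩
    filter_upwards [h.isOpen.mem_nhds hx, (h.smooth_al x hx).continuousAt.eventually_ne h1,
      (h.smooth_be x hx).continuousAt.eventually_ne h2] with y hy h1 h2 using ⟨hy, h1, h2⟩
  have h' := h.mono hopen fun x hx => hx.1
  have hS := h'.structEqs hΛ (fun x hx => hx.2.1) (fun x hx => hx.2.2)
  have hm : ∀ x ∈ Ω, ∀ (ψ χ : E4 → Fin 2 → ℂ) (v : E4),
      formOf e (fun b y => bil (ψ y) (χ y) b) x v
        = ∑ a, bil (ψ x) (χ x) a * (coframe e a x v : ℂ) := by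
    intro x hx ψ χ v
    rw [formOf_apply]
    refine Finset.sum_congr rfl fun a _ => ?_
    rw [Complex.real_smul, mul_comm]
  have hk : ∀ x ∈ Ω, ∀ a, coframe e a x (∑ a, killVec (al x) (be x) a • e a x)
      = killVec (al x) (be x) a := fun x hx a => coframe_unique (h.indep x hx) rfl a
  have hmet : ∀ x, x ∈ Ω ∧ al x ≠ 0 ∧ be x ≠ 0 → ∀ v, ∑ a, coframe e a x v ^ 2
      = 2 / (spinNorm (al x) * spinNorm (be x))
        * (Complex.normSq (formOf e (fun b y => bil (al y) (be y) b) x v)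
          + Complex.normSq (formOf e (fun b y => bil (al y) (hat (be y)) b) x v)) := by
    intro x hx v
    rw [hm x hx.1 al be, hm x hx.1 al fun y => hat (be y)]
    exact norm_sq_eq_bil hx.2.1 hx.2.2 _
  obtain ⟨Φ, D, u, V, om, h1, h2, h3, h4, h5, h6⟩ := hS.exists_toda hΛ hopen
    (k := fun x => ∑ a, killVec (al x) (be x) a • e a x)
    (fun x hx => ContDiffAt.sum fun a _ => (h.contDiffAt_killVec hx.1 a).smul (h.smooth_e x hx.1 a))
    (fun x hx => by
      rw [hm x hx.1 al be]
      simp only [hk x hx.1]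
      exact sum_bil_killVec _ _)
    (fun x hx => by
      rw [hm x hx.1 al fun y => hat (be y)]
      simp only [hk x hx.1]
      exact sum_bil_hat_killVec _ _)
    (fun x hx v hv1 hv2 => by
      have hz := hmet x hx v
      rw [hv1, hv2, map_zero, add_zero, mul_zero] at hz
      have hz' := (Finset.sum_eq_zero_iff_of_nonneg fun a _ => sq_nonneg (coframe e a x v)).1 hz
      rw [← sum_coframe (h.indep x hx.1) v]
      refine Finset.sum_eq_zero fun a ha => ?_
      rw [pow_eq_zero_iff two_ne_zero |>.1 (hz' a ha), zero_smul])
    (p := p) ⟨hp, hal, hbe⟩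
  refine ⟨Φ, D, u, V, om, h1, fun x hx => (h2 hx).1, h3, h4, h5, fun x hx => ?_⟩
  obtain ⟨a1, a2, a3⟩ := h6 x hx
  refine ⟨a1, fun v => ?_, a3⟩
  rw [← a2, hmet x (h2 hx)]

end KSLocal

end SpinGeometry
end

/-! ### Zeros of the spinor fields. -/

noncomputable section
namespace SpinGeometry
open Set Filter Topology

theorem spinNorm_nonneg (ψ : Fin 2 → ℂ) : 0 ≤ spinNorm ψ :=
  add_nonneg (Complex.normSq_nonneg _) (Complex.normSq_nonneg _)

theorem spinNorm_zero : spinNorm 0 = 0 := by simp [spinNorm]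

theorem spinNorm_eq_zero {ψ : Fin 2 → ℂ} : spinNorm ψ = 0 ↔ ψ = 0 :=
  ⟨fun h => by_contra fun hn => (spinNorm_pos hn).ne' h, fun h => by rw [h, spinNorm_zero]⟩

namespace KSLocal

variable {Λ : ℝ} {Ω : Set E4} {e : Fin 4 → E4 → E4} {al be : E4 → Fin 2 → ℂ}
    {A : Fin 4 → E4 → ℝ} {φ : E4 → Matrix (Fin 2) (Fin 2) ℂ}

theorem continuousAt_frameF (h : KSLocal Λ Ω e al be A φ) {x : E4} (hx : x ∈ Ω) (a b : Fin 4) :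
    ContinuousAt (fun y => frameF e A y a b) x := by
  have h1 : ∀ a b, ContDiffAt ℝ ∞ (fun y => fderiv ℝ (A b) y (e a y)) x := fun a b =>
    ((h.smooth_A x hx b).fderiv_right (m := ∞) (by simp)).clm_apply (h.smooth_e x hx a)
  have h2 : ContDiffAt ℝ ∞ (fun y => ∑ c, frameC e a b c y * A c y) x :=
    ContDiffAt.sum fun c _ =>
      (contDiffAt_frameC (h.indep x hx) (h.smooth_e x hx) a b c).mul (h.smooth_A x hx c)
  exact (((h1 a b).sub (h1 b a)).sub h2).continuousAt

/-- A linear differential inequality for |α|² + |β|², with a coefficient continuous in the frame and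
the field strength. It makes Grönwall's argument available at a common zero. -/
theorem abs_fderiv_spinNorm_le (h : KSLocal Λ Ω e al be A φ) {x : E4} (hx : x ∈ Ω) (v : E4) :
    |fderiv ℝ (fun y => spinNorm (al y) + spinNorm (be y)) x v|
      ≤ (∑ a, ‖coframe e a x‖) * ‖v‖ * (8 * |Λ| + (8 + 16 * |Λ|⁻¹ * ∑ a, ∑ b, |frameF e A x a b|))
        * (spinNorm (al x) + spinNorm (be x)) := by
  have hal := (contDiffAt_spinNorm (h.smooth_al x hx)).differentiableAt (n := ∞) (by simp)
  have hbe := (contDiffAt_spinNorm (h.smooth_be x hx)).differentiableAt (n := ∞) (by simp)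
  set f := fun y => spinNorm (al y) + spinNorm (be y)
  set C := 8 * |Λ| + (8 + 16 * |Λ|⁻¹ * ∑ a, ∑ b, |frameF e A x a b|)
  have hn : 0 ≤ spinNorm (al x) + spinNorm (be x) := add_nonneg (spinNorm_nonneg _) (spinNorm_nonneg _)
  have h1 : ∀ a, |fderiv ℝ f x (e a x)| ≤ C * (spinNorm (al x) + spinNorm (be x)) := by
    intro a
    have e1 : fderiv ℝ f x (e a x) = dNorm (al x) (fderiv ℝ al x (e a x))
        + dNorm (be x) (fderiv ℝ be x (e a x)) := by
      rw [← fderiv_spinNorm ((h.smooth_al x hx).differentiableAt (by simp)),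
        ← fderiv_spinNorm ((h.smooth_be x hx).differentiableAt (by simp)), fderiv_fun_add hal hbe]
      rfl
    rw [e1]
    refine (abs_add_le _ _).trans ?_
    have b1 := (h.jet x hx).abs_dNorm_al_le a
    have b2 := (h.jet x hx).abs_dNorm_be_le a
    calc _ ≤ _ := add_le_add b1 b2
      _ = _ := by ring
  have h2 : fderiv ℝ f x v = ∑ a, coframe e a x v * fderiv ℝ f x (e a x) := by
    conv_lhs => rw [← sum_coframe (h.indep x hx) v]
    simp
  have hC : 0 ≤ C * (spinNorm (al x) + spinNorm (be x)) := (abs_nonneg _).trans (h1 0)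
  rw [h2]
  refine (Finset.abs_sum_le_sum_abs _ _).trans ?_
  rw [mul_assoc, Finset.sum_mul, Finset.sum_mul]
  refine Finset.sum_le_sum fun a _ => ?_
  rw [abs_mul]
  exact mul_le_mul ((coframe e a x).le_opNorm v) (h1 a) (abs_nonneg _)
    (mul_nonneg (norm_nonneg _) (norm_nonneg _))

/-- The common zeros of the two spinors form an open set. -/
theorem eventually_eq_zero (h : KSLocal Λ Ω e al be A φ) {x : E4} (hx : x ∈ Ω) (hal : al x = 0)
    (hbe : be x = 0) : ∀ᶠ y in 𝓝 x, al y = 0 ∧ be y = 0 := by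
  set G : E4 → ℝ := fun x => (∑ a, ‖coframe e a x‖)
    * (8 * |Λ| + (8 + 16 * |Λ|⁻¹ * ∑ a, ∑ b, |frameF e A x a b|)) with hG
  have hGc : ContinuousAt G x := by
    refine ContinuousAt.mul ?_ (continuousAt_const.add (continuousAt_const.add
      (continuousAt_const.mul ?_)))
    · exact tendsto_finsetSum _ fun a _ =>
        ((contDiffAt_coframe (h.indep x hx) (h.smooth_e x hx) a).continuousAt).norm
    · exact tendsto_finsetSum _ fun a _ => tendsto_finsetSum _ fun b _ =>
        (h.continuousAt_frameF hx a b).abs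
  set K := G x + 1
  have hev : ∀ᶠ y in 𝓝 x, y ∈ Ω ∧ G y < K :=
    (h.isOpen.eventually_mem hx).and (hGc.eventually_lt continuousAt_const (lt_add_one _))
  obtain ⟨r, hr, hball⟩ := Metric.eventually_nhds_iff_ball.1 hev
  -- Radius at most 1 lets the factor ‖y - x‖ in the differential inequality be absorbed into the
  -- constant K.
  have hmin : 0 < min r 1 := lt_min hr one_pos
  filter_upwards [Metric.ball_mem_nhds x hmin] with y hy
  set f := fun y => spinNorm (al y) + spinNorm (be y) with hf
  have hnn : ∀ y, 0 ≤ f y := fun y => add_nonneg (spinNorm_nonneg _) (spinNorm_nonneg _)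
  have hyn : ‖y - x‖ < min r 1 := by rwa [← dist_eq_norm]
  have hmem : ∀ t ∈ Icc (0 : ℝ) 1, x + t • (y - x) ∈ Metric.ball x r := by
    intro t ht
    rw [Metric.mem_ball, dist_eq_norm, add_sub_cancel_left, norm_smul, Real.norm_eq_abs,
      abs_of_nonneg ht.1]
    have : t * ‖y - x‖ ≤ ‖y - x‖ := mul_le_of_le_one_left (norm_nonneg _) ht.2
    exact this.trans_lt (hyn.trans_le (min_le_left _ _))
  have hd : ∀ t ∈ Icc (0 : ℝ) 1, HasDerivAt (fun t : ℝ => f (x + t • (y - x)))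
      (fderiv ℝ f (x + t • (y - x)) (y - x)) t := by
    intro t ht
    have hz := (hball _ (hmem t ht)).1
    have h1 : HasFDerivAt f (fderiv ℝ f (x + t • (y - x))) (x + t • (y - x)) :=
      (((contDiffAt_spinNorm (h.smooth_al _ hz)).add
        (contDiffAt_spinNorm (h.smooth_be _ hz))).differentiableAt (by simp)).hasFDerivAt
    have h2 : HasDerivAt (fun t : ℝ => x + t • (y - x)) (y - x) t := by
      simpa using ((hasDerivAt_id t).smul_const (y - x)).const_add x
    exact h1.comp_hasDerivAt t h2
  -- Grönwall's inequality along the segment from x to y: a function starting at zero with |f'| ≤ K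
  -- |f| stays zero.
  have hz := eq_zero_of_abs_deriv_le_mul_abs_self_of_eq_zero_right (K := K) (a := 0) (b := 1)
    (fun t ht => (hd t ht).continuousAt.continuousWithinAt)
    (fun t ht => (hd t ⟨ht.1, ht.2.le⟩).hasDerivWithinAt)
    (by simp [hf, hal, hbe, spinNorm_zero]) (fun t ht => by
      have hz := hball _ (hmem t ⟨ht.1, ht.2.le⟩)
      rw [Real.norm_eq_abs, Real.norm_eq_abs, abs_of_nonneg (hnn _)]
      refine (h.abs_fderiv_spinNorm_le hz.1 (y - x)).trans ?_
      refine mul_le_mul_of_nonneg_right ?_ (hnn _)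
      refine le_trans ?_ hz.2.le
      rw [hG]
      refine mul_le_mul_of_nonneg_right ?_ ?_
      · exact mul_le_of_le_one_right (Finset.sum_nonneg fun a _ => norm_nonneg _)
          (hyn.le.trans (min_le_right _ _))
      · positivity) 1 (right_mem_Icc.2 zero_le_one)
  simp only [one_smul, add_sub_cancel, hf] at hz
  have h1 := spinNorm_nonneg (al y)
  have h2 := spinNorm_nonneg (be y)
  exact ⟨spinNorm_eq_zero.1 (by linarith), spinNorm_eq_zero.1 (by linarith)⟩

theorem be_eq_zero (h : KSLocal Λ Ω e al be A φ) {x : E4} (hx : x ∈ Ω)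
    (hal : ∀ᶠ y in 𝓝 x, al y = 0) : be x = 0 := by
  refine (h.jet x hx).eq_zero_of_al_eq_zero hal.self_of_nhds fun a => ?_
  have : al =ᶠ[𝓝 x] fun _ => 0 := hal
  rw [this.fderiv_eq (𝕜 := ℝ)]
  simp

theorem al_eq_zero (h : KSLocal Λ Ω e al be A φ) (hΛ : Λ ≠ 0) {x : E4} (hx : x ∈ Ω)
    (hbe : ∀ᶠ y in 𝓝 x, be y = 0) : al x = 0 := by
  refine (h.jet x hx).eq_zero_of_be_eq_zero hΛ hbe.self_of_nhds fun a => ?_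
  have : be =ᶠ[𝓝 x] fun _ => 0 := hbe
  rw [this.fderiv_eq (𝕜 := ℝ)]
  simp

theorem continuousAt_frameRiem (h : KSLocal Λ Ω e al be A φ) {x : E4} (hx : x ∈ Ω)
    (a b c d : Fin 4) : ContinuousAt (fun y => frameRiem e y a b c d) x := by
  have h1 : ∀ a b c, ContinuousAt (frameConn e a b c) x := fun a b c =>
    (contDiffAt_frameConn (h.indep x hx) (h.smooth_e x hx) a b c).continuousAt
  have h2 : ∀ a b c d, ContinuousAt (fun y => fderiv ℝ (frameConn e b c d) y (e a y)) x :=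
    fun a b c d => (((contDiffAt_frameConn (h.indep x hx) (h.smooth_e x hx) b c d).fderiv_right
      (m := ∞) (by simp)).clm_apply (h.smooth_e x hx a)).continuousAt
  simp only [frameRiem, algRiem]
  refine (((h2 a b c d).sub (h2 b a c d)).add (tendsto_finsetSum _ fun k _ => ?_)).sub
    (tendsto_finsetSum _ fun k _ => ?_)
  · exact ((h1 b c k).mul (h1 a k d)).sub ((h1 a c k).mul (h1 b k d))
  · exact ((h1 a b k).sub (h1 b a k)).mul (h1 k c d)

end KSLocal

end SpinGeometry
end

noncomputable section
namespace SpinGeometry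
open Set Filter Topology

/-! ### Transfer between a manifold and its charts -/

section Transfer

variable {M : Type*} [TopologicalSpace M] [ChartedSpace E4 M]

/-- The expression of a vector field in a chart. -/
def locVec (ψ : OpenPartialHomeomorph M E4) (X : VField M) (w : E4) : E4 :=
  mfderiv 𝓘(ℝ, E4) 𝓘(ℝ, E4) ψ (ψ.symm w) (X (ψ.symm w))

theorem locVec_apply {ψ : OpenPartialHomeomorph M E4} (X : VField M) {x : M} (hx : x ∈ ψ.source) :
    locVec ψ X (ψ x) = mfderiv 𝓘(ℝ, E4) 𝓘(ℝ, E4) ψ x (X x) := by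
  have : ∀ y, y = x → (mfderiv 𝓘(ℝ, E4) 𝓘(ℝ, E4) ψ y (X y) : E4)
      = mfderiv 𝓘(ℝ, E4) 𝓘(ℝ, E4) ψ x (X x) := by
    rintro _ rfl
    rfl
  exact this _ (ψ.left_inv hx)

variable [IsManifold 𝓘(ℝ, E4) ∞ M] {ψ : OpenPartialHomeomorph M E4}

theorem mdifferentiable_of_maximalAtlas (hψ : ψ ∈ IsManifold.maximalAtlas 𝓘(ℝ, E4) ∞ M) :
    ψ.MDifferentiable 𝓘(ℝ, E4) 𝓘(ℝ, E4) :=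
  ⟨(contMDiffOn_of_mem_maximalAtlas hψ).mdifferentiableOn (by simp),
    (contMDiffOn_symm_of_mem_maximalAtlas hψ).mdifferentiableOn (by simp)⟩

theorem mfderiv_of_eventuallyEq {F : Type*} [NormedAddCommGroup F] [NormedSpace ℝ F]
    (hψ : ψ ∈ IsManifold.maximalAtlas 𝓘(ℝ, E4) ∞ M) {x : M} (hx : x ∈ ψ.source) {f : M → F}
    {h : E4 → F} (hf : f =ᶠ[𝓝 x] fun y => h (ψ y)) (hh : DifferentiableAt ℝ h (ψ x))
    (v : TangentSpace 𝓘(ℝ, E4) x) :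
    mfderiv 𝓘(ℝ, E4) 𝓘(ℝ, F) f x v
      = fderiv ℝ h (ψ x) (mfderiv 𝓘(ℝ, E4) 𝓘(ℝ, E4) ψ x v) := by
  rw [hf.mfderiv_eq]
  have h1 := mfderiv_comp x (I := 𝓘(ℝ, E4)) (I' := 𝓘(ℝ, E4)) (I'' := 𝓘(ℝ, F)) (g := h) (f := ψ)
    hh.mdifferentiableAt ((mdifferentiable_of_maximalAtlas hψ).mdifferentiableAt hx)
  have h2 : mfderiv 𝓘(ℝ, E4) 𝓘(ℝ, F) (fun y => h (ψ y)) x = _ := h1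
  rw [h2, mfderiv_eq_fderiv]
  rfl

theorem contDiffAt_comp_symm {F : Type*} [NormedAddCommGroup F] [NormedSpace ℝ F]
    (hψ : ψ ∈ IsManifold.maximalAtlas 𝓘(ℝ, E4) ∞ M) {W : Set M} (hW : IsOpen W) {f : M → F}
    (hf : ContMDiffOn 𝓘(ℝ, E4) 𝓘(ℝ, F) ∞ f W) {w : E4} (hw : w ∈ ψ.target) (hwW : ψ.symm w ∈ W) :
    ContDiffAt ℝ ∞ (fun w => f (ψ.symm w)) w := by
  rw [← contMDiffAt_iff_contDiffAt]
  exact ContMDiffAt.comp w (hf.contMDiffAt (hW.mem_nhds hwW))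
    (contMDiffAt_symm_of_mem_maximalAtlas hψ hw)

theorem isInvertible_mfderiv_symm (hψ : ψ ∈ IsManifold.maximalAtlas 𝓘(ℝ, E4) ∞ M) {w : E4}
    (hw : w ∈ ψ.target) : (mfderiv 𝓘(ℝ, E4) 𝓘(ℝ, E4) ψ.symm w).IsInvertible :=
  ⟨(mdifferentiable_of_maximalAtlas hψ).symm.mfderiv hw, rfl⟩

/-- The chart expression of a field is its pullback under the inverse chart. Smoothness and brackets
therefore transfer by naturality of the pullback. -/
theorem mpullback_eq_locVec (hψ : ψ ∈ IsManifold.maximalAtlas 𝓘(ℝ, E4) ∞ M) {w : E4}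
    (hw : w ∈ ψ.target) (X : VField M) :
    VectorField.mpullback 𝓘(ℝ, E4) 𝓘(ℝ, E4) ψ.symm X w = locVec ψ X w := by
  have h1 := (mdifferentiable_of_maximalAtlas hψ).comp_symm_deriv hw
  have h2 := isInvertible_mfderiv_symm hψ hw
  rw [VectorField.mpullback_apply]
  obtain ⟨L, hL⟩ := h2
  rw [← hL, ContinuousLinearMap.inverse_equiv]
  have h3 := DFunLike.congr_fun h1 (L.symm (X (ψ.symm w)))
  rw [← hL] at h3
  have h4 : L (L.symm (X (ψ.symm w))) = X (ψ.symm w) := L.apply_symm_apply _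
  simp only [ContinuousLinearMap.comp_apply, ContinuousLinearEquiv.coe_coe, h4] at h3
  exact h3.symm

theorem contDiffAt_locVec (hψ : ψ ∈ IsManifold.maximalAtlas 𝓘(ℝ, E4) ∞ M) {W : Set M}
    (hW : IsOpen W) {X : VField M} (hX : SmoothVFieldOn X W) {w : E4} (hw : w ∈ ψ.target)
    (hwW : ψ.symm w ∈ W) : ContDiffAt ℝ ∞ (locVec ψ X) w := by
  have h1 := ContMDiffAt.mpullback_vectorField_preimage (m := ∞) (n := ∞)
    (hX.contMDiffAt (hW.mem_nhds hwW)) (contMDiffAt_symm_of_mem_maximalAtlas hψ hw)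
    (isInvertible_mfderiv_symm hψ hw) (by simp)
  have h2 := contMDiffAt_vectorSpace_iff_contDiffAt.1 h1
  refine h2.congr_of_eventuallyEq ?_
  filter_upwards [ψ.open_target.mem_nhds hw] with y hy
  exact (mpullback_eq_locVec hψ hy X).symm

theorem locVec_bracket (hψ : ψ ∈ IsManifold.maximalAtlas 𝓘(ℝ, E4) ∞ M) {W : Set M}
    (hW : IsOpen W) {X Y : VField M} (hX : SmoothVFieldOn X W) (hY : SmoothVFieldOn Y W) {w : E4}
    (hw : w ∈ ψ.target) (hwW : ψ.symm w ∈ W) :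
    locVec ψ (bracket X Y) w
      = fderiv ℝ (locVec ψ Y) w (locVec ψ X w) - fderiv ℝ (locVec ψ X) w (locVec ψ Y w) := by
  have : IsManifold 𝓘(ℝ, E4) (minSmoothness ℝ 2) M := by
    rw [minSmoothness_of_isRCLikeNormedField]
    exact IsManifold.of_le (n := ∞) (WithTop.coe_le_coe.2 le_top)
  have h1 := VectorField.mpullback_mlieBracket (𝕜 := ℝ) (I := 𝓘(ℝ, E4)) (I' := 𝓘(ℝ, E4)) (n := ∞)
    (f := ψ.symm) (x₀ := w) (V := X) (W := Y)
    ((hX.contMDiffAt (hW.mem_nhds hwW)).mdifferentiableAt (by simp))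
    ((hY.contMDiffAt (hW.mem_nhds hwW)).mdifferentiableAt (by simp))
    (contMDiffAt_symm_of_mem_maximalAtlas hψ hw)
    (by rw [minSmoothness_of_isRCLikeNormedField]; exact WithTop.coe_le_coe.2 le_top)
  have h2 : ∀ X : VField M, VectorField.mpullback 𝓘(ℝ, E4) 𝓘(ℝ, E4) ψ.symm X =ᶠ[𝓝 w] locVec ψ X :=
    fun X => by
      filter_upwards [ψ.open_target.mem_nhds hw] with y hy
      exact mpullback_eq_locVec hψ hy X
  have h3 : ∀ V W : (∀ x : E4, TangentSpace 𝓘(ℝ, E4) x),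
      VectorField.mlieBracket 𝓘(ℝ, E4) V W w = VectorField.lieBracket ℝ V W w := by
    intro V W
    rw [← VectorField.mlieBracketWithin_univ, VectorField.mlieBracketWithin_eq_lieBracketWithin]
    exact congrFun (VectorField.lieBracketWithin_univ (𝕜 := ℝ) (V := fun x => (V x : E4))
      (W := fun x => (W x : E4))) w
  rw [(h2 X).mlieBracket_vectorField_eq (h2 Y)] at h1
  rw [← mpullback_eq_locVec hψ hw]
  exact h1.trans (h3 _ _)

end Transfer

end SpinGeometry
end

/-! ### Orthonormal frames and Killing spinors in charts. -/

noncomputable section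
namespace SpinGeometry
open Set Filter Topology

section Frames

variable {M : Type*} [TopologicalSpace M] [ChartedSpace E4 M] [IsManifold 𝓘(ℝ, E4) ∞ M]
  {g : Metric M} {ψ : OpenPartialHomeomorph M E4} {U : Set M} {E : Fin 4 → VField M}

theorem orthonormal_linearIndependent {x : M} {v : Fin 4 → TangentSpace 𝓘(ℝ, E4) x}
    (h : ∀ a b, g.inner x (v a) (v b) = kd a b) : LinearIndependent ℝ v := by
  rw [Fintype.linearIndependent_iff]
  intro c hc a
  have h1 : g.inner x (∑ b, c b • v b) (v a) = c a := by
    simp [map_sum, h, kd]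
  rw [← h1, hc]
  simp

theorem sum_inner_smul {x : M} {v : Fin 4 → TangentSpace 𝓘(ℝ, E4) x}
    (h : ∀ a b, g.inner x (v a) (v b) = kd a b) (w : TangentSpace 𝓘(ℝ, E4) x) :
    ∑ a, g.inner x w (v a) • v a = w := by
  have hli := orthonormal_linearIndependent h
  have : FiniteDimensional ℝ (TangentSpace 𝓘(ℝ, E4) x) := inferInstanceAs (FiniteDimensional ℝ E4)
  have hfin : Module.finrank ℝ (TangentSpace 𝓘(ℝ, E4) x) = 4 := finrank_euclideanSpace_fin (𝕜 := ℝ)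
  have hsp : Submodule.span ℝ (Set.range v) = ⊤ :=
    hli.span_eq_top_of_card_eq_finrank' (by rw [hfin]; rfl)
  have hw : w ∈ Submodule.span ℝ (Set.range v) := by rw [hsp]; trivial
  obtain ⟨c, rfl⟩ := (Submodule.mem_span_range_iff_exists_fun ℝ).1 hw
  refine Finset.sum_congr rfl fun a _ => ?_
  congr 1
  simp [map_sum, h, kd]

/-- A smooth orthonormal frame over an open set. -/
structure OrthoFrame (g : Metric M) (U : Set M) (E : Fin 4 → VField M) : Prop where
  isOpen : IsOpen U
  smooth : ∀ a, SmoothVFieldOn (E a) U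
  orthonormal : ∀ x ∈ U, ∀ a b, g.inner x (E a x) (E b x) = kd a b

namespace OrthoFrame

theorem isOpen_preimage (h : OrthoFrame g U E) (ψ : OpenPartialHomeomorph M E4) :
    IsOpen (ψ.target ∩ ψ.symm ⁻¹' U) :=
  ψ.isOpen_inter_preimage_symm h.isOpen

theorem mem_preimage {x : M} (hx : x ∈ ψ.source) (hU : x ∈ U) : ψ x ∈ ψ.target ∩ ψ.symm ⁻¹' U :=
  ⟨ψ.map_source hx, by rwa [Set.mem_preimage, ψ.left_inv hx]⟩

theorem indep (h : OrthoFrame g U E) (hψ : ψ ∈ IsManifold.maximalAtlas 𝓘(ℝ, E4) ∞ M) {w : E4}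
    (hw : w ∈ ψ.target ∩ ψ.symm ⁻¹' U) : LinearIndependent ℝ fun a => locVec ψ (E a) w := by
  have h1 := orthonormal_linearIndependent (h.orthonormal _ hw.2)
  exact h1.map' (mfderiv 𝓘(ℝ, E4) 𝓘(ℝ, E4) ψ (ψ.symm w) :
    TangentSpace 𝓘(ℝ, E4) (ψ.symm w) →ₗ[ℝ] TangentSpace 𝓘(ℝ, E4) (ψ (ψ.symm w)))
    (LinearMap.ker_eq_bot.2
      ((mdifferentiable_of_maximalAtlas hψ).mfderiv_injective (ψ.map_target hw.1)))

theorem smooth_locVec (h : OrthoFrame g U E) (hψ : ψ ∈ IsManifold.maximalAtlas 𝓘(ℝ, E4) ∞ M)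
    {w : E4} (hw : w ∈ ψ.target ∩ ψ.symm ⁻¹' U) (a : Fin 4) : ContDiffAt ℝ ∞ (locVec ψ (E a)) w :=
  contDiffAt_locVec hψ h.isOpen (h.smooth a) hw.1 hw.2

/-- In an orthonormal frame the dual coframe is given by inner products. All metric quantities in a
chart can thus be expressed through the frame alone. -/
theorem coframe_mfderiv (h : OrthoFrame g U E) (hψ : ψ ∈ IsManifold.maximalAtlas 𝓘(ℝ, E4) ∞ M)
    {x : M} (hx : x ∈ ψ.source) (hU : x ∈ U) (v : TangentSpace 𝓘(ℝ, E4) x) (a : Fin 4) :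
    coframe (fun a => locVec ψ (E a)) a (ψ x) (mfderiv 𝓘(ℝ, E4) 𝓘(ℝ, E4) ψ x v)
      = g.inner x v (E a x) := by
  refine coframe_unique (h.indep hψ (mem_preimage hx hU)) (c := fun a => g.inner x v (E a x)) ?_ a
  conv_lhs => rw [← sum_inner_smul (h.orthonormal x hU) v]
  rw [map_sum]
  refine Finset.sum_congr rfl fun b _ => ?_
  rw [map_smul, locVec_apply _ hx]
  rfl

theorem structFun_eq (h : OrthoFrame g U E) (hψ : ψ ∈ IsManifold.maximalAtlas 𝓘(ℝ, E4) ∞ M)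
    {x : M} (hx : x ∈ ψ.source) (hU : x ∈ U) (a b c : Fin 4) :
    structFun g E a b c x = frameC (fun a => locVec ψ (E a)) a b c (ψ x) := by
  have hw := mem_preimage (ψ := ψ) hx hU
  rw [structFun, ← h.coframe_mfderiv hψ hx hU, ← locVec_apply _ hx,
    locVec_bracket hψ h.isOpen (h.smooth a) (h.smooth b) hw.1 hw.2]
  rfl

theorem conn_eq (h : OrthoFrame g U E) (hψ : ψ ∈ IsManifold.maximalAtlas 𝓘(ℝ, E4) ∞ M)
    {x : M} (hx : x ∈ ψ.source) (hU : x ∈ U) (a b c : Fin 4) :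
    conn g E a b c x = frameConn (fun a => locVec ψ (E a)) a b c (ψ x) := by
  simp only [conn, frameConn, h.structFun_eq hψ hx hU]

theorem riem_eq (h : OrthoFrame g U E) (hψ : ψ ∈ IsManifold.maximalAtlas 𝓘(ℝ, E4) ∞ M)
    {x : M} (hx : x ∈ ψ.source) (hU : x ∈ U) (a b c d : Fin 4) :
    riem g E a b c d x = frameRiem (fun a => locVec ψ (E a)) (ψ x) a b c d := by
  have hw := mem_preimage (ψ := ψ) hx hU
  have hdir : ∀ a b c d, dirR (conn g E b c d) (E a) x
      = fderiv ℝ (frameConn (fun a => locVec ψ (E a)) b c d) (ψ x) (locVec ψ (E a) (ψ x)) := by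
    intro a b c d
    rw [locVec_apply _ hx]
    refine mfderiv_of_eventuallyEq hψ hx ?_ ((contDiffAt_frameConn (h.indep hψ hw)
      (h.smooth_locVec hψ hw) b c d).differentiableAt (by simp)) _
    filter_upwards [ψ.open_source.mem_nhds hx, h.isOpen.mem_nhds hU] with y hy hyU
    exact h.conn_eq hψ hy hyU b c d
  simp only [riem, frameRiem, algRiem, hdir, h.conn_eq hψ hx hU, h.structFun_eq hψ hx hU,
    frameConn_sub]

end OrthoFrame

end Frames

section KillingSpinors

variable {M : Type*} [TopologicalSpace M] [ChartedSpace E4 M] [IsManifold 𝓘(ℝ, E4) ∞ M]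
  {g : Metric M} {ι : Type*} {s : SpinStructure g ι} {ψ : OpenPartialHomeomorph M E4}
  {Λ : ℝ} {A : OneForm M} {φ : ι → M → Matrix (Fin 2) (Fin 2) ℂ} {α β : ι → M → Fin 2 → ℂ}

theorem SpinStructure.orthoFrame (s : SpinStructure g ι) (i : ι) : OrthoFrame g (s.U i) (s.E i) :=
  ⟨s.isOpen_U i, s.smooth_E i, s.orthonormal i⟩

theorem solder_eq_spinContr (v : Fin 4 → ℝ) (P P' : Fin 2) :
    solder v P P' = spinContr (fun a => (v a : ℂ)) P P' := by
  simp only [solder, spinContr, Matrix.sum_apply, Matrix.smul_apply, smul_eq_mul, mul_comm]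

theorem exp_half_pi : Complex.exp (((Real.pi / 2 : ℝ) : ℂ) * Complex.I) = Complex.I := by
  push_cast
  exact Complex.exp_pi_div_two_mul_I

/-- Every ingredient of the global equations has a chart expression computed from the frame. The
value θ = π/2 enters only through e^{iθ} = i. -/
theorem ksLocal (hF : IsASDMaxwell s A φ) (hKS : IsKillingSpinor s (Real.pi / 2) Λ A φ α β)
    (hψ : ψ ∈ IsManifold.maximalAtlas 𝓘(ℝ, E4) ∞ M) (i : ι) :
    KSLocal Λ (ψ.target ∩ ψ.symm ⁻¹' s.U i) (fun a => locVec ψ (s.E i a))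
      (fun w => α i (ψ.symm w)) (fun w => β i (ψ.symm w))
      (fun a w => A (ψ.symm w) (s.E i a (ψ.symm w))) (fun w => φ i (ψ.symm w)) := by
  have h := s.orthoFrame i
  have hsm : ∀ {α : ι → M → Fin 2 → ℂ} {T : ι → ι → M → Matrix (Fin 2) (Fin 2) ℂ},
      IsSpinorField s.U T α → ∀ w ∈ ψ.target ∩ ψ.symm ⁻¹' s.U i,
      ContDiffAt ℝ ∞ (fun w => α i (ψ.symm w)) w := fun hα w hw =>
    contDiffAt_pi.2 fun B => contDiffAt_comp_symm hψ h.isOpen (hα.smooth i B) hw.1 hw.2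
  have hA : ∀ w ∈ ψ.target ∩ ψ.symm ⁻¹' s.U i, ∀ a,
      ContDiffAt ℝ ∞ (fun w => A (ψ.symm w) (s.E i a (ψ.symm w))) w := fun w hw a =>
    contDiffAt_comp_symm hψ h.isOpen (hF.smooth _ _ h.isOpen (h.smooth a)) hw.1 hw.2
  refine ⟨h.isOpen_preimage ψ, fun w hw => h.indep hψ hw, fun w hw => h.smooth_locVec hψ hw,
    hsm hKS.unprimed, hsm hKS.primed, hA, fun w hw => ?_⟩
  obtain ⟨x, hx, rfl⟩ : ∃ x ∈ ψ.source, ψ x = w := ⟨ψ.symm w, ψ.map_target hw.1, ψ.right_inv hw.1⟩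
  have hU : x ∈ s.U i := by
    have := hw.2
    rwa [Set.mem_preimage, ψ.left_inv hx] at this
  have hnear : ∀ {F : Type} (f : M → F), f =ᶠ[𝓝 x] fun y => f (ψ.symm (ψ y)) := fun f => by
    filter_upwards [ψ.open_source.mem_nhds hx] with y hy
    rw [ψ.left_inv hy]
  have hdirC : ∀ {α : ι → M → Fin 2 → ℂ} {T : ι → ι → M → Matrix (Fin 2) (Fin 2) ℂ},
      IsSpinorField s.U T α → ∀ a B, dirC (fun y => α i y B) (s.E i a) x
        = fderiv ℝ (fun w => α i (ψ.symm w)) (ψ x) (locVec ψ (s.E i a) (ψ x)) B := by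
    intro α T hα a B
    have hd := (hsm hα _ hw).differentiableAt (n := ∞) (by simp)
    rw [locVec_apply _ hx]
    have h1 := mfderiv_of_eventuallyEq hψ hx (f := fun y => α i y B)
      (h := fun w => α i (ψ.symm w) B) (hnear fun y => α i y B)
      (hasFDerivAt_component hd B).differentiableAt (s.E i a x)
    rw [(hasFDerivAt_component hd B).fderiv] at h1
    exact h1
  have hdirR : ∀ a b, dirR (fun y => A y (s.E i b y)) (s.E i a) x
      = fderiv ℝ (fun w => A (ψ.symm w) (s.E i b (ψ.symm w))) (ψ x)
        (locVec ψ (s.E i a) (ψ x)) := by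
    intro a b
    rw [locVec_apply _ hx]
    exact mfderiv_of_eventuallyEq hψ hx (hnear fun y => A y (s.E i b y))
      ((hA _ hw b).differentiableAt (by simp)) _
  have hconn : ∀ a b c, frameConn (fun a => locVec ψ (s.E i a)) a b c (ψ x) = conn g (s.E i) a b c x :=
    fun a b c => (h.conn_eq hψ hx hU a b c).symm
  simp only [hconn]
  have hjet : KSJet Λ (α i x) (β i x)
      (fun a => fderiv ℝ (fun w => α i (ψ.symm w)) (ψ x) (locVec ψ (s.E i a) (ψ x)))
      (fun a => fderiv ℝ (fun w => β i (ψ.symm w)) (ψ x) (locVec ψ (s.E i a) (ψ x)))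
      (fun a b c => conn g (s.E i) a b c x) (fun a => A x (s.E i a x))
      (frameF (fun a => locVec ψ (s.E i a)) (fun a w => A (ψ.symm w) (s.E i a (ψ.symm w))) (ψ x))
      (φ i x) := by
    refine ⟨fun a b c => ?_, hF.symm i x hU, fun P P' Q Q' => ?_, fun P P' Q => ?_,
      fun P P' Q' => ?_⟩
    · rw [← hconn, ← hconn]
      exact frameConn_antisymm a b c
    · rw [← hF.field i x hU, spinContr₂_eq_sum]
      refine Finset.sum_congr rfl fun a _ => Finset.sum_congr rfl fun b _ => ?_
      congr 3
      rw [frameF, dOneForm, hdirR, hdirR]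
      congr 1
      conv_rhs => rw [← sum_inner_smul (h.orthonormal x hU) (bracket (s.E i a) (s.E i b) x), map_sum]
      refine Finset.sum_congr rfl fun c _ => ?_
      rw [map_smul, smul_eq_mul, ← h.structFun_eq hψ hx hU, ψ.left_inv hx]
      rfl
    · have h1 := hKS.eq_unprimed i x hU P P' Q
      rw [exp_half_pi, solder_eq_spinContr] at h1
      rw [← h1]
      refine Finset.sum_congr rfl fun a _ => ?_
      rw [covD, hdirC hKS.unprimed]
      rfl
    · have h1 := hKS.eq_primed i x hU P P' Q'
      rw [exp_half_pi, solder_eq_spinContr] at h1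
      rw [← h1]
      refine Finset.sum_congr rfl fun a _ => ?_
      rw [covD', hdirC hKS.primed]
      rfl
  rw [ψ.left_inv hx]
  exact hjet

end KillingSpinors

end SpinGeometry
end

/-! ### Invariance of the metric under K, and K as a global field. -/

noncomputable section
namespace SpinGeometry
open Set Filter Topology

section FrameBracket

variable {e : Fin 4 → E4 → E4} {x : E4}

theorem extd_coframe {Ω : Set E4} (hΩ : IsOpen Ω) (h : ∀ y ∈ Ω, LinearIndependent ℝ fun a => e a y)
    (he : ∀ y ∈ Ω, ∀ a, ContDiffAt ℝ ∞ (e a) y) (hx : x ∈ Ω) (a : Fin 4) (v w : E4) :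
    extd (coframe e a) x v w
      = -∑ b, ∑ c, coframe e b x v * coframe e c x w * frameC e b c a x := by
  have h1 : coframe e a = formOf e fun c _ => kd c a := by
    funext y
    simp [formOf, kd]
    ext v
    simp
  refine congrFun (congrFun (bilinear_ext_frame (h x hx) (isBilinearMap_extd _ x)
    (g := fun v w => -∑ b, ∑ c, coframe e b x v * coframe e c x w * frameC e b c a x)
    ⟨?_, ?_, ?_, ?_⟩ ?_) v) w
  · intro _ _ _
    simp only [map_add, add_mul, Finset.sum_add_distrib]
    ring
  · intro r _ _
    simp only [map_smul, smul_eq_mul, mul_neg, Finset.mul_sum, mul_assoc]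
  · intro _ _ _
    simp only [map_add, add_mul, mul_add, Finset.sum_add_distrib]
    ring
  · intro r _ _
    simp only [map_smul, smul_eq_mul, mul_neg, Finset.mul_sum, mul_assoc, mul_left_comm r]
  · intro b c
    rw [h1, extd_formOf hΩ h he hx fun a => contDiffAt_const]
    simp [coframe_apply (h x hx), kd]

/-- Cartan's formula for the differential of a dual coframe form, whose values on the frame are
minus the structure functions. -/
theorem coframe_bracket {Ω : Set E4} (hΩ : IsOpen Ω) (h : ∀ y ∈ Ω, LinearIndependent ℝ fun a => e a y)
    (he : ∀ y ∈ Ω, ∀ a, ContDiffAt ℝ ∞ (e a) y) (hx : x ∈ Ω) {X Y : E4 → E4}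
    (hX : DifferentiableAt ℝ X x) (hY : DifferentiableAt ℝ Y x) (a : Fin 4) :
    coframe e a x (fderiv ℝ Y x (X x) - fderiv ℝ X x (Y x))
      = fderiv ℝ (fun y => coframe e a y (Y y)) x (X x)
        - fderiv ℝ (fun y => coframe e a y (X y)) x (Y x)
        + ∑ b, ∑ c, coframe e b x (X x) * coframe e c x (Y x) * frameC e b c a x := by
  have hd := ((contDiffAt_coframe (h x hx) (he x hx) a).differentiableAt (by simp)).hasFDerivAt
  have h1 := extd_coframe hΩ h he hx a (X x) (Y x)
  rw [(hd.clm_apply hY.hasFDerivAt).fderiv, (hd.clm_apply hX.hasFDerivAt).fderiv]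
  simp only [extd] at h1
  simp only [add_apply, ContinuousLinearMap.comp_apply, ContinuousLinearMap.flip_apply, map_sub]
  linarith

end FrameBracket

/-- The vector field `K` is a Killing vector field, in components. -/
theorem KSLocal.lie_inner {Λ : ℝ} {Ω : Set E4} {e : Fin 4 → E4 → E4} {al be : E4 → Fin 2 → ℂ}
    {A : Fin 4 → E4 → ℝ} {φ : E4 → Matrix (Fin 2) (Fin 2) ℂ} (h : KSLocal Λ Ω e al be A φ) {x : E4}
    (hx : x ∈ Ω) {K X Y : E4 → E4} (hK : K =ᶠ[𝓝 x] fun y => ∑ a, killVec (al y) (be y) a • e a y)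
    (hX : DifferentiableAt ℝ X x) (hY : DifferentiableAt ℝ Y x) :
    fderiv ℝ (fun y => ∑ a, coframe e a y (X y) * coframe e a y (Y y)) x (K x)
      = ∑ a, coframe e a x (fderiv ℝ X x (K x) - fderiv ℝ K x (X x)) * coframe e a x (Y x)
        + ∑ a, coframe e a x (X x) * coframe e a x (fderiv ℝ Y x (K x) - fderiv ℝ K x (Y x)) := by
  have hKd : DifferentiableAt ℝ K x := by
    refine DifferentiableAt.congr_of_eventuallyEq ?_ hK
    exact (ContDiffAt.sum fun a _ => (h.contDiffAt_killVec hx a).smul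
      (h.smooth_e x hx a)).differentiableAt (n := ∞) (by simp)
  have hco : ∀ a, DifferentiableAt ℝ (coframe e a) x := fun a =>
    (contDiffAt_coframe (h.indep x hx) (h.smooth_e x hx) a).differentiableAt (by simp)
  have hXa : ∀ a, HasFDerivAt (fun y => coframe e a y (X y))
      (fderiv ℝ (fun y => coframe e a y (X y)) x) x := fun a =>
    ((hco a).clm_apply hX).hasFDerivAt
  have hYa : ∀ a, HasFDerivAt (fun y => coframe e a y (Y y))
      (fderiv ℝ (fun y => coframe e a y (Y y)) x) x := fun a =>
    ((hco a).clm_apply hY).hasFDerivAt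
  have hk : (fun a => coframe e a x (K x)) = killVec (al x) (be x) := by
    funext a
    rw [hK.self_of_nhds]
    exact coframe_unique (h.indep x hx) rfl a
  have hk' := fun a => congrFun hk a
  have hKa : ∀ a, fderiv ℝ (fun y => coframe e a y (K y)) x
      = fderiv ℝ (fun y => killVec (al y) (be y) a) x := by
    intro a
    refine Filter.EventuallyEq.fderiv_eq ?_
    filter_upwards [hK, h.isOpen.mem_nhds hx] with y hy hyΩ
    rw [hy]
    exact coframe_unique (h.indep y hyΩ) rfl a
  have hexp : ∀ (L : E4 →L[ℝ] ℝ) v, L v = ∑ c, coframe e c x v * L (e c x) := by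
    intro L v
    conv_lhs => rw [← sum_coframe (h.indep x hx) v]
    simp
  have hkil := fun a b => h.killing hx a b
  have hL : fderiv ℝ (fun y => ∑ a, coframe e a y (X y) * coframe e a y (Y y)) x = _ :=
    (HasFDerivAt.fun_sum fun a _ => (hXa a).mul (hYa a)).fderiv
  rw [hL]
  simp only [coframe_bracket h.isOpen h.indep h.smooth_e hx hKd hX,
    coframe_bracket h.isOpen h.indep h.smooth_e hx hKd hY, hKa, hk']
  simp only [sum_apply, add_apply, smul_apply, smul_eq_mul]
  simp only [hexp (fderiv ℝ (fun y => killVec (al y) (be y) _) x) (X x),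
    hexp (fderiv ℝ (fun y => killVec (al y) (be y) _) x) (Y x)]
  generalize killVec (al x) (be x) = k at *
  set D : Fin 4 → Fin 4 → ℝ := fun a b => fderiv ℝ (fun y => killVec (al y) (be y) b) x (e a x)
  set C : Fin 4 → Fin 4 → Fin 4 → ℝ := fun a b c => frameC e a b c x
  set X' : Fin 4 → ℝ := fun a => coframe e a x (X x)
  set Y' : Fin 4 → ℝ := fun a => coframe e a x (Y x)
  -- The Killing equation in the frame, contracted with the components of X and Y. The remaining
  -- work is to match these double sums with the bracket terms.
  have key : ∑ a, ∑ c, X' c * Y' a * (D c a + D a c)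
      = ∑ a, ∑ c, ∑ b, k b * X' c * Y' a * (C b c a + C b a c) := by
    refine Finset.sum_congr rfl fun a _ => Finset.sum_congr rfl fun c _ => ?_
    have := hkil c a
    change D c a + D a c = ∑ b, (C b c a + C b a c) * k b at this
    rw [this, Finset.mul_sum]
    refine Finset.sum_congr rfl fun b _ => ?_
    ring
  have e1 : ∑ a, ∑ c, X' c * Y' a * (D c a + D a c)
      = ∑ a, (∑ c, X' c * D c a) * Y' a + ∑ a, X' a * ∑ c, Y' c * D c a := by
    simp only [mul_add, Finset.sum_add_distrib]
    congr 1
    · refine Finset.sum_congr rfl fun a _ => ?_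
      rw [Finset.sum_mul]
      refine Finset.sum_congr rfl fun c _ => ?_
      ring
    · rw [Finset.sum_comm]
      refine Finset.sum_congr rfl fun a _ => ?_
      rw [Finset.mul_sum]
      refine Finset.sum_congr rfl fun c _ => ?_
      ring
  have e2 : ∑ a, ∑ c, ∑ b, k b * X' c * Y' a * (C b c a + C b a c)
      = ∑ a, (∑ b, ∑ c, k b * X' c * C b c a) * Y' a
        + ∑ a, X' a * ∑ b, ∑ c, k b * Y' c * C b c a := by
    simp only [mul_add, Finset.sum_add_distrib]
    congr 1
    · refine Finset.sum_congr rfl fun a _ => ?_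
      rw [Finset.sum_comm, Finset.sum_mul]
      refine Finset.sum_congr rfl fun b _ => ?_
      rw [Finset.sum_mul]
      refine Finset.sum_congr rfl fun c _ => ?_
      ring
    · rw [Finset.sum_comm]
      refine Finset.sum_congr rfl fun a _ => ?_
      rw [Finset.sum_comm, Finset.mul_sum]
      refine Finset.sum_congr rfl fun b _ => ?_
      rw [Finset.mul_sum]
      refine Finset.sum_congr rfl fun c _ => ?_
      ring
  rw [e1, e2] at key
  change ∑ a, (X' a * fderiv ℝ (fun y => coframe e a y (Y y)) x (K x)
      + Y' a * fderiv ℝ (fun y => coframe e a y (X y)) x (K x))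
    = ∑ a, (fderiv ℝ (fun y => coframe e a y (X y)) x (K x) - ∑ c, X' c * D c a
        + ∑ b, ∑ c, k b * X' c * C b c a) * Y' a
      + ∑ a, X' a * (fderiv ℝ (fun y => coframe e a y (Y y)) x (K x) - ∑ c, Y' c * D c a
        + ∑ b, ∑ c, k b * Y' c * C b c a)
  simp only [add_mul, sub_mul, mul_add, mul_sub, Finset.sum_add_distrib, Finset.sum_sub_distrib]
  have e3 : ∑ a, Y' a * fderiv ℝ (fun y => coframe e a y (X y)) x (K x)
      = ∑ a, fderiv ℝ (fun y => coframe e a y (X y)) x (K x) * Y' a :=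
    Finset.sum_congr rfl fun a _ => mul_comm _ _
  linarith

/-! ### The global vector field -/

/-- For a matrix in SU(2) the adjoint equals the adjugate, and this is precisely commutation with
the quaternionic structure hat. -/
theorem hat_mulVec_of_mem {L : Matrix (Fin 2) (Fin 2) ℂ}
    (hL : L ∈ Matrix.specialUnitaryGroup (Fin 2) ℂ) (ψ : Fin 2 → ℂ) :
    hat (L *ᵥ ψ) = L *ᵥ hat ψ := by
  obtain ⟨h1, h2⟩ := Matrix.mem_specialUnitaryGroup_iff.1 hL
  have h3 : star L * L = 1 := (Matrix.mem_unitaryGroup_iff').1 h1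
  have h4 : star L = L.adjugate := by
    have h5 : L * L.adjugate = 1 := by rw [Matrix.mul_adjugate, h2, one_smul]
    calc star L = star L * (L * L.adjugate) := by rw [h5, mul_one]
      _ = L.adjugate := by rw [← mul_assoc, h3, one_mul]
  rw [Matrix.adjugate_fin_two] at h4
  have e : ∀ i j, (starRingEnd ℂ) (L j i) = !![L 1 1, -L 0 1; -L 1 0, L 0 0] i j := fun i j =>
    congrFun (congrFun h4 i) j
  have e00 := e 0 0
  have e01 := e 0 1
  have e10 := e 1 0
  have e11 := e 1 1
  simp at e00 e01 e10 e11
  ext i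
  fin_cases i
  · simp [hat_zero, hat_one, Matrix.mulVec, dotProduct, Fin.sum_univ_two, e01, e11]
    ring
  · simp [hat_zero, hat_one, Matrix.mulVec, dotProduct, Fin.sum_univ_two, e00, e10]

section Global

variable {M : Type*} [TopologicalSpace M] [ChartedSpace E4 M] [IsManifold 𝓘(ℝ, E4) ∞ M]
  {g : Metric M} {ι : Type*}

/-- The vector field determined by two spinor fields. -/
def spinorVector (s : SpinStructure g ι) (α β : ι → M → Fin 2 → ℂ) : VField M := fun x =>
  ∑ a, killVec (α (s.cover x).choose x) (β (s.cover x).choose x) a • s.E (s.cover x).choose a x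

variable {s : SpinStructure g ι} {α β : ι → M → Fin 2 → ℂ}

theorem solder_killVec (al be : Fin 2 → ℂ) : solder (killVec al be)
    = Matrix.of fun P P' => Complex.I * (hat al P * be P' + al P * hat be P') := by
  ext P P'
  rw [solder_eq_spinContr, spinContr_killVec]
  rfl

/-- The field is defined with a frame chosen separately at each point. Transition matrices in SU(2)
commute with hat and act on α ⊗ β as the frame change acts on vectors, so the defining identity
holds in every frame. -/
theorem isSpinorVector_spinorVector (hα : IsSpinorField s.U s.L α) (hβ : IsSpinorField s.U s.R β) :
    IsSpinorVector s α β (spinorVector s α β) := by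
  intro j x hj P P'
  set i := (s.cover x).choose with hi_def
  have hi : x ∈ s.U i := (s.cover x).choose_spec
  have h1 : (fun a => g.inner x (spinorVector s α β x) (s.E i a x)) = killVec (α i x) (β i x) := by
    funext a
    rw [spinorVector, ← hi_def]
    simp [map_sum, s.orthonormal i x hi, kd]
  rw [s.frame_transition j i x ⟨hj, hi⟩, h1, solder_killVec, hα.transition j i x ⟨hj, hi⟩,
    hβ.transition j i x ⟨hj, hi⟩, hat_mulVec_of_mem (s.L_mem j i x ⟨hj, hi⟩),
    hat_mulVec_of_mem (s.R_mem j i x ⟨hj, hi⟩)]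
  simp only [Matrix.mul_apply, Matrix.transpose_apply, Matrix.of_apply, Matrix.mulVec, dotProduct,
    Fin.sum_univ_two]
  ring

theorem IsSpinorVector.inner_eq {K : VField M} (hK : IsSpinorVector s α β K) {i : ι} {x : M}
    (hx : x ∈ s.U i) (a : Fin 4) : g.inner x (K x) (s.E i a x) = killVec (α i x) (β i x) a := by
  have h : (fun a => ((g.inner x (K x) (s.E i a x) : ℝ) : ℂ))
      = fun a => (killVec (α i x) (β i x) a : ℂ) := by
    refine ext_spinContr fun P P' => ?_
    rw [spinContr_killVec, ← hK i x hx, solder_eq_spinContr]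
  exact Complex.ofReal_injective (congrFun h a)

theorem IsSpinorVector.eq_sum {K : VField M} (hK : IsSpinorVector s α β K) {i : ι} {x : M}
    (hx : x ∈ s.U i) : K x = ∑ a, killVec (α i x) (β i x) a • s.E i a x := by
  conv_lhs => rw [← sum_inner_smul (s.orthonormal i x hx) (K x)]
  simp only [hK.inner_eq hx]

theorem nonzeroAt_iff {T : ι → ι → M → Matrix (Fin 2) (Fin 2) ℂ} (hα : IsSpinorField s.U T α) {i : ι}
    {x : M} (hx : x ∈ s.U i) : NonzeroAt s.U α x ↔ α i x ≠ 0 := by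
  refine ⟨fun h => h i hx, fun h j hj h0 => h ?_⟩
  rw [hα.transition i j x ⟨hx, hj⟩, h0, Matrix.mulVec_zero]

/-- The squared length of K is 2|α|²|β|². -/
theorem IsSpinorVector.ne_zero_iff {K : VField M} (hK : IsSpinorVector s α β K)
    (hα : IsSpinorField s.U s.L α) (hβ : IsSpinorField s.U s.R β) (x : M) :
    K x ≠ 0 ↔ NonzeroAt s.U α x ∧ NonzeroAt s.U β x := by
  obtain ⟨i, hi⟩ := s.cover x
  rw [nonzeroAt_iff hα hi, nonzeroAt_iff hβ hi, ← not_iff_not, not_not, not_and_or, not_not, not_not,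
    ← spinNorm_eq_zero, ← spinNorm_eq_zero, ← mul_eq_zero]
  have h1 := sum_killVec_sq (α i x) (β i x)
  constructor
  · intro h
    have h2 : ∀ a, killVec (α i x) (β i x) a = 0 := fun a => by rw [← hK.inner_eq hi, h]; simp
    simp only [h2] at h1
    linarith [h1, show ∑ _a : Fin 4, (0 : ℝ) ^ 2 = 0 by simp]
  · intro h
    rw [h, mul_zero] at h1
    have h2 := (Finset.sum_eq_zero_iff_of_nonneg fun a _ =>
      sq_nonneg (killVec (α i x) (β i x) a)).1 h1
    rw [hK.eq_sum hi]
    refine Finset.sum_eq_zero fun a ha => ?_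
    rw [pow_eq_zero_iff two_ne_zero |>.1 (h2 a ha), zero_smul]

end Global

end SpinGeometry
end

/-! ### Global conclusions. -/

noncomputable section
namespace SpinGeometry
open Set Filter Topology

section Main

variable {M : Type*} [TopologicalSpace M] [ChartedSpace E4 M] [IsManifold 𝓘(ℝ, E4) ∞ M]
  {g : Metric M} {ι : Type*} {s : SpinStructure g ι}
  {Λ : ℝ} {A : OneForm M} {φ : ι → M → Matrix (Fin 2) (Fin 2) ℂ} {α β : ι → M → Fin 2 → ℂ}

theorem isOpen_nonzeroAt {T : ι → ι → M → Matrix (Fin 2) (Fin 2) ℂ} (hα : IsSpinorField s.U T α) :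
    IsOpen {x | NonzeroAt s.U α x} := by
  rw [isOpen_iff_mem_nhds]
  intro x hx
  obtain ⟨i, hi⟩ := s.cover x
  have h1 : ContinuousAt (α i) x := continuousAt_pi.2 fun B =>
    ((hα.smooth i B).contMDiffAt ((s.isOpen_U i).mem_nhds hi)).continuousAt
  filter_upwards [(s.isOpen_U i).mem_nhds hi, h1.eventually_ne (hx i hi)] with y hy h
  exact (nonzeroAt_iff hα hy).2 h

theorem not_nonzeroAt_iff {T : ι → ι → M → Matrix (Fin 2) (Fin 2) ℂ} (hα : IsSpinorField s.U T α)
    {i : ι} {x : M} (hx : x ∈ s.U i) : ¬NonzeroAt s.U α x ↔ α i x = 0 := by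
  rw [nonzeroAt_iff hα hx, not_not]

/-- A property of points near `x` holds in a chart around `x`. -/
theorem eventually_chart {ψ : OpenPartialHomeomorph M E4} {x : M} (hx : x ∈ ψ.source) {p : M → Prop}
    (h : ∀ᶠ y in 𝓝 x, p y) : ∀ᶠ w in 𝓝 (ψ x), p (ψ.symm w) := by
  have := ψ.symm.continuousAt (x := ψ x) (ψ.map_source hx)
  rw [ContinuousAt, ψ.left_inv hx] at this
  exact this.eventually h

/-- The common zero set is closed by continuity and open by Grönwall's inequality. A common zero
would force both spinors to vanish on its whole connected component. -/
theorem nonzeroAt_or (hF : IsASDMaxwell s A φ) (hKS : IsKillingSpinor s (Real.pi / 2) Λ A φ α β)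
    (hne : ∀ p : M, ∃ q ∈ connectedComponent p, NonzeroAt s.U α q ∨ NonzeroAt s.U β q) (p : M) :
    NonzeroAt s.U α p ∨ NonzeroAt s.U β p := by
  set Z : Set M := {x | NonzeroAt s.U α x ∨ NonzeroAt s.U β x} with hZ
  have hopen : IsOpen Z := (isOpen_nonzeroAt hKS.unprimed).union (isOpen_nonzeroAt hKS.primed)
  have hclosed : IsOpen Zᶜ := by
    rw [isOpen_iff_mem_nhds]
    intro x hx
    obtain ⟨i, hi⟩ := s.cover x
    have hx' := hx
    simp only [hZ, mem_compl_iff, mem_ofPred_eq, not_or, not_nonzeroAt_iff hKS.unprimed hi,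
      not_nonzeroAt_iff hKS.primed hi] at hx'
    have hψx := mem_chart_source E4 x
    have h := ksLocal hF hKS (IsManifold.chart_mem_maximalAtlas (I := 𝓘(ℝ, E4)) (n := ∞) x) i
    have hw := OrthoFrame.mem_preimage hψx hi
    have hev := h.eventually_eq_zero hw
      (by simp only [(chartAt E4 x).left_inv hψx]; exact hx'.1)
      (by simp only [(chartAt E4 x).left_inv hψx]; exact hx'.2)
    filter_upwards [(chartAt E4 x).continuousAt hψx |>.eventually hev,
      (chartAt E4 x).open_source.mem_nhds hψx, (s.isOpen_U i).mem_nhds hi] with y hy hys hyi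
    rw [(chartAt E4 x).left_inv hys] at hy
    simp only [hZ, mem_compl_iff, mem_ofPred_eq, not_or, not_nonzeroAt_iff hKS.unprimed hyi,
      not_nonzeroAt_iff hKS.primed hyi]
    exact hy
  obtain ⟨q, hq, hqn⟩ := hne p
  by_contra hp
  have hsub := IsClopen.connectedComponent_subset (s := Zᶜ) ⟨isClosed_compl_iff.2 hopen, hclosed⟩
    (x := p) hp
  exact hsub hq hqn

/-- If β vanished near x, its equation would give α = 0 at x, and x would be a common zero. The
argument for α is analogous. -/
theorem dense_nonzeroAt_primed (hF : IsASDMaxwell s A φ)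
    (hKS : IsKillingSpinor s (Real.pi / 2) Λ A φ α β) (hΛ : Λ ≠ 0)
    (hne : ∀ p : M, ∃ q ∈ connectedComponent p, NonzeroAt s.U α q ∨ NonzeroAt s.U β q) :
    Dense {x | NonzeroAt s.U β x} := by
  intro x
  by_contra hx
  rw [mem_closure_iff_frequently, not_frequently] at hx
  obtain ⟨i, hi⟩ := s.cover x
  have hψx := mem_chart_source E4 x
  have h := ksLocal hF hKS (IsManifold.chart_mem_maximalAtlas (I := 𝓘(ℝ, E4)) (n := ∞) x) i
  have hz : ∀ᶠ y in 𝓝 x, β i y = 0 := by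
    filter_upwards [hx, (s.isOpen_U i).mem_nhds hi] with y hy hyi
    exact (not_nonzeroAt_iff hKS.primed hyi).1 hy
  have h0 := h.al_eq_zero hΛ (OrthoFrame.mem_preimage hψx hi) (eventually_chart hψx hz)
  simp only [(chartAt E4 x).left_inv hψx] at h0
  rcases nonzeroAt_or hF hKS hne x with h1 | h1
  · exact h1 i hi h0
  · exact h1 i hi hz.self_of_nhds

theorem dense_nonzeroAt_unprimed (hF : IsASDMaxwell s A φ)
    (hKS : IsKillingSpinor s (Real.pi / 2) Λ A φ α β)
    (hne : ∀ p : M, ∃ q ∈ connectedComponent p, NonzeroAt s.U α q ∨ NonzeroAt s.U β q) :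
    Dense {x | NonzeroAt s.U α x} := by
  intro x
  by_contra hx
  rw [mem_closure_iff_frequently, not_frequently] at hx
  obtain ⟨i, hi⟩ := s.cover x
  have hψx := mem_chart_source E4 x
  have h := ksLocal hF hKS (IsManifold.chart_mem_maximalAtlas (I := 𝓘(ℝ, E4)) (n := ∞) x) i
  have hz : ∀ᶠ y in 𝓝 x, α i y = 0 := by
    filter_upwards [hx, (s.isOpen_U i).mem_nhds hi] with y hy hyi
    exact (not_nonzeroAt_iff hKS.unprimed hyi).1 hy
  have h0 := h.be_eq_zero (OrthoFrame.mem_preimage hψx hi) (eventually_chart hψx hz)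
  simp only [(chartAt E4 x).left_inv hψx] at h0
  rcases nonzeroAt_or hF hKS hne x with h1 | h1
  · exact h1 i hi hz.self_of_nhds
  · exact h1 i hi h0

theorem continuousAt_riem (hF : IsASDMaxwell s A φ) (hKS : IsKillingSpinor s (Real.pi / 2) Λ A φ α β)
    {i : ι} {x : M} (hi : x ∈ s.U i) (a b c d : Fin 4) : ContinuousAt (riem g (s.E i) a b c d) x := by
  have hψx := mem_chart_source E4 x
  have hψ := IsManifold.chart_mem_maximalAtlas (I := 𝓘(ℝ, E4)) (n := ∞) x
  have h := ksLocal hF hKS hψ i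
  have h1 := (h.continuousAt_frameRiem (OrthoFrame.mem_preimage hψx hi) a b c d).comp
    ((chartAt E4 x).continuousAt hψx)
  refine h1.congr ?_
  filter_upwards [(chartAt E4 x).open_source.mem_nhds hψx, (s.isOpen_U i).mem_nhds hi] with y hy hyi
  exact ((s.orthoFrame i).riem_eq hψ hy hyi a b c d).symm

theorem einstein_weyl_of_nonzeroAt (hF : IsASDMaxwell s A φ)
    (hKS : IsKillingSpinor s (Real.pi / 2) Λ A φ α β) (hΛ : Λ ≠ 0) {i : ι} {x : M} (hi : x ∈ s.U i)
    (hx : NonzeroAt s.U β x) :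
    EinsteinAt g (s.E i) (-6 * Λ) x ∧ WeylASDAt g (s.E i) x := by
  have hψx := mem_chart_source E4 x
  have hψ := IsManifold.chart_mem_maximalAtlas (I := 𝓘(ℝ, E4)) (n := ∞) x
  have h := ksLocal hF hKS hψ i
  have h1 := h.asd_einstein hΛ (OrthoFrame.mem_preimage hψx hi)
    (by simp only [(chartAt E4 x).left_inv hψx]; exact hx i hi)
  have h2 : (fun a b c d => riem g (s.E i) a b c d x) = frameRiem
      (fun a => locVec (chartAt E4 x) (s.E i a)) ((chartAt E4 x) x) := by
    funext a b c d
    exact (s.orthoFrame i).riem_eq hψ hψx hi a b c d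
  rw [← h2] at h1
  exact h1

/-- The integrability argument requires β ≠ 0. The components of the curvature in a fixed frame are
continuous, so the identities pass from the dense set where β ≠ 0 to all points. -/
theorem einstein_weyl (hF : IsASDMaxwell s A φ)
    (hKS : IsKillingSpinor s (Real.pi / 2) Λ A φ α β) (hΛ : Λ ≠ 0)
    (hne : ∀ p : M, ∃ q ∈ connectedComponent p, NonzeroAt s.U α q ∨ NonzeroAt s.U β q)
    {i : ι} {x : M} (hi : x ∈ s.U i) :
    EinsteinAt g (s.E i) (-6 * Λ) x ∧ WeylASDAt g (s.E i) x := by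
  have hfr : ∃ᶠ y in 𝓝 x, EinsteinAt g (s.E i) (-6 * Λ) y ∧ WeylASDAt g (s.E i) y := by
    have h1 := mem_closure_iff_frequently.1 (dense_nonzeroAt_primed hF hKS hΛ hne x)
    refine (h1.and_eventually ((s.isOpen_U i).eventually_mem hi)).mono fun y hy => ?_
    exact einstein_weyl_of_nonzeroAt hF hKS hΛ hy.2 hy.1
  have hR := continuousAt_riem hF hKS hi
  have hric : ∀ b c, ContinuousAt (ricci g (s.E i) b c) x := fun b c =>
    tendsto_finsetSum _ fun a _ => hR a b c a
  have hsc : ContinuousAt (scalarCurv g (s.E i)) x := tendsto_finsetSum _ fun a _ => hric a a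
  have hW : ∀ a b c d, ContinuousAt (weyl g (s.E i) a b c d) x := fun a b c d =>
    ((hR a b c d).sub ((((((hric b c).mul continuousAt_const).sub
      ((hric a c).mul continuousAt_const)).add (continuousAt_const.mul (hric a d))).sub
      (continuousAt_const.mul (hric b d))).div_const 2)).add
      ((hsc.div_const 6).mul continuousAt_const)
  have hlim : ∀ {f : M → ℝ} {r : ℝ}, ContinuousAt f x → (∃ᶠ y in 𝓝 x, f y = r) → f x = r :=
    fun hf hr => isClosed_singleton.mem_of_frequently_of_tendsto hr hf
  refine ⟨fun a b => hlim (hric a b) (hfr.mono fun y hy => hy.1 a b), fun a b c d => ?_⟩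
  have h1 := hlim (f := fun y => (∑ e, ∑ f, leviCivita a b e f * weyl g (s.E i) e f c d y) / 2
      + weyl g (s.E i) a b c d y) (r := 0)
    (((tendsto_finsetSum _ fun e _ => tendsto_finsetSum _ fun f _ =>
      tendsto_const_nhds.mul (hW e f c d)).div_const 2).add (hW a b c d))
    (hfr.mono fun y hy => by rw [hy.2 a b c d, neg_add_cancel])
  linarith

theorem locVec_spinorVector (hKS : IsKillingSpinor s (Real.pi / 2) Λ A φ α β)
    {ψ : OpenPartialHomeomorph M E4} {i : ι} {w : E4} (hw : w ∈ ψ.target ∩ ψ.symm ⁻¹' s.U i) :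
    locVec ψ (spinorVector s α β) w
      = ∑ a, killVec (α i (ψ.symm w)) (β i (ψ.symm w)) a • locVec ψ (s.E i a) w := by
  have hK := isSpinorVector_spinorVector hKS.unprimed hKS.primed
  rw [locVec, hK.eq_sum hw.2, map_sum]
  simp only [map_smul]
  rfl

/-- The pointwise choice of frame in the definition is not continuous, but near each point the field
agrees with its expression in one fixed smooth frame. -/
theorem smooth_spinorVector (hKS : IsKillingSpinor s (Real.pi / 2) Λ A φ α β) :
    SmoothVFieldOn (spinorVector s α β) univ := by
  intro x _
  rw [contMDiffWithinAt_univ]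
  obtain ⟨i, hi⟩ := s.cover x
  have hsm : ∀ a, ContMDiffAt 𝓘(ℝ, E4) 𝓘(ℝ, ℝ) ∞ (fun y => killVec (α i y) (β i y) a) x := by
    intro a
    have h1 : ContMDiffAt 𝓘(ℝ, E4) 𝓘(ℝ, Fin 2 → ℂ) ∞ (α i) x := contMDiffAt_pi_space.2 fun B =>
      (hKS.unprimed.smooth i B).contMDiffAt ((s.isOpen_U i).mem_nhds hi)
    have h2 : ContMDiffAt 𝓘(ℝ, E4) 𝓘(ℝ, Fin 2 → ℂ) ∞ (β i) x := contMDiffAt_pi_space.2 fun B =>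
      (hKS.primed.smooth i B).contMDiffAt ((s.isOpen_U i).mem_nhds hi)
    have h3 : ContDiffAt ℝ ∞ (fun q : (Fin 2 → ℂ) × (Fin 2 → ℂ) => killVec q.1 q.2 a)
        (α i x, β i x) :=
      contDiffAt_const.mul (Complex.imCLM.contDiff.contDiffAt.comp _
        (contDiffAt_bil contDiffAt_fst (contDiffAt_hat contDiffAt_snd) a))
    have h4 := ContMDiffAt.comp x (I' := 𝓘(ℝ, (Fin 2 → ℂ) × (Fin 2 → ℂ)))
      (g := fun q : (Fin 2 → ℂ) × (Fin 2 → ℂ) => killVec q.1 q.2 a)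
      (f := fun y => (α i y, β i y)) h3.contMDiffAt (h1.prodMk_space h2)
    exact h4
  have hsum : ContMDiffAt 𝓘(ℝ, E4) 𝓘(ℝ, E4).tangent ∞
      (fun y => (⟨y, ∑ a, killVec (α i y) (β i y) a • s.E i a y⟩ : TangentBundle 𝓘(ℝ, E4) M)) x :=
    ContMDiffAt.sum_section fun a _ => (hsm a).smul_section
      ((s.smooth_E i a).contMDiffAt ((s.isOpen_U i).mem_nhds hi))
  refine hsum.congr_of_eventuallyEq ?_
  filter_upwards [(s.isOpen_U i).mem_nhds hi] with y hy
  rw [(isSpinorVector_spinorVector hKS.unprimed hKS.primed).eq_sum hy]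

theorem isKilling_spinorVector (hF : IsASDMaxwell s A φ)
    (hKS : IsKillingSpinor s (Real.pi / 2) Λ A φ α β) : IsKilling g (spinorVector s α β) := by
  refine ⟨smooth_spinorVector hKS, fun W X Y hW hX hY x hx => ?_⟩
  have hKsm := smooth_spinorVector hKS (s := s)
  obtain ⟨i, hi⟩ := s.cover x
  set K := spinorVector s α β with hK
  set ψ := chartAt E4 x
  have hψx : x ∈ ψ.source := mem_chart_source E4 x
  have hψ : ψ ∈ IsManifold.maximalAtlas 𝓘(ℝ, E4) ∞ M := IsManifold.chart_mem_maximalAtlas x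
  have h := ksLocal hF hKS hψ i
  have hfr := s.orthoFrame i
  have hw : ψ x ∈ ψ.target ∩ ψ.symm ⁻¹' s.U i := OrthoFrame.mem_preimage hψx hi
  have hwW : ψ.symm (ψ x) ∈ W := by rwa [ψ.left_inv hψx]
  set e : Fin 4 → E4 → E4 := fun a => locVec ψ (s.E i a)
  have hXd := contDiffAt_locVec hψ hW hX hw.1 hwW
  have hYd := contDiffAt_locVec hψ hW hY hw.1 hwW
  have key := h.lie_inner hw (K := locVec ψ K) (X := locVec ψ X) (Y := locVec ψ Y)
    (by
      filter_upwards [hfr.isOpen_preimage ψ |>.mem_nhds hw] with w hw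
      exact locVec_spinorVector hKS hw)
    (hXd.differentiableAt (by simp)) (hYd.differentiableAt (by simp))
  have hin : ∀ y ∈ ψ.source, y ∈ s.U i → ∀ v w : TangentSpace 𝓘(ℝ, E4) y,
      g.inner y v w = ∑ a, coframe e a (ψ y) (mfderiv 𝓘(ℝ, E4) 𝓘(ℝ, E4) ψ y v)
        * coframe e a (ψ y) (mfderiv 𝓘(ℝ, E4) 𝓘(ℝ, E4) ψ y w) := by
    intro y hy hyi v w
    simp only [e, hfr.coframe_mfderiv hψ hy hyi]
    conv_lhs => rw [← sum_inner_smul (hfr.orthonormal y hyi) w]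
    simp only [map_sum, map_smul, smul_eq_mul]
    exact Finset.sum_congr rfl fun a _ => mul_comm _ _
  have hbr : ∀ Z : VField M, SmoothVFieldOn Z W → mfderiv 𝓘(ℝ, E4) 𝓘(ℝ, E4) ψ x (bracket K Z x)
      = fderiv ℝ (locVec ψ Z) (ψ x) (locVec ψ K (ψ x))
        - fderiv ℝ (locVec ψ K) (ψ x) (locVec ψ Z (ψ x)) := by
    intro Z hZ
    rw [← locVec_apply _ hψx]
    exact locVec_bracket hψ hW (hKsm.mono (subset_univ _)) hZ hw.1 hwW
  rw [hin x hψx hi, hin x hψx hi, hbr X hX, hbr Y hY]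
  simp only [← locVec_apply _ hψx]
  rw [← key, locVec_apply K hψx]
  have hco : ∀ a, DifferentiableAt ℝ (coframe e a) (ψ x) := fun a =>
    (contDiffAt_coframe (h.indep _ hw) (h.smooth_e _ hw) a).differentiableAt (by simp)
  refine mfderiv_of_eventuallyEq hψ hψx ?_ ?_ _
  · filter_upwards [ψ.open_source.mem_nhds hψx, (s.isOpen_U i).mem_nhds hi] with y hy hyi
    rw [hin y hy hyi]
    simp only [locVec_apply _ hy]
  · exact DifferentiableAt.fun_sum fun a _ =>
      ((hco a).clm_apply (hXd.differentiableAt (by simp))).mul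
        ((hco a).clm_apply (hYd.differentiableAt (by simp)))

theorem exists_toda_chart (hF : IsASDMaxwell s A φ)
    (hKS : IsKillingSpinor s (Real.pi / 2) Λ A φ α β) (hΛ : Λ ≠ 0) {p : M}
    (hα : NonzeroAt s.U α p) (hβ : NonzeroAt s.U β p) :
    ∃ (Φ : OpenPartialHomeomorph M E4) (D : Set E3) (u V : E3 → ℝ) (om : Fin 3 → E3 → ℝ),
      p ∈ Φ.source ∧ Φ ∈ IsManifold.maximalAtlas 𝓘(ℝ, E4) ∞ M ∧ IsTodaData Λ D u V om ∧
      ∀ x ∈ Φ.source, proj (Φ x) ∈ D ∧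
        (∀ v : TangentSpace 𝓘(ℝ, E4) x,
          g.inner x v v = todaMetric u V om (Φ x) (coordVec Φ x v)) ∧
        coordVec Φ x (spinorVector s α β x) = EuclideanSpace.single 3 (Real.sqrt 2) := by
  obtain ⟨i, hi⟩ := s.cover p
  set ψ := chartAt E4 p
  have hψx : p ∈ ψ.source := mem_chart_source E4 p
  have hψ : ψ ∈ IsManifold.maximalAtlas 𝓘(ℝ, E4) ∞ M := IsManifold.chart_mem_maximalAtlas p
  have h := ksLocal hF hKS hψ i
  have hfr := s.orthoFrame i
  obtain ⟨Φ, D, u, V, om, h1, h2, h3, h4, h5, h6⟩ := h.exists_toda hΛ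
    (OrthoFrame.mem_preimage hψx hi) (by simp only [ψ.left_inv hψx]; exact hα i hi)
    (by simp only [ψ.left_inv hψx]; exact hβ i hi)
  have hsrc : ∀ x, x ∈ (ψ.trans Φ).source ↔ x ∈ ψ.source ∧ ψ x ∈ Φ.source := fun x => by
    rw [ψ.trans_source]; rfl
  refine ⟨ψ.trans Φ, D, u, V, om, (hsrc p).2 ⟨hψx, h1⟩, ?_, h5, fun x hx => ?_⟩
  · refine (ψ.trans Φ).mem_maximalAtlas_of_contMDiffOn (I := 𝓘(ℝ, E4)) ?_ ?_
    · intro x hx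
      obtain ⟨hx1, hx2⟩ := (hsrc x).1 hx
      exact (ContMDiffAt.comp x (h3 _ hx2).contMDiffAt
        (contMDiffAt_of_mem_maximalAtlas hψ hx1)).contMDiffWithinAt
    · intro w hw
      have hw' : w ∈ Φ.target ∧ Φ.symm w ∈ ψ.target := by
        rw [ψ.trans_target] at hw; exact hw
      exact (ContMDiffAt.comp w (contMDiffAt_symm_of_mem_maximalAtlas hψ hw'.2)
        (h4 _ hw'.1).contMDiffAt).contMDiffWithinAt
  · obtain ⟨hx1, hx2⟩ := (hsrc x).1 hx
    have hxi : x ∈ s.U i := by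
      have := (h2 hx2).2
      rwa [Set.mem_preimage, ψ.left_inv hx1] at this
    obtain ⟨a1, a2, a3⟩ := h6 _ hx2
    have hcv : ∀ v : TangentSpace 𝓘(ℝ, E4) x, coordVec (ψ.trans Φ) x v
        = fderiv ℝ Φ (ψ x) (mfderiv 𝓘(ℝ, E4) 𝓘(ℝ, E4) ψ x v) := fun v =>
      mfderiv_of_eventuallyEq hψ hx1 (f := ψ.trans Φ) (h := Φ) (Eventually.of_forall fun y => rfl)
        ((h3 _ hx2).differentiableAt (by simp)) v
    refine ⟨a1, fun v => ?_, ?_⟩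
    · rw [hcv]
      refine Eq.trans ?_ (a2 _)
      simp only [hfr.coframe_mfderiv hψ hx1 hxi]
      have : g.inner x v (∑ a, g.inner x v (s.E i a x) • s.E i a x)
          = ∑ a, g.inner x v (s.E i a x) ^ 2 := by
        simp only [map_sum, map_smul, smul_eq_mul, sq]
      rw [← this, sum_inner_smul (hfr.orthonormal x hxi) v]
    · rw [hcv, ← locVec_apply _ hx1, locVec_spinorVector hKS (OrthoFrame.mem_preimage hx1 hxi)]
      exact a3

end Main

end SpinGeometry
end

theorem proposition2 {M : Type*} [TopologicalSpace M] [ChartedSpace SpinGeometry.E4 M]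
    [IsManifold 𝓘(ℝ, SpinGeometry.E4) ∞ M] (g : SpinGeometry.Metric M)
    {ι : Type*} (s : SpinGeometry.SpinStructure g ι) (Λ : ℝ) (hΛ : Λ ≠ 0)
    (A : SpinGeometry.OneForm M) (φ : ι → M → Matrix (Fin 2) (Fin 2) ℂ)
    (hF : SpinGeometry.IsASDMaxwell s A φ)
    (α β : ι → M → Fin 2 → ℂ)
    (hKS : SpinGeometry.IsKillingSpinor s (Real.pi / 2) Λ A φ α β)
    (hne : ∀ p : M, ∃ q ∈ connectedComponent p,
      SpinGeometry.NonzeroAt s.U α q ∨ SpinGeometry.NonzeroAt s.U β q) :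
    (∀ i, ∀ x ∈ s.U i,
      SpinGeometry.EinsteinAt g (s.E i) (-6 * Λ) x ∧ SpinGeometry.WeylASDAt g (s.E i) x) ∧
    Dense {p : M | SpinGeometry.NonzeroAt s.U α p ∧ SpinGeometry.NonzeroAt s.U β p} ∧
    ∃ K : SpinGeometry.VField M,
      SpinGeometry.IsSpinorVector s α β K ∧ SpinGeometry.IsKilling g K ∧
      (∀ p : M, K p ≠ 0 ↔ SpinGeometry.NonzeroAt s.U α p ∧ SpinGeometry.NonzeroAt s.U β p) ∧
      ∀ p : M, K p ≠ 0 →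
        ∃ (Φ : OpenPartialHomeomorph M SpinGeometry.E4) (D : Set SpinGeometry.E3)
          (u V : SpinGeometry.E3 → ℝ) (om : Fin 3 → SpinGeometry.E3 → ℝ),
          p ∈ Φ.source ∧ Φ ∈ IsManifold.maximalAtlas 𝓘(ℝ, SpinGeometry.E4) ∞ M ∧
          SpinGeometry.IsTodaData Λ D u V om ∧
          ∀ x ∈ Φ.source, SpinGeometry.proj (Φ x) ∈ D ∧
            (∀ v : TangentSpace 𝓘(ℝ, SpinGeometry.E4) x, g.inner x v v =
              SpinGeometry.todaMetric u V om (Φ x) (SpinGeometry.coordVec Φ x v)) ∧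
            SpinGeometry.coordVec Φ x (K x) = EuclideanSpace.single 3 (Real.sqrt 2) := by
  have hα := hKS.unprimed
  have hβ := hKS.primed
  have hK := SpinGeometry.isSpinorVector_spinorVector hα hβ
  refine ⟨fun i x hx => SpinGeometry.einstein_weyl hF hKS hΛ hne hx, ?_,
    SpinGeometry.spinorVector s α β, hK, SpinGeometry.isKilling_spinorVector hF hKS,
    hK.ne_zero_iff hα hβ, fun p hp => ?_⟩
  · exact (SpinGeometry.dense_nonzeroAt_unprimed hF hKS hne).inter_of_isOpen_left
      (SpinGeometry.dense_nonzeroAt_primed hF hKS hΛ hne) (SpinGeometry.isOpen_nonzeroAt hα)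
  · obtain ⟨h1, h2⟩ := (hK.ne_zero_iff hα hβ p).1 hp
    exact SpinGeometry.exists_toda_chart hF hKS hΛ h1 h2
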